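/- Conventions. A 2-category is a strict 2-category (a $\mathrm{Cat}$-enriched category), a 2-functor is a strict 2-functor and a 2-natural transformation is a strict one. A 2-category is locally small if the 1-cells between any two objects form a small set and the 2-cells between any two 1-cells form a small set. A 2-category $\mathcal I$ is 2-filtered if (F0) any two objects $i,j$ admit arrows $i\to k$, $j\to k$ to a common object; (F1) for any two arrows $f,g:i\to j$ there are an arrow $h:j\to k$ and an invertible 2-cell $hf\cong hg$; (F2) for any two 2-cells $\alpha,\beta:f\Rightarrow g:i\to j$ there is an arrow $h:j\to k$ with $h\alpha=h\beta$. It is 2-cofiltered if $\mathcal I^{op}$ is 2-filtered. A pseudocone with vertex $A$ over a 2-functor $X:\mathcal K\to\mathcal C$ consists of arrows $\pi_k:A\to X_k$ and invertible 2-cells $\pi_u:\pi_l\Rightarrow X_u\pi_k$ for $u:k\to l$, compatible with identities, composition and 2-cells of $\mathcal K$; it is a pseudolimit if for every $B$ composition with it is an isomorphism of categories from $\mathcal C(B,A)$ to the category of pseudocones over $X$ with vertex $B$. A 2-functor preserves such a pseudolimit if it maps this pseudocone to a pseudolimit pseudocone. For a locally small 2-category $\mathcal C$ let $2\text{-}\mathcal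 Pro(\mathcal C)$ be the 2-category whose objects are the 2-functors $X=(X_i)_{i\in\mathcal I}:\mathcal I^{op}\to\mathcal C$ with $\mathcal I$ small and 2-filtered, and whose hom-categories are $$2\text{-}\mathcal Pro(\mathcal C)(X,Y)=\mathcal Hom(\mathcal C,\mathcal Cat)(LY,LX),\qquad LX=\operatorname*{colim}_{i\in\mathcal I}\mathcal C(X_i,-)\ \text{(pseudocolimit)},$$ where $\mathcal Hom(\mathcal C,\mathcal Cat)$ is the 2-category of 2-functors, 2-natural transformations and modifications; compositions are those of $\mathcal Hom(\mathcal C,\mathcal Cat)^{op}$. Let $c_{\mathcal C}:\mathcal C\to 2\text{-}\mathcal Pro(\mathcal C)$ be the 2-functor which sends an object to itself, viewed as a 2-pro-object indexed by the one-point 2-category. Let $2\text{-}\mathcal{CAT}$ be the 2-category of locally small 2-categories, 2-functors and 2-natural transformations, and let $2\text{-}\mathcal{CAT}_+$ be its sub-2-category whose objects are the locally small 2-categories closed under small 2-cofiltered pseudolimits, whose 1-cells are the 2-functors preserving small 2-cofiltered pseudolimits, and whose 2-cells are all 2-natural transformations between them. Theorem. For every locally small 2-category $\mathcal C$ the 2-category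 $2\text{-}\mathcal Pro(\mathcal C)$ is locally small and closed under small 2-cofiltered pseudolimits, and the assignment $\mathcal C\mapsto 2\text{-}\mathcal Pro(\mathcal C)$ is the object function of a (strict) 2-functor $$2\text{-}\mathcal Pro(-):2\text{-}\mathcal{CAT}\longrightarrow 2\text{-}\mathcal{CAT}_+$$ such that: 1. the 2-functors $c_{\mathcal C}$ are the components of a 2-natural transformation from the identity of $2\text{-}\mathcal{CAT}$ to $2\text{-}\mathcal Pro(-)$ (followed by the inclusion $2\text{-}\mathcal{CAT}_+\subset 2\text{-}\mathcal{CAT}$); 2. for every 2-functor $F:\mathcal C\to\mathcal D$ between locally small 2-categories and every 2-pro-object $X=(X_i)_{i\in\mathcal I}$ of $\mathcal C$, $2\text{-}\mathcal Pro(F)(X)$ is the 2-pro-object $F\circ X=(FX_i)_{i\in\mathcal I}$; 3. $2\text{-}\mathcal Pro(F)$ is, up to a unique isomorphism, the extension $\widehat F$ of $F$: if $H:2\text{-}\mathcal Pro(\mathcal C)\to 2\text{-}\mathcal Pro(\mathcal D)$ is a 2-functor that preserves small 2-cofiltered pseudolimits and $e:H c_{\mathcal C}\cong c_{\mathcal D}F$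 is a 2-natural isomorphism, then there is exactly one 2-natural isomorphism $\hat e:H\cong 2\text{-}\mathcal Pro(F)$ with $\hat e\,c_{\mathcal C}=e$ (where $2\text{-}\mathcal Pro(F)\,c_{\mathcal C}=c_{\mathcal D}F$ by 1). In particular each $2\text{-}\mathcal Pro(F)$ preserves small 2-cofiltered pseudolimits. -/

import Mathlib

open CategoryTheory Bicategory
universe t v w t' v' w' t'' v'' w'' u
namespace TwoPro

section Hom

variable {C : Type w} [Bicategory.{t, v} C] {D : Type w'} [Bicategory.{t', v'} D]

/- 2-categories are bicategories with `Strict`, 2-functors are `StrictPseudofunctor`s. Since equations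
between 1-cells are only propositional, strict equations between 2-cells are stated with `eqToHom`
(which in a strict 2-category composes and whiskers to `eqToHom`).
-/

/-- A 2-natural transformation `F ⇒ G` between 2-functors: `F f ≫ app b = app a ≫ G f` strictly,
and likewise for 2-cells. -/
@[ext]
structure TwoNat (F G : StrictPseudofunctor C D) where
  app (a : C) : F.obj a ⟶ G.obj a
  naturality {a b : C} (f : a ⟶ b) : F.map f ≫ app b = app a ≫ G.map f
  naturality₂ {a b : C} {f g : a ⟶ b} (η : f ⟶ g) :
    F.map₂ η ▷ app b =
      eqToHom (naturality f) ≫ app a ◁ G.map₂ η ≫ eqToHom (naturality g).symm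

variable [Strict D]

/-- The identity 2-natural transformation. -/
@[simps]
def TwoNat.id (F : StrictPseudofunctor C D) : TwoNat F F where
  app a := 𝟙 (F.obj a)
  naturality f := by rw [Strict.comp_id, Strict.id_comp]
  naturality₂ η := by
    simp [id_whiskerLeft, whiskerRight_id, Strict.leftUnitor_eqToIso, Strict.rightUnitor_eqToIso]

/-- Vertical composition of 2-natural transformations. -/
@[simps]
def TwoNat.vcomp {F G H : StrictPseudofunctor C D} (α : TwoNat F G) (β : TwoNat G H) :
    TwoNat F H where
  app a := α.app a ≫ β.app a
  naturality f := by
    rw [← Strict.assoc, α.naturality, Strict.assoc, β.naturality, Strict.assoc]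
  naturality₂ η := by
    have h1 := α.naturality₂ η
    have h2 := β.naturality₂ η
    simp [whiskerRight_comp, comp_whiskerLeft, h1, h2, Strict.associator_eqToIso]

instance : CategoryStruct (StrictPseudofunctor C D) where
  Hom F G := TwoNat F G
  id F := TwoNat.id F
  comp α β := TwoNat.vcomp α β

@[simp] lemma TwoNat.id_app' (F : StrictPseudofunctor C D) (a : C) :
    TwoNat.app (𝟙 F) a = 𝟙 (F.obj a) := rfl
@[simp] lemma TwoNat.comp_app {F G H : StrictPseudofunctor C D} (α : F ⟶ G) (β : G ⟶ H) (a : C) :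
    TwoNat.app (α ≫ β) a = TwoNat.app α a ≫ TwoNat.app β a := rfl

lemma TwoNat.ext' {F G : StrictPseudofunctor C D} {α β : F ⟶ G}
    (h : ∀ a, TwoNat.app α a = TwoNat.app β a) : α = β := TwoNat.ext (funext h)

/-- A modification `θ ⇛ η` between 2-natural transformations: `F f ◁ app b = app a ▷ G f` modulo the
naturality equations of `θ` and `η`. -/
@[ext]
structure Modif {F G : StrictPseudofunctor C D} (θ η : F ⟶ G) where
  app (a : C) : TwoNat.app θ a ⟶ TwoNat.app η a
  naturality {a b : C} (f : a ⟶ b) :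
    F.map f ◁ app b =
      eqToHom (TwoNat.naturality θ f) ≫ app a ▷ G.map f ≫ eqToHom (TwoNat.naturality η f).symm

instance (F G : StrictPseudofunctor C D) : Category (F ⟶ G) where
  Hom θ η := Modif θ η
  id θ := { app a := 𝟙 _, naturality f := by simp }
  comp ρ σ := { app a := ρ.app a ≫ σ.app a, naturality f := by simp [ρ.naturality, σ.naturality] }

@[simp] lemma Modif.id_app {F G : StrictPseudofunctor C D} (θ : F ⟶ G) (a : C) :
    Modif.app (𝟙 θ) a = 𝟙 _ := rfl
@[simp] lemma Modif.comp_app {F G : StrictPseudofunctor C D} {θ η ι : F ⟶ G}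
    (ρ : θ ⟶ η) (σ : η ⟶ ι) (a : C) :
    Modif.app (ρ ≫ σ) a = ρ.app a ≫ σ.app a := rfl
lemma Modif.ext' {F G : StrictPseudofunctor C D} {θ η : F ⟶ G} {ρ σ : θ ⟶ η}
    (h : ∀ a, Modif.app ρ a = Modif.app σ a) : ρ = σ := Modif.ext (funext h)
@[simp] lemma Modif.eqToHom_app {F G : StrictPseudofunctor C D} {θ η : F ⟶ G} (h : θ = η) (a : C) :
    Modif.app (eqToHom h) a = eqToHom (by rw [h]) := by subst h; rfl

section aux

variable {a b c d e e' : D}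

lemma whiskerLeft_aux {f : a ⟶ b} {x : b ⟶ c} {y : a ⟶ d} {g : d ⟶ c} (n : f ≫ x = y ≫ g)
    {θ η : c ⟶ e} {θ' η' : d ⟶ e'} {h : e' ⟶ e} (p : g ≫ θ = θ' ≫ h) (q : g ≫ η = η' ≫ h)
    (ρ : θ ⟶ η) (ρ' : θ' ⟶ η') (w : g ◁ ρ = eqToHom p ≫ ρ' ▷ h ≫ eqToHom q.symm)
    (h₁ : f ≫ x ≫ θ = (y ≫ θ') ≫ h) (h₂ : (y ≫ η') ≫ h = f ≫ x ≫ η) :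
    f ◁ x ◁ ρ = eqToHom h₁ ≫ (y ◁ ρ') ▷ h ≫ eqToHom h₂ := by
  have k := congr_whiskerLeft n ρ
  simp only [comp_whiskerLeft, Strict.associator_eqToIso, w] at k
  rw [← cancel_epi (eqToHom (Strict.assoc f x θ)),
    ← cancel_mono (eqToHom (Strict.assoc f x η).symm)]
  simp [Strict.associator_eqToIso] at k ⊢
  exact k

lemma whiskerRight_aux {f : a ⟶ b} {x : c ⟶ e} {y : d ⟶ e'} {g : d ⟶ c} {h : e' ⟶ e}
    (n : g ≫ x = y ≫ h) {θ η : b ⟶ c} {θ' η' : a ⟶ d} (p : f ≫ θ = θ' ≫ g) (q : f ≫ η = η' ≫ g)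
    (ρ : θ ⟶ η) (ρ' : θ' ⟶ η') (w : f ◁ ρ = eqToHom p ≫ ρ' ▷ g ≫ eqToHom q.symm)
    (h₁ : f ≫ θ ≫ x = (θ' ≫ y) ≫ h) (h₂ : (η' ≫ y) ≫ h = f ≫ η ≫ x) :
    f ◁ ρ ▷ x = eqToHom h₁ ≫ (ρ' ▷ y) ▷ h ≫ eqToHom h₂ := by
  have k := whiskerRight_congr n ρ'
  have k₂ : (f ◁ ρ) ▷ x = _ := congrArg (· ▷ x) w
  simp only [whisker_assoc, whiskerRight_comp, comp_whiskerRight, Strict.associator_eqToIso,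
    eqToIso.hom, eqToIso.inv, eqToHom_whiskerRight, ← cancel_epi (eqToHom (Strict.assoc f θ x)),
    ← cancel_mono (eqToHom (Strict.assoc f η x).symm)] at k k₂ ⊢
  have k₃ : ρ' ▷ g ▷ x = eqToHom (Strict.assoc θ' g x) ≫ (eqToHom (Strict.assoc θ' g x).symm ≫
      ρ' ▷ g ▷ x ≫ eqToHom (Strict.assoc η' g x)) ≫ eqToHom (Strict.assoc η' g x).symm := by simp
  rw [k] at k₃
  simp at k₂ k₃ ⊢
  rw [k₂, k₃]
  simp

end aux

/-- Left whiskering of a modification. -/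
@[simps!]
def Modif.whiskerLeft {F G H : StrictPseudofunctor C D} (α : F ⟶ G) {θ η : G ⟶ H} (ρ : θ ⟶ η) :
    Modif (α ≫ θ) (α ≫ η) where
  app a := TwoNat.app α a ◁ Modif.app ρ a
  naturality f := whiskerLeft_aux (TwoNat.naturality α f) _ (TwoNat.naturality η f) _ _ (ρ.naturality f) _ _

/-- Right whiskering of a modification. -/
@[simps!]
def Modif.whiskerRight {F G H : StrictPseudofunctor C D} {θ η : F ⟶ G} (ρ : θ ⟶ η) (α : G ⟶ H) :
    Modif (θ ≫ α) (η ≫ α) where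
  app a := Modif.app ρ a ▷ TwoNat.app α a
  naturality f := whiskerRight_aux (TwoNat.naturality α f) _ (TwoNat.naturality η f) _ _ (ρ.naturality f) _ _

/-- The 2-category `Hom(C, D)` of 2-functors, 2-natural transformations and modifications. -/
instance homBicategory : Bicategory (StrictPseudofunctor C D) where
  whiskerLeft α _ _ ρ := Modif.whiskerLeft α ρ
  whiskerRight ρ α := Modif.whiskerRight ρ α
  associator α β γ := eqToIso (TwoNat.ext' (fun _ => Strict.assoc _ _ _))
  leftUnitor α := eqToIso (TwoNat.ext' (fun _ => Strict.id_comp _))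
  rightUnitor α := eqToIso (TwoNat.ext' (fun _ => Strict.comp_id _))
  whiskerLeft_id _ _ := by apply Modif.ext'; intro a; simp
  whiskerLeft_comp _ _ _ _ _ _ := by apply Modif.ext'; intro a; simp
  id_whiskerLeft ρ := by apply Modif.ext'; intro a; simp [Strict.leftUnitor_eqToIso]
  comp_whiskerLeft _ _ _ _ ρ := by apply Modif.ext'; intro a; simp [Strict.associator_eqToIso]
  id_whiskerRight _ _ := by apply Modif.ext'; intro a; simp
  comp_whiskerRight _ _ _ := by apply Modif.ext'; intro a; simp
  whiskerRight_id ρ := by apply Modif.ext'; intro a; simp [Strict.rightUnitor_eqToIso]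
  whiskerRight_comp ρ _ _ := by apply Modif.ext'; intro a; simp [Strict.associator_eqToIso]
  whisker_assoc _ _ _ _ _ := by apply Modif.ext'; intro a; simp [Strict.associator_eqToIso]
  whisker_exchange _ _ := by apply Modif.ext'; intro a; simp [whisker_exchange]
  pentagon α β γ δ := by
    apply Modif.ext'; intro a
    have h := Bicategory.pentagon (TwoNat.app α a) (TwoNat.app β a) (TwoNat.app γ a)
      (TwoNat.app δ a)
    simp only [Strict.associator_eqToIso, eqToIso.hom] at h
    simp only [eqToIso.hom, Modif.comp_app, Modif.whiskerRight_app, Modif.whiskerLeft_app,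
      Modif.eqToHom_app]
    exact h
  triangle α β := by
    apply Modif.ext'; intro a
    have h := Bicategory.triangle (TwoNat.app α a) (TwoNat.app β a)
    simp only [Strict.associator_eqToIso, Strict.leftUnitor_eqToIso, Strict.rightUnitor_eqToIso,
      eqToIso.hom] at h
    simp only [eqToIso.hom, Modif.comp_app, Modif.whiskerRight_app, Modif.whiskerLeft_app,
      Modif.eqToHom_app]
    exact h

instance homStrict : Strict (StrictPseudofunctor C D) where
  id_comp _ := TwoNat.ext' (fun _ => Strict.id_comp _)
  comp_id _ := TwoNat.ext' (fun _ => Strict.comp_id _)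
  assoc _ _ _ := TwoNat.ext' (fun _ => Strict.assoc _ _ _)
  leftUnitor_eqToIso _ := rfl
  rightUnitor_eqToIso _ := rfl
  associator_eqToIso _ _ _ := rfl

end Hom
section El

variable {C : Type w} [Bicategory.{t, v} C] [Strict C]
  {K : Type w'} [Bicategory.{t', v'} K] [Strict K]

section aux

variable {a b c d e : C}

lemma post_aux₁ {x : a ⟶ b} {p : b ⟶ c} {q : a ⟶ c} (φ : x ≫ p ⟶ q) {g h : c ⟶ d} (γ : g ⟶ h)
    (e₁ : x ≫ p ≫ g = (x ≫ p) ≫ g) (e₂ : x ≫ p ≫ h = (x ≫ p) ≫ h) :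
    (eqToHom e₁ ≫ φ ▷ g) ≫ q ◁ γ = x ◁ p ◁ γ ≫ eqToHom e₂ ≫ φ ▷ h := by
  have k := whisker_exchange φ γ
  simp only [comp_whiskerLeft, Strict.associator_eqToIso, eqToIso.hom, eqToIso.inv] at k
  rw [Category.assoc, ← k]
  simp

lemma post_aux₂ {x : a ⟶ b} {p : b ⟶ c} {q : a ⟶ c} (φ : x ≫ p ⟶ q) {g : c ⟶ d} {h : d ⟶ e}
    (e₁ : x ≫ p ≫ g ≫ h = (x ≫ p) ≫ g ≫ h) (e₂ : x ≫ p ≫ g ≫ h = x ≫ (p ≫ g) ≫ h)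
    (e₃ : x ≫ (p ≫ g) ≫ h = (x ≫ (p ≫ g)) ≫ h) (e₄ : x ≫ p ≫ g = (x ≫ p) ≫ g)
    (e₅ : (q ≫ g) ≫ h = q ≫ g ≫ h) :
    eqToHom e₁ ≫ φ ▷ (g ≫ h) =
      eqToHom e₂ ≫ (eqToHom e₃ ≫ (eqToHom e₄ ≫ φ ▷ g) ▷ h) ≫ eqToHom e₅ := by
  simp [whiskerRight_comp, Strict.associator_eqToIso]

lemma pre_aux {y : C} {v : a ⟶ b} {α : b ⟶ c} {α' : a ⟶ y} {v' : y ⟶ c} (n : v ≫ α = α' ≫ v')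
    {p q : c ⟶ d} (φ : p ⟶ q) {r : y ⟶ d} (ψ : v' ≫ q ⟶ r) {s : y ⟶ d} (e₀ : s = v' ≫ p)
    {m : a ⟶ d} (e₁ : m = α' ≫ s)
    {o : b ⟶ d} (e₂ : m = v ≫ o) (e₃ : o = α ≫ p) (e₄ : v ≫ α ≫ q = α' ≫ v' ≫ q) :
    eqToHom e₁ ≫ α' ◁ (eqToHom e₀ ≫ v' ◁ φ ≫ ψ) =
      eqToHom e₂ ≫ v ◁ (eqToHom e₃ ≫ α ◁ φ) ≫ eqToHom e₄ ≫ α' ◁ ψ := by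
  have k := congr_whiskerLeft n φ
  simp only [comp_whiskerLeft, Strict.associator_eqToIso, eqToIso.hom, eqToIso.inv] at k
  rw [← cancel_epi (eqToHom (Strict.assoc _ _ _).symm),
    ← cancel_mono (eqToHom (Strict.assoc _ _ _))] at k
  simp only [Category.assoc, eqToHom_trans, eqToHom_trans_assoc, eqToHom_refl,
    Category.id_comp, Category.comp_id] at k
  subst e₀ e₁ e₃
  simp [k]

end aux

/- For a 2-functor `X : K → C` and `A : C`, the pseudocolimit over `Kᵒᵖ` of the categories `C(X k, A)` is
the localization of the category of elements `El X A` (the Grothendieck construction of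
`k ↦ C(X k, A)`, with arrows taken modulo the 2-cells of `K`) at the arrows whose 2-cell component
is invertible.
-/

/-- Objects of the category of elements: pairs `(k, f : X k ⟶ A)`. -/
structure El (X : StrictPseudofunctor K C) (A : C) where
  idx : K
  arr : X.obj idx ⟶ A

variable (X : StrictPseudofunctor K C) {Y Z : StrictPseudofunctor K C} {A B D : C}

/-- Representatives of arrows `(k, f) ⟶ (l, g)`: an arrow `u : l ⟶ k` of `K` and a 2-cell
`X u ≫ f ⟶ g`. -/
structure PreHom (p q : El X A) where
  base : q.idx ⟶ p.idx
  cell : X.map base ≫ p.arr ⟶ q.arr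

/-- `(u, X α ≫ φ)` and `(u', φ)` represent the same arrow, for every 2-cell `α : u ⟶ u'`. -/
def PreHom.Rel (p q : El X A) (h h' : PreHom X p q) : Prop :=
  ∃ α : h.base ⟶ h'.base, h.cell = X.map₂ α ▷ p.arr ≫ h'.cell

namespace El

variable {X}

instance : Quiver (El X A) where
  Hom p q := Quot (PreHom.Rel X p q)

/-- The class of `(u, φ)`. -/
def mk' {p q : El X A} (u : q.idx ⟶ p.idx) (φ : X.map u ≫ p.arr ⟶ q.arr) : p ⟶ q := Quot.mk _ ⟨u, φ⟩

lemma mk'_eq {p q : El X A} {u u' : q.idx ⟶ p.idx} {φ : X.map u ≫ p.arr ⟶ q.arr}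
    {φ' : X.map u' ≫ p.arr ⟶ q.arr} (α : u ⟶ u') (h : φ = X.map₂ α ▷ p.arr ≫ φ') :
    mk' u φ = mk' u' φ' := Quot.sound ⟨α, h⟩

lemma mk'_cell {p q : El X A} {u : q.idx ⟶ p.idx} {φ φ' : X.map u ≫ p.arr ⟶ q.arr}
    (h : φ = φ') : mk' u φ = mk' u φ' := by rw [h]

lemma mk'_congr {p q : El X A} {u u' : q.idx ⟶ p.idx} {φ : X.map u ≫ p.arr ⟶ q.arr}
    {φ' : X.map u' ≫ p.arr ⟶ q.arr} (α : u = u') (h : φ = eqToHom (by rw [α]) ≫ φ') :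
    mk' u φ = mk' u' φ' := by
  subst α; simp at h; rw [h]

/-- The identity arrow of `p`. -/
def id (p : El X A) : p ⟶ p :=
  mk' (𝟙 p.idx) (eqToHom (by rw [X.map_id, Strict.id_comp]))

/-- `(u, φ)` followed by `(v, ψ)` is `(v ≫ u, X v ◁ φ ≫ ψ)`. -/
def comp {p q r : El X A} (a : p ⟶ q) (b : q ⟶ r) : p ⟶ r :=
  Quot.liftOn₂ a b
    (fun h k => mk' (k.base ≫ h.base)
      (eqToHom (by rw [X.map_comp, Strict.assoc]) ≫ X.map k.base ◁ h.cell ≫ k.cell))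
    (by
      rintro ⟨u, φ⟩ ⟨v, ψ⟩ ⟨v', ψ'⟩ ⟨α, h⟩
      dsimp at α h
      refine mk'_eq (α ▷ u) ?_
      subst h
      simp only [X.map₂_whisker_right, X.mapComp_eq_eqToIso, whisker_exchange_assoc,
        whiskerRight_comp]
      simp [Strict.associator_eqToIso])
    (by
      rintro ⟨u, φ⟩ ⟨u', φ'⟩ ⟨v, ψ⟩ ⟨α, h⟩
      dsimp at α h
      refine mk'_eq (v ◁ α) ?_
      subst h
      simp [X.map₂_whisker_left, X.mapComp_eq_eqToIso, Strict.associator_eqToIso])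

instance : CategoryStruct (El X A) where
  id p := id p
  comp a b := comp a b

lemma mk'_comp {p q r : El X A} (u : q.idx ⟶ p.idx) (φ : X.map u ≫ p.arr ⟶ q.arr)
    (v : r.idx ⟶ q.idx) (ψ : X.map v ≫ q.arr ⟶ r.arr) :
    mk' u φ ≫ mk' v ψ = mk' (v ≫ u)
      (eqToHom (by rw [X.map_comp, Strict.assoc]) ≫ X.map v ◁ φ ≫ ψ) := rfl

lemma id_def (p : El X A) : 𝟙 p = mk' (𝟙 p.idx) (eqToHom (by rw [X.map_id, Strict.id_comp])) := rfl

lemma hom_ind {p q : El X A} {P : (p ⟶ q) → Prop} (h : ∀ u φ, P (mk' u φ)) (f : p ⟶ q) : P f := by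
  obtain ⟨u, φ⟩ := f
  exact h u φ

instance : Category (El X A) where
  id_comp {p q} f := by
    induction f using hom_ind with | h u φ => ?_
    rw [id_def, mk'_comp]
    refine mk'_congr (Strict.comp_id u) ?_
    simp
  comp_id {p q} f := by
    induction f using hom_ind with | h u φ => ?_
    rw [id_def, mk'_comp]
    refine mk'_congr (Strict.id_comp u) ?_
    simp [congr_whiskerLeft (X.map_id _), Strict.leftUnitor_eqToIso]
  assoc {p q r s} f g h := by
    induction f using hom_ind with | h u φ => ?_
    induction g using hom_ind with | h u₁ φ₁ => ?_
    induction h using hom_ind with | h u₂ φ₂ => ?_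
    simp only [mk'_comp]
    refine mk'_congr (Strict.assoc _ _ _).symm ?_
    simp [congr_whiskerLeft (X.map_comp _ _), Strict.associator_eqToIso]

lemma mk'_heq {k l : K} {f f' : X.obj k ⟶ A} {g g' : X.obj l ⟶ A} (hf : f = f') (hg : g = g')
    (u : l ⟶ k) (φ : X.map u ≫ f ⟶ g) (φ' : X.map u ≫ f' ⟶ g')
    (h : φ = eqToHom (by rw [hf]) ≫ φ' ≫ eqToHom hg.symm) :
    mk' (p := ⟨k, f⟩) (q := ⟨l, g⟩) u φ ≍ mk' (p := ⟨k, f'⟩) (q := ⟨l, g'⟩) u φ' := by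
  subst hf hg; simp at h; rw [h]

/-- The arrow `(k, f) ⟶ (k, g)` given by a 2-cell `f ⟶ g`. -/
def vert {k : K} {f g : X.obj k ⟶ A} (φ : f ⟶ g) : (⟨k, f⟩ : El X A) ⟶ ⟨k, g⟩ :=
  mk' (𝟙 k) (eqToHom (by rw [X.map_id, Strict.id_comp]) ≫ φ)

lemma vert_eqToHom {k : K} {f g : X.obj k ⟶ A} (h : f = g) :
    eqToHom (by rw [h]) = (vert (eqToHom h) : (⟨k, f⟩ : El X A) ⟶ ⟨k, g⟩) := by
  subst h; simp [vert]; rfl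

lemma vert_comp_mk' {k : K} {f g : X.obj k ⟶ A} (φ : f ⟶ g) {q : El X A}
    (u : q.idx ⟶ k) (ψ : X.map u ≫ g ⟶ q.arr) :
    vert φ ≫ mk' (p := ⟨k, g⟩) u ψ = mk' (p := ⟨k, f⟩) u (X.map u ◁ φ ≫ ψ) := by
  simp only [vert, mk'_comp]
  refine mk'_congr (Strict.comp_id u) ?_
  simp

lemma mk'_comp_vert {k : K} {f g : X.obj k ⟶ A} (φ : f ⟶ g) {p : El X A}
    (u : k ⟶ p.idx) (ψ : X.map u ≫ p.arr ⟶ f) :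
    mk' (q := ⟨k, f⟩) u ψ ≫ vert φ = mk' (q := ⟨k, g⟩) u (ψ ≫ φ) := by
  simp only [vert, mk'_comp]
  refine mk'_congr (Strict.id_comp u) ?_
  simp [congr_whiskerLeft (X.map_id _), Strict.leftUnitor_eqToIso]

lemma vert_id {k : K} (f : X.obj k ⟶ A) : vert (𝟙 f) = 𝟙 (⟨k, f⟩ : El X A) := by
  simp [vert, id_def]

lemma vert_comp {k : K} {f g h : X.obj k ⟶ A} (φ : f ⟶ g) (ψ : g ⟶ h) :
    vert (φ ≫ ψ) = vert φ ≫ vert ψ := by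
  rw [vert, vert, mk'_comp_vert, Category.assoc]

lemma vert_conj {k : K} {f f' g g' : X.obj k ⟶ A} (φ : f ⟶ g) (φ' : f' ⟶ g') (e : f = f')
    (e' : g' = g) (h : φ = eqToHom e ≫ φ' ≫ eqToHom e') :
    vert φ = eqToHom (by rw [e]) ≫ vert φ' ≫ eqToHom (by rw [e']) := by
  subst e e'; simp at h ⊢; rw [h]

variable (X) in
/-- Composition with `g : A ⟶ B` as a functor `El X A ⥤ El X B`. -/
def post (g : A ⟶ B) : El X A ⥤ El X B where
  obj p := ⟨p.idx, p.arr ≫ g⟩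
  map {p q} f := Quot.liftOn f
    (fun h => mk' h.base (eqToHom (Strict.assoc _ _ _).symm ≫ h.cell ▷ g))
    (by
      rintro ⟨u, φ⟩ ⟨u', φ'⟩ ⟨α, h⟩
      dsimp at α h
      refine mk'_eq α ?_
      subst h
      simp [Strict.associator_eqToIso])
  map_id p := congrArg (mk' (p := ⟨_, p.arr ≫ g⟩) (q := ⟨_, p.arr ≫ g⟩) (𝟙 p.idx)) (by simp)
  map_comp f h := by
    induction f using hom_ind with | h u φ => ?_
    induction h using hom_ind with | h v ψ => ?_
    refine mk'_congr rfl ?_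
    simp [Strict.associator_eqToIso]

lemma post_map (g : A ⟶ B) {p q : El X A} (u : q.idx ⟶ p.idx) (φ : X.map u ≫ p.arr ⟶ q.arr) :
    (post X g).map (mk' u φ) = mk' (p := ⟨_, p.arr ≫ g⟩) (q := ⟨_, q.arr ≫ g⟩) u
      (eqToHom (Strict.assoc _ _ _).symm ≫ φ ▷ g) := rfl

lemma post_id : post X (𝟙 A) = 𝟭 (El X A) := by
  refine _root_.CategoryTheory.Functor.hext (fun p => ?_) (fun p q f => ?_)
  · exact congrArg (El.mk p.idx) (Strict.comp_id p.arr)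
  · induction f using hom_ind with | h u φ => ?_
    refine mk'_heq (Strict.comp_id _) (Strict.comp_id _) u _ _ ?_
    simp [whiskerRight_id, Strict.rightUnitor_eqToIso]

lemma post_comp (g : A ⟶ B) (h : B ⟶ D) : post X (g ≫ h) = post X g ⋙ post X h := by
  refine _root_.CategoryTheory.Functor.hext (fun p => ?_) (fun p q f => ?_)
  · exact congrArg (El.mk p.idx) (Strict.assoc _ _ _).symm
  · induction f using hom_ind with | h u φ => ?_
    refine mk'_heq (Strict.assoc _ _ _).symm (Strict.assoc _ _ _).symm u _ _ ?_
    exact post_aux₂ _ _ _ _ _ _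

variable (X) in
/-- Whiskering with a 2-cell `g ⟶ h` as a natural transformation. -/
def postMap {g h : A ⟶ B} (γ : g ⟶ h) : post X g ⟶ post X h where
  app p := vert (p.arr ◁ γ)
  naturality p q f := by
    induction f using hom_ind with | h u φ => ?_
    rw [post_map, post_map]
    refine (mk'_comp_vert _ _ _).trans (Eq.trans ?_ (vert_comp_mk' _ _ _).symm)
    exact mk'_cell (post_aux₁ _ _ _ _)

/-- Composition with a 2-natural transformation `α : X ⇒ Y` as a functor `El Y A ⥤ El X A`. -/
def pre (α : TwoNat X Y) (A : C) : El Y A ⥤ El X A where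
  obj p := ⟨p.idx, α.app p.idx ≫ p.arr⟩
  map {p q} f := Quot.liftOn f
    (fun h => mk' h.base (eqToHom (by
      rw [← Strict.assoc, α.naturality, Strict.assoc]) ≫ α.app q.idx ◁ h.cell))
    (by
      rintro ⟨u, φ⟩ ⟨u', φ'⟩ ⟨β, h⟩
      dsimp at β h
      refine mk'_eq β ?_
      subst h
      have k := congrArg (· ▷ p.arr) (α.naturality₂ β)
      simp only [Strict.associator_eqToIso, comp_whiskerRight, whiskerRight_comp, whisker_assoc,
        whiskerLeft_comp, eqToHom_whiskerRight, eqToIso.hom, eqToIso.inv] at k ⊢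
      simp only [Category.assoc] at k ⊢
      rw [← cancel_epi (eqToHom (Strict.assoc _ _ _)), reassoc_of% k]
      simp)
  map_id p := congrArg (mk' (p := ⟨_, α.app _ ≫ p.arr⟩) (q := ⟨_, α.app _ ≫ p.arr⟩) (𝟙 p.idx))
    (by simp)
  map_comp {p q r} f h := by
    induction f using hom_ind with | h u φ => ?_
    induction h using hom_ind with | h v ψ => ?_
    refine mk'_cell ?_
    exact pre_aux (α.naturality v) φ ψ _ _ _ _ _

lemma pre_map (α : TwoNat X Y) {p q : El Y A} (u : q.idx ⟶ p.idx)
    (φ : Y.map u ≫ p.arr ⟶ q.arr) :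
    (pre α A).map (mk' u φ) = mk' (p := ⟨_, α.app _ ≫ p.arr⟩) (q := ⟨_, α.app _ ≫ q.arr⟩) u
      (eqToHom (by
        rw [← Strict.assoc, α.naturality, Strict.assoc]) ≫ α.app q.idx ◁ φ) := rfl

end El
end El

section Loc

open CategoryTheory.Localization.Construction

universe v₁ u₁ v₂ u₂ v₃ u₃

variable {E : Type u₁} [Category.{v₁} E] {E' : Type u₂} [Category.{v₂} E']
  {E'' : Type u₃} [Category.{v₃} E'']
  {W : MorphismProperty E} {W' : MorphismProperty E'} {W'' : MorphismProperty E''}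

/-- The functor between localizations induced by a functor. -/
noncomputable def locMap (F : E ⥤ E') (h : W ≤ W'.inverseImage F) :
    W.Localization ⥤ W'.Localization :=
  lift (F ⋙ W'.Q) (fun _ _ f hf => W'.Q_inverts _ (h f hf))

lemma Q_locMap (F : E ⥤ E') (h : W ≤ W'.inverseImage F) :
    W.Q ⋙ locMap F h = F ⋙ W'.Q := fac _ _

lemma locMap_map (F : E ⥤ E') (h : W ≤ W'.inverseImage F) {X Y : E} (f : X ⟶ Y) :
    (locMap F h).map (W.Q.map f) = W'.Q.map (F.map f) := by
  refine (Functor.congr_hom (Q_locMap F h) f).trans ?_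
  erw [eqToHom_refl, eqToHom_refl, Category.id_comp, Category.comp_id]
  rfl

lemma locMap_eq {F G : E ⥤ E'} (e : F = G) (h : W ≤ W'.inverseImage F)
    (h' : W ≤ W'.inverseImage G) : locMap F h = locMap G h' := by
  subst e; rfl

lemma locMap_id (h : W ≤ W.inverseImage (𝟭 E)) : locMap (𝟭 E) h = 𝟭 W.Localization :=
  uniq _ _ (by rw [Q_locMap]; rfl)

lemma locMap_comp (F : E ⥤ E') (G : E' ⥤ E'') (h : W ≤ W'.inverseImage F)
    (h' : W' ≤ W''.inverseImage G) (h'' : W ≤ W''.inverseImage (F ⋙ G)) :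
    locMap (F ⋙ G) h'' = locMap F h ⋙ locMap G h' :=
  uniq _ _ (by
    rw [Q_locMap, ← Functor.assoc, Q_locMap, Functor.assoc, Functor.assoc, Q_locMap])

/-- The natural transformation between functors of localizations induced by a natural
transformation. -/
noncomputable def locNat {F G : E ⥤ E'} (h : W ≤ W'.inverseImage F) (h' : W ≤ W'.inverseImage G)
    (τ : F ⟶ G) : locMap F h ⟶ locMap G h' :=
  natTransExtension
    (eqToHom (Q_locMap F h) ≫ Functor.whiskerRight τ W'.Q ≫ eqToHom (Q_locMap G h').symm)

lemma locNat_app {F G : E ⥤ E'} (h : W ≤ W'.inverseImage F) (h' : W ≤ W'.inverseImage G)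
    (τ : F ⟶ G) (X : E) :
    (locNat h h' τ).app (W.Q.obj X) = W'.Q.map (τ.app X) := by
  refine (NatTransExtension.app_eq _ X).trans ?_
  simp
  erw [Category.id_comp, Category.comp_id]

lemma loc_natTrans_ext {F G : W.Localization ⥤ E'} {τ τ' : F ⟶ G}
    (h : ∀ X : E, τ.app (W.Q.obj X) = τ'.app (W.Q.obj X)) : τ = τ' := by
  ext X
  obtain ⟨X, rfl⟩ := (objEquiv W).surjective X
  exact h X

lemma locNat_id {F : E ⥤ E'} (h : W ≤ W'.inverseImage F) :
    locNat h h (𝟙 F) = 𝟙 (locMap F h) := by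
  refine loc_natTrans_ext fun p => (locNat_app _ _ _ _).trans ?_
  exact W'.Q.map_id _

lemma locNat_comp {F G H : E ⥤ E'} (h : W ≤ W'.inverseImage F) (h' : W ≤ W'.inverseImage G)
    (h'' : W ≤ W'.inverseImage H) (τ : F ⟶ G) (σ : G ⟶ H) :
    locNat h h'' (τ ≫ σ) = locNat h h' τ ≫ locNat h' h'' σ := by
  refine loc_natTrans_ext fun p => (locNat_app _ _ _ _).trans ?_
  refine (W'.Q.map_comp _ _).trans ?_
  exact (congr (congrArg _ (locNat_app h h' τ p)) (locNat_app h' h'' σ p)).symm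

lemma locNat_conj {F G F' G' : E ⥤ E'} (h : W ≤ W'.inverseImage F) (h' : W ≤ W'.inverseImage G)
    (k : W ≤ W'.inverseImage F') (k' : W ≤ W'.inverseImage G')
    (τ : F ⟶ G) (τ' : F' ⟶ G') (e : F = F') (e' : G' = G) (w : τ = eqToHom e ≫ τ' ≫ eqToHom e') :
    locNat h h' τ = eqToHom (locMap_eq e h k) ≫ locNat k k' τ' ≫ eqToHom (locMap_eq e' k' h') := by
  subst e e'; simp at w ⊢; rw [w]

lemma locNat_whiskerLeft {F : E ⥤ E'} {G H : E' ⥤ E''} (h : W ≤ W'.inverseImage F)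
    (k : W' ≤ W''.inverseImage G) (k' : W' ≤ W''.inverseImage H) (τ : G ⟶ H)
    (l : W ≤ W''.inverseImage (F ⋙ G)) (l' : W ≤ W''.inverseImage (F ⋙ H)) :
    locNat l l' (F.whiskerLeft τ) = eqToHom (locMap_comp F G h k l) ≫
      (locMap F h).whiskerLeft (locNat k k' τ) ≫ eqToHom (locMap_comp F H h k' l').symm := by
  refine loc_natTrans_ext fun p => (locNat_app _ _ _ _).trans ?_
  refine (locNat_app k k' τ (F.obj p)).symm.trans ?_
  simp only [NatTrans.comp_app, eqToHom_app]
  erw [eqToHom_refl, eqToHom_refl, Category.id_comp, Category.comp_id]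
  rfl

lemma locNat_whiskerRight {F G : E ⥤ E'} {H : E' ⥤ E''} (h : W ≤ W'.inverseImage F)
    (h' : W ≤ W'.inverseImage G) (k : W' ≤ W''.inverseImage H) (τ : F ⟶ G)
    (l : W ≤ W''.inverseImage (F ⋙ H)) (l' : W ≤ W''.inverseImage (G ⋙ H)) :
    locNat l l' (Functor.whiskerRight τ H) = eqToHom (locMap_comp F H h k l) ≫
      Functor.whiskerRight (locNat h h' τ) (locMap H k) ≫
        eqToHom (locMap_comp G H h' k l').symm := by
  refine loc_natTrans_ext fun p => (locNat_app _ _ _ _).trans ?_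
  refine (locMap_map H k (τ.app p)).symm.trans ?_
  simp only [NatTrans.comp_app, eqToHom_app]
  erw [eqToHom_refl, eqToHom_refl, Category.id_comp, Category.comp_id]
  exact congrArg (locMap H k).map (locNat_app h h' τ p).symm

end Loc

section PseudoColim

variable {C : Type w} [Bicategory.{t, v} C] [Strict C]
  {K : Type w'} [Bicategory.{t', v'} K] [Strict K]

/-- The arrows of `El X A` with a representative `(u, φ)` such that `φ` is invertible. -/
def El.W (X : StrictPseudofunctor K C) (A : C) : MorphismProperty (El X A) :=
  fun p q f => ∃ (u : q.idx ⟶ p.idx) (φ : X.map u ≫ p.arr ⟶ q.arr), IsIso φ ∧ f = El.mk' u φ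

variable (X : StrictPseudofunctor K C) {Y Z : StrictPseudofunctor K C} {A B D : C}

lemma isIso_whiskerRight_aux {a b c : C} {x : a ⟶ c} {y z : a ⟶ b} (φ : y ⟶ z) (h : IsIso φ)
    (g : b ⟶ c) (e : x = y ≫ g) : IsIso (eqToHom e ≫ φ ▷ g) := inferInstance

lemma isIso_whiskerLeft_aux {a b c : C} {x : a ⟶ c} {y z : b ⟶ c} (φ : y ⟶ z) (h : IsIso φ)
    (g : a ⟶ b) (e : x = g ≫ y) : IsIso (eqToHom e ≫ g ◁ φ) := inferInstance

lemma El.postMap_app {g h : A ⟶ B} (γ : g ⟶ h) (p : El X A) :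
    (El.postMap X γ).app p = El.vert (p.arr ◁ γ) := rfl

lemma El.post_W (g : A ⟶ B) : El.W X A ≤ (El.W X B).inverseImage (El.post X g) := by
  rintro p q f ⟨u, φ, hφ, rfl⟩
  exact ⟨u, _, isIso_whiskerRight_aux φ hφ g _, El.post_map g u φ⟩

lemma El.pre_W {X} (α : TwoNat X Y) : El.W Y A ≤ (El.W X A).inverseImage (El.pre α A) := by
  rintro p q f ⟨u, φ, hφ, rfl⟩
  exact ⟨u, _, isIso_whiskerLeft_aux φ hφ _ _, El.pre_map α u φ⟩

lemma El.postMap_id (g : A ⟶ B) : El.postMap X (𝟙 g) = 𝟙 (El.post X g) := by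
  ext p
  rw [El.postMap_app, whiskerLeft_id]
  exact El.vert_id _

lemma El.postMap_comp {g g' g'' : A ⟶ B} (γ : g ⟶ g') (δ : g' ⟶ g'') :
    El.postMap X (γ ≫ δ) = El.postMap X γ ≫ El.postMap X δ := by
  ext p
  rw [El.postMap_app, whiskerLeft_comp]
  exact El.vert_comp _ _

lemma El.postMap_whiskerLeft (g : A ⟶ B) {h h' : B ⟶ D} (γ : h ⟶ h') :
    El.postMap X (g ◁ γ) = eqToHom (El.post_comp g h) ≫
      (El.post X g).whiskerLeft (El.postMap X γ) ≫ eqToHom (El.post_comp g h').symm := by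
  ext p
  simp only [NatTrans.comp_app, eqToHom_app]
  exact El.vert_conj (p.arr ◁ g ◁ γ) ((p.arr ≫ g) ◁ γ) (Strict.assoc _ _ _).symm
    (Strict.assoc _ _ _) (by simp [Strict.associator_eqToIso])

lemma El.postMap_whiskerRight {g g' : A ⟶ B} (γ : g ⟶ g') (h : B ⟶ D) :
    El.postMap X (γ ▷ h) = eqToHom (El.post_comp g h) ≫
      Functor.whiskerRight (El.postMap X γ) (El.post X h) ≫
        eqToHom (El.post_comp g' h).symm := by
  ext p
  simp only [NatTrans.comp_app, eqToHom_app]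
  have e : (El.post X h).map (El.vert (p.arr ◁ γ)) = El.vert ((p.arr ◁ γ) ▷ h) :=
    (El.post_map _ _ _).trans (El.mk'_cell (by simp [Strict.associator_eqToIso]))
  refine (El.vert_conj (p.arr ◁ γ ▷ h) ((p.arr ◁ γ) ▷ h) (Strict.assoc _ _ _).symm
    (Strict.assoc _ _ _) (by simp [Strict.associator_eqToIso])).trans ?_
  rw [← e]
  rfl

/-- The 2-functor `A ↦ colim C(X k, A)` (pseudocolimit over `Kᵒᵖ`) from `C` to `Cat`. -/
noncomputable def colimHom : StrictPseudofunctor C Cat :=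
  StrictPseudofunctor.mk'' {
    obj A := Cat.of (El.W X A).Localization
    map g := (locMap (El.post X g) (El.post_W X g)).toCatHom
    map₂ γ := (locNat (El.post_W X _) (El.post_W X _) (El.postMap X γ)).toCatHom₂
    map₂_id g := by
      rw [El.postMap_id, locNat_id]; rfl
    map₂_comp γ δ := by
      rw [El.postMap_comp, locNat_comp _ (El.post_W X _)]; rfl
    map_id A := by
      have k : El.W X A ≤ (El.W X A).inverseImage (𝟭 (El X A)) := fun _ _ _ h => h
      exact congrArg (fun F : (El.W X A).Localization ⥤ (El.W X A).Localization => F.toCatHom)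
        ((locMap_eq El.post_id (El.post_W X (𝟙 A)) k).trans (locMap_id k))
    map_comp {A B D} g h := by
      have k : El.W X _ ≤ (El.W X _).inverseImage (El.post X g ⋙ El.post X h) :=
        fun _ _ _ k => El.post_W X h _ (El.post_W X g _ k)
      exact congrArg (fun F : (El.W X A).Localization ⥤ (El.W X D).Localization => F.toCatHom)
        ((locMap_eq (El.post_comp g h) (El.post_W X (g ≫ h)) k).trans
          (locMap_comp _ _ (El.post_W X g) (El.post_W X h) k))
    map₂_whisker_left {A B D} g h h' γ := by
      have k (h : B ⟶ D) : El.W X _ ≤ (El.W X _).inverseImage (El.post X g ⋙ El.post X h) :=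
        fun _ _ _ k => El.post_W X h _ (El.post_W X g _ k)
      ext1
      refine (locNat_conj _ _ (k h) (k h') _ _ _ _ (El.postMap_whiskerLeft X g γ)).trans ?_
      rw [locNat_whiskerLeft (El.post_W X g) (El.post_W X h) (El.post_W X h') _ (k h) (k h')]
      simp
      rfl
    map₂_whisker_right {A B D} {g g'} γ h := by
      have k (g : A ⟶ B) : El.W X _ ≤ (El.W X _).inverseImage (El.post X g ⋙ El.post X h) :=
        fun _ _ _ k => El.post_W X h _ (El.post_W X g _ k)
      ext1
      refine (locNat_conj _ _ (k g) (k g') _ _ _ _ (El.postMap_whiskerRight X γ h)).trans ?_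
      rw [locNat_whiskerRight (El.post_W X g) (El.post_W X g') (El.post_W X h) _ (k g) (k g')]
      simp
      rfl }

end PseudoColim

section Level

variable {C : Type w} [Bicategory.{t, v} C] [Strict C]
  {K : Type w'} [Bicategory.{t', v'} K] [Strict K]

section aux

variable {a b c d e : C}

lemma pre_id_aux {x : a ⟶ b} {y : b ⟶ c} {z : a ⟶ c} (φ : x ≫ y ⟶ z)
    (e₁ : x ≫ 𝟙 b ≫ y = 𝟙 a ≫ x ≫ y) (e₂ : x ≫ 𝟙 b ≫ y = x ≫ y) (e₃ : z = 𝟙 a ≫ z) :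
    eqToHom e₁ ≫ 𝟙 a ◁ φ = eqToHom e₂ ≫ φ ≫ eqToHom e₃ := by
  simp [id_whiskerLeft, Strict.leftUnitor_eqToIso]

lemma pre_comp_aux {α : a ⟶ b} {β : b ⟶ c} {y z : c ⟶ d} (φ : y ⟶ z) {m m' : a ⟶ d} {n : b ⟶ d}
    (e₁ : m = (α ≫ β) ≫ y) (e₂ : m = m') (e₃ : m' = α ≫ n) (e₄ : n = β ≫ y)
    (e₅ : α ≫ β ≫ z = (α ≫ β) ≫ z) :
    eqToHom e₁ ≫ (α ≫ β) ◁ φ =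
      eqToHom e₂ ≫ (eqToHom e₃ ≫ α ◁ (eqToHom e₄ ≫ β ◁ φ)) ≫ eqToHom e₅ := by
  subst e₄
  simp [comp_whiskerLeft, Strict.associator_eqToIso]

lemma post_pre_aux {α : a ⟶ b} {y z : b ⟶ c} (φ : y ⟶ z) {g : c ⟶ d} {m m' : a ⟶ d} {n : b ⟶ d}
    {l : a ⟶ c} (e₁ : m = α ≫ n) (e₂ : n = y ≫ g) (e₃ : m = m') (e₄ : m' = l ≫ g) (e₅ : l = α ≫ y)
    (e₆ : (α ≫ z) ≫ g = α ≫ z ≫ g) :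
    eqToHom e₁ ≫ α ◁ (eqToHom e₂ ≫ φ ▷ g) =
      eqToHom e₃ ≫ (eqToHom e₄ ≫ (eqToHom e₅ ≫ α ◁ φ) ▷ g) ≫ eqToHom e₆ := by
  subst e₂ e₅
  simp [Strict.associator_eqToIso]

lemma preMap_aux {x : a ⟶ b} {α β : b ⟶ c} {α' β' : a ⟶ d} {x' : d ⟶ c} {y : c ⟶ e} {z : d ⟶ e}
    (φ : x' ≫ y ⟶ z) (ρ : α ⟶ β) (ρ' : α' ⟶ β') (e₁ : x ≫ α = α' ≫ x') (e₂ : β' ≫ x' = x ≫ β)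
    (w : x ◁ ρ = eqToHom e₁ ≫ ρ' ▷ x' ≫ eqToHom e₂) (e₃ : x ≫ α ≫ y = α' ≫ x' ≫ y)
    (e₄ : x ≫ β ≫ y = β' ≫ x' ≫ y) :
    (eqToHom e₃ ≫ α' ◁ φ) ≫ ρ' ▷ z = x ◁ ρ ▷ y ≫ eqToHom e₄ ≫ β' ◁ φ := by
  have k : (x ◁ ρ) ▷ y = _ := congrArg (· ▷ y) w
  simp only [whisker_assoc, comp_whiskerRight, Strict.associator_eqToIso,
    eqToIso.hom, eqToIso.inv, eqToHom_whiskerRight] at k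
  rw [← cancel_epi (eqToHom (Strict.assoc x α y).symm),
    ← cancel_mono (eqToHom (Strict.assoc x β y))] at k
  simp only [Category.assoc, eqToHom_trans, eqToHom_trans_assoc, eqToHom_refl,
    Category.id_comp, Category.comp_id] at k
  rw [Category.assoc, whisker_exchange]
  simp [k, Strict.associator_eqToIso]

end aux

namespace El

variable {X Y Z : StrictPseudofunctor K C} {A B D : C}

lemma pre_id : pre (𝟙 X : X ⟶ X) A = 𝟭 (El X A) := by
  refine _root_.CategoryTheory.Functor.hext (fun p => ?_) (fun p q f => ?_)
  · exact congrArg (El.mk p.idx) (Strict.id_comp p.arr)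
  · induction f using hom_ind with | h u φ => ?_
    refine mk'_heq (Strict.id_comp _) (Strict.id_comp _) u _ _ ?_
    exact pre_id_aux _ _ _ _

lemma pre_comp (α : X ⟶ Y) (β : Y ⟶ Z) : pre (α ≫ β) A = pre β A ⋙ pre α A := by
  refine _root_.CategoryTheory.Functor.hext (fun p => ?_) (fun p q f => ?_)
  · exact congrArg (El.mk p.idx) (Strict.assoc _ _ _)
  · induction f using hom_ind with | h u φ => ?_
    refine mk'_heq (Strict.assoc _ _ _) (Strict.assoc _ _ _) u _ _ ?_
    exact pre_comp_aux _ _ _ _ _ _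

lemma post_pre (α : X ⟶ Y) (g : A ⟶ B) : post Y g ⋙ pre α B = pre α A ⋙ post X g := by
  refine _root_.CategoryTheory.Functor.hext (fun p => ?_) (fun p q f => ?_)
  · exact congrArg (El.mk p.idx) (Strict.assoc _ _ _).symm
  · induction f using hom_ind with | h u φ => ?_
    refine mk'_heq (Strict.assoc _ _ _).symm (Strict.assoc _ _ _).symm u _ _ ?_
    exact post_pre_aux _ _ _ _ _ _ _

variable (A) in
/-- Whiskering with a modification as a natural transformation. -/
def preMap {α β : X ⟶ Y} (ρ : α ⟶ β) : pre α A ⟶ pre β A where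
  app p := vert (Modif.app ρ p.idx ▷ p.arr)
  naturality p q f := by
    induction f using hom_ind with | h u φ => ?_
    rw [pre_map, pre_map]
    refine (mk'_comp_vert _ _ _).trans (Eq.trans ?_ (vert_comp_mk' _ _ _).symm)
    exact mk'_cell (preMap_aux _ _ _ _ _ (ρ.naturality u) _ _)

lemma preMap_app {α β : X ⟶ Y} (ρ : α ⟶ β) (p : El Y A) :
    (preMap A ρ).app p = vert (Modif.app ρ p.idx ▷ p.arr) := rfl

lemma preMap_id (α : X ⟶ Y) : preMap A (𝟙 α) = 𝟙 (pre α A) := by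
  ext p
  rw [preMap_app, Modif.id_app, id_whiskerRight]
  exact vert_id _

lemma preMap_comp {α β γ : X ⟶ Y} (ρ : α ⟶ β) (σ : β ⟶ γ) :
    preMap A (ρ ≫ σ) = preMap A ρ ≫ preMap A σ := by
  ext p
  rw [preMap_app, Modif.comp_app, comp_whiskerRight]
  exact vert_comp _ _

lemma pre_vert (α : X ⟶ Y) {k : K} {f g : Y.obj k ⟶ A} (φ : f ⟶ g) :
    (pre α A).map (vert φ) = vert (TwoNat.app α k ◁ φ) :=
  (pre_map _ _ _).trans (mk'_cell (by simp))

lemma post_vert (g : A ⟶ B) {k : K} {f f' : X.obj k ⟶ A} (φ : f ⟶ f') :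
    (post X g).map (vert φ) = vert (φ ▷ g) :=
  (post_map _ _ _).trans (mk'_cell (by simp))

lemma preMap_whiskerLeft (α : X ⟶ Y) {β γ : Y ⟶ Z} (ρ : β ⟶ γ) :
    preMap A (α ◁ ρ) = eqToHom (pre_comp α β) ≫
      Functor.whiskerRight (preMap A ρ) (pre α A) ≫ eqToHom (pre_comp α γ).symm := by
  ext p
  simp only [NatTrans.comp_app, eqToHom_app]
  refine (vert_conj ((TwoNat.app α p.idx ◁ Modif.app ρ p.idx) ▷ p.arr)
    (TwoNat.app α p.idx ◁ Modif.app ρ p.idx ▷ p.arr) (Strict.assoc _ _ _)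
    (Strict.assoc _ _ _).symm (by simp [Strict.associator_eqToIso])).trans ?_
  rw [← pre_vert]
  rfl

lemma preMap_whiskerRight {α β : X ⟶ Y} (ρ : α ⟶ β) (γ : Y ⟶ Z) :
    preMap A (ρ ▷ γ) = eqToHom (pre_comp α γ) ≫
      (pre γ A).whiskerLeft (preMap A ρ) ≫ eqToHom (pre_comp β γ).symm := by
  ext p
  simp only [NatTrans.comp_app, eqToHom_app]
  exact vert_conj (Modif.app ρ p.idx ▷ TwoNat.app γ p.idx ▷ p.arr)
    (Modif.app ρ p.idx ▷ (TwoNat.app γ p.idx ≫ p.arr)) (Strict.assoc _ _ _)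
    (Strict.assoc _ _ _).symm (by simp [Strict.associator_eqToIso])

lemma postMap_pre (α : X ⟶ Y) {g h : A ⟶ B} (γ : g ⟶ h) :
    Functor.whiskerRight (postMap Y γ) (pre α B) = eqToHom (post_pre α g) ≫
      (pre α A).whiskerLeft (postMap X γ) ≫ eqToHom (post_pre α h).symm := by
  ext p
  simp only [NatTrans.comp_app, eqToHom_app]
  refine (pre_vert α (p.arr ◁ γ)).trans ?_
  exact vert_conj (TwoNat.app α p.idx ◁ p.arr ◁ γ)
    ((TwoNat.app α p.idx ≫ p.arr) ◁ γ) (Strict.assoc _ _ _).symm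
    (Strict.assoc _ _ _) (by simp [Strict.associator_eqToIso])

lemma post_preMap {α β : X ⟶ Y} (ρ : α ⟶ β) (g : A ⟶ B) :
    (post Y g).whiskerLeft (preMap B ρ) = eqToHom (post_pre α g) ≫
      Functor.whiskerRight (preMap A ρ) (post X g) ≫ eqToHom (post_pre β g).symm := by
  ext p
  simp only [NatTrans.comp_app, eqToHom_app]
  refine (vert_conj (Modif.app ρ p.idx ▷ (p.arr ≫ g))
    ((Modif.app ρ p.idx ▷ p.arr) ▷ g) (Strict.assoc _ _ _).symm
    (Strict.assoc _ _ _) (by simp [Strict.associator_eqToIso])).trans ?_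
  rw [← post_vert]
  rfl

end El
end Level

section LevelLoc

lemma conj_symm {E : Type*} [Category* E] {a b a' b' : E} {e : a = b} {e' : b' = a'} {f : a ⟶ a'}
    {g : b ⟶ b'} (h : f = eqToHom e ≫ g ≫ eqToHom e') :
    g = eqToHom e.symm ≫ f ≫ eqToHom e'.symm := by
  subst h; simp

lemma cat_conj {E E' : Cat} {F G H I : E ⟶ E'} (e : F = G) (τ : G ⟶ H) (e' : H = I) :
    (eqToHom e ≫ τ ≫ eqToHom e').toNatTrans =
      eqToHom (by rw [e]) ≫ τ.toNatTrans ≫ eqToHom (by rw [e']) := by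
  subst e e'; simp

section

universe v₁ u₁

variable {E E' E'' D' : Type u₁} [Category.{v₁} E] [Category.{v₁} E'] [Category.{v₁} E'']
  [Category.{v₁} D'] {W : MorphismProperty E} {W' : MorphismProperty E'}
  {W'' : MorphismProperty E''} {V : MorphismProperty D'}

lemma loc_square₁ {F : E ⥤ E'} {P : E' ⥤ E''} {P' : E ⥤ D'} {G : D' ⥤ E''}
    (hF : W ≤ W'.inverseImage F) (hP : W' ≤ W''.inverseImage P)
    (hP' : W ≤ V.inverseImage P') (hG : V ≤ W''.inverseImage G) (e : F ⋙ P = P' ⋙ G) :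
    (locMap F hF).toCatHom ≫ (locMap P hP).toCatHom =
      (locMap P' hP').toCatHom ≫ (locMap G hG).toCatHom := by
  have k : W ≤ W''.inverseImage (F ⋙ P) := fun _ _ _ h => hP _ (hF _ h)
  have k' : W ≤ W''.inverseImage (P' ⋙ G) := fun _ _ _ h => hG _ (hP' _ h)
  exact congrArg (fun F : W.Localization ⥤ W''.Localization => F.toCatHom)
    ((locMap_comp F P hF hP k).symm.trans ((locMap_eq e k k').trans (locMap_comp P' G hP' hG k')))

lemma loc_square₂ {F F' : E ⥤ E'} {P : E' ⥤ E''} {P' : E ⥤ D'} {G G' : D' ⥤ E''}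
    (hF : W ≤ W'.inverseImage F) (hF' : W ≤ W'.inverseImage F') (hP : W' ≤ W''.inverseImage P)
    (hP' : W ≤ V.inverseImage P') (hG : V ≤ W''.inverseImage G) (hG' : V ≤ W''.inverseImage G')
    (τ : F ⟶ F') (σ : G ⟶ G')
    (e : F ⋙ P = P' ⋙ G) (e' : F' ⋙ P = P' ⋙ G')
    (w : Functor.whiskerRight τ P = eqToHom e ≫ P'.whiskerLeft σ ≫ eqToHom e'.symm)
    (e₁ : (locMap F hF).toCatHom ≫ (locMap P hP).toCatHom =
      (locMap P' hP').toCatHom ≫ (locMap G hG).toCatHom)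
    (e₂ : (locMap F' hF').toCatHom ≫ (locMap P hP).toCatHom =
      (locMap P' hP').toCatHom ≫ (locMap G' hG').toCatHom) :
    (locNat hF hF' τ).toCatHom₂ ▷ (locMap P hP).toCatHom =
      eqToHom e₁ ≫ (locMap P' hP').toCatHom ◁ (locNat hG hG' σ).toCatHom₂ ≫ eqToHom e₂.symm := by
  have k₁ : W ≤ W''.inverseImage (F ⋙ P) := fun _ _ _ h => hP _ (hF _ h)
  have k₁' : W ≤ W''.inverseImage (F' ⋙ P) := fun _ _ _ h => hP _ (hF' _ h)
  have k₂ : W ≤ W''.inverseImage (P' ⋙ G) := fun _ _ _ h => hG _ (hP' _ h)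
  have k₂' : W ≤ W''.inverseImage (P' ⋙ G') := fun _ _ _ h => hG' _ (hP' _ h)
  have h₁ := locNat_whiskerRight hF hF' hP τ k₁ k₁'
  have h₂ := locNat_conj k₁ k₁' k₂ k₂' _ _ _ _ w
  have h₃ := locNat_whiskerLeft hP' hG hG' σ k₂ k₂'
  rw [h₃] at h₂
  rw [h₂, ← cancel_epi (eqToHom (locMap_comp F P hF hP k₁).symm),
    ← cancel_mono (eqToHom (locMap_comp F' P hF' hP k₁'))] at h₁
  ext1
  simp only [Category.assoc, eqToHom_trans, eqToHom_trans_assoc, eqToHom_refl,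
    Category.id_comp, Category.comp_id] at h₁
  refine h₁.symm.trans ?_
  simp
  rfl

end

variable {C : Type w} [Bicategory.{t, v} C] [Strict C]
  {K : Type w'} [Bicategory.{t', v'} K] [Strict K]
  {X Y Z : StrictPseudofunctor K C}

lemma colimPre_naturality (α : X ⟶ Y) {A B : C} (g : A ⟶ B) :
    (locMap (El.post Y g) (El.post_W Y g)).toCatHom ≫
      (locMap (El.pre α B) (El.pre_W α)).toCatHom =
    (locMap (El.pre α A) (El.pre_W α)).toCatHom ≫
      (locMap (El.post X g) (El.post_W X g)).toCatHom :=
  loc_square₁ (El.post_W Y g) (El.pre_W α) (El.pre_W α) (El.post_W X g) (El.post_pre α g)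

/-- The 2-natural transformation `colim C(Y k, -) ⇒ colim C(X k, -)` induced by `α : X ⇒ Y`. -/
noncomputable def colimPre (α : X ⟶ Y) : colimHom Y ⟶ colimHom X where
  app A := (locMap (El.pre α A) (El.pre_W α)).toCatHom
  naturality g := colimPre_naturality α g
  naturality₂ {_ _ f g} γ := loc_square₂ (El.post_W Y f) (El.post_W Y g) (El.pre_W α) (El.pre_W α)
    (El.post_W X f) (El.post_W X g) _ _ (El.post_pre α f) (El.post_pre α g) (El.postMap_pre α γ)
    (colimPre_naturality α f) (colimPre_naturality α g)

/-- The modification induced by a modification `α ⇛ β`. -/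
noncomputable def colimPreMap {α β : X ⟶ Y} (ρ : α ⟶ β) : colimPre α ⟶ colimPre β where
  app A := (locNat (El.pre_W α) (El.pre_W β) (El.preMap A ρ)).toCatHom₂
  naturality f := conj_symm (loc_square₂ (El.pre_W α) (El.pre_W β) (El.post_W X f)
    (El.post_W Y f) (El.pre_W α) (El.pre_W β) _ _ (El.post_pre α f).symm (El.post_pre β f).symm
    (conj_symm (El.post_preMap ρ f)) (colimPre_naturality α f).symm
    (colimPre_naturality β f).symm)

lemma colimPre_id (X : StrictPseudofunctor K C) : colimPre (𝟙 X) = 𝟙 (colimHom X) :=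
  TwoNat.ext' fun A => by
    have k : El.W X A ≤ (El.W X A).inverseImage (𝟭 (El X A)) := fun _ _ _ h => h
    exact congrArg (fun F : (El.W X A).Localization ⥤ (El.W X A).Localization => F.toCatHom)
      ((locMap_eq El.pre_id (El.pre_W (𝟙 X)) k).trans (locMap_id k))

lemma pre_comp_W (α : X ⟶ Y) (β : Y ⟶ Z) (A : C) :
    El.W Z A ≤ (El.W X A).inverseImage (El.pre β A ⋙ El.pre α A) :=
  fun _ _ _ k => El.pre_W α _ (El.pre_W β _ k)

lemma colimPre_comp (α : X ⟶ Y) (β : Y ⟶ Z) : colimPre (α ≫ β) = colimPre β ≫ colimPre α :=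
  TwoNat.ext' fun A =>
    congrArg (fun F : (El.W Z A).Localization ⥤ (El.W X A).Localization => F.toCatHom)
      ((locMap_eq (El.pre_comp α β) (El.pre_W (α ≫ β)) (pre_comp_W α β A)).trans
        (locMap_comp _ _ (El.pre_W β) (El.pre_W α) _))

lemma colimPreMap_id (α : X ⟶ Y) : colimPreMap (𝟙 α) = 𝟙 (colimPre α) :=
  Modif.ext' fun _ => congrArg NatTrans.toCatHom₂
    ((congrArg (locNat _ _) (El.preMap_id α)).trans (locNat_id (El.pre_W α)))

lemma colimPreMap_comp {α β γ : X ⟶ Y} (ρ : α ⟶ β) (σ : β ⟶ γ) :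
    colimPreMap (ρ ≫ σ) = colimPreMap ρ ≫ colimPreMap σ :=
  Modif.ext' fun _ => congrArg NatTrans.toCatHom₂
    ((congrArg (locNat _ _) (El.preMap_comp ρ σ)).trans
      (locNat_comp (El.pre_W α) (El.pre_W β) (El.pre_W γ) _ _))

lemma colimPreMap_whiskerLeft (α : X ⟶ Y) {β γ : Y ⟶ Z} (ρ : β ⟶ γ) :
    colimPreMap (α ◁ ρ) =
      eqToHom (colimPre_comp α β) ≫ colimPreMap ρ ▷ colimPre α ≫
        eqToHom (colimPre_comp α γ).symm := by
  refine Modif.ext' fun A => ?_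
  simp only [Modif.comp_app, Modif.eqToHom_app]
  ext1
  refine (locNat_conj _ _ (pre_comp_W α β A) (pre_comp_W α γ A) _ _ _ _
    (El.preMap_whiskerLeft α ρ)).trans ?_
  rw [locNat_whiskerRight (El.pre_W β) (El.pre_W γ) (El.pre_W α) _ (pre_comp_W α β A)
    (pre_comp_W α γ A)]
  refine Eq.trans ?_ (cat_conj (congrArg (TwoNat.app · A) (colimPre_comp α β))
    (Modif.app (colimPreMap ρ) A ▷ TwoNat.app (colimPre α) A)
    (congrArg (TwoNat.app · A) (colimPre_comp α γ).symm)).symm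
  simp
  rfl

lemma colimPreMap_whiskerRight {α β : X ⟶ Y} (ρ : α ⟶ β) (γ : Y ⟶ Z) :
    colimPreMap (ρ ▷ γ) =
      eqToHom (colimPre_comp α γ) ≫ colimPre γ ◁ colimPreMap ρ ≫
        eqToHom (colimPre_comp β γ).symm := by
  refine Modif.ext' fun A => ?_
  simp only [Modif.comp_app, Modif.eqToHom_app]
  ext1
  refine (locNat_conj _ _ (pre_comp_W α γ A) (pre_comp_W β γ A) _ _ _ _
    (El.preMap_whiskerRight ρ γ)).trans ?_
  rw [locNat_whiskerLeft (El.pre_W γ) (El.pre_W α) (El.pre_W β) _ (pre_comp_W α γ A)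
    (pre_comp_W β γ A)]
  refine Eq.trans ?_ (cat_conj (congrArg (TwoNat.app · A) (colimPre_comp α γ))
    (TwoNat.app (colimPre γ) A ◁ Modif.app (colimPreMap ρ) A)
    (congrArg (TwoNat.app · A) (colimPre_comp β γ).symm)).symm
  simp
  rfl

end LevelLoc

/-- A 2-category is 2-cofiltered: any two objects receive arrows from a common object, any two parallel
arrows become isomorphic, and any two parallel 2-cells equal, after precomposition with an arrow. -/
structure TwoCofiltered (K : Type w) [Bicategory.{t, v} K] : Prop where
  f0 (a b : K) : ∃ c : K, Nonempty (c ⟶ a) ∧ Nonempty (c ⟶ b)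
  f1 {a b : K} (f g : a ⟶ b) : ∃ (c : K) (h : c ⟶ a), Nonempty (h ≫ f ≅ h ≫ g)
  f2 {a b : K} {f g : a ⟶ b} (α β : f ⟶ g) : ∃ (c : K) (h : c ⟶ a), h ◁ α = h ◁ β

/-- A 2-pro-object of `C`: a 2-functor `diag : K → C` with `K` a small 2-cofiltered 2-category. (`K` is
the opposite of the 2-filtered index `I`, so this is a 2-functor `Iᵒᵖ → C`.) -/
structure ProObj (C : Type w) [Bicategory.{t, v} C] where
  K : Type u
  [bicategory : Bicategory.{u, u} K]
  [strict : Strict K]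
  cofiltered : TwoCofiltered K
  diag : StrictPseudofunctor K C

attribute [instance] ProObj.bicategory ProObj.strict

namespace ProObj

variable {C : Type w} [Bicategory.{t, v} C] [Strict C]

/-- The 2-functor `LX = colim C(X k, -) : C → Cat`. -/
noncomputable def L (X : ProObj.{t, v, w, u} C) : StrictPseudofunctor C Cat := colimHom X.diag

/-- `2-Pro(C)(X, Y) = Hom(C, Cat)(LY, LX)`, with the compositions of `Hom(C, Cat)ᵒᵖ`. -/
noncomputable instance : CategoryStruct (ProObj.{t, v, w, u} C) where
  Hom X Y := L Y ⟶ L X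
  id X := 𝟙 (L X)
  comp f g := g ≫ f

noncomputable instance (X Y : ProObj.{t, v, w, u} C) : Category (X ⟶ Y) :=
  inferInstanceAs (Category (L Y ⟶ L X))

/-- The 2-category `2-Pro(C)`: 1-cells are reversed with respect to `Hom(C, Cat)`, 2-cells are not. -/
noncomputable instance : Bicategory (ProObj.{t, v, w, u} C) where
  whiskerLeft {X Y Z} f g h η := Bicategory.whiskerRight (B := StrictPseudofunctor C Cat)
    (a := L Z) (b := L Y) (c := L X) η f
  whiskerRight {X Y Z f g} η h := Bicategory.whiskerLeft (B := StrictPseudofunctor C Cat)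
    (a := L Z) (b := L Y) (c := L X) h η
  associator {W X Y Z} f g h := (Bicategory.associator (B := StrictPseudofunctor C Cat)
    (a := L Z) (b := L Y) (c := L X) (d := L W) h g f).symm
  leftUnitor {X Y} f := Bicategory.rightUnitor (B := StrictPseudofunctor C Cat)
    (a := L Y) (b := L X) f
  rightUnitor {X Y} f := Bicategory.leftUnitor (B := StrictPseudofunctor C Cat)
    (a := L Y) (b := L X) f
  whiskerLeft_id {X Y Z} f g := Bicategory.id_whiskerRight (B := StrictPseudofunctor C Cat)
    (a := L Z) (b := L Y) (c := L X) g f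
  whiskerLeft_comp {X Y Z} f g h i η θ := Bicategory.comp_whiskerRight
    (B := StrictPseudofunctor C Cat) (a := L Z) (b := L Y) (c := L X) η θ f
  id_whiskerLeft {X Y f g} η := Bicategory.whiskerRight_id (B := StrictPseudofunctor C Cat)
    (a := L Y) (b := L X) η
  comp_whiskerLeft {X Y Z W} f g h h' η := Bicategory.whiskerRight_comp
    (B := StrictPseudofunctor C Cat) (a := L W) (b := L Z) (c := L Y) (d := L X) η g f
  id_whiskerRight {X Y Z} f g := Bicategory.whiskerLeft_id (B := StrictPseudofunctor C Cat)
    (a := L Z) (b := L Y) (c := L X) g f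
  comp_whiskerRight {X Y Z f g h} η θ i := Bicategory.whiskerLeft_comp
    (B := StrictPseudofunctor C Cat) (a := L Z) (b := L Y) (c := L X) i η θ
  whiskerRight_id {X Y f g} η := Bicategory.id_whiskerLeft (B := StrictPseudofunctor C Cat)
    (a := L Y) (b := L X) η
  whiskerRight_comp {X Y Z W f f'} η g h := Bicategory.comp_whiskerLeft
    (B := StrictPseudofunctor C Cat) (a := L W) (b := L Z) (c := L Y) (d := L X) h g η
  whisker_assoc {X Y Z W} f g g' η h := Bicategory.whisker_assoc_symm
    (B := StrictPseudofunctor C Cat) (a := L W) (b := L Z) (c := L Y) (d := L X) h η f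
  whisker_exchange {X Y Z f g h i} η θ := (Bicategory.whisker_exchange
    (B := StrictPseudofunctor C Cat) (a := L Z) (b := L Y) (c := L X) θ η).symm
  pentagon {V W X Y Z} f g h i := Bicategory.pentagon_inv
    (B := StrictPseudofunctor C Cat) (a := L Z) (b := L Y) (c := L X) (d := L W) (e := L V) i h g f
  triangle {X Y Z} f g := Bicategory.triangle_assoc_comp_right
    (B := StrictPseudofunctor C Cat) (a := L Z) (b := L Y) (c := L X) g f

noncomputable instance : Strict (ProObj.{t, v, w, u} C) where
  id_comp {X Y} f := Strict.comp_id (B := StrictPseudofunctor C Cat) (a := L Y) (b := L X) f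
  comp_id {X Y} f := Strict.id_comp (B := StrictPseudofunctor C Cat) (a := L Y) (b := L X) f
  assoc {W X Y Z} f g h := (Strict.assoc (B := StrictPseudofunctor C Cat)
    (a := L Z) (b := L Y) (c := L X) (d := L W) h g f).symm
  leftUnitor_eqToIso _ := rfl
  rightUnitor_eqToIso _ := rfl
  associator_eqToIso {W X Y Z} f g h := by
    ext; exact (Iso.symm_hom _).trans rfl

end ProObj

section Embedding

variable {C : Type w} [Bicategory.{t, v} C] [Strict C]

lemma eq_conj {E : Type*} [Category* E] {a b : E} (f : a ⟶ b) (e : a = a) (e' : b = b) :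
    f = eqToHom e ≫ f ≫ eqToHom e' := by simp

lemma const_aux₁ {A B : C} (f : A ⟶ B) (e : 𝟙 A ≫ f = f ≫ 𝟙 B) :
    𝟙 (𝟙 A) ▷ f = eqToHom e ≫ f ◁ 𝟙 (𝟙 B) ≫ eqToHom e.symm := by simp

lemma const_aux₂ {A B : C} {f g : A ⟶ B} (α : f ⟶ g) (e : 𝟙 A ≫ f = f ≫ 𝟙 B)
    (e' : 𝟙 A ≫ g = g ≫ 𝟙 B) :
    𝟙 A ◁ α = eqToHom e ≫ α ▷ 𝟙 B ≫ eqToHom e'.symm := by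
  simp [id_whiskerLeft, whiskerRight_id, Strict.leftUnitor_eqToIso, Strict.rightUnitor_eqToIso]

section

variable (K : Type w') [Bicategory.{t', v'} K] [Strict K]

/-- The constant 2-functor. -/
@[simps!]
def constObj (A : C) : StrictPseudofunctor K C :=
  StrictPseudofunctor.mk'' {
    obj _ := A
    map _ := 𝟙 A
    map₂ _ := 𝟙 (𝟙 A)
    map_comp _ _ := (Strict.id_comp _).symm }

/-- The constant 2-natural transformation. -/
@[simps!]
def constMap {A B : C} (f : A ⟶ B) : constObj K A ⟶ constObj K B where
  app _ := f
  naturality _ := (Strict.id_comp f).trans (Strict.comp_id f).symm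
  naturality₂ _ := const_aux₁ f _

/-- The constant modification. -/
@[simps!]
def constMap₂ {A B : C} {f g : A ⟶ B} (α : f ⟶ g) : constMap K f ⟶ constMap K g where
  app _ := α
  naturality _ := const_aux₂ α ((Strict.id_comp f).trans (Strict.comp_id f).symm)
    ((Strict.id_comp g).trans (Strict.comp_id g).symm)

/-- The diagonal 2-functor `C → Hom(K, C)`. -/
def const : StrictPseudofunctor C (StrictPseudofunctor K C) :=
  StrictPseudofunctor.mk'' {
    obj A := constObj K A
    map f := constMap K f
    map₂ α := constMap₂ K α
    map₂_id _ := rfl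
    map₂_comp _ _ := rfl
    map₂_whisker_left f g g' α := eq_conj (constMap₂ K (f ◁ α)) _ _
    map₂_whisker_right α g := eq_conj (constMap₂ K (α ▷ g)) _ _ }

end

/-- For a small 2-cofiltered 2-category `K`, the 2-functor `Hom(K, C) → 2-Pro(C)` which is `X ↦ X` on
objects. -/
noncomputable def level (K : Type u) [Bicategory.{u, u} K] [Strict K] (hK : TwoCofiltered K) :
    StrictPseudofunctor (StrictPseudofunctor K C) (ProObj.{t, v, w, u} C) :=
  StrictPseudofunctor.mk'' {
    obj X := ⟨K, hK, X⟩
    map α := colimPre α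
    map₂ ρ := colimPreMap ρ
    map₂_id α := colimPreMap_id α
    map₂_comp ρ σ := colimPreMap_comp ρ σ
    map_id X := colimPre_id X
    map_comp α β := colimPre_comp α β
    map₂_whisker_left α _ _ ρ := colimPreMap_whiskerLeft α ρ
    map₂_whisker_right ρ γ := colimPreMap_whiskerRight ρ γ }

/-- The one-point 2-category. -/
abbrev Pt : Type u := LocallyDiscrete (Discrete PUnit.{u + 1})

lemma subsingleton_pt {a b : Pt.{u}} (f g : a ⟶ b) : f = g := by
  obtain ⟨f⟩ := f
  obtain ⟨g⟩ := g
  congr 1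
  exact Subsingleton.elim (α := (a.as ⟶ b.as)) f g

lemma twoCofiltered_pt : TwoCofiltered Pt.{u} where
  f0 a b := ⟨a, ⟨𝟙 a⟩, ⟨⟨⟨⟨Subsingleton.elim _ _⟩⟩⟩⟩⟩
  f1 {a b} f g := ⟨a, 𝟙 a, ⟨eqToIso (by rw [subsingleton_pt f g])⟩⟩
  f2 {a b f g} α β := ⟨a, 𝟙 a, by rw [Subsingleton.elim α β]⟩

variable (C) in
/-- The 2-functor `c : C → 2-Pro(C)`, sending `A` to the 2-pro-object `A` indexed by a point. -/
noncomputable def proEmbedding : StrictPseudofunctor C (ProObj.{t, v, w, u} C) :=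
  (const Pt.{u}).comp (level Pt.{u} twoCofiltered_pt)

end Embedding

section Pseudolimits

variable {C : Type w} [Bicategory.{t, v} C] [Strict C] {K : Type w'} [Bicategory.{t', v'} K]
  [Strict K]

/-- A pseudocone for the 2-functor `X : K → C` with vertex `A`. -/
structure PseudoCone (X : StrictPseudofunctor K C) (A : C) where
  leg (k : K) : A ⟶ X.obj k
  cell {k l : K} (u : k ⟶ l) : leg l ≅ leg k ≫ X.map u
  cell_id (k : K) : (cell (𝟙 k)).hom = eqToHom (by rw [X.map_id, Strict.comp_id])
  cell_comp {k l m : K} (u : k ⟶ l) (v : l ⟶ m) :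
    (cell (u ≫ v)).hom =
      (cell v).hom ≫ (cell u).hom ▷ X.map v ≫ eqToHom (by rw [X.map_comp, Strict.assoc])
  cell_naturality {k l : K} {u v : k ⟶ l} (α : u ⟶ v) :
    (cell v).hom = (cell u).hom ≫ leg k ◁ X.map₂ α

namespace PseudoCone

variable {X : StrictPseudofunctor K C} {A B : C}

/-- A morphism of pseudocones. -/
@[ext]
structure Hom (σ τ : PseudoCone X A) where
  app (k : K) : σ.leg k ⟶ τ.leg k
  w {k l : K} (u : k ⟶ l) : (σ.cell u).hom ≫ app k ▷ X.map u = app l ≫ (τ.cell u).hom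

instance : Category (PseudoCone X A) where
  Hom σ τ := Hom σ τ
  id σ := { app k := 𝟙 _, w u := by simp }
  comp f g := { app k := f.app k ≫ g.app k, w u := by simp [← g.w, reassoc_of% f.w] }

/-- Whiskering of a pseudocone with an arrow into its vertex. -/
def whisker (π : PseudoCone X A) (f : B ⟶ A) : PseudoCone X B where
  leg k := f ≫ π.leg k
  cell u := whiskerLeftIso f (π.cell u) ≪≫ eqToIso (Strict.assoc _ _ _).symm
  cell_id k := by simp [π.cell_id]
  cell_comp u v := by simp [π.cell_comp, Strict.associator_eqToIso]
  cell_naturality α := by simp [π.cell_naturality α, Strict.associator_eqToIso]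

/-- The functor `C(B, A) → PC(B, X)` given by composition with the pseudocone `π`. -/
def whiskerFunctor (π : PseudoCone X A) (B : C) : (B ⟶ A) ⥤ PseudoCone X B where
  obj f := π.whisker f
  map α :=
    { app k := α ▷ π.leg k
      w u := by
        have h := whisker_exchange α (π.cell u).hom
        simp only [whiskerRight_comp, Strict.associator_eqToIso, eqToIso.hom, eqToIso.inv] at h
        simp [whisker, ← reassoc_of% h] }
  map_id f := Hom.ext (funext fun _ => id_whiskerRight _ _)
  map_comp α β := Hom.ext (funext fun _ => comp_whiskerRight _ _ _)

/-- `π` is a pseudolimit pseudocone: composition with `π` is an isomorphism of categories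
`C(B, A) ≅ PC(B, X)` for all `B`. -/
def IsPseudolimit (π : PseudoCone X A) : Prop :=
  ∀ B : C, ∃ G : PseudoCone X B ⥤ (B ⟶ A),
    π.whiskerFunctor B ⋙ G = 𝟭 _ ∧ G ⋙ π.whiskerFunctor B = 𝟭 _

section aux

variable {D : Type w''} [Bicategory.{t'', v''} D] (H : StrictPseudofunctor C D)
  {a b c d : C}

lemma map_id_aux {x y : a ⟶ b} (φ : x ⟶ y) (e : x = y) (h : φ = eqToHom e) {z : H.obj a ⟶ H.obj b}
    (e' : H.map y = z) (e'' : H.map x = z) : H.map₂ φ ≫ eqToHom e' = eqToHom e'' := by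
  subst h
  simp [PrelaxFunctor.map₂_eqToHom]

lemma map_comp_aux {x : a ⟶ b} {y : a ⟶ c} {z : a ⟶ d} {u : b ⟶ c} {v : c ⟶ d} {uv : b ⟶ d}
    (φ : z ⟶ x ≫ uv) (ψ : z ⟶ y ≫ v) (χ : y ⟶ x ≫ u) (e : (x ≫ u) ≫ v = x ≫ uv)
    (h : φ = ψ ≫ χ ▷ v ≫ eqToHom e) (e₁ : H.map (x ≫ uv) = H.map x ≫ H.map uv)
    (e₂ : H.map (y ≫ v) = H.map y ≫ H.map v) (e₃ : H.map (x ≫ u) = H.map x ≫ H.map u)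
    (e₄ : (H.map x ≫ H.map u) ≫ H.map v = H.map x ≫ H.map uv) :
    H.map₂ φ ≫ eqToHom e₁ =
      (H.map₂ ψ ≫ eqToHom e₂) ≫ (H.map₂ χ ≫ eqToHom e₃) ▷ H.map v ≫ eqToHom e₄ := by
  subst h
  simp [PrelaxFunctor.map₂_eqToHom, H.map₂_whisker_right, H.mapComp_eq_eqToIso]

lemma map_naturality_aux {x : a ⟶ b} {z : a ⟶ c} {u v : b ⟶ c} (α : u ⟶ v) (φ : z ⟶ x ≫ v)
    (ψ : z ⟶ x ≫ u) (h : φ = ψ ≫ x ◁ α) (e₁ : H.map (x ≫ v) = H.map x ≫ H.map v)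
    (e₂ : H.map (x ≫ u) = H.map x ≫ H.map u) :
    H.map₂ φ ≫ eqToHom e₁ = (H.map₂ ψ ≫ eqToHom e₂) ≫ H.map x ◁ H.map₂ α := by
  subst h
  simp [H.map₂_whisker_left, H.mapComp_eq_eqToIso]

end aux

/-- The image of a pseudocone under a 2-functor. -/
def map {D : Type w''} [Bicategory.{t'', v''} D] [Strict D] (H : StrictPseudofunctor C D)
    (π : PseudoCone X A) : PseudoCone (X.comp H) (H.obj A) where
  leg k := H.map (π.leg k)
  cell u := H.map₂Iso (π.cell u) ≪≫ eqToIso (H.map_comp _ _)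
  cell_id k := map_id_aux H _ _ (π.cell_id k) (H.map_comp _ _) _
  cell_comp u v := map_comp_aux H _ _ _ _ (π.cell_comp u v) (H.map_comp _ _) (H.map_comp _ _)
    (H.map_comp _ _) _
  cell_naturality α := map_naturality_aux H _ _ _ (π.cell_naturality α) (H.map_comp _ _)
    (H.map_comp _ _)

end PseudoCone

/-- `C` is closed under small 2-cofiltered pseudolimits. -/
def HasCofilteredPseudolimits (C : Type w) [Bicategory.{t, v} C] [Strict C] : Prop :=
  ∀ (K : Type u) [Bicategory.{u, u} K] [Strict K], TwoCofiltered K →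
    ∀ X : StrictPseudofunctor K C, ∃ (A : C) (π : PseudoCone X A), π.IsPseudolimit

/-- `H` preserves small 2-cofiltered pseudolimits. -/
def PreservesCofilteredPseudolimits {D : Type w'} [Bicategory.{t', v'} D] [Strict D]
    (H : StrictPseudofunctor C D) : Prop :=
  ∀ (K : Type u) [Bicategory.{u, u} K] [Strict K], TwoCofiltered K →
    ∀ (X : StrictPseudofunctor K C) (A : C) (π : PseudoCone X A),
      π.IsPseudolimit → (π.map H).IsPseudolimit

end Pseudolimits

section TwoCat

lemma strictPseudofunctor_ext {C : Type w} [Bicategory.{t, v} C] {D : Type w'}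
    [Bicategory.{t', v'} D] {F G : StrictPseudofunctor C D}
    (h : F.toPrelaxFunctor = G.toPrelaxFunctor) : F = G := by
  obtain ⟨⟨⟨F, mapId, mapComp, a₁, a₂, a₃, a₄, a₅⟩, b₁, b₂⟩, c₁, c₂⟩ := F
  obtain ⟨⟨⟨G, mapId', mapComp', a₁', a₂', a₃', a₄', a₅'⟩, b₁', b₂'⟩, c₁', c₂'⟩ := G
  dsimp at h
  subst h
  obtain rfl : mapId = mapId' := by ext1 x; exact (b₂ x).trans (b₂' x).symm
  obtain rfl : @mapComp = @mapComp' := by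
    funext x y z f g; exact (c₂ f g).trans (c₂' f g).symm
  rfl

namespace PseudoCone

variable {C : Type w} [Bicategory.{t, v} C] [Strict C] {K : Type w'} [Bicategory.{t', v'} K]
  [Strict K]

lemma isPseudolimit_congr {X X' : StrictPseudofunctor K C} (h : X = X') {A : C}
    (π : PseudoCone X A) (π' : PseudoCone X' A) (hl : ∀ k, HEq (π.leg k) (π'.leg k))
    (hc : ∀ {k l : K} (u : k ⟶ l), HEq (π.cell u).hom (π'.cell u).hom) (hπ : π.IsPseudolimit) :
    π'.IsPseudolimit := by
  subst h
  suffices π = π' by rwa [← this]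
  obtain ⟨leg, cell, _, _, _⟩ := π
  obtain ⟨leg', cell', _, _, _⟩ := π'
  obtain rfl : leg = leg' := funext fun k => eq_of_heq (hl k)
  obtain rfl : @cell = @cell' := by
    funext k l u; ext1; exact eq_of_heq (hc u)
  rfl

lemma map_map_aux {D : Type w''} [Bicategory.{t'', v''} D] [Strict D]
    (H : StrictPseudofunctor C D) {a b : C} {x y z : a ⟶ b} (φ : x ⟶ y) (e : y = z)
    {z' : H.obj a ⟶ H.obj b} (e' : H.map z = z') (e'' : H.map y = z') :
    H.map₂ (φ ≫ eqToHom e) ≫ eqToHom e' = H.map₂ φ ≫ eqToHom e'' := by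
  subst e e'; simp

end PseudoCone

lemma PreservesCofilteredPseudolimits.id (C : Type w) [Bicategory.{t, v} C] [Strict C] :
    PreservesCofilteredPseudolimits.{t, v, w, t, v, w, u} (StrictPseudofunctor.id C) := by
  intro K _ _ _ X A π hπ
  refine PseudoCone.isPseudolimit_congr (X := X) (X' := X.comp (StrictPseudofunctor.id C))
    (strictPseudofunctor_ext rfl) π (π.map (StrictPseudofunctor.id C)) (fun _ => HEq.rfl) (fun u => heq_of_eq ?_) hπ
  exact (Category.comp_id _).symm

lemma PreservesCofilteredPseudolimits.comp {C : Type w} [Bicategory.{t, v} C] [Strict C]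
    {D : Type w'} [Bicategory.{t', v'} D] [Strict D] {E : Type w''} [Bicategory.{t'', v''} E]
    [Strict E] {F : StrictPseudofunctor C D} {G : StrictPseudofunctor D E}
    (hF : PreservesCofilteredPseudolimits.{t, v, w, t', v', w', u} F)
    (hG : PreservesCofilteredPseudolimits.{t', v', w', t'', v'', w'', u} G) :
    PreservesCofilteredPseudolimits.{t, v, w, t'', v'', w'', u} (F.comp G) := by
  intro K _ _ hK X A π hπ
  refine PseudoCone.isPseudolimit_congr (X := (X.comp F).comp G) (X' := X.comp (F.comp G))
    (strictPseudofunctor_ext rfl) ((π.map F).map G) (π.map (F.comp G)) (fun _ => HEq.rfl) (fun u => heq_of_eq ?_)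
    (hG K hK _ _ _ (hF K hK _ _ _ hπ))
  exact PseudoCone.map_map_aux G (F.map₂ (π.cell u).hom) (F.map_comp _ _) (G.map_comp _ _)
    ((F.comp G).map_comp _ _)

/-- A 2-category is locally small if its arrows between two objects form a small set, and so do the
2-cells between two arrows. -/
structure TwoLocallySmall (C : Type w) [Bicategory.{t, v} C] : Prop where
  small_hom (a b : C) : Small.{u} (a ⟶ b)
  small_hom₂ {a b : C} (f g : a ⟶ b) : Small.{u} (f ⟶ g)

/-- An object of `2-CAT`: a locally small 2-category. -/
structure TwoCAT where
  carrier : Type w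
  [bicategory : Bicategory.{w, w} carrier]
  [strict : Strict carrier]
  locallySmall : TwoLocallySmall.{w, w, w, u} carrier

attribute [instance] TwoCAT.bicategory TwoCAT.strict

instance : CoeSort TwoCAT.{w, u} (Type w) := ⟨TwoCAT.carrier⟩

namespace TwoNat

variable {B : Type w} [Bicategory.{t, v} B] {C : Type w'} [Bicategory.{t', v'} C]
  {D : Type w''} [Bicategory.{t'', v''} D]

/-- Whiskering of a 2-natural transformation `η : G ⇒ H` with a 2-functor `F` on the source side. -/
@[simps]
def whiskerLeft (F : StrictPseudofunctor B C) {G H : StrictPseudofunctor C D} (η : TwoNat G H) :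
    TwoNat (F.comp G) (F.comp H) where
  app a := η.app (F.obj a)
  naturality f := η.naturality (F.map f)
  naturality₂ α := η.naturality₂ (F.map₂ α)

lemma whiskerRight_aux (H : StrictPseudofunctor C D) {a b c d : C} {f g : a ⟶ b}
    {y : b ⟶ d} {x : a ⟶ c} {f' g' : c ⟶ d} (α : f ⟶ g) (α' : f' ⟶ g') (e₁ : f ≫ y = x ≫ f')
    (e₂ : x ≫ g' = g ≫ y) (h : α ▷ y = eqToHom e₁ ≫ x ◁ α' ≫ eqToHom e₂)
    (e₃ : H.map f ≫ H.map y = H.map x ≫ H.map f')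
    (e₄ : H.map x ≫ H.map g' = H.map g ≫ H.map y) :
    H.map₂ α ▷ H.map y = eqToHom e₃ ≫ H.map x ◁ H.map₂ α' ≫ eqToHom e₄ := by
  have k := congrArg H.map₂ h
  simp only [H.map₂_whisker_right, H.map₂_whisker_left, H.mapComp_eq_eqToIso,
    PrelaxFunctor.map₂_comp, PrelaxFunctor.map₂_eqToHom, eqToIso.hom, eqToIso.inv] at k
  rw [← cancel_epi (eqToHom (H.map_comp f y)), ← cancel_mono (eqToHom (H.map_comp g y).symm)]
  simp at k ⊢
  exact k

/-- Whiskering of a 2-natural transformation `η : F ⇒ G` with a 2-functor `H` on the target side. -/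
@[simps]
def whiskerRight {F G : StrictPseudofunctor B C} (η : TwoNat F G) (H : StrictPseudofunctor C D) :
    TwoNat (F.comp H) (G.comp H) where
  app a := H.map (η.app a)
  naturality f := (H.map_comp _ _).symm.trans ((congrArg H.map (η.naturality f)).trans
    (H.map_comp _ _))
  naturality₂ {_ _ f g} α := whiskerRight_aux H _ _ (η.naturality f) (η.naturality g).symm
    (η.naturality₂ α) _ _

end TwoNat

namespace TwoCAT

/-- The 1-cells of `2-CAT` are the 2-functors. -/
instance : CategoryStruct TwoCAT.{w, u} where
  Hom C D := StrictPseudofunctor C D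
  id C := StrictPseudofunctor.id C
  comp F G := F.comp G

/-- The 2-cells of `2-CAT` are the 2-natural transformations. -/
instance (C D : TwoCAT.{w, u}) : Category (C ⟶ D) where
  Hom F G := TwoNat (C := C) (D := D) F G
  id F := TwoNat.id F
  comp α β := TwoNat.vcomp α β
  id_comp _ := TwoNat.ext (funext fun _ => Strict.id_comp _)
  comp_id _ := TwoNat.ext (funext fun _ => Strict.comp_id _)
  assoc _ _ _ := TwoNat.ext (funext fun _ => Strict.assoc _ _ _)

@[simp] lemma id_app {C D : TwoCAT.{w, u}} (F : C ⟶ D) (a : C) :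
    TwoNat.app (𝟙 F) a = 𝟙 (F.obj a) := rfl

@[simp] lemma comp_app {C D : TwoCAT.{w, u}} {F G H : C ⟶ D} (α : F ⟶ G) (β : G ⟶ H) (a : C) :
    TwoNat.app (α ≫ β) a = TwoNat.app α a ≫ TwoNat.app β a := rfl

lemma hom_ext {C D : TwoCAT.{w, u}} {F G : C ⟶ D} {α β : F ⟶ G}
    (h : ∀ a, TwoNat.app α a = TwoNat.app β a) : α = β := TwoNat.ext (funext h)

lemma eq_eqToHom {C D : TwoCAT.{w, u}} {F G : C ⟶ D} (h : F = G) (α : F ⟶ G)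
    (hα : ∀ a, HEq (TwoNat.app α a) (𝟙 (F.obj a))) : α = eqToHom h := by
  subst h
  exact hom_ext fun a => eq_of_heq (hα a)

/-- The associator; all its components are identities. -/
def associator {B C D E : TwoCAT.{w, u}} (F : B ⟶ C) (G : C ⟶ D) (H : D ⟶ E) :
    (F ≫ G) ≫ H ≅ F ≫ G ≫ H where
  hom :=
    { app := (TwoNat.id ((F.comp G).comp H)).app
      naturality := (TwoNat.id ((F.comp G).comp H)).naturality
      naturality₂ := (TwoNat.id ((F.comp G).comp H)).naturality₂ }
  inv :=
    { app := (TwoNat.id (F.comp (G.comp H))).app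
      naturality := (TwoNat.id (F.comp (G.comp H))).naturality
      naturality₂ := (TwoNat.id (F.comp (G.comp H))).naturality₂ }
  hom_inv_id := hom_ext fun _ => Strict.comp_id _
  inv_hom_id := hom_ext fun _ => Strict.comp_id _

/-- The left unitor; all its components are identities. -/
def leftUnitor {C D : TwoCAT.{w, u}} (F : C ⟶ D) : 𝟙 C ≫ F ≅ F where
  hom :=
    { app := (TwoNat.id F).app
      naturality := (TwoNat.id F).naturality
      naturality₂ := (TwoNat.id F).naturality₂ }
  inv :=
    { app := (TwoNat.id F).app
      naturality := (TwoNat.id F).naturality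
      naturality₂ := (TwoNat.id F).naturality₂ }
  hom_inv_id := hom_ext fun _ => Strict.comp_id _
  inv_hom_id := hom_ext fun _ => Strict.comp_id _

/-- The right unitor; all its components are identities. -/
def rightUnitor {C D : TwoCAT.{w, u}} (F : C ⟶ D) : F ≫ 𝟙 D ≅ F where
  hom :=
    { app := (TwoNat.id F).app
      naturality := (TwoNat.id F).naturality
      naturality₂ := (TwoNat.id F).naturality₂ }
  inv :=
    { app := (TwoNat.id F).app
      naturality := (TwoNat.id F).naturality
      naturality₂ := (TwoNat.id F).naturality₂ }
  hom_inv_id := hom_ext fun _ => Strict.comp_id _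
  inv_hom_id := hom_ext fun _ => Strict.comp_id _

lemma unit_aux {C : Type w} [Bicategory.{t, v} C] [Strict C] {a b : C} (f : a ⟶ b) :
    f = 𝟙 a ≫ f ≫ 𝟙 b := by rw [Strict.id_comp, Strict.comp_id]

lemma pentagon_aux {C D : TwoCAT.{w, u}} (F : StrictPseudofunctor C D) (a : C) :
    F.map (𝟙 a) ≫ 𝟙 (F.obj a) ≫ 𝟙 (F.obj a) = 𝟙 (F.obj a) ≫ 𝟙 (F.obj a) := by
  rw [F.map_id, Strict.id_comp]

lemma triangle_aux {C D : TwoCAT.{w, u}} (F : StrictPseudofunctor C D) (a : C) :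
    𝟙 (F.obj a) ≫ 𝟙 (F.obj a) = F.map (𝟙 a) := by
  rw [F.map_id, Strict.id_comp]

lemma id_comp' {C D : TwoCAT.{w, u}} (F : C ⟶ D) : 𝟙 C ≫ F = F := strictPseudofunctor_ext rfl

lemma comp_id' {C D : TwoCAT.{w, u}} (F : C ⟶ D) : F ≫ 𝟙 D = F := strictPseudofunctor_ext rfl

lemma assoc' {B C D E : TwoCAT.{w, u}} (F : B ⟶ C) (G : C ⟶ D) (H : D ⟶ E) :
    (F ≫ G) ≫ H = F ≫ G ≫ H := strictPseudofunctor_ext rfl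

/-- The 2-category `2-CAT` of locally small 2-categories. -/
instance : Bicategory TwoCAT.{w, u} where
  whiskerLeft F _ _ η := TwoNat.whiskerLeft F η
  whiskerRight η H := TwoNat.whiskerRight η H
  associator := associator
  leftUnitor := leftUnitor
  rightUnitor := rightUnitor
  whiskerLeft_id _ _ := hom_ext fun _ => rfl
  whiskerLeft_comp _ _ _ _ _ _ := hom_ext fun _ => rfl
  id_whiskerLeft _ := hom_ext fun _ => unit_aux _
  comp_whiskerLeft _ _ _ _ _ := hom_ext fun _ => unit_aux _
  id_whiskerRight _ H := hom_ext fun _ => StrictlyUnitaryPseudofunctor.map_id _ _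
  comp_whiskerRight _ _ H := hom_ext fun _ => StrictPseudofunctor.map_comp _ _ _
  whiskerRight_id _ := hom_ext fun _ => unit_aux _
  whiskerRight_comp _ _ _ := hom_ext fun _ => unit_aux _
  whisker_assoc _ _ _ _ _ := hom_ext fun _ => unit_aux _
  whisker_exchange α β := hom_ext fun a => (TwoNat.naturality β (TwoNat.app α a)).symm
  pentagon _ _ _ I := hom_ext fun _ => pentagon_aux I _
  triangle _ G := hom_ext fun _ => triangle_aux G _

instance : Strict TwoCAT.{w, u} where
  id_comp := id_comp'
  comp_id := comp_id'
  assoc := assoc'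
  leftUnitor_eqToIso F := Iso.ext (eq_eqToHom (id_comp' F) _ fun _ => HEq.rfl)
  rightUnitor_eqToIso F := Iso.ext (eq_eqToHom (comp_id' F) _ fun _ => HEq.rfl)
  associator_eqToIso F G H := Iso.ext (eq_eqToHom (assoc' F G H) _ fun _ => HEq.rfl)

end TwoCAT

/-- An object of `2-CAT_+`: a locally small 2-category closed under small 2-cofiltered pseudolimits. -/
structure TwoCATPlus where
  toTwoCAT : TwoCAT.{w, u}
  hasCofilteredPseudolimits : HasCofilteredPseudolimits.{w, w, w, u} toTwoCAT

namespace TwoCATPlus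

/-- A 1-cell of `2-CAT_+`: a 2-functor which preserves small 2-cofiltered pseudolimits. -/
@[ext]
structure Hom (C D : TwoCATPlus.{w, u}) where
  functor : C.toTwoCAT ⟶ D.toTwoCAT
  preserves : PreservesCofilteredPseudolimits.{w, w, w, w, w, w, u} (C := C.toTwoCAT)
    (D := D.toTwoCAT) functor

instance : CategoryStruct TwoCATPlus.{w, u} where
  Hom C D := Hom C D
  id C := ⟨𝟙 C.toTwoCAT, .id _⟩
  comp F G := ⟨F.functor ≫ G.functor, F.preserves.comp G.preserves⟩

/-- The 2-cells of `2-CAT_+` are all 2-natural transformations. -/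
instance (C D : TwoCATPlus.{w, u}) : Category (C ⟶ D) where
  Hom F G := F.functor ⟶ G.functor
  id F := 𝟙 F.functor
  comp α β := α ≫ β
  id_comp α := Category.id_comp (obj := C.toTwoCAT ⟶ D.toTwoCAT) α
  comp_id α := Category.comp_id (obj := C.toTwoCAT ⟶ D.toTwoCAT) α
  assoc α β γ := Category.assoc (obj := C.toTwoCAT ⟶ D.toTwoCAT) α β γ

/-- Isomorphisms between 1-cells of `2-CAT_+` are those of `2-CAT`. -/
def isoMk {C D : TwoCATPlus.{w, u}} {F G : C ⟶ D} (e : F.functor ≅ G.functor) : F ≅ G where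
  hom := e.hom
  inv := e.inv
  hom_inv_id := e.hom_inv_id
  inv_hom_id := e.inv_hom_id

/-- The 2-category `2-CAT_+`. -/
instance : Bicategory TwoCATPlus.{w, u} where
  whiskerLeft {B C D} F G H η := Bicategory.whiskerLeft (B := TwoCAT.{w, u}) F.functor η
  whiskerRight η H := Bicategory.whiskerRight (B := TwoCAT.{w, u}) η H.functor
  associator F G H := isoMk (α_ F.functor G.functor H.functor)
  leftUnitor F := isoMk (λ_ F.functor)
  rightUnitor F := isoMk (ρ_ F.functor)
  whiskerLeft_id _ _ := Bicategory.whiskerLeft_id (B := TwoCAT.{w, u}) _ _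
  whiskerLeft_comp _ _ _ _ _ _ := Bicategory.whiskerLeft_comp (B := TwoCAT.{w, u}) _ _ _
  id_whiskerLeft _ := Bicategory.id_whiskerLeft (B := TwoCAT.{w, u}) _
  comp_whiskerLeft _ _ _ _ _ := Bicategory.comp_whiskerLeft (B := TwoCAT.{w, u}) _ _ _
  id_whiskerRight _ _ := Bicategory.id_whiskerRight (B := TwoCAT.{w, u}) _ _
  comp_whiskerRight _ _ _ := Bicategory.comp_whiskerRight (B := TwoCAT.{w, u}) _ _ _
  whiskerRight_id _ := Bicategory.whiskerRight_id (B := TwoCAT.{w, u}) _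
  whiskerRight_comp _ _ _ := Bicategory.whiskerRight_comp (B := TwoCAT.{w, u}) _ _ _
  whisker_assoc _ _ _ _ _ := Bicategory.whisker_assoc (B := TwoCAT.{w, u}) _ _ _
  whisker_exchange _ _ := Bicategory.whisker_exchange (B := TwoCAT.{w, u}) _ _
  pentagon _ _ _ _ := Bicategory.pentagon (B := TwoCAT.{w, u}) _ _ _ _
  triangle _ _ := Bicategory.triangle (B := TwoCAT.{w, u}) _ _

lemma eqToHom_eq {C D : TwoCATPlus.{w, u}} {F G : C ⟶ D} (h : F = G) :
    (eqToHom h : F ⟶ G) = eqToHom (C := C.toTwoCAT ⟶ D.toTwoCAT) (congrArg Hom.functor h) := by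
  subst h; rfl

lemma id_comp' {C D : TwoCATPlus.{w, u}} (F : C ⟶ D) : 𝟙 C ≫ F = F :=
  Hom.ext (Strict.id_comp F.functor)

lemma comp_id' {C D : TwoCATPlus.{w, u}} (F : C ⟶ D) : F ≫ 𝟙 D = F :=
  Hom.ext (Strict.comp_id F.functor)

lemma assoc' {B C D E : TwoCATPlus.{w, u}} (F : B ⟶ C) (G : C ⟶ D) (H : D ⟶ E) :
    (F ≫ G) ≫ H = F ≫ G ≫ H := Hom.ext (Strict.assoc F.functor G.functor H.functor)

instance : Strict TwoCATPlus.{w, u} where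
  id_comp := id_comp'
  comp_id := comp_id'
  assoc := assoc'
  leftUnitor_eqToIso F := Iso.ext ((congrArg Iso.hom (Strict.leftUnitor_eqToIso F.functor)).trans
    (eqToHom_eq (id_comp' F)).symm)
  rightUnitor_eqToIso F := Iso.ext
    ((congrArg Iso.hom (Strict.rightUnitor_eqToIso F.functor)).trans
      (eqToHom_eq (comp_id' F)).symm)
  associator_eqToIso F G H := Iso.ext
    ((congrArg Iso.hom (Strict.associator_eqToIso F.functor G.functor H.functor)).trans
      (eqToHom_eq (assoc' F G H)).symm)

/-- The inclusion 2-functor `2-CAT_+ → 2-CAT`. -/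
def inclusion : StrictPseudofunctor TwoCATPlus.{w, u} TwoCAT.{w, u} :=
  StrictPseudofunctor.mk'' {
    obj C := C.toTwoCAT
    map F := F.functor
    map₂ α := α
    map₂_whisker_left F _ _ α :=
      eq_conj (Bicategory.whiskerLeft (B := TwoCAT.{w, u}) F.functor α) rfl rfl
    map₂_whisker_right α F :=
      eq_conj (Bicategory.whiskerRight (B := TwoCAT.{w, u}) α F.functor) rfl rfl }

end TwoCATPlus

/-- A 2-functor with prescribed object function `obj`. -/
structure TwoFunctorOn {A : Type w} [Bicategory.{t, v} A] [Strict A] {B : Type w'}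
    [Bicategory.{t', v'} B] [Strict B] (obj : A → B) where
  map {a b : A} (f : a ⟶ b) : obj a ⟶ obj b
  map₂ {a b : A} {f g : a ⟶ b} (η : f ⟶ g) : map f ⟶ map g
  map₂_id {a b : A} (f : a ⟶ b) : map₂ (𝟙 f) = 𝟙 (map f)
  map₂_comp {a b : A} {f g h : a ⟶ b} (η : f ⟶ g) (θ : g ⟶ h) :
    map₂ (η ≫ θ) = map₂ η ≫ map₂ θ
  map_id (a : A) : map (𝟙 a) = 𝟙 (obj a)
  map_comp {a b c : A} (f : a ⟶ b) (g : b ⟶ c) : map (f ≫ g) = map f ≫ map g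
  map₂_whiskerLeft {a b c : A} (f : a ⟶ b) {g h : b ⟶ c} (η : g ⟶ h) :
    map₂ (f ◁ η) = eqToHom (map_comp f g) ≫ map f ◁ map₂ η ≫ eqToHom (map_comp f h).symm
  map₂_whiskerRight {a b c : A} {f g : a ⟶ b} (η : f ⟶ g) (h : b ⟶ c) :
    map₂ (η ▷ h) = eqToHom (map_comp f h) ≫ map₂ η ▷ map h ≫ eqToHom (map_comp g h).symm

/-- The underlying 2-functor. -/
def TwoFunctorOn.toStrictPseudofunctor {A : Type w} [Bicategory.{t, v} A] [Strict A] {B : Type w'}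
    [Bicategory.{t', v'} B] [Strict B] {obj : A → B} (P : TwoFunctorOn obj) :
    StrictPseudofunctor A B :=
  StrictPseudofunctor.mk'' {
    obj := obj
    map := P.map
    map₂ := P.map₂
    map₂_id := P.map₂_id
    map₂_comp := P.map₂_comp
    map_id := P.map_id
    map_comp := P.map_comp
    map₂_whisker_left f _ _ η := P.map₂_whiskerLeft f η
    map₂_whisker_right η h := P.map₂_whiskerRight η h }

end TwoCat

section Pro

/-- The 2-pro-object `FX = (F(X k))`, i.e. the composite 2-functor `F ∘ X`. -/
def ProObj.map {C : Type w} [Bicategory.{t, v} C] {D : Type w'} [Bicategory.{t', v'} D]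
    (F : StrictPseudofunctor C D) (X : ProObj.{t, v, w, u} C) : ProObj.{t', v', w', u} D where
  K := X.K
  cofiltered := X.cofiltered
  diag := X.diag.comp F

/-- A family of arrows `app a : F a ⟶ G a` is 2-natural. -/
structure IsTwoNatural {A : Type w} [Bicategory.{t, v} A] {B : Type w'} [Bicategory.{t', v'} B]
    (F G : StrictPseudofunctor A B) (app : ∀ a, F.obj a ⟶ G.obj a) : Prop where
  naturality {a b : A} (f : a ⟶ b) : F.map f ≫ app b = app a ≫ G.map f
  naturality₂ {a b : A} {f g : a ⟶ b} (η : f ⟶ g) :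
    F.map₂ η ▷ app b =
      eqToHom (naturality f) ≫ app a ◁ G.map₂ η ≫ eqToHom (naturality g).symm

/-- The 2-category `2-Pro(C)`, for `C` in `2-CAT`. -/
abbrev Pro (C : TwoCAT.{max w (u + 1), u}) : Type max w (u + 1) :=
  ProObj.{max w (u + 1), max w (u + 1), max w (u + 1), u} C

/-- `2-Pro(C)`, once it is known to be locally small, as an object of `2-CAT`. -/
noncomputable abbrev proCAT (C : TwoCAT.{max w (u + 1), u})
    (h : TwoLocallySmall.{max w (u + 1), max w (u + 1), max w (u + 1), u} (Pro.{w, u} C)) :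
    TwoCAT.{max w (u + 1), u} where
  carrier := Pro.{w, u} C
  locallySmall := h

/-- The 2-functor `c : C → 2-Pro(C)` as a 1-cell of `2-CAT`. -/
noncomputable abbrev cCAT (C : TwoCAT.{max w (u + 1), u})
    (h : TwoLocallySmall.{max w (u + 1), max w (u + 1), max w (u + 1), u} (Pro.{w, u} C)) :
    C ⟶ proCAT.{w, u} C h :=
  proEmbedding.{max w (u + 1), max w (u + 1), max w (u + 1), u} C

end Pro

end TwoPro

open TwoPro

/-! Everything rests on one strict universal property. The pseudocolimit `LX` is realized at `A` as
the localization of the category of pairs `(k, f : X k ⟶ A)`. A 2-natural transformation `LX ⇒ M` to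
a `Cat`-valued `M` is determined, by Yoneda, by its values on the identities of the `X k`. This
makes `Hom(LX, M)` isomorphic, and not merely equivalent, to the category `PsFam X M` of families of
objects of the `M (X k)` with coherent invertible cells (`isIsoCat_evalUniv`).

With `M = LB` it describes the arrows `B ⟶ X` of 2-Pro. Local smallness follows, given that `LB` has
small values. For `X` indexed by a point it gives `2-Pro(X, cA) ≅ LX(A)`. The universal family
thereby becomes a pseudocone from `X` to the `c (X k)`, and the same property says that this
pseudocone is a pseudolimit (`isPseudolimit_canonCone`). Cofilteredness of the index gives a
calculus of fractions on pairs (`El.hasLeftCalculusOfFractions`), and hence a finite description of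
the objects and 2-cells of `LX(A)`: the pseudocone is "canonical" (`IsCanonical`).

For a small 2-cofiltered diagram `S` in 2-Pro, presented objectwise by canonical pseudocones, the
2-category `Tot` collects pairs of an index `j` and an index of the presentation of `S j`. It is
2-cofiltered (`Tot.twoCofiltered`) and it maps to `C`. If `Y` turns the presenting pseudocones into
limits, then families over `S` with values in `Y` are the same as families over `Tot`
(`Tot.isIsoCat_res`). The 2-pro-object of the diagram `Tot → C` is therefore a pseudolimit of `S`.
Taking for `Y` a composite of a 2-functor `Φ` with a representable shows at the same time that `Φ`
preserves all small 2-cofiltered pseudolimits as soon as it preserves the canonical ones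
(`IsProCompletion.preserves`). Since `Tot` is only essentially small in its arrows and 2-cells, it
is first replaced by an isomorphic small 2-category.

For `F : C → D` the transformation `transport F X : LX ⇒ L(FX) ∘ F` is a universal arrow from `LX`
to precomposition with `F` (`isUniv_transport`), again by the universal property. Factoring through
it defines `2-Pro(F)` on arrows and 2-cells, and mates define it on 2-natural transformations. The
factorizations are strictly unique, so every required equation, including the strict functoriality
in `F`, holds because both sides solve the same factorization problem. The objects on the two sides
are often equal only propositionally, and such comparisons are made by heterogeneous equality.

Finally, a transformation between the restrictions of `H` and `G` along `c` extends uniquely when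
`G` preserves the canonical pseudolimits: the components are induced by the pseudolimit `GX`, and
every arrow or 2-cell from `X` to an object `cA` comes from the diagram (`existsUnique_extension`).
Applied in both directions, this gives the uniqueness of `2-Pro(F)`.

Two devices serve throughout. Being an isomorphism of categories is handled as bijectivity
(`IsIsoCat`), which can be cancelled in composites. The relation `≐` is equality up to `eqToHom`;
modulo it, the coherence 2-cells of a strict 2-category disappear. -/

namespace TwoPro

section

/-! ### Isomorphisms of categories as bijective functors. -/

section IsIsoCat

universe v₁ u₁ v₂ u₂ v₃ u₃

variable {A : Type u₁} [Category.{v₁} A] {B : Type u₂} [Category.{v₂} B] {C : Type u₃}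
  [Category.{v₃} C]

/-- A functor is an isomorphism of categories: bijective on objects and on arrows. -/
structure IsIsoCat (F : A ⥤ B) : Prop where
  obj : Function.Bijective F.obj
  map (x y : A) : Function.Bijective (F.map : (x ⟶ y) → (F.obj x ⟶ F.obj y))

/-- This translates between the form used in the definition of a pseudolimit and bijectivity, which
composes and cancels without carrying inverse functors along. -/
lemma isIsoCat_iff (F : A ⥤ B) : IsIsoCat F ↔ ∃ G : B ⥤ A, F ⋙ G = 𝟭 _ ∧ G ⋙ F = 𝟭 _ := by
  constructor
  · intro h
    let o := Equiv.ofBijective _ h.obj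
    let m (x y : A) := Equiv.ofBijective _ (h.map x y)
    have e (x : B) : F.obj (o.symm x) = x := o.apply_symm_apply x
    -- Preimages of arrows exist only after transport along `e`; the functor laws and the equations
    -- with `F` are then verified after applying `F`, which is injective on arrows.
    let G : B ⥤ A :=
      { obj := o.symm
        map {x y} f := (m (o.symm x) (o.symm y)).symm (eqToHom (e x) ≫ f ≫ eqToHom (e y).symm)
        map_id x := (h.map _ _).1 (((m _ _).apply_symm_apply _).trans (by simp))
        map_comp f g := (h.map _ _).1 (by
          rw [F.map_comp]
          refine ((m _ _).apply_symm_apply _).trans ?_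
          refine Eq.trans ?_ (congr (congrArg _ ((m _ _).apply_symm_apply _).symm)
            ((m _ _).apply_symm_apply _).symm)
          simp) }
    have k : G ⋙ F = 𝟭 _ := CategoryTheory.Functor.ext e (fun x y f => (m _ _).apply_symm_apply _)
    have k' (x : A) : (F ⋙ G).obj x = (𝟭 A).obj x := o.symm_apply_apply x
    refine ⟨G, ?_, k⟩
    refine CategoryTheory.Functor.ext k' (fun x y f => (h.map _ _).1 ?_)
    refine ((m _ _).apply_symm_apply _).trans ?_
    rw [F.map_comp, F.map_comp, eqToHom_map]
    erw [eqToHom_map]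
    rfl
  · rintro ⟨G, h₁, h₂⟩
    have o₁ x : G.obj (F.obj x) = x := Functor.congr_obj h₁ x
    have o₂ x : F.obj (G.obj x) = x := Functor.congr_obj h₂ x
    refine ⟨⟨fun x y e => ?_, fun y => ⟨_, o₂ y⟩⟩, fun x y => ⟨fun f g e => ?_, fun g => ?_⟩⟩
    · rw [← o₁ x, ← o₁ y, e]
    · have k := congrArg G.map e
      have k₁ := Functor.congr_hom h₁ f
      have k₂ := Functor.congr_hom h₁ g
      simp only [Functor.comp_map, Functor.id_map] at k₁ k₂
      rw [k₁, k₂] at k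
      simpa only [cancel_epi, cancel_mono] using k
    · refine ⟨eqToHom (o₁ x).symm ≫ G.map g ≫ eqToHom (o₁ y), ?_⟩
      have k := Functor.congr_hom h₂ g
      simp only [Functor.comp_map, Functor.id_map] at k
      simp [eqToHom_map, k]

namespace IsIsoCat

variable {F : A ⥤ B} {G : B ⥤ C} {H : A ⥤ C}

lemma comp (h : IsIsoCat F) (h' : IsIsoCat G) : IsIsoCat (F ⋙ G) :=
  ⟨h'.obj.comp h.obj, fun _ _ => (h'.map _ _).comp (h.map _ _)⟩

lemma of_comp (h : IsIsoCat (F ⋙ G)) (h' : IsIsoCat G) : IsIsoCat F :=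
  ⟨(Function.Bijective.of_comp_iff' h'.obj _).1 h.obj,
    fun _ _ => (Function.Bijective.of_comp_iff' (h'.map _ _) _).1 (h.map _ _)⟩

/-- The usual way of proving a functor bijective below: continue it by a known isomorphism `G` and
recognize the composite as another one. -/
lemma of_eq (e : F ⋙ G = H) (h : IsIsoCat H) (h' : IsIsoCat G) : IsIsoCat F := by
  subst e; exact h.of_comp h'

end IsIsoCat

end IsIsoCat

/-! ### Equality of arrows up to equality of their ends. -/

section EqMod

universe v₁ u₁ v₂ u₂

variable {A : Type u₁} [Category.{v₁} A] {B : Type u₂} [Category.{v₂} B] {a b c a' b' c' a'' b'' : A}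

/-- Equality of arrows up to equalities between their sources and targets. -/
def EqMod (f : a ⟶ b) (g : a' ⟶ b') : Prop :=
  ∃ (p : a = a') (q : b' = b), f = eqToHom p ≫ g ≫ eqToHom q

infix:50 " ≐ " => EqMod


namespace EqMod

lemma of_conj {f : a ⟶ b} {g : a' ⟶ b'} {p : a = a'} {q : b' = b}
    (h : f = eqToHom p ≫ g ≫ eqToHom q) : f ≐ g := ⟨p, q, h⟩

lemma refl (f : a ⟶ b) : f ≐ f := ⟨rfl, rfl, by simp⟩

lemma of_eq {f g : a ⟶ b} (h : f = g) : f ≐ g := h ▸ refl f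

lemma eq {f g : a ⟶ b} (h : f ≐ g) : f = g := by
  obtain ⟨_, _, h⟩ := h; simpa using h

lemma conj {f : a ⟶ b} {g : a' ⟶ b'} (h : f ≐ g) (p : a = a') (q : b' = b) :
    f = eqToHom p ≫ g ≫ eqToHom q := by
  obtain ⟨_, _, h⟩ := h; exact h

lemma symm {f : a ⟶ b} {g : a' ⟶ b'} (h : f ≐ g) : g ≐ f := by
  obtain ⟨p, q, rfl⟩ := h; subst p q; exact ⟨rfl, rfl, by simp⟩

lemma trans {f : a ⟶ b} {g : a' ⟶ b'} {h : a'' ⟶ b''} (k : f ≐ g) (l : g ≐ h) : f ≐ h := by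
  obtain ⟨p, q, rfl⟩ := k
  obtain ⟨p', q', rfl⟩ := l
  exact ⟨p.trans p', q'.trans q, by simp⟩

lemma comp {f : a ⟶ b} {f' : a' ⟶ b'} {g : b ⟶ c} {g' : b' ⟶ c'} (h : f ≐ f') (k : g ≐ g') :
    f ≫ g ≐ f' ≫ g' := by
  obtain ⟨p, q, rfl⟩ := h
  obtain ⟨p', q', rfl⟩ := k
  exact ⟨p, q', by simp⟩

lemma comp_eqToHom (f : a ⟶ b) (p : b = c) : f ≫ eqToHom p ≐ f := ⟨rfl, p, by simp⟩

lemma eqToHom_comp (p : a = b) (f : b ⟶ c) : eqToHom p ≫ f ≐ f := ⟨p, rfl, by simp⟩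

lemma eqToHom_eqToHom (p : a = b) (q : a' = b') (h : a = a') : eqToHom p ≐ eqToHom q := by
  subst p q h; exact refl _

lemma eqToHom_id (p : a = b) : eqToHom p ≐ 𝟙 a := by subst p; exact refl _

lemma id_eq (p : a = b) : 𝟙 a ≐ 𝟙 b := by subst p; exact refl _

lemma map (F : A ⥤ B) {f : a ⟶ b} {g : a' ⟶ b'} (h : f ≐ g) : F.map f ≐ F.map g := by
  obtain ⟨p, q, rfl⟩ := h; subst p q; exact of_eq (by simp)

lemma map_congr {F G : A ⥤ B} (e : F = G) {f : a ⟶ b} {g : a' ⟶ b'} (h : f ≐ g) :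
    F.map f ≐ G.map g := by
  subst e; exact h.map F

lemma app {F G : A ⥤ B} (τ : F ⟶ G) (h : a = b) : τ.app a ≐ τ.app b := by
  subst h; exact refl _

lemma inv {e : a ≅ b} {e' : a' ≅ b'} (h : e.hom ≐ e'.hom) : e.inv ≐ e'.inv := by
  obtain ⟨p, q, h⟩ := h
  subst p q
  obtain rfl : e = e' := by ext1; simpa using h
  exact refl _

end EqMod

end EqMod

/-! ### `Cat`-valued 2-functors, their transformations and modifications in terms of ordinary
functors. -/

section CatValued

lemma cat_conj_app {E E' : Cat.{v', w'}} {F G H I : E ⟶ E'} (e : F = G) (τ : G ⟶ H) (e' : H = I)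
    (x : E) : (eqToHom e ≫ τ ≫ eqToHom e').toNatTrans.app x =
      eqToHom (by rw [e]) ≫ τ.toNatTrans.app x ≫ eqToHom (by rw [e']) := by
  subst e e'; simp

variable {C : Type w} [Bicategory.{t, v} C]

/-- The underlying type of the category `M a`, for a 2-functor `M` to `Cat`. -/
def car (M : StrictPseudofunctor C Cat.{v', w'}) (a : C) : Type w' := M.obj a

instance (M : StrictPseudofunctor C Cat.{v', w'}) (a : C) : Category.{v'} (car M a) :=
  (M.obj a).str

/-- The functor `M f`, for a 2-functor `M` to `Cat`. -/
def fn (M : StrictPseudofunctor C Cat.{v', w'}) {a b : C} (f : a ⟶ b) : car M a ⥤ car M b :=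
  (M.map f).toFunctor

/-- The natural transformation `M α`, for a 2-functor `M` to `Cat`. -/
def nt (M : StrictPseudofunctor C Cat.{v', w'}) {a b : C} {f g : a ⟶ b} (α : f ⟶ g) :
    fn M f ⟶ fn M g :=
  (M.map₂ α).toNatTrans

section

variable (M : StrictPseudofunctor C Cat.{v', w'}) {a b c : C}

lemma fn_id (a : C) : fn M (𝟙 a) = 𝟭 _ := congrArg Cat.Hom.toFunctor (M.map_id a)

lemma fn_comp (f : a ⟶ b) (g : b ⟶ c) : fn M (f ≫ g) = fn M f ⋙ fn M g :=
  congrArg Cat.Hom.toFunctor (M.map_comp f g)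

lemma fn_id_obj (x : car M a) : (fn M (𝟙 a)).obj x = x := Functor.congr_obj (fn_id M a) x

lemma fn_comp_obj (f : a ⟶ b) (g : b ⟶ c) (x : car M a) :
    (fn M (f ≫ g)).obj x = (fn M g).obj ((fn M f).obj x) :=
  Functor.congr_obj (fn_comp M f g) x

lemma fn_id_map {x y : car M a} (s : x ⟶ y) :
    (fn M (𝟙 a)).map s = eqToHom (fn_id_obj M x) ≫ s ≫ eqToHom (fn_id_obj M y).symm :=
  Functor.congr_hom (fn_id M a) s

lemma fn_comp_map (f : a ⟶ b) (g : b ⟶ c) {x y : car M a} (s : x ⟶ y) :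
    (fn M (f ≫ g)).map s = eqToHom (fn_comp_obj M f g x) ≫ (fn M g).map ((fn M f).map s) ≫
      eqToHom (fn_comp_obj M f g y).symm :=
  Functor.congr_hom (fn_comp M f g) s

lemma nt_id {f : a ⟶ b} : nt M (𝟙 f) = 𝟙 _ := congrArg Cat.Hom₂.toNatTrans (M.map₂_id f)

lemma nt_id_app {f : a ⟶ b} (x : car M a) : (nt M (𝟙 f)).app x = 𝟙 _ := by rw [nt_id]; rfl

lemma nt_comp {f g h : a ⟶ b} (α : f ⟶ g) (β : g ⟶ h) : nt M (α ≫ β) = nt M α ≫ nt M β :=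
  congrArg Cat.Hom₂.toNatTrans (M.map₂_comp α β)

lemma nt_comp_app {f g h : a ⟶ b} (α : f ⟶ g) (β : g ⟶ h) (x : car M a) :
    (nt M (α ≫ β)).app x = (nt M α).app x ≫ (nt M β).app x := by rw [nt_comp]; rfl

lemma nt_eqToHom_app {f g : a ⟶ b} (e : f = g) (x : car M a) :
    (nt M (eqToHom e)).app x = eqToHom (by rw [e]) := by
  subst e; exact nt_id_app M x

lemma nt_whiskerLeft_app (f : a ⟶ b) {g h : b ⟶ c} (α : g ⟶ h) (x : car M a) :
    (nt M (f ◁ α)).app x = eqToHom (fn_comp_obj M f g x) ≫ (nt M α).app ((fn M f).obj x) ≫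
      eqToHom (fn_comp_obj M f h x).symm := by
  have k := M.map₂_whisker_left f α
  simp only [M.mapComp_eq_eqToIso, eqToIso.hom, eqToIso.inv] at k
  exact (congrArg (fun s => s.toNatTrans.app x) k).trans (cat_conj_app _ _ _ _)

lemma nt_whiskerRight_app {f g : a ⟶ b} (α : f ⟶ g) (h : b ⟶ c) (x : car M a) :
    (nt M (α ▷ h)).app x = eqToHom (fn_comp_obj M f h x) ≫ (fn M h).map ((nt M α).app x) ≫
      eqToHom (fn_comp_obj M g h x).symm := by
  have k := M.map₂_whisker_right α h
  simp only [M.mapComp_eq_eqToIso, eqToIso.hom, eqToIso.inv] at k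
  exact (congrArg (fun s => s.toNatTrans.app x) k).trans (cat_conj_app _ _ _ _)

lemma nt_inv_app {f g : a ⟶ b} (α : f ≅ g) (x : car M a) :
    (nt M α.hom).app x ≫ (nt M α.inv).app x = 𝟙 _ := by
  rw [← nt_comp_app, α.hom_inv_id, nt_id_app]

lemma nt_inv_app' {f g : a ⟶ b} (α : f ≅ g) (x : car M a) :
    (nt M α.inv).app x ≫ (nt M α.hom).app x = 𝟙 _ := by
  rw [← nt_comp_app, α.inv_hom_id, nt_id_app]

/-- The component at `x` of the natural isomorphism `M α`. -/
@[simps]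
def ntIso {f g : a ⟶ b} (α : f ≅ g) (x : car M a) : (fn M f).obj x ≅ (fn M g).obj x where
  hom := (nt M α.hom).app x
  inv := (nt M α.inv).app x
  hom_inv_id := nt_inv_app M α x
  inv_hom_id := nt_inv_app' M α x

lemma EqMod.fn_id {x y : car M a} (s : x ⟶ y) : (fn M (𝟙 a)).map s ≐ s := of_conj (fn_id_map M s)

lemma EqMod.fn_comp (f : a ⟶ b) (g : b ⟶ c) {x y : car M a} (s : x ⟶ y) :
    (fn M (f ≫ g)).map s ≐ (fn M g).map ((fn M f).map s) := of_conj (fn_comp_map M f g s)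

lemma EqMod.fn_congr {f g : a ⟶ b} (e : f = g) {x y x' y' : car M a} {s : x ⟶ y} {s' : x' ⟶ y'}
    (h : s ≐ s') : (fn M f).map s ≐ (fn M g).map s' := by
  subst e; exact h.map _

lemma EqMod.nt_whiskerLeft (f : a ⟶ b) {g h : b ⟶ c} (α : g ⟶ h) (x : car M a) :
    (nt M (f ◁ α)).app x ≐ (nt M α).app ((fn M f).obj x) := of_conj (nt_whiskerLeft_app M f α x)

lemma EqMod.nt_whiskerRight {f g : a ⟶ b} (α : f ⟶ g) (h : b ⟶ c) (x : car M a) :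
    (nt M (α ▷ h)).app x ≐ (fn M h).map ((nt M α).app x) := of_conj (nt_whiskerRight_app M α h x)

lemma EqMod.nt_congr {f g f' g' : a ⟶ b} {α : f ⟶ g} {α' : f' ⟶ g'} (h : α ≐ α') {x y : car M a}
    (e : x = y) : (nt M α).app x ≐ (nt M α').app y := by
  obtain ⟨p, q, rfl⟩ := h
  subst p q e
  exact of_eq (by simp)

end

section

variable {M N O : StrictPseudofunctor C Cat.{v', w'}} {a b : C}

/-- The component at `a` of a 2-natural transformation between 2-functors to `Cat`. -/
def tf (θ : TwoNat M N) (a : C) : car M a ⥤ car N a := (θ.app a).toFunctor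

lemma tf_natural (θ : TwoNat M N) (f : a ⟶ b) : fn M f ⋙ tf θ b = tf θ a ⋙ fn N f :=
  congrArg Cat.Hom.toFunctor (θ.naturality f)

lemma tf_natural_obj (θ : TwoNat M N) (f : a ⟶ b) (x : car M a) :
    (tf θ b).obj ((fn M f).obj x) = (fn N f).obj ((tf θ a).obj x) :=
  Functor.congr_obj (tf_natural θ f) x

lemma tf_natural_map (θ : TwoNat M N) (f : a ⟶ b) {x y : car M a} (s : x ⟶ y) :
    (tf θ b).map ((fn M f).map s) = eqToHom (tf_natural_obj θ f x) ≫
      (fn N f).map ((tf θ a).map s) ≫ eqToHom (tf_natural_obj θ f y).symm :=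
  Functor.congr_hom (tf_natural θ f) s

lemma tf_natural₂ (θ : TwoNat M N) {f g : a ⟶ b} (α : f ⟶ g) (x : car M a) :
    (tf θ b).map ((nt M α).app x) = eqToHom (tf_natural_obj θ f x) ≫
      (nt N α).app ((tf θ a).obj x) ≫ eqToHom (tf_natural_obj θ g x).symm := by
  exact (congrArg (fun s => s.toNatTrans.app x) (θ.naturality₂ α)).trans (cat_conj_app _ _ _ _)

lemma EqMod.tf_fn (θ : TwoNat M N) (f : a ⟶ b) {x y : car M a} (s : x ⟶ y) :
    (tf θ b).map ((fn M f).map s) ≐ (fn N f).map ((tf θ a).map s) :=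
  of_conj (tf_natural_map θ f s)

lemma EqMod.tf_nt (θ : TwoNat M N) {f g : a ⟶ b} (α : f ⟶ g) (x : car M a) :
    (tf θ b).map ((nt M α).app x) ≐ (nt N α).app ((tf θ a).obj x) := of_conj (tf_natural₂ θ α x)

lemma tf_ext {θ θ' : M ⟶ N} (h : ∀ a, tf θ a = tf θ' a) : θ = θ' :=
  TwoNat.ext' fun a => Cat.ext (h a)

/-- A 2-natural transformation from functors. -/
def TwoNat.ofFunctors (F : ∀ a, car M a ⥤ car N a)
    (h : ∀ {a b : C} (f : a ⟶ b), fn M f ⋙ F b = F a ⋙ fn N f)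
    (h₂ : ∀ {a b : C} {f g : a ⟶ b} (α : f ⟶ g) (x : car M a), (F b).map ((nt M α).app x) =
      eqToHom (Functor.congr_obj (h f) x) ≫ (nt N α).app ((F a).obj x) ≫
        eqToHom (Functor.congr_obj (h g) x).symm) : M ⟶ N where
  app a := (F a).toCatHom
  naturality f := Cat.ext (h f)
  naturality₂ α := by
    ext x
    refine Eq.trans ?_ (cat_conj_app _ _ _ _).symm
    exact h₂ α x

/-- The component at `a` of a modification. -/
def mf {θ η : M ⟶ N} (ρ : θ ⟶ η) (a : C) : tf θ a ⟶ tf η a := (Modif.app ρ a).toNatTrans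

lemma mf_natural {θ η : M ⟶ N} (ρ : θ ⟶ η) (f : a ⟶ b) (x : car M a) :
    (mf ρ b).app ((fn M f).obj x) = eqToHom (tf_natural_obj θ f x) ≫
      (fn N f).map ((mf ρ a).app x) ≫ eqToHom (tf_natural_obj η f x).symm := by
  exact (congrArg (fun s => s.toNatTrans.app x) (Modif.naturality ρ f)).trans
    (cat_conj_app _ _ _ _)

lemma EqMod.mf_fn {θ η : M ⟶ N} (ρ : θ ⟶ η) (f : a ⟶ b) (x : car M a) :
    (mf ρ b).app ((fn M f).obj x) ≐ (fn N f).map ((mf ρ a).app x) := of_conj (mf_natural ρ f x)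

lemma mf_ext {θ η : M ⟶ N} {ρ σ : θ ⟶ η} (h : ∀ a x, (mf ρ a).app x = (mf σ a).app x) : ρ = σ :=
  Modif.ext' fun a => Cat.Hom₂.ext (NatTrans.ext (funext (h a)))

/-- A modification from natural transformations. -/
def Modif.ofNatTrans {θ η : M ⟶ N} (τ : ∀ a, tf θ a ⟶ tf η a)
    (h : ∀ {a b : C} (f : a ⟶ b) (x : car M a), (τ b).app ((fn M f).obj x) =
      eqToHom (tf_natural_obj θ f x) ≫ (fn N f).map ((τ a).app x) ≫
        eqToHom (tf_natural_obj η f x).symm) : θ ⟶ η where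
  app a := ⟨τ a⟩
  naturality f := by
    ext x
    refine Eq.trans ?_ (cat_conj_app _ _ _ _).symm
    exact h f x

end

end CatValued

end

/-! ### Calculus of 2-cells in strict 2-categories modulo `≐`. -/

section StrictCells

variable {C : Type w} [Bicategory.{t, v} C] [Strict C] {D : Type w'} [Bicategory.{t', v'} D]
  {a b c d : C}

namespace EqMod

lemma whiskerLeft {f f' : a ⟶ b} (e : f = f') {g h g' h' : b ⟶ c} {α : g ⟶ h} {α' : g' ⟶ h'}
    (k : α ≐ α') : f ◁ α ≐ f' ◁ α' := by
  obtain ⟨p, q, rfl⟩ := k; subst e p q; exact .of_eq (by simp)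

lemma whiskerRight {f g f' g' : a ⟶ b} {α : f ⟶ g} {α' : f' ⟶ g'} (k : α ≐ α') {h h' : b ⟶ c}
    (e : h = h') : α ▷ h ≐ α' ▷ h' := by
  obtain ⟨p, q, rfl⟩ := k; subst e p q; exact .of_eq (by simp)

lemma whiskerRight_id {f g : a ⟶ b} (α : f ⟶ g) : α ▷ 𝟙 b ≐ α :=
  ⟨Strict.comp_id f, (Strict.comp_id g).symm, by
    simp [Bicategory.whiskerRight_id, Strict.rightUnitor_eqToIso]⟩

lemma id_whiskerLeft {f g : a ⟶ b} (α : f ⟶ g) : 𝟙 a ◁ α ≐ α :=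
  ⟨Strict.id_comp f, (Strict.id_comp g).symm, by
    simp [Bicategory.id_whiskerLeft, Strict.leftUnitor_eqToIso]⟩

lemma comp_whiskerLeft (f : a ⟶ b) (g : b ⟶ c) {h i : c ⟶ d} (α : h ⟶ i) :
    (f ≫ g) ◁ α ≐ f ◁ g ◁ α :=
  ⟨Strict.assoc _ _ _, (Strict.assoc _ _ _).symm, by
    simp [Bicategory.comp_whiskerLeft, Strict.associator_eqToIso]⟩

lemma whiskerRight_comp {f g : a ⟶ b} (α : f ⟶ g) (h : b ⟶ c) (i : c ⟶ d) :
    α ▷ (h ≫ i) ≐ (α ▷ h) ▷ i :=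
  ⟨(Strict.assoc _ _ _).symm, Strict.assoc _ _ _, by
    simp [Bicategory.whiskerRight_comp, Strict.associator_eqToIso]⟩

lemma whisker_assoc (f : a ⟶ b) {g h : b ⟶ c} (α : g ⟶ h) (i : c ⟶ d) :
    (f ◁ α) ▷ i ≐ f ◁ (α ▷ i) :=
  ⟨Strict.assoc _ _ _, (Strict.assoc _ _ _).symm, by
    simp [Bicategory.whisker_assoc, Strict.associator_eqToIso]⟩

lemma map₂ (F : StrictPseudofunctor C D) {f g f' g' : a ⟶ b} {α : f ⟶ g} {α' : f' ⟶ g'}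
    (h : α ≐ α') : F.map₂ α ≐ F.map₂ α' := by
  obtain ⟨p, q, rfl⟩ := h; subst p q; exact .of_eq (by simp)

lemma map₂_whiskerLeft (F : StrictPseudofunctor C D) (f : a ⟶ b) {g h : b ⟶ c} (α : g ⟶ h) :
    F.map₂ (f ◁ α) ≐ F.map f ◁ F.map₂ α :=
  ⟨F.map_comp _ _, (F.map_comp _ _).symm, by simp [F.map₂_whisker_left, F.mapComp_eq_eqToIso]⟩

lemma map₂_whiskerRight (F : StrictPseudofunctor C D) {f g : a ⟶ b} (α : f ⟶ g) (h : b ⟶ c) :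
    F.map₂ (α ▷ h) ≐ F.map₂ α ▷ F.map h :=
  ⟨F.map_comp _ _, (F.map_comp _ _).symm, by simp [F.map₂_whisker_right, F.mapComp_eq_eqToIso]⟩

lemma app_map₂ {F G : StrictPseudofunctor C D} (θ : TwoNat F G) {f g : a ⟶ b} (α : f ⟶ g) :
    F.map₂ α ▷ θ.app b ≐ θ.app a ◁ G.map₂ α := .of_conj (θ.naturality₂ α)

lemma modif [Strict D] {F G : StrictPseudofunctor C D} {θ η : F ⟶ G} (ρ : θ ⟶ η) (f : a ⟶ b) :
    F.map f ◁ Modif.app ρ b ≐ Modif.app ρ a ▷ G.map f := .of_conj (Modif.naturality ρ f)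

end EqMod

end StrictCells

/-! ### Pseudo-families: the pseudolimit of the categories `M (X k)`. -/

section

universe v₁ u₁

variable {C : Type w} [Bicategory.{t, v} C] {K : Type w'} [Bicategory.{t', v'} K]

/-- A pseudo-family for a 2-functor `X : K → C` with values in `M : C → Cat`: an object of the
pseudolimit of the categories `M (X k)`. -/
structure PsFam (X : StrictPseudofunctor K C) (M : StrictPseudofunctor C Cat.{v₁, u₁}) where
  pt (k : K) : car M (X.obj k)
  cell {k l : K} (u : k ⟶ l) : pt l ≅ (fn M (X.map u)).obj (pt k)
  cell_id (k : K) : (cell (𝟙 k)).hom = eqToHom (by rw [X.map_id, fn_id_obj])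
  cell_comp {k l m : K} (u : k ⟶ l) (v : l ⟶ m) :
    (cell (u ≫ v)).hom = (cell v).hom ≫ (fn M (X.map v)).map (cell u).hom ≫
      eqToHom (by rw [X.map_comp, fn_comp_obj])
  cell_nat {k l : K} {u v : k ⟶ l} (α : u ⟶ v) :
    (cell v).hom = (cell u).hom ≫ (nt M (X.map₂ α)).app (pt k)

namespace PsFam

variable {X : StrictPseudofunctor K C} {M N O : StrictPseudofunctor C Cat.{v₁, u₁}}

lemma ext' {σ τ : PsFam X M} (h : ∀ k, σ.pt k = τ.pt k)
    (hc : ∀ {k l : K} (u : k ⟶ l), (σ.cell u).hom ≐ (τ.cell u).hom) : σ = τ := by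
  obtain ⟨pt, cell, _, _, _⟩ := σ
  obtain ⟨pt', cell', _, _, _⟩ := τ
  obtain rfl : pt = pt' := funext h
  obtain rfl : @cell = @cell' := by
    funext k l u; ext1; exact (hc u).eq
  rfl

lemma cell_congr {σ τ : PsFam X M} (h : σ = τ) {k l : K} (u : k ⟶ l) :
    (σ.cell u).hom ≐ (τ.cell u).hom := by subst h; exact .refl _

/-- A morphism of pseudo-families. -/
@[ext]
structure Hom (σ τ : PsFam X M) where
  app (k : K) : σ.pt k ⟶ τ.pt k
  w {k l : K} (u : k ⟶ l) :
    (σ.cell u).hom ≫ (fn M (X.map u)).map (app k) = app l ≫ (τ.cell u).hom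

instance : Category (PsFam X M) where
  Hom σ τ := Hom σ τ
  id σ := { app k := 𝟙 _, w u := by simp }
  comp f g := { app k := f.app k ≫ g.app k, w u := by simp [← g.w, reassoc_of% f.w] }

@[simp] lemma id_app (σ : PsFam X M) (k : K) : Hom.app (𝟙 σ) k = 𝟙 _ := rfl
@[simp] lemma comp_app {σ τ ρ : PsFam X M} (f : σ ⟶ τ) (g : τ ⟶ ρ) (k : K) :
    Hom.app (f ≫ g) k = f.app k ≫ g.app k := rfl

lemma hom_ext {σ τ : PsFam X M} {f g : σ ⟶ τ} (h : ∀ k, Hom.app f k = Hom.app g k) : f = g :=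
  Hom.ext (funext h)

@[simp] lemma eqToHom_app {σ τ : PsFam X M} (h : σ = τ) (k : K) :
    Hom.app (eqToHom h) k = eqToHom (by rw [h]) := by subst h; rfl

lemma isIsoCat_of {A : Type*} [Category* A] (F : A ⥤ PsFam X M) (inj : Function.Injective F.obj)
    (surj : Function.Surjective F.obj)
    (faithful : ∀ {x y : A} (f g : x ⟶ y), (∀ k, Hom.app (F.map f) k = Hom.app (F.map g) k) → f = g)
    (full : ∀ {x y : A} (s : F.obj x ⟶ F.obj y),
      ∃ f : x ⟶ y, ∀ k, Hom.app (F.map f) k = Hom.app s k) : IsIsoCat F :=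
  ⟨⟨inj, surj⟩, fun _ _ => ⟨fun f g e => faithful f g (fun k => by rw [e]),
    fun s => (full s).imp fun _ h => hom_ext h⟩⟩

variable (X) in
/-- The functor induced on pseudo-families by a 2-natural transformation. -/
def map (θ : M ⟶ N) : PsFam X M ⥤ PsFam X N where
  obj σ :=
    { pt k := (tf θ _).obj (σ.pt k)
      cell u := (tf θ _).mapIso (σ.cell u) ≪≫ eqToIso (tf_natural_obj θ _ _)
      cell_id k := by simp [σ.cell_id, eqToHom_map]
      cell_comp u v := by simp [σ.cell_comp, eqToHom_map, tf_natural_map]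
      cell_nat α := by simp [σ.cell_nat α, tf_natural₂] }
  map f :=
    { app k := (tf θ _).map (f.app k)
      w u := by
        have h := congrArg (tf θ _).map (f.w u)
        simp only [CategoryTheory.Functor.map_comp, tf_natural_map] at h
        simp only [Iso.trans_hom, CategoryTheory.Functor.mapIso_hom, eqToIso.hom, Category.assoc]
        rw [← reassoc_of% h]
        simp }
  map_id σ := hom_ext fun k => (tf θ _).map_id _
  map_comp f g := hom_ext fun k => (tf θ _).map_comp _ _

@[simp] lemma map_obj_pt (θ : M ⟶ N) (σ : PsFam X M) (k : K) :
    ((map X θ).obj σ).pt k = (tf θ _).obj (σ.pt k) := rfl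

@[simp] lemma map_obj_cell_hom (θ : M ⟶ N) (σ : PsFam X M) {k l : K} (u : k ⟶ l) :
    (((map X θ).obj σ).cell u).hom =
      (tf θ _).map (σ.cell u).hom ≫ eqToHom (tf_natural_obj θ _ _) := rfl

@[simp] lemma map_map_app (θ : M ⟶ N) {σ τ : PsFam X M} (f : σ ⟶ τ) (k : K) :
    Hom.app ((map X θ).map f) k = (tf θ _).map (Hom.app f k) := rfl

lemma map_cell_hom (θ : M ⟶ N) (σ : PsFam X M) {k l : K} (u : k ⟶ l) :
    (((map X θ).obj σ).cell u).hom ≐ (tf θ _).map (σ.cell u).hom :=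
  EqMod.comp_eqToHom _ (tf_natural_obj θ (X.map u) (σ.pt k))

/-- The morphism induced on pseudo-families by a modification. -/
def map₂ {θ η : M ⟶ N} (ρ : θ ⟶ η) (σ : PsFam X M) : (map X θ).obj σ ⟶ (map X η).obj σ where
  app k := (mf ρ _).app (σ.pt k)
  w u := by
    have h := (mf ρ _).naturality (σ.cell u).hom
    rw [mf_natural] at h
    dsimp
    rw [Category.assoc, ← reassoc_of% h]
    simp

/-- Points and cells lift along the bijections `tf θ (X k)`, and the axioms of a family hold
upstairs because these functors reflect equality of arrows. -/
lemma isIsoCat_map (θ : M ⟶ N) (h : ∀ k, IsIsoCat (tf θ (X.obj k))) : IsIsoCat (map X θ) := by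
  -- Injectivity on arrows, extended to arrows whose ends agree only propositionally, as is the case
  -- for the two sides of each axiom.
  have hi {k : K} {x y x' y' : car M (X.obj k)} {f : x ⟶ y} {g : x' ⟶ y'} (p : x = x') (q : y' = y)
      (e : (tf θ (X.obj k)).map f ≐ (tf θ (X.obj k)).map g) : f ≐ g := by
    subst p q; exact .of_eq (((h k).map _ _).1 e.eq)
  refine isIsoCat_of _ (fun σ τ e => ?_) (fun τ => ?_) (fun f g e => ?_) (fun {x y} s => ?_)
  · have e' (k : K) : σ.pt k = τ.pt k := (h k).obj.1 (congrArg (PsFam.pt · k) e)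
    exact ext' e' fun {k l} u => hi (e' l) (by rw [e' k])
      ((map_cell_hom θ σ u).symm.trans ((cell_congr e u).trans (map_cell_hom θ τ u)))
  · choose p hp using fun k => (h k).obj.2 (τ.pt k)
    have e {k l : K} (u : k ⟶ l) : (tf θ _).obj ((fn M (X.map u)).obj (p k)) =
        (fn N (X.map u)).obj (τ.pt k) := by rw [tf_natural_obj, hp]
    choose c hc using fun {k l : K} (u : k ⟶ l) => ((h l).map _ _).2
      (eqToHom (hp l) ≫ (τ.cell u).hom ≫ eqToHom (e u).symm)
    -- The inverses of the cells are lifted separately; that they are inverse to the lifted cells is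
    -- checked downstairs.
    choose d hd using fun {k l : K} (u : k ⟶ l) => ((h l).map _ _).2
      (eqToHom (e u) ≫ (τ.cell u).inv ≫ eqToHom (hp l).symm)
    have hc' {k l : K} (u : k ⟶ l) : (tf θ _).map (c u) ≐ (τ.cell u).hom := .of_conj (hc u)
    refine ⟨{ pt := p
              cell u := ⟨c u, d u, ((h _).map _ _).1 (by simp [hc, hd]),
                ((h _).map _ _).1 (by simp [hc, hd])⟩
              cell_id k := (hi rfl rfl ?_).eq
              cell_comp u v := (hi rfl rfl ?_).eq
              cell_nat α := (hi rfl rfl ?_).eq }, ext' hp (fun u => ?_)⟩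
    · refine (hc' _).trans ((EqMod.of_eq (τ.cell_id k)).trans ?_)
      rw [eqToHom_map]
      exact .eqToHom_eqToHom _ _ (hp k).symm
    · refine (hc' _).trans ((EqMod.of_eq (τ.cell_comp u v)).trans ?_)
      dsimp only
      rw [CategoryTheory.Functor.map_comp, CategoryTheory.Functor.map_comp, eqToHom_map]
      refine .comp (hc' v).symm (.comp (EqMod.symm ?_) (.eqToHom_eqToHom _ _ ?_))
      · exact (EqMod.tf_fn _ _ _).trans ((hc' u).map _)
      · rw [tf_natural_obj, e]
    · refine (hc' _).trans ((EqMod.of_eq (τ.cell_nat α)).trans ?_)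
      rw [CategoryTheory.Functor.map_comp]
      exact .comp (hc' _).symm ((EqMod.tf_nt θ _ _).trans (.app _ (hp _))).symm
    · exact (map_cell_hom _ _ _).trans (hc' u)
  · exact hom_ext fun k => ((h k).map _ _).1 (e k)
  · choose a ha using fun k => ((h k).map _ _).2 (Hom.app s k)
    refine ⟨⟨a, fun u => ((h _).map _ _).1 ?_⟩, ha⟩
    have k := Hom.w s u
    simp only [map_obj_cell_hom] at k
    rw [CategoryTheory.Functor.map_comp, CategoryTheory.Functor.map_comp, tf_natural_map, ha, ha,
      ← cancel_mono (eqToHom (tf_natural_obj θ _ _))]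
    refine Eq.trans ?_ (k.trans (Category.assoc _ _ _).symm)
    simp

lemma functor_ext {A : Type*} [Category* A] {F G : A ⥤ PsFam X M} (h : ∀ x, F.obj x = G.obj x)
    (hm : ∀ {x y : A} (f : x ⟶ y) (k : K), Hom.app (F.map f) k ≐ Hom.app (G.map f) k) : F = G := by
  refine CategoryTheory.Functor.ext h (fun x y f => hom_ext fun k => ?_)
  rw [comp_app, comp_app, eqToHom_app, eqToHom_app]
  exact (hm f k).conj _ _

/-- Pseudo-families for `X ⋙ Φ` with values in `M` are pseudo-families for `X` with values in
`Φ ⋙ M`. -/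
def assoc {D : Type w''} [Bicategory.{t'', v''} D] (X : StrictPseudofunctor K D)
    (Φ : StrictPseudofunctor D C) (M : StrictPseudofunctor C Cat.{v₁, u₁}) :
    PsFam (X.comp Φ) M ⥤ PsFam X (Φ.comp M) where
  obj σ :=
    { pt := σ.pt
      cell := σ.cell
      cell_id := σ.cell_id
      cell_comp := σ.cell_comp
      cell_nat := σ.cell_nat }
  map f := { app := f.app, w := f.w }
  map_id _ := rfl
  map_comp _ _ := rfl

/-- Values and cells of the two kinds of family have the same types by unfolding the composites, and
so do the axioms, so that the data can be reused unchanged. -/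
lemma isIsoCat_assoc {D : Type w''} [Bicategory.{t'', v''} D] (X : StrictPseudofunctor K D)
    (Φ : StrictPseudofunctor D C) (M : StrictPseudofunctor C Cat.{v₁, u₁}) :
    IsIsoCat (assoc X Φ M) := by
  refine isIsoCat_of _ (fun σ τ e => ?_) (fun τ => ?_) (fun f g e => ?_) (fun {x y} s => ?_)
  · exact ext' (fun k => congrArg (fun s : PsFam X (Φ.comp M) => s.pt k) e)
      (fun u => cell_congr (X := X) (M := Φ.comp M) e u)
  · exact ⟨⟨τ.pt, τ.cell, τ.cell_id, τ.cell_comp, τ.cell_nat⟩, rfl⟩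
  · exact hom_ext e
  · exact ⟨⟨s.app, s.w⟩, fun _ => rfl⟩

end PsFam

/-! ### Representable 2-functors, and pseudocones as pseudo-families. -/

section HomFrom

variable [Strict C] [Strict K]

/-- The representable 2-functor `C(B, -)`. -/
def homFrom (B : C) : StrictPseudofunctor C Cat.{t, v} :=
  StrictPseudofunctor.mk'' {
    obj A := Cat.of (B ⟶ A)
    map f := Functor.toCatHom
      { obj g := g ≫ f
        map s := s ▷ f }
    map₂ {a b f g} α := NatTrans.toCatHom₂ (F := { obj h := h ≫ f, map s := s ▷ f })
      (G := { obj h := h ≫ g, map s := s ▷ g })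
      { app h := h ◁ α
        naturality _ _ s := (whisker_exchange s α).symm }
    map₂_id f := by ext x; exact whiskerLeft_id _ _
    map₂_comp α β := by ext x; exact whiskerLeft_comp _ _ _
    map_id A := Cat.ext (CategoryTheory.Functor.ext (fun f => Strict.comp_id f)
      (fun f g s => (EqMod.whiskerRight_id s).conj (Strict.comp_id f) (Strict.comp_id g).symm))
    map_comp f g := Cat.ext (CategoryTheory.Functor.ext (fun h => (Strict.assoc h f g).symm)
      (fun h h' s => (EqMod.whiskerRight_comp s f g).conj (Strict.assoc h f g).symm
        (Strict.assoc h' f g)))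
    map₂_whisker_left f g h α := by
      ext x
      refine Eq.trans ?_ (cat_conj_app _ _ _ _).symm
      exact (EqMod.comp_whiskerLeft x f α).symm.conj (Strict.assoc x f g).symm (Strict.assoc x f h)
    map₂_whisker_right {_ _ _ f h} α g := by
      ext x
      refine Eq.trans ?_ (cat_conj_app _ _ _ _).symm
      exact (EqMod.whisker_assoc x α g).symm.conj (Strict.assoc x f g).symm (Strict.assoc x h g) }

/-- A pseudocone with vertex `B` as a pseudo-family with values in `C(B, -)`. -/
def toFam (S : StrictPseudofunctor K C) (B : C) : PseudoCone S B ⥤ PsFam S (homFrom B) where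
  obj π :=
    { pt := π.leg
      cell := π.cell
      cell_id := π.cell_id
      cell_comp := π.cell_comp
      cell_nat := π.cell_naturality }
  map f := { app := f.app, w := f.w }
  map_id _ := rfl
  map_comp _ _ := rfl

/-- A pseudocone with vertex `B` is by definition an object of the pseudolimit of the categories
`C(B, S k)`; only the names of the fields change. -/
lemma isIsoCat_toFam (S : StrictPseudofunctor K C) (B : C) : IsIsoCat (toFam S B) := by
  refine PsFam.isIsoCat_of _ (fun σ τ e => ?_) (fun τ => ?_) (fun f g e => ?_) (fun {x y} s => ?_)
  · obtain ⟨p, c, _, _, _⟩ := σ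
    obtain ⟨p', c', _, _, _⟩ := τ
    have h (k : K) : p k = p' k := congrArg (fun s : PsFam S (homFrom B) => s.pt k) e
    obtain rfl : p = p' := funext h
    obtain rfl : @c = @c' := by
      funext k l u
      ext1
      exact (PsFam.cell_congr (X := S) (M := homFrom B) e u).eq
    rfl
  · exact ⟨⟨τ.pt, τ.cell, τ.cell_id, τ.cell_comp, τ.cell_nat⟩, rfl⟩
  · exact PseudoCone.Hom.ext (funext e)
  · exact ⟨⟨s.app, s.w⟩, fun _ => rfl⟩

end HomFrom

/-! ### Pseudolimits tested by `Cat`-valued 2-functors. -/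

section EvalCone

variable [Strict C] [Strict K] {S : StrictPseudofunctor K C} {A : C}

/-- The functor `Y A ⥤ PsFam S Y` given by applying `Y` to a pseudocone with vertex `A`. -/
def evalCone (π : PseudoCone S A) (Y : StrictPseudofunctor C Cat.{v₁, u₁}) :
    car Y A ⥤ PsFam S Y where
  obj y :=
    { pt k := (fn Y (π.leg k)).obj y
      cell u := ntIso Y (π.cell u) y ≪≫ eqToIso (fn_comp_obj Y _ _ y)
      cell_id k := by simp [π.cell_id, nt_eqToHom_app]
      cell_comp u v := by
        simp [π.cell_comp, nt_eqToHom_app, nt_comp_app, nt_whiskerRight_app, eqToHom_map]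
      cell_nat α := by
        simp [π.cell_naturality α, nt_comp_app, nt_whiskerLeft_app] }
  map s :=
    { app k := (fn Y (π.leg k)).map s
      w {k l} u := by
        have h := (nt Y (π.cell u).hom).naturality s
        rw [fn_comp_map] at h
        simp only [Iso.trans_hom, eqToIso.hom, ntIso_hom, Category.assoc]
        rw [reassoc_of% h]
        simp }
  map_id y := PsFam.hom_ext fun k => (fn Y (π.leg k)).map_id y
  map_comp s s' := PsFam.hom_ext fun k => (fn Y (π.leg k)).map_comp s s'

lemma evalCone_cell_hom (π : PseudoCone S A) (Y : StrictPseudofunctor C Cat.{v₁, u₁})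
    (y : car Y A) {k l : K} (u : k ⟶ l) :
    (((evalCone π Y).obj y).cell u).hom ≐ (nt Y (π.cell u).hom).app y :=
  EqMod.comp_eqToHom _ (fn_comp_obj Y (π.leg k) (S.map u) y)

/-- Whiskering a pseudocone with an arrow and reading the result as a family is, definitionally,
evaluation in a representable. From here on the property of being a pseudolimit is used in this
form, in which the representable may be replaced by any `Cat`-valued 2-functor. -/
lemma isPseudolimit_iff (π : PseudoCone S A) :
    π.IsPseudolimit ↔ ∀ B, IsIsoCat (evalCone π (homFrom B)) := by
  refine forall_congr' fun B => (isIsoCat_iff _).symm.trans ?_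
  have e : π.whiskerFunctor B ⋙ toFam S B = evalCone π (homFrom B) := rfl
  exact ⟨fun h => e ▸ h.comp (isIsoCat_toFam S B), fun h => .of_eq e h (isIsoCat_toFam S B)⟩

lemma evalCone_map_assoc {D : Type w''} [Bicategory.{t'', v''} D] [Strict D] (π : PseudoCone S A)
    (Φ : StrictPseudofunctor C D) (M : StrictPseudofunctor D Cat.{v₁, u₁}) :
    evalCone (π.map Φ) M ⋙ PsFam.assoc S Φ M = evalCone π (Φ.comp M) := by
  refine PsFam.functor_ext (fun y => PsFam.ext' (fun _ => rfl) fun {k l} u => ?_) (fun f k => .refl _)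
  refine (evalCone_cell_hom (π.map Φ) M y u).trans (.trans ?_
    (evalCone_cell_hom π (Φ.comp M) y u).symm)
  exact .nt_congr M (EqMod.comp_eqToHom _ (Φ.map_comp _ _)) rfl

/-- Evaluating the image pseudocone in `D(B, -)` is evaluating `π` itself in the composite of `Φ`
with `D(B, -)`. Preservation thus becomes a property of the original pseudocone, of the same kind as
being a pseudolimit. -/
lemma isPseudolimit_map_iff {D : Type w''} [Bicategory.{t'', v''} D] [Strict D]
    (π : PseudoCone S A) (Φ : StrictPseudofunctor C D) :
    (π.map Φ).IsPseudolimit ↔ ∀ B, IsIsoCat (evalCone π (Φ.comp (homFrom B))) := by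
  rw [isPseudolimit_iff]
  refine forall_congr' fun B => ?_
  have e := evalCone_map_assoc π Φ (homFrom B)
  exact ⟨fun h => e ▸ h.comp (PsFam.isIsoCat_assoc _ _ _),
    fun h => .of_eq e h (PsFam.isIsoCat_assoc _ _ _)⟩

end EvalCone

end

/-! ### Consequences of the 2-cofilteredness axioms. -/

section Cofiltered

variable {K : Type w'} [Bicategory.{t', v'} K]

lemma TwoCofiltered.exists_square (hK : TwoCofiltered K) {a b c : K} (f : a ⟶ c) (g : b ⟶ c) :
    ∃ (d : K) (h : d ⟶ a) (k : d ⟶ b), Nonempty (h ≫ f ≅ k ≫ g) := by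
  obtain ⟨d, ⟨h⟩, ⟨k⟩⟩ := hK.f0 a b
  obtain ⟨e, l, ⟨θ⟩⟩ := hK.f1 (h ≫ f) (k ≫ g)
  exact ⟨e, l ≫ h, l ≫ k, ⟨α_ l h f ≪≫ θ ≪≫ (α_ l k g).symm⟩⟩

/-- Every 2-cell becomes invertible after precomposition with an arrow. -/
lemma TwoCofiltered.exists_iso (hK : TwoCofiltered K) {a b : K} {f g : a ⟶ b} (α : f ⟶ g) :
    ∃ (c : K) (h : c ⟶ a) (θ : h ≫ f ≅ h ≫ g), θ.hom = h ◁ α := by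
  obtain ⟨c, h, ⟨θ⟩⟩ := hK.f1 f g
  -- The isomorphism given by the second axiom has nothing to do with `α`; the third axiom makes the
  -- two agree after a further precomposition.
  obtain ⟨d, k, e⟩ := hK.f2 θ.hom (h ◁ α)
  refine ⟨d, k ≫ h, α_ k h f ≪≫ whiskerLeftIso k θ ≪≫ (α_ k h g).symm, ?_⟩
  simp [e]

end Cofiltered

/-! ### Calculus of fractions in the category of elements. -/

section ElEquality

variable {C : Type w} [Bicategory.{t, v} C] [Strict C]
  {K : Type w'} [Bicategory.{t', v'} K] [Strict K] {X : StrictPseudofunctor K C} {A B : C}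

namespace El

/-- The 2-cell of `mk' u φ ≫ mk' h (𝟙 _)`. -/
def pull {p q : El X A} {u : q.idx ⟶ p.idx} {m : K} (h : m ⟶ q.idx)
    (φ : X.map u ≫ p.arr ⟶ q.arr) : X.map (h ≫ u) ≫ p.arr ⟶ X.map h ≫ q.arr :=
  eqToHom (by rw [X.map_comp, Strict.assoc]) ≫ X.map h ◁ φ

variable {p q : El X A} {u u' u'' : q.idx ⟶ p.idx} {m m' : K}

lemma pull_eqMod (h : m ⟶ q.idx) (φ : X.map u ≫ p.arr ⟶ q.arr) : pull h φ ≐ X.map h ◁ φ :=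
  EqMod.eqToHom_comp _ _

lemma pull_comp (h : m ⟶ q.idx) (h' : m' ⟶ m) (φ : X.map u ≫ p.arr ⟶ q.arr) :
    pull (h' ≫ h) φ ≐ X.map h' ◁ pull h φ :=
  (pull_eqMod _ _).trans ((EqMod.whiskerLeft (X.map_comp _ _) (.refl _)).trans
    ((EqMod.comp_whiskerLeft _ _ _).trans (EqMod.whiskerLeft rfl (pull_eqMod h φ).symm)))

/-- The interchange law for `κ` and `φ`; it allows an arrow `h` to be replaced by an isomorphic one.
-/
lemma pull_exchange {h h' : m ⟶ q.idx} (κ : h ⟶ h') (φ : X.map u ≫ p.arr ⟶ q.arr) :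
    X.map₂ (κ ▷ u) ▷ p.arr ≫ pull h' φ = pull h φ ≫ X.map₂ κ ▷ q.arr := by
  refine EqMod.eq (.trans (.comp (f' := X.map₂ κ ▷ (X.map u ≫ p.arr)) ?_ (pull_eqMod h' φ)) ?_)
  · exact ((EqMod.map₂_whiskerRight X κ u).whiskerRight rfl).trans
      (EqMod.whiskerRight_comp _ _ _).symm
  · rw [← whisker_exchange]
    exact .comp (pull_eqMod h φ).symm (.refl _)

lemma pull_whisker {h : m ⟶ q.idx} (α : u ⟶ u') (φ : X.map u' ≫ p.arr ⟶ q.arr) :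
    pull h (X.map₂ α ▷ p.arr ≫ φ) = X.map₂ (h ◁ α) ▷ p.arr ≫ pull h φ := by
  refine EqMod.eq ((pull_eqMod h _).trans ?_)
  rw [Bicategory.whiskerLeft_comp]
  refine .comp (.symm ?_) (pull_eqMod h φ).symm
  exact ((EqMod.map₂_whiskerLeft X h α).whiskerRight rfl).trans (EqMod.whisker_assoc _ _ _)

/-- `(u, φ)` and `(u', φ')` agree up to an invertible 2-cell after precomposition with `h`. -/
def SameAt (h : m ⟶ q.idx) (φ : X.map u ≫ p.arr ⟶ q.arr) (φ' : X.map u' ≫ p.arr ⟶ q.arr) : Prop :=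
  ∃ θ : h ≫ u ≅ h ≫ u', pull h φ = X.map₂ θ.hom ▷ p.arr ≫ pull h φ'

variable {φ : X.map u ≫ p.arr ⟶ q.arr} {φ' : X.map u' ≫ p.arr ⟶ q.arr}
  {φ'' : X.map u'' ≫ p.arr ⟶ q.arr}

lemma whisker_pull_eq {h : m ⟶ q.idx} (h' : m' ⟶ m) {θ : h ≫ u ⟶ h ≫ u'}
    {θ' : (h' ≫ h) ≫ u ⟶ (h' ≫ h) ≫ u'}
    (e : pull h φ = X.map₂ θ ▷ p.arr ≫ pull h φ') (e' : θ' ≐ h' ◁ θ) :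
    pull (h' ≫ h) φ = X.map₂ θ' ▷ p.arr ≫ pull (h' ≫ h) φ' := by
  refine EqMod.eq ((pull_comp h h' φ).trans ?_)
  rw [e, Bicategory.whiskerLeft_comp]
  refine .comp (.symm ?_) (pull_comp h h' φ').symm
  exact (((e'.map₂ X).trans (EqMod.map₂_whiskerLeft X h' θ)).whiskerRight rfl).trans
    (EqMod.whisker_assoc _ _ _)

lemma SameAt.refine {h : m ⟶ q.idx} (h' : m' ⟶ m) (k : SameAt h φ φ') :
    SameAt (h' ≫ h) φ φ' := by
  obtain ⟨θ, e⟩ := k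
  exact ⟨eqToIso (Strict.assoc _ _ _) ≪≫ whiskerLeftIso h' θ ≪≫ eqToIso (Strict.assoc _ _ _).symm,
    whisker_pull_eq h' e ⟨Strict.assoc _ _ _, (Strict.assoc _ _ _).symm, rfl⟩⟩

/-- Squares in the index commute only up to isomorphism, so two witnesses brought to a common source
still differ by an invertible 2-cell; conjugating with it moves the agreement from one to the other.
-/
lemma SameAt.transfer {h h' : m ⟶ q.idx} (κ : h ≅ h') (k : SameAt h φ φ') : SameAt h' φ φ' := by
  obtain ⟨θ, e⟩ := k
  refine ⟨whiskerRightIso κ.symm u ≪≫ θ ≪≫ whiskerRightIso κ u', ?_⟩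
  have : IsIso (X.map₂ κ.inv ▷ q.arr) := inferInstance
  rw [← cancel_mono (X.map₂ κ.inv ▷ q.arr), ← pull_exchange, e]
  simp only [Iso.trans_hom, whiskerRightIso_hom, Iso.symm_hom, PrelaxFunctor.map₂_comp,
    comp_whiskerRight, Category.assoc]
  rw [← pull_exchange, ← comp_whiskerRight_assoc (X.map₂ (κ.hom ▷ u')), ← PrelaxFunctor.map₂_comp,
    ← comp_whiskerRight]
  simp

lemma SameAt.symm {h : m ⟶ q.idx} (k : SameAt h φ φ') : SameAt h φ' φ := by
  obtain ⟨θ, e⟩ := k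
  refine ⟨θ.symm, ?_⟩
  rw [e, ← comp_whiskerRight_assoc, ← PrelaxFunctor.map₂_comp]
  simp

lemma SameAt.trans {h : m ⟶ q.idx} (k : SameAt h φ φ') (k' : SameAt h φ' φ'') :
    SameAt h φ φ'' := by
  obtain ⟨θ, e⟩ := k
  obtain ⟨θ', e'⟩ := k'
  exact ⟨θ ≪≫ θ', by rw [e, e']; simp⟩

/-- Two representatives of the same arrow agree after precomposition with an arrow of `K`. -/
lemma exists_sameAt (hK : TwoCofiltered K) (e : mk' u φ = mk' u' φ') :
    ∃ (m : K) (h : m ⟶ q.idx), SameAt h φ φ' := by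
  have e := Quot.eqvGen_exact e
  suffices ∀ a b : PreHom X p q, Relation.EqvGen (PreHom.Rel X p q) a b →
      ∃ (m : K) (h : m ⟶ q.idx), SameAt h a.cell b.cell from this _ _ e
  intro a b k
  induction k with
  | rel a b k =>
    obtain ⟨α, k⟩ := k
    -- The elementary relation involves an arbitrary 2-cell `α`, which cofilteredness makes
    -- invertible.
    obtain ⟨m, h, θ, e⟩ := hK.exists_iso α
    exact ⟨m, h, θ, by rw [k, e, pull_whisker]⟩
  | refl a => exact ⟨_, 𝟙 _, Iso.refl _, by simp⟩
  | symm a b _ k =>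
    obtain ⟨m, h, k⟩ := k
    exact ⟨m, h, k.symm⟩
  | trans a b c _ _ k k' =>
    obtain ⟨m, h, k⟩ := k
    obtain ⟨m', h', k'⟩ := k'
    -- The two agreements occur along different arrows of the index, which are compared in a square.
    obtain ⟨n, g, g', ⟨κ⟩⟩ := hK.exists_square h h'
    exact ⟨n, g ≫ h, (k.refine g).trans ((k'.refine g').transfer κ.symm)⟩

/-- The arrow `(k, f) ⟶ (l, X v ≫ f)` given by `v`. -/
def along (p : El X A) {m : K} (h : m ⟶ p.idx) : p ⟶ ⟨m, X.map h ≫ p.arr⟩ :=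
  mk' h (𝟙 _)

lemma along_W (p : El X A) (h : m ⟶ p.idx) : W X A (along p h) := ⟨h, 𝟙 _, inferInstance, rfl⟩

lemma mk'_comp_along (φ : X.map u ≫ p.arr ⟶ q.arr) (h : m ⟶ q.idx) :
    mk' u φ ≫ along q h = mk' (q := ⟨m, X.map h ≫ q.arr⟩) (h ≫ u) (pull h φ) :=
  (mk'_comp _ _ _ _).trans (mk'_cell (by simp [pull]))

lemma along_comp_vert (p : El X A) (h : m ⟶ p.idx) {g : X.obj m ⟶ A} (φ : X.map h ≫ p.arr ⟶ g) :
    along p h ≫ vert φ = mk' (q := ⟨m, g⟩) h φ :=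
  (mk'_comp_vert _ _ _).trans (mk'_cell (Category.id_comp _))

lemma isMultiplicative_W : (W X A).IsMultiplicative where
  id_mem p := ⟨𝟙 _, _, inferInstance, id_def p⟩
  comp_mem := by
    rintro p q r _ _ ⟨u, φ, _, rfl⟩ ⟨v, ψ, _, rfl⟩
    exact ⟨v ≫ u, _, inferInstance, mk'_comp _ _ _ _⟩

/-- Ore condition. The bases of the two arrows are completed to a square in the index; since the
2-cell `φ` of the denominator is invertible, the new arrow can go back along it, across the 2-cell
of the square, and then along `ψ`. The new denominator is a pure transition. -/
lemma exists_square (hK : TwoCofiltered K) {p q r : El X A} (s : p ⟶ q) (hs : W X A s)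
    (f : p ⟶ r) : ∃ (z : El X A) (t : r ⟶ z) (g : q ⟶ z), W X A t ∧ f ≫ t = s ≫ g := by
  obtain ⟨u, φ, _, rfl⟩ := hs
  induction f using hom_ind with | h v ψ => ?_
  obtain ⟨m, a, b, ⟨θ⟩⟩ := hK.exists_square u v
  refine ⟨_, along r b, mk' (p := q) (q := ⟨m, X.map b ≫ r.arr⟩) a (X.map a ◁ inv φ ≫
    eqToHom (by rw [X.map_comp, Strict.assoc]) ≫ X.map₂ θ.hom ▷ p.arr ≫ pull b ψ), along_W _ _, ?_⟩
  rw [mk'_comp_along]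
  refine Eq.trans ?_ (mk'_comp _ _ _ _).symm
  refine (mk'_eq θ.hom ?_).symm
  rw [← Bicategory.whiskerLeft_comp_assoc, IsIso.hom_inv_id]
  simp

lemma pull_comp_cell {p p' q : El X A} {u : p.idx ⟶ p'.idx} {v : q.idx ⟶ p.idx}
    (σ : X.map u ≫ p'.arr ⟶ p.arr) (φ : X.map v ≫ p.arr ⟶ q.arr) (h : m ⟶ q.idx) :
    pull (p := p') h (eqToHom (by rw [X.map_comp, Strict.assoc]) ≫ X.map v ◁ σ ≫ φ) ≐ X.map (h ≫ v) ◁ σ ≫ pull h φ := by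
  refine (pull_eqMod _ _).trans ?_
  simp only [Bicategory.whiskerLeft_comp, whiskerLeft_eqToHom]
  refine (EqMod.eqToHom_comp _ _).trans (.comp ?_ (pull_eqMod _ _).symm)
  exact (EqMod.comp_whiskerLeft _ _ _).symm.trans (.whiskerLeft (X.map_comp _ _).symm (.refl _))

/-- Cancellation condition. Equality after composition with `(u, σ)` yields a 2-cell between `h ≫ v
≫ u` and `h ≫ v' ≫ u`, whereas a 2-cell between `h ≫ v` and `h ≫ v'` is required. One is supplied by
the second axiom and made compatible with the former by the third; the invertible `σ` is then
cancelled. -/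
lemma exists_equalizing (hK : TwoCofiltered K) {p p' q : El X A} (s : p' ⟶ p) (hs : W X A s)
    (f g : p ⟶ q) (e : s ≫ f = s ≫ g) : ∃ (z : El X A) (t : q ⟶ z), W X A t ∧ f ≫ t = g ≫ t := by
  obtain ⟨u, σ, _, rfl⟩ := hs
  induction f using hom_ind with | h v φ => ?_
  induction g using hom_ind with | h v' φ' => ?_
  rw [mk'_comp, mk'_comp] at e
  obtain ⟨m, h, θ, e⟩ := exists_sameAt hK e
  obtain ⟨n, h', ⟨κ⟩⟩ := hK.f1 (h ≫ v) (h ≫ v')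
  -- After this precomposition, whiskering `κ` with `u` gives the 2-cell `θ` that comes from the
  -- equality.
  obtain ⟨o, h'', e'⟩ := hK.f2
    (eqToHom (by simp only [Strict.assoc]) ≫ κ.hom ▷ u ≫ eqToHom (by simp only [Strict.assoc]) :
      h' ≫ h ≫ v ≫ u ⟶ h' ≫ h ≫ v' ≫ u) (h' ◁ θ.hom)
  have a₁ (v : q.idx ⟶ p.idx) : ((h'' ≫ h') ≫ h) ≫ v = h'' ≫ h' ≫ h ≫ v := by
    simp only [Strict.assoc]
  let κ' : ((h'' ≫ h') ≫ h) ≫ v ⟶ ((h'' ≫ h') ≫ h) ≫ v' :=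
    eqToHom (a₁ v) ≫ h'' ◁ κ.hom ≫ eqToHom (a₁ v').symm
  have k₁ : κ' ≐ h'' ◁ κ.hom := .of_conj rfl
  let θ' : ((h'' ≫ h') ≫ h) ≫ v ≫ u ⟶ ((h'' ≫ h') ≫ h) ≫ v' ≫ u :=
    eqToHom (Strict.assoc _ _ _).symm ≫ κ' ▷ u ≫ eqToHom (Strict.assoc _ _ _)
  have k₂ : θ' ≐ κ' ▷ u := .of_conj rfl
  have k₃ : κ' ▷ u ≐ h'' ◁ h' ◁ θ.hom := by
    refine (k₁.whiskerRight rfl).trans ((EqMod.whisker_assoc _ _ _).trans ?_)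
    rw [← e']
    exact .whiskerLeft rfl (.symm (.of_conj rfl))
  have k := whisker_pull_eq (h'' ≫ h') e (θ' := θ')
    ((k₂.trans k₃).trans (EqMod.comp_whiskerLeft _ _ _).symm)
  refine ⟨_, along q ((h'' ≫ h') ≫ h), along_W _ _, ?_⟩
  rw [mk'_comp_along, mk'_comp_along]
  refine mk'_eq κ' ?_
  -- Whiskering with `σ` is epic; by interchange it turns the claim into the equality `k` of
  -- pulled-back composites.
  rw [← cancel_epi (X.map (((h'' ≫ h') ≫ h) ≫ v) ◁ σ), whisker_exchange_assoc]
  refine EqMod.eq ((pull_comp_cell σ φ _).symm.trans ?_)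
  rw [k]
  refine .comp ?_ (pull_comp_cell σ φ' _)
  exact (((k₂.map₂ X).trans (EqMod.map₂_whiskerRight X κ' u)).whiskerRight rfl).trans
    (EqMod.whiskerRight_comp _ _ _).symm

lemma hasLeftCalculusOfFractions (hK : TwoCofiltered K) :
    (W X A).HasLeftCalculusOfFractions where
  toIsMultiplicative := isMultiplicative_W
  exists_leftFraction _ _ φ := by
    obtain ⟨z, t, g, ht, e⟩ := exists_square hK φ.s φ.hs φ.f
    exact ⟨⟨g, t, ht⟩, e⟩
  ext _ _ _ f g s hs e := by
    obtain ⟨z, t, ht, e⟩ := exists_equalizing hK s hs f g e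
    exact ⟨z, t, ht, e⟩

end El

end ElEquality

/-! ### Objects and arrows of the pseudocolimit. -/

section ColimHom

variable {C : Type w} [Bicategory.{t, v} C] [Strict C]
  {K : Type w'} [Bicategory.{t', v'} K] [Strict K] (X : StrictPseudofunctor K C) {A B : C}

/-- The object of `colim C(X k, A)` given by `f : X k ⟶ A`. -/
def inc {k : K} (f : X.obj k ⟶ A) : car (colimHom X) A := (El.W X A).Q.obj ⟨k, f⟩

/-- The arrow of `colim C(X k, A)` given by a 2-cell. -/
def incMap {k : K} {f g : X.obj k ⟶ A} (φ : f ⟶ g) : inc X f ⟶ inc X g :=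
  (El.W X A).Q.map (El.vert φ)

/-- The transition isomorphism of `colim C(X k, A)` given by `u : l ⟶ k`. -/
noncomputable def incIso {k l : K} (u : l ⟶ k) (f : X.obj k ⟶ A) :
    inc X f ≅ inc X (X.map u ≫ f) :=
  Localization.isoOfHom (El.W X A).Q (El.W X A) (El.along ⟨k, f⟩ u) (El.along_W _ _)

lemma incIso_hom {k l : K} (u : l ⟶ k) (f : X.obj k ⟶ A) :
    (incIso X u f).hom = (El.W X A).Q.map (El.along ⟨k, f⟩ u) := rfl

lemma incMap_id {k : K} (f : X.obj k ⟶ A) : incMap X (𝟙 f) = 𝟙 _ := by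
  exact (congrArg _ (El.vert_id f)).trans ((El.W X A).Q.map_id _)

lemma incMap_comp {k : K} {f g h : X.obj k ⟶ A} (φ : f ⟶ g) (ψ : g ⟶ h) :
    incMap X (φ ≫ ψ) = incMap X φ ≫ incMap X ψ := by
  exact (congrArg _ (El.vert_comp φ ψ)).trans ((El.W X A).Q.map_comp _ _)

lemma incMap_eqToHom {k : K} {f g : X.obj k ⟶ A} (h : f = g) :
    incMap X (eqToHom h) = eqToHom (by rw [h]) := by
  subst h; exact incMap_id X f

lemma incMap_eqMod {k : K} {f g f' g' : X.obj k ⟶ A} {φ : f ⟶ g} {φ' : f' ⟶ g'} (h : φ ≐ φ') :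
    incMap X φ ≐ incMap X φ' := by
  obtain ⟨p, q, rfl⟩ := h; subst p q; exact .of_eq (by simp)

lemma inc_surjective (x : car (colimHom X) A) : ∃ (k : K) (f : X.obj k ⟶ A), inc X f = x := by
  obtain ⟨⟨k, f⟩, rfl⟩ := (Localization.Construction.objEquiv (El.W X A)).surjective x
  exact ⟨k, f, rfl⟩

/-- Every arrow of the localization is determined by the images of the arrows of `El X A`. -/
lemma Q_map_mk' {p q : El X A} (u : q.idx ⟶ p.idx) (φ : X.map u ≫ p.arr ⟶ q.arr) :
    (El.W X A).Q.map (El.mk' u φ) = (incIso X u p.arr).hom ≫ incMap X φ := by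
  rw [incIso_hom, incMap]
  refine Eq.trans ?_ ((El.W X A).Q.map_comp (El.along p u) (El.vert φ))
  exact congrArg _ (El.along_comp_vert _ _ _).symm

lemma fn_incMap {k : K} {f f' : X.obj k ⟶ A} (φ : f ⟶ f') (g : A ⟶ B) :
    (fn (colimHom X) g).map (incMap X φ) = incMap X (φ ▷ g) :=
  (locMap_map _ (El.post_W X g) _).trans (congrArg (El.W X B).Q.map (El.post_vert g φ))

lemma nt_inc {k : K} (f : X.obj k ⟶ A) {g g' : A ⟶ B} (γ : g ⟶ g') :
    (nt (colimHom X) γ).app (inc X f) = incMap X (f ◁ γ) :=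
  locNat_app (El.post_W X g) (El.post_W X g') _ _

lemma fn_incIso {k l : K} (u : l ⟶ k) (f : X.obj k ⟶ A) (g : A ⟶ B) :
    (fn (colimHom X) g).map (incIso X u f).hom ≐ (incIso X u (f ≫ g)).hom := by
  refine (EqMod.of_eq (locMap_map _ (El.post_W X g) _)).trans ?_
  have e : (El.post X g).map (El.along ⟨k, f⟩ u) = El.along ⟨k, f ≫ g⟩ u ≫
      El.vert (eqToHom (Strict.assoc _ _ _).symm) :=
    (El.post_map _ _ _).trans (.trans (El.mk'_cell (by simp)) (El.along_comp_vert _ _ _).symm)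
  refine (EqMod.of_eq ((congrArg _ e).trans ((El.W X B).Q.map_comp _ _))).trans ?_
  refine .trans (.comp (.refl _) (.of_eq ?_)) (.comp_eqToHom _
    (congrArg (inc X) (Strict.assoc (X.map u) f g).symm))
  · exact incMap_eqToHom X (Strict.assoc _ _ _).symm

lemma incIso_id {k : K} (f : X.obj k ⟶ A) : (incIso X (𝟙 k) f).hom ≐ 𝟙 (inc X f) := by
  rw [incIso_hom]
  have e : El.along ⟨k, f⟩ (𝟙 k) = El.vert (eqToHom (by rw [X.map_id, Strict.id_comp])) :=
    El.mk'_cell (by simp)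
  rw [e]
  refine (EqMod.of_eq (incMap_eqToHom X _)).trans (.eqToHom_id _)

lemma incIso_comp {k l m : K} (u : l ⟶ k) (v : m ⟶ l) (f : X.obj k ⟶ A) :
    (incIso X (v ≫ u) f).hom ≐ (incIso X u f).hom ≫ (incIso X v (X.map u ≫ f)).hom := by
  have e : El.along ⟨k, f⟩ u ≫ El.along ⟨l, X.map u ≫ f⟩ v = El.along ⟨k, f⟩ (v ≫ u) ≫
      El.vert (eqToHom (by rw [X.map_comp, Strict.assoc])) :=
    (El.mk'_comp_along _ _).trans (.trans (El.mk'_cell (by simp [El.pull]))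
      (El.along_comp_vert _ _ _).symm)
  refine .symm ((EqMod.of_eq (((El.W X A).Q.map_comp _ _).symm.trans
    ((congrArg _ e).trans ((El.W X A).Q.map_comp _ _)))).trans ?_)
  refine .trans (.comp (.refl _) (.of_eq ?_)) (.comp_eqToHom _
    (congrArg (inc X) (by rw [X.map_comp, Strict.assoc])))
  · exact incMap_eqToHom X _

lemma incIso_natural₂ {k l : K} {u u' : l ⟶ k} (α : u ⟶ u') (f : X.obj k ⟶ A) :
    (incIso X u f).hom ≫ incMap X (X.map₂ α ▷ f) = (incIso X u' f).hom := by
  refine ((El.W X A).Q.map_comp _ _).symm.trans (congrArg _ ?_)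
  refine (El.along_comp_vert _ _ _).trans (El.mk'_eq α ?_)
  exact (Category.comp_id _).symm

variable {X} in
lemma exists_incMap (hK : TwoCofiltered K) {k l : K} {f : X.obj k ⟶ A} {g : X.obj l ⟶ A}
    (s : inc X f ⟶ inc X g) : ∃ (m : K) (u : m ⟶ k) (v : m ⟶ l) (γ : X.map u ≫ f ⟶ X.map v ≫ g),
      s = (incIso X u f).hom ≫ incMap X γ ≫ (incIso X v g).inv := by
  have := El.hasLeftCalculusOfFractions (X := X) (A := A) hK
  obtain ⟨φ, e⟩ := Localization.exists_leftFraction (El.W X A).Q (El.W X A) s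
  obtain @⟨⟨m, h⟩, φ, s', v, ψ, _, rfl⟩ := φ
  induction φ using El.hom_ind with | h u φ => ?_
  refine ⟨m, u, v, φ ≫ inv ψ, ?_⟩
  have : IsIso ((El.W X A).Q.map (El.mk' v ψ)) :=
    Localization.inverts _ (El.W X A) _ ⟨v, ψ, inferInstance, rfl⟩
  rw [e]
  refine (cancel_mono (C := (El.W X A).Localization) ((El.W X A).Q.map (El.mk' v ψ))).1 ?_
  refine (MorphismProperty.LeftFraction.map_comp_map_s _ _ _).trans ?_
  have k : (incIso X u f).hom ≫ incMap X φ =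
      ((incIso X u f).hom ≫ incMap X (φ ≫ inv ψ) ≫ (incIso X v g).inv) ≫
        (incIso X v g).hom ≫ incMap X ψ := by
    simp only [Category.assoc, Iso.inv_hom_id_assoc, ← incMap_comp, IsIso.inv_hom_id,
      Category.comp_id]
  exact (Q_map_mk' X u φ).trans (k.trans (congrArg (fun t => (_ ≫ _ ≫ _) ≫ t)
    (Q_map_mk' X v ψ).symm))

variable {X} in
lemma exists_of_incMap_eq (hK : TwoCofiltered K) {k : K} {f g : X.obj k ⟶ A} {φ φ' : f ⟶ g}
    (e : incMap X φ = incMap X φ') : ∃ (m : K) (u : m ⟶ k), X.map u ◁ φ = X.map u ◁ φ' := by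
  have := El.hasLeftCalculusOfFractions (X := X) (A := A) hK
  obtain ⟨⟨m, h⟩, s, ⟨u, ψ, _, rfl⟩, e⟩ :=
    (MorphismProperty.map_eq_iff_postcomp (El.W X A).Q (El.W X A) (El.vert φ) (El.vert φ')).1 e
  rw [El.vert_comp_mk', El.vert_comp_mk'] at e
  obtain ⟨n, h, θ, e⟩ := El.exists_sameAt hK e
  obtain ⟨o, h', e'⟩ := hK.f2 θ.hom (𝟙 _)
  have k := El.whisker_pull_eq h' e (θ' := 𝟙 _) ((EqMod.id_eq (Strict.assoc _ _ _)).trans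
    (.of_eq (by rw [e', Bicategory.whiskerLeft_id])))
  simp only [El.pull, PrelaxFunctor.map₂_id, id_whiskerRight, Category.id_comp, cancel_epi,
    Bicategory.whiskerLeft_comp, cancel_mono] at k
  have a (φ : f ⟶ g) : X.map ((h' ≫ h) ≫ u) ◁ φ ≐ X.map (h' ≫ h) ◁ X.map u ◁ φ :=
    (EqMod.whiskerLeft (X.map_comp _ _) (.refl _)).trans (EqMod.comp_whiskerLeft _ _ _)
  exact ⟨o, (h' ≫ h) ≫ u, ((a φ).trans ((EqMod.of_eq k).trans (a φ').symm)).eq⟩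

end ColimHom

section Universal

variable {C : Type w} [Bicategory.{t, v} C] [Strict C]
  {K : Type w'} [Bicategory.{t', v'} K] [Strict K] (X : StrictPseudofunctor K C) {A B : C}

section Ext

variable {E : Type*} [Category* E] {F G : car (colimHom X) A ⥤ E}

lemma colimHom_functor_ext (h : ∀ {k : K} (f : X.obj k ⟶ A), F.obj (inc X f) = G.obj (inc X f))
    (hm : ∀ {k : K} {f g : X.obj k ⟶ A} (φ : f ⟶ g), F.map (incMap X φ) ≐ G.map (incMap X φ))
    (hi : ∀ {k l : K} (u : l ⟶ k) (f : X.obj k ⟶ A),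
      F.map (incIso X u f).hom ≐ G.map (incIso X u f).hom) : F = G := by
  refine Localization.Construction.uniq (W := El.W X A) F G
    (CategoryTheory.Functor.ext (fun p => h p.arr) (fun p q f => ?_))
  induction f using El.hom_ind with | h u φ => ?_
  have k : F.map ((incIso X u p.arr).hom ≫ incMap X φ) ≐
      G.map ((incIso X u p.arr).hom ≫ incMap X φ) := by
    rw [Functor.map_comp, Functor.map_comp]
    exact .comp (hi u p.arr) (hm φ)
  refine (congrArg F.map (Q_map_mk' X u φ)).trans (Eq.trans ?_
    (congrArg (fun t => eqToHom (h p.arr) ≫ G.map t ≫ eqToHom (h q.arr).symm)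
      (Q_map_mk' X u φ)).symm)
  exact k.conj _ _

end Ext

/-- The universal pseudo-family with values in `colim C(X k, -)`. -/
noncomputable def univ : PsFam X (colimHom X) where
  pt k := inc X (𝟙 (X.obj k))
  cell u := incIso X u (𝟙 _) ≪≫
    eqToIso (congrArg (inc X) ((Strict.comp_id _).trans (Strict.id_comp _).symm))
  cell_id k := ((EqMod.comp_eqToHom _ (congrArg (inc X) ((Strict.comp_id _).trans
      (Strict.id_comp _).symm))).trans ((incIso_id X _).trans (.symm (.eqToHom_id _)))).eq
  cell_comp {k l m} u v := by
    refine EqMod.eq ((EqMod.comp_eqToHom _ (congrArg (inc X) ((Strict.comp_id _).trans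
      (Strict.id_comp _).symm))).trans ((incIso_comp X v u _).trans ?_))
    have k : (incIso X u (𝟙 _)).hom ≫ eqToHom (congrArg (inc X) ((Strict.comp_id _).trans
      (Strict.id_comp _).symm)) ≐ (incIso X u (𝟙 (X.obj l))).hom := .comp_eqToHom _ _
    refine .comp (.symm (.comp_eqToHom _ (congrArg (inc X) ((Strict.comp_id _).trans
      (Strict.id_comp _).symm)))) (.symm (.trans (.comp_eqToHom _
        (by rw [X.map_comp, fn_comp_obj])) ?_))
    refine (k.map (fn (colimHom X) (X.map v))).trans ((fn_incIso X u _ _).trans ?_)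
    rw [Strict.id_comp, Strict.comp_id]
    exact .refl _
  cell_nat {k l u v} α := by
    refine EqMod.eq ((EqMod.comp_eqToHom _ (congrArg (inc X) ((Strict.comp_id _).trans
      (Strict.id_comp _).symm))).trans ?_)
    rw [← incIso_natural₂ X α]
    refine .comp (.symm (.comp_eqToHom _ (congrArg (inc X) ((Strict.comp_id _).trans
      (Strict.id_comp _).symm)))) ?_
    refine .trans ?_ (.of_eq (nt_inc X (𝟙 _) (X.map₂ α)).symm)
    exact incMap_eqMod X ((EqMod.whiskerRight_id _).trans (EqMod.id_whiskerLeft _).symm)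

lemma univ_cell {k l : K} (u : k ⟶ l) : ((univ X).cell u).hom ≐ (incIso X u (𝟙 _)).hom :=
  .comp_eqToHom _ (congrArg (inc X) ((Strict.comp_id _).trans (Strict.id_comp _).symm))

lemma inc_eq {k : K} (f : X.obj k ⟶ A) :
    inc X f = (fn (colimHom X) f).obj (inc X (𝟙 (X.obj k))) :=
  congrArg (inc X) (Strict.id_comp f).symm

lemma incMap_eq {k : K} {f g : X.obj k ⟶ A} (φ : f ⟶ g) :
    incMap X φ ≐ (nt (colimHom X) φ).app (inc X (𝟙 (X.obj k))) :=
  (incMap_eqMod X (EqMod.id_whiskerLeft φ).symm).trans (.of_eq (nt_inc X _ φ).symm)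

lemma incIso_eq {k l : K} (u : l ⟶ k) (f : X.obj k ⟶ A) :
    (incIso X u f).hom ≐ (fn (colimHom X) f).map ((univ X).cell u).hom := by
  refine .symm (((univ_cell X u).map _).trans ((fn_incIso X u _ f).trans ?_))
  rw [Strict.id_comp]
  exact .refl _

variable {X}
  {M : StrictPseudofunctor C Cat.{max (max (max t v) v') w', max v w'}}

lemma tf_inc (θ : colimHom X ⟶ M) {k : K} (f : X.obj k ⟶ A) :
    (tf θ A).obj (inc X f) = (fn M f).obj ((tf θ _).obj (inc X (𝟙 (X.obj k)))) := by
  rw [inc_eq, tf_natural_obj]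

lemma tf_incMap (θ : colimHom X ⟶ M) {k : K} {f g : X.obj k ⟶ A} (φ : f ⟶ g) :
    (tf θ A).map (incMap X φ) ≐ (nt M φ).app ((tf θ _).obj (inc X (𝟙 (X.obj k)))) :=
  ((incMap_eq X φ).map _).trans (EqMod.tf_nt θ φ _)

lemma tf_incIso (θ : colimHom X ⟶ M) {k l : K} (u : l ⟶ k) (f : X.obj k ⟶ A) :
    (tf θ A).map (incIso X u f).hom ≐ (fn M f).map (((PsFam.map X θ).obj (univ X)).cell u).hom :=
  ((incIso_eq X u f).map _).trans ((EqMod.tf_fn θ f _).trans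
    ((PsFam.map_cell_hom θ (univ X) u).symm.map _))

variable (X M) in
/-- Evaluation of 2-natural transformations `colim C(X k, -) ⇒ M` at the universal family. -/
noncomputable def evalUniv : (colimHom X ⟶ M) ⥤ PsFam X M where
  obj θ := (PsFam.map X θ).obj (univ X)
  map ρ := PsFam.map₂ ρ (univ X)
  map_id _ := rfl
  map_comp _ _ := rfl

lemma evalUniv_injective : Function.Injective (evalUniv X M).obj := by
  intro θ η e
  have h (k : K) : (tf θ _).obj (inc X (𝟙 (X.obj k))) = (tf η _).obj (inc X (𝟙 (X.obj k))) :=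
    congrArg (fun s : PsFam X M => s.pt k) e
  refine tf_ext fun A => colimHom_functor_ext X (fun f => ?_) (fun φ => ?_) (fun u f => ?_)
  · exact (tf_inc θ f).trans (.trans (by rw [h]) (tf_inc η f).symm)
  · exact (tf_incMap θ φ).trans (.trans (.app _ (h _)) (tf_incMap η φ).symm)
  · exact (tf_incIso θ u f).trans (.trans ((PsFam.cell_congr e u).map _) (tf_incIso η u f).symm)

section Desc

variable (σ : PsFam X M)

/-- The action on arrows of `famEl`. -/
def famElMap {p q : El X A} (f : p ⟶ q) :
    (fn M p.arr).obj (σ.pt p.idx) ⟶ (fn M q.arr).obj (σ.pt q.idx) :=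
  Quot.liftOn f
    (fun h => (fn M p.arr).map (σ.cell h.base).hom ≫
      eqToHom (fn_comp_obj M (X.map h.base) p.arr (σ.pt q.idx)).symm ≫
        (nt M h.cell).app (σ.pt q.idx))
    (by
      rintro ⟨u, φ⟩ ⟨u', φ'⟩ ⟨α, h⟩
      dsimp at α h
      subst h
      rw [σ.cell_nat α]
      simp [nt_comp_app, nt_whiskerRight_app])

lemma famElMap_mk' {p q : El X A} (u : q.idx ⟶ p.idx) (φ : X.map u ≫ p.arr ⟶ q.arr) :
    famElMap σ (El.mk' u φ) = (fn M p.arr).map (σ.cell u).hom ≫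
      eqToHom (fn_comp_obj M (X.map u) p.arr (σ.pt q.idx)).symm ≫
        (nt M φ).app (σ.pt q.idx) := rfl

variable (A) in
/-- The functor on elements induced by a pseudo-family. -/
def famEl : El X A ⥤ car M A where
  obj p := (fn M p.arr).obj (σ.pt p.idx)
  map f := famElMap σ f
  map_id p := by
    refine (famElMap_mk' σ _ _).trans ?_
    rw [σ.cell_id, nt_eqToHom_app, eqToHom_map]
    simp
  map_comp {p q r} f g := by
    induction f using El.hom_ind with | h u φ => ?_
    induction g using El.hom_ind with | h v ψ => ?_
    have n := (nt M φ).naturality (σ.cell v).hom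
    rw [fn_comp_map] at n
    rw [El.mk'_comp, famElMap_mk', famElMap_mk', famElMap_mk', σ.cell_comp]
    simp only [CategoryTheory.Functor.map_comp, nt_comp_app, nt_eqToHom_app, nt_whiskerLeft_app,
      Category.assoc, eqToHom_map, ← reassoc_of% n, eqToHom_trans_assoc, eqToHom_refl,
      Category.id_comp]

lemma famEl_W {p q : El X A} (f : p ⟶ q) (hf : El.W X A f) : IsIso ((famEl A σ).map f) := by
  obtain ⟨u, φ, _, rfl⟩ := hf
  have : IsIso ((nt M φ).app (σ.pt q.idx)) := (ntIso M (asIso φ) (σ.pt q.idx)).isIso_hom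
  have k : IsIso (famElMap σ (El.mk' u φ)) := by rw [famElMap_mk']; infer_instance
  exact k

variable (A) in
/-- The functor on the pseudocolimit induced by a pseudo-family. -/
noncomputable def descApp : car (colimHom X) A ⥤ car M A :=
  Localization.Construction.lift (W := El.W X A) (famEl A σ) (fun _ _ f hf => famEl_W σ f hf)

lemma descApp_Q {p q : El X A} (f : p ⟶ q) :
    (descApp A σ).map ((El.W X A).Q.map f) = famElMap σ f := by
  refine (Functor.congr_hom (Localization.Construction.fac (W := El.W X A) (famEl A σ)
    (fun _ _ f hf => famEl_W σ f hf)) f).trans ?_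
  erw [eqToHom_refl, eqToHom_refl, Category.id_comp, Category.comp_id]
  rfl

lemma descApp_incMap {k : K} {f g : X.obj k ⟶ A} (φ : f ⟶ g) :
    (descApp A σ).map (incMap X φ) = (nt M φ).app (σ.pt k) := by
  refine (descApp_Q σ (El.vert φ)).trans ((famElMap_mk' σ _ _).trans ?_)
  rw [σ.cell_id, nt_comp_app, nt_eqToHom_app, eqToHom_map]
  simp

lemma descApp_incIso {k l : K} (u : l ⟶ k) (f : X.obj k ⟶ A) :
    (descApp A σ).map (incIso X u f).hom ≐ (fn M f).map (σ.cell u).hom := by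
  refine (EqMod.of_eq ((descApp_Q σ _).trans (famElMap_mk' σ _ _))).trans ?_
  rw [nt_id_app, Category.comp_id]
  exact .comp_eqToHom _ (fn_comp_obj M (X.map u) f (σ.pt l)).symm

/-- The 2-natural transformation induced by a pseudo-family. -/
noncomputable def desc : colimHom X ⟶ M :=
  TwoNat.ofFunctors (fun A => descApp A σ)
    (fun {A B} g => colimHom_functor_ext X
      (fun f => fn_comp_obj M f g (σ.pt _))
      (fun {k f f'} φ => by
        refine (EqMod.of_eq ((congrArg (descApp B σ).map (fn_incMap X φ g)).trans
          (descApp_incMap σ _))).trans ?_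
        refine (EqMod.nt_whiskerRight M φ g _).trans (.of_eq ?_)
        exact congrArg (fn M g).map (descApp_incMap σ φ).symm)
      (fun u f => by
        refine ((fn_incIso X u f g).map _).trans ((descApp_incIso σ u _).trans ?_)
        exact (EqMod.fn_comp M f g _).trans ((descApp_incIso σ u f).symm.map (fn M g))))
    (fun {A B g g'} γ x => by
      obtain ⟨k, f, rfl⟩ := inc_surjective X x
      refine EqMod.conj (.trans (.of_eq ((congrArg (descApp B σ).map (nt_inc X f γ)).trans
        (descApp_incMap σ _))) ?_) _ _
      exact .nt_whiskerLeft M f γ _)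

lemma evalUniv_desc : (evalUniv X M).obj (desc σ) = σ := by
  refine PsFam.ext' (fun k => fn_id_obj M _) (fun u => ?_)
  refine (PsFam.map_cell_hom _ _ u).trans (((univ_cell X u).map (descApp _ σ)).trans ?_)
  exact (descApp_incIso σ u _).trans (.fn_id M _)

end Desc


lemma mf_inc {θ η : colimHom X ⟶ M} (ρ : θ ⟶ η) {k : K} (f : X.obj k ⟶ A) :
    (mf ρ A).app (inc X f) ≐ (fn M f).map ((mf ρ _).app (inc X (𝟙 (X.obj k)))) :=
  (EqMod.app _ (inc_eq X f)).trans (EqMod.mf_fn ρ f _)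

section DescMap

variable {σ τ : PsFam X M} (s : σ ⟶ τ)

lemma famElMap_naturality {p q : El X A} (f : p ⟶ q) :
    famElMap σ f ≫ (fn M q.arr).map (PsFam.Hom.app s q.idx) =
      (fn M p.arr).map (PsFam.Hom.app s p.idx) ≫ famElMap τ f := by
  induction f using El.hom_ind with | h u φ => ?_
  have n := (nt M φ).naturality (PsFam.Hom.app s q.idx)
  rw [fn_comp_map] at n
  have k := congrArg (fn M p.arr).map (PsFam.Hom.w s u)
  rw [CategoryTheory.Functor.map_comp, CategoryTheory.Functor.map_comp] at k
  rw [famElMap_mk', famElMap_mk', Category.assoc, Category.assoc, ← n, ← reassoc_of% k]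
  simp

variable (A) in
/-- The natural transformation induced by a morphism of pseudo-families. -/
noncomputable def descAppMap : descApp A σ ⟶ descApp A τ :=
  Localization.Construction.natTransExtension (W := El.W X A)
    { app p := (fn M p.arr).map (PsFam.Hom.app s p.idx)
      naturality p q f := (congrArg (· ≫ _) (descApp_Q σ f)).trans ((famElMap_naturality s f).trans
        (congrArg (_ ≫ ·) (descApp_Q τ f).symm)) }

lemma descAppMap_inc {k : K} (f : X.obj k ⟶ A) :
    (descAppMap A s).app (inc X f) = (fn M f).map (PsFam.Hom.app s k) :=
  Localization.Construction.NatTransExtension.app_eq (W := El.W X A) _ _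

/-- The modification induced by a morphism of pseudo-families. -/
noncomputable def descMap : desc σ ⟶ desc τ :=
  Modif.ofNatTrans (fun A => descAppMap A s) (fun {A B} g x => by
    obtain ⟨k, f, rfl⟩ := inc_surjective X x
    refine EqMod.conj (.trans (.of_eq (descAppMap_inc s (f ≫ g))) ?_) _ _
    refine (EqMod.fn_comp M f g _).trans (.of_eq ?_)
    exact congrArg (fn M g).map (descAppMap_inc s f).symm)

lemma descMap_inc (k : K) : (mf (descMap s) _).app (inc X (𝟙 (X.obj k))) =
    eqToHom (fn_id_obj M _) ≫ PsFam.Hom.app s k ≫ eqToHom (fn_id_obj M _).symm :=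
  (descAppMap_inc s _).trans (fn_id_map M _)

end DescMap

lemma isIsoCat_evalUniv : IsIsoCat (evalUniv X M) := by
  refine PsFam.isIsoCat_of _ evalUniv_injective (fun σ => ⟨desc σ, evalUniv_desc σ⟩)
    (fun {θ η} ρ ρ' e => mf_ext fun A x => ?_) (fun {θ η} s => ?_)
  · obtain ⟨k, f, rfl⟩ := inc_surjective X x
    exact ((mf_inc ρ f).trans (.trans (.map _ (.of_eq (e k))) (mf_inc ρ' f).symm)).eq
  · obtain ⟨σ, rfl⟩ : ∃ σ, desc σ = θ := ⟨_, evalUniv_injective (evalUniv_desc _)⟩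
    obtain ⟨τ, rfl⟩ : ∃ σ, desc σ = η := ⟨_, evalUniv_injective (evalUniv_desc _)⟩
    refine ⟨descMap (eqToHom (evalUniv_desc σ).symm ≫ s ≫ eqToHom (evalUniv_desc τ)),
      fun k => (descMap_inc _ k).trans ?_⟩
    refine EqMod.eq (.trans (.of_conj rfl) ?_)
    rw [PsFam.comp_app, PsFam.comp_app, PsFam.eqToHom_app, PsFam.eqToHom_app]
    exact .of_conj rfl

end Universal

section

section Point

universe v₁ u₁

variable {C : Type w} [Bicategory.{t, v} C] (D : StrictPseudofunctor Pt.{u} C)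
  (M : StrictPseudofunctor C Cat.{v₁, u₁})

/-- The point of the one-point 2-category. -/
abbrev pt : Pt.{u} := ⟨⟨⟨⟩⟩⟩

lemma map_pt (u : pt.{u} ⟶ pt.{u}) : D.map u = 𝟙 (D.obj pt.{u}) := by
  rw [subsingleton_pt u (𝟙 pt), D.map_id]

lemma fn_map_pt_obj (u : pt.{u} ⟶ pt.{u}) (x : car M (D.obj pt.{u})) :
    x = (fn M (D.map u)).obj x := by
  rw [map_pt, fn_id_obj]

/-- Pseudo-families indexed by a point, evaluated at that point. -/
def ptEval : PsFam D M ⥤ car M (D.obj pt.{u}) where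
  obj σ := σ.pt pt
  map f := PsFam.Hom.app f pt
  map_id _ := rfl
  map_comp _ _ := rfl

lemma isIsoCat_ptEval : IsIsoCat (ptEval D M) := by
  have hc (σ : PsFam D M) (u : pt.{u} ⟶ pt.{u}) : (σ.cell u).hom ≐ 𝟙 (σ.pt pt) := by
    rw [subsingleton_pt u (𝟙 pt)]
    exact (EqMod.of_eq (σ.cell_id pt)).trans (.eqToHom_id _)
  refine ⟨⟨fun σ τ e => PsFam.ext' (fun _ => e) (fun u => ?_), fun x => ?_⟩, fun σ τ =>
    ⟨fun f g e => PsFam.hom_ext fun _ => e, fun f => ⟨⟨fun _ => f, fun {k l} u => ?_⟩, rfl⟩⟩⟩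
  · exact (hc σ u).trans (.trans (.id_eq e) (hc τ u).symm)
  · refine ⟨⟨fun _ => x, fun u => eqToIso (fn_map_pt_obj D M u x), fun _ => rfl, fun u v => ?_,
      fun {k l u v} α => ?_⟩, rfl⟩
    · simp [eqToHom_map]
    · obtain rfl := subsingleton_pt u v
      obtain rfl : α = 𝟙 u := Subsingleton.elim _ _
      simp [nt_id_app]
  · refine EqMod.eq (.trans (.comp (f' := 𝟙 (σ.pt pt)) (hc σ u) (g' := f) ?_) ?_)
    · refine .trans (.fn_congr M (map_pt D u) (.refl f)) (.fn_id M f)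
    · exact (EqMod.of_eq (Category.id_comp f)).trans (.trans (.of_eq (Category.comp_id f).symm)
        (.comp (.refl f) (hc τ u).symm))

end Point

/-- 2-pro-objects, at the universe levels for which `2-Pro(C)` is again of the same size. -/
abbrev ProOf (C : Type (max w (u + 1))) [Bicategory.{max w (u + 1), max w (u + 1)} C] :
    Type max w (u + 1) :=
  ProObj.{max w (u + 1), max w (u + 1), max w (u + 1), u} C

section Canonical

variable {C : Type (max w (u + 1))} [Bicategory.{max w (u + 1), max w (u + 1)} C] [Strict C]

/-- The 2-pro-object given by a diagram indexed by a point. -/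
abbrev ofPt (D : StrictPseudofunctor Pt.{u} C) : ProOf.{w, u} C := ⟨Pt.{u}, twoCofiltered_pt, D⟩

/-- Yoneda: arrows `X ⟶ D` in `2-Pro(C)` to a 2-pro-object indexed by a point are objects of
`LX`. -/
noncomputable def evPt (X : ProOf.{w, u} C) (D : StrictPseudofunctor Pt.{u} C) :
    (X ⟶ ofPt.{w, u} D) ⥤ car (ProObj.L X) (D.obj pt.{u}) :=
  evalUniv D (ProObj.L X) ⋙ ptEval D (ProObj.L X)

lemma isIsoCat_evPt (X : ProOf.{w, u} C) (D : StrictPseudofunctor Pt.{u} C) :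
    IsIsoCat (evPt X D) :=
  isIsoCat_evalUniv.comp (isIsoCat_ptEval _ _)

variable (C) in
/-- The 2-functor `c : C → 2-Pro(C)`. -/
noncomputable abbrev cPro : StrictPseudofunctor C (ProOf.{w, u} C) := proEmbedding C

end Canonical

section ColimPre

variable {C : Type w} [Bicategory.{t, v} C] [Strict C]
  {K : Type w'} [Bicategory.{t', v'} K] [Strict K] {X Y : StrictPseudofunctor K C} {A : C}

lemma colimPreMap_inc {α β : X ⟶ Y} (ρ : α ⟶ β) {k : K} (f : Y.obj k ⟶ A) :
    (mf (colimPreMap ρ) A).app (inc Y f) = incMap X (Modif.app ρ k ▷ f) :=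
  locNat_app (El.pre_W α) (El.pre_W β) _ _

end ColimPre

section EvNat

variable {D : Type (max w (u + 1))} [Bicategory.{max w (u + 1), max w (u + 1)} D] [Strict D]
  {E : Type w'} [Bicategory.{t', v'} E] {P : Type w''} [Bicategory.{t'', v''} P]
  (G : StrictPseudofunctor E P) (Φ : StrictPseudofunctor P (ProOf.{w, u} D))
  (H : StrictPseudofunctor E D)

/-- A 2-natural element of the categories `L(ΦGe)(He)`. -/
structure NatElement where
  elem (e : E) : car (ProObj.L (Φ.obj (G.obj e))) (H.obj e)
  natural {e e' : E} (f : e ⟶ e') :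
    (tf (M := ProObj.L (Φ.obj (G.obj e'))) (N := ProObj.L (Φ.obj (G.obj e)))
      (Φ.map (G.map f)) (H.obj e')).obj (elem e') =
    (fn (ProObj.L (Φ.obj (G.obj e))) (H.map f)).obj (elem e)
  natural₂ {e e' : E} {f g : e ⟶ e'} (γ : f ⟶ g) :
    (mf (M := ProObj.L (Φ.obj (G.obj e'))) (N := ProObj.L (Φ.obj (G.obj e)))
      (Φ.map₂ (G.map₂ γ)) (H.obj e')).app (elem e') ≐
    (nt (ProObj.L (Φ.obj (G.obj e))) (H.map₂ γ)).app (elem e)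

/-- Evaluation of arrows of `2-Pro(D)` at an element. -/
noncomputable def evAt {X Y : ProOf.{w, u} D} {A : D} (x : car (ProObj.L Y) A) :
    (X ⟶ Y) ⥤ car (ProObj.L X) A where
  obj f := (tf (M := ProObj.L Y) (N := ProObj.L X) f A).obj x
  map s := (mf (M := ProObj.L Y) (N := ProObj.L X) s A).app x
  map_id _ := rfl
  map_comp _ _ := rfl

variable {G Φ H} in
/-- The Yoneda transformation of a 2-natural element. -/
noncomputable def NatElement.ev (x : NatElement G Φ H) (X : ProOf.{w, u} D) :
    G.comp (Φ.comp (homFrom X)) ⟶ H.comp (ProObj.L X) :=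
  TwoNat.ofFunctors (fun e => evAt (x.elem e))
    (fun {e e'} f => CategoryTheory.Functor.ext
      (fun y => (congrArg (tf (M := ProObj.L (Φ.obj (G.obj e))) (N := ProObj.L X) y _).obj
        (x.natural f)).trans (tf_natural_obj _ _ _))
      (fun y z s => by
        refine EqMod.conj ?_ _ _
        refine (EqMod.app (mf (M := ProObj.L (Φ.obj (G.obj e))) (N := ProObj.L X) s _)
          (x.natural f)).trans ?_
        exact EqMod.mf_fn (M := ProObj.L (Φ.obj (G.obj e))) (N := ProObj.L X) s (H.map f) _))
    (fun {e e' f g} γ y => by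
      refine EqMod.conj ?_ _ _
      refine ((x.natural₂ γ).map (tf (M := ProObj.L (Φ.obj (G.obj e))) (N := ProObj.L X) y _)).trans ?_
      exact EqMod.tf_nt (M := ProObj.L (Φ.obj (G.obj e))) (N := ProObj.L X) y (H.map₂ γ) _)

end EvNat

end

section

section ConeFam

variable {K : Type w'} [Bicategory.{t', v'} K] [Strict K] {E : Type w''} [Bicategory.{t'', v''} E]
  {P : Type w} [Bicategory.{t, v} P] [Strict P]

/-- Removal of composition with identities. -/
def TwoNat.dropId {G : StrictPseudofunctor E P} {N : StrictPseudofunctor P Cat.{t', v'}}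
    {M : StrictPseudofunctor E Cat.{t', v'}}
    (θ : G.comp ((StrictPseudofunctor.id P).comp N) ⟶ (StrictPseudofunctor.id E).comp M) :
    G.comp N ⟶ M where
  app a := θ.app a
  naturality f := θ.naturality f
  naturality₂ γ := θ.naturality₂ γ

/-- Pseudocones over `S ⋙ G` with vertex `B` as pseudo-families for `S`. -/
def coneFam (S : StrictPseudofunctor K E) {G : StrictPseudofunctor E P} {B : P}
    {M : StrictPseudofunctor E Cat.{t, v}} (θ : G.comp (homFrom B) ⟶ M) :
    PseudoCone (S.comp G) B ⥤ PsFam S M :=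
  toFam (S.comp G) B ⋙ PsFam.assoc S G (homFrom B) ⋙ PsFam.map S θ

section

variable {S : StrictPseudofunctor K E} {G : StrictPseudofunctor E P} {B : P}
    {M : StrictPseudofunctor E Cat.{t, v}} (θ : G.comp (homFrom B) ⟶ M)

lemma isIsoCat_coneFam (h : ∀ A, IsIsoCat (tf θ A)) : IsIsoCat (coneFam S θ) :=
  (isIsoCat_toFam _ _).comp
    ((PsFam.isIsoCat_assoc _ _ _).comp (PsFam.isIsoCat_map _ fun _ => h _))

variable {π : PseudoCone (S.comp G) B} {σ : PsFam S M}

lemma coneFam_leg (h : (coneFam S θ).obj π = σ) (k : K) :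
    (tf θ (S.obj k)).obj (π.leg k) = σ.pt k :=
  congrArg (fun σ : PsFam S M => σ.pt k) h

lemma coneFam_cell (h : (coneFam S θ).obj π = σ) {k l : K} (u : k ⟶ l) :
    (tf θ (S.obj l)).map (π.cell u).hom ≐ (σ.cell u).hom :=
  (PsFam.map_cell_hom θ _ u).symm.trans (PsFam.cell_congr (X := S) (M := M) h u)

end

section

variable {D : Type w} [Bicategory.{t, v} D] [Strict D] {Q : Type*} [Bicategory Q]

lemma isIsoCat_evalCone_of {X : P} {S : StrictPseudofunctor K E} {c : StrictPseudofunctor E P}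
    (π : PseudoCone (S.comp c) X) (Y : StrictPseudofunctor P Cat.{t, v})
    {N : StrictPseudofunctor E Cat.{t, v}} (θ : c.comp Y ⟶ N) (hθ : ∀ A, IsIsoCat (tf θ A))
    (l : car Y X ⥤ PsFam S N) (hl : IsIsoCat l)
    (hpt : ∀ f k, (tf θ (S.obj k)).obj ((fn Y (π.leg k)).obj f) = (l.obj f).pt k)
    (hcell : ∀ f {k k' : K} (u : k ⟶ k'), (tf θ (S.obj k')).map ((nt Y (π.cell u).hom).app f) ≐
      ((l.obj f).cell u).hom)
    (hmap : ∀ {f g} (s : f ⟶ g) k, (tf θ (S.obj k)).map ((fn Y (π.leg k)).map s) ≐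
      PsFam.Hom.app (l.map s) k) : IsIsoCat (evalCone π Y) := by
  have e : evalCone π Y ⋙ (PsFam.assoc S c Y ⋙ PsFam.map S θ) = l := by
    refine PsFam.functor_ext (fun f => PsFam.ext' (hpt f) (fun {k k'} u => ?_)) (fun s k => hmap s k)
    exact (PsFam.map_cell_hom θ ((PsFam.assoc S c Y).obj ((evalCone π Y).obj f)) u).trans
      (((evalCone_cell_hom π Y f u).map (tf θ (S.obj k'))).trans (hcell f u))
  exact .of_eq e hl ((PsFam.isIsoCat_assoc _ _ _).comp (PsFam.isIsoCat_map _ fun _ => hθ _))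

end

end ConeFam

section Canonical

variable {C : Type w} [Bicategory.{t, v} C] [Strict C] {K : Type w'} [Bicategory.{t', v'} K]
  [Strict K] {P : Type w''} [Bicategory.{t'', v''} P] [Strict P]

/-- The 2-cell at `u` of a pseudocone over `D ⋙ c`, whiskered with `cf`. -/
def shift {c : StrictPseudofunctor C P} {D : StrictPseudofunctor K C} {X : P}
    (π : PseudoCone (D.comp c) X) {A : C} {k l : K} (u : l ⟶ k) (f : D.obj k ⟶ A) :
    π.leg k ≫ c.map f ≅ π.leg l ≫ c.map (D.map u ≫ f) :=
  whiskerRightIso (π.cell u) (c.map f) ≪≫ eqToIso ((Strict.assoc _ _ _).trans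
    (congrArg (π.leg l ≫ ·) (c.map_comp (D.map u) f).symm))

lemma shift_eqMod {c : StrictPseudofunctor C P} {D : StrictPseudofunctor K C} {X : P}
    (π : PseudoCone (D.comp c) X) {A : C} {k l : K} (u : l ⟶ k) (f : D.obj k ⟶ A) :
    (shift π u f).hom ≐ (π.cell u).hom ▷ c.map f :=
  EqMod.comp_eqToHom _ ((Strict.assoc _ _ _).trans
    (congrArg (π.leg l ≫ ·) (c.map_comp (D.map u) f).symm))

/-- A pseudocone over `D ⋙ c` exhibits `X` as a 2-pro-object with diagram `D`: it is a pseudolimit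
and arrows and 2-cells into objects `cA` come from the diagram. -/
structure IsCanonical (c : StrictPseudofunctor C P) (D : StrictPseudofunctor K C) {X : P}
    (π : PseudoCone (D.comp c) X) : Prop where
  cofiltered : TwoCofiltered K
  isPseudolimit : π.IsPseudolimit
  exists_leg {A : C} (g : X ⟶ c.obj A) : ∃ (k : K) (f : D.obj k ⟶ A), g = π.leg k ≫ c.map f
  exists_whisker {A : C} {k l : K} {f : D.obj k ⟶ A} {g : D.obj l ⟶ A}
    (s : π.leg k ≫ c.map f ⟶ π.leg l ≫ c.map g) :
    ∃ (m : K) (u : m ⟶ k) (v : m ⟶ l) (γ : D.map u ≫ f ⟶ D.map v ≫ g),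
      s ≫ (shift π v g).hom = (shift π u f).hom ≫ π.leg m ◁ c.map₂ γ
  exists_of_whisker_eq {A : C} {k : K} {f f' : D.obj k ⟶ A} {γ γ' : f ⟶ f'}
    (h : π.leg k ◁ c.map₂ γ = π.leg k ◁ c.map₂ γ') :
    ∃ (m : K) (u : m ⟶ k), D.map u ◁ γ = D.map u ◁ γ'

end Canonical

section Generating

variable {C : Type w} [Bicategory.{t, v} C] [Strict C] {K : Type w'} [Bicategory.{t', v'} K]
  [Strict K]

universe v₁ u₁

/-- Objects and arrows of the values of `M` come from the diagram `D`, by means of the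
pseudo-family `σ`. -/
structure PsFam.Generates {D : StrictPseudofunctor K C} {M : StrictPseudofunctor C Cat.{v₁, u₁}}
    (σ : PsFam D M) : Prop where
  exists_obj {A : C} (x : car M A) : ∃ (k : K) (f : D.obj k ⟶ A), x = (fn M f).obj (σ.pt k)
  exists_map {A : C} {k l : K} {f : D.obj k ⟶ A} {g : D.obj l ⟶ A}
    (s : (fn M f).obj (σ.pt k) ⟶ (fn M g).obj (σ.pt l)) :
    ∃ (m : K) (u : m ⟶ k) (v : m ⟶ l) (γ : D.map u ≫ f ⟶ D.map v ≫ g),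
      s ≫ (fn M g).map (σ.cell v).hom ≫ eqToHom (fn_comp_obj M (D.map v) g (σ.pt m)).symm =
        (fn M f).map (σ.cell u).hom ≫ eqToHom (fn_comp_obj M (D.map u) f (σ.pt m)).symm ≫
          (nt M γ).app (σ.pt m)
  exists_eq {A : C} {k : K} {f f' : D.obj k ⟶ A} {γ γ' : f ⟶ f'}
    (h : (nt M γ).app (σ.pt k) = (nt M γ').app (σ.pt k)) :
    ∃ (m : K) (u : m ⟶ k), D.map u ◁ γ = D.map u ◁ γ'

lemma generates_univ (D : StrictPseudofunctor K C) (hK : TwoCofiltered K) :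
    (univ D).Generates where
  exists_obj {A} x := by
    obtain ⟨k, f, e⟩ := inc_surjective D x
    exact ⟨k, f, e.symm.trans (inc_eq D f)⟩
  exists_map {A k l f g} s := by
    obtain ⟨m, u, v, γ, e⟩ := exists_incMap hK
      (eqToHom (inc_eq D f) ≫ s ≫ eqToHom (inc_eq D g).symm)
    refine ⟨m, u, v, γ, EqMod.eq ?_⟩
    have e' : s ≐ (incIso D u f).hom ≫ incMap D γ ≫ (incIso D v g).inv :=
      .trans (.symm (.of_conj rfl)) (.of_eq e)
    refine (EqMod.comp e' (.trans (EqMod.comp_eqToHom _ (fn_comp_obj _ (D.map v) g _).symm)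
      (incIso_eq D v g).symm)).trans ?_
    refine EqMod.trans (.of_eq ?_) (EqMod.comp (incIso_eq D u f)
      ((incMap_eq D γ).trans (.symm (.eqToHom_comp (fn_comp_obj _ (D.map u) f _).symm _))))
    rw [Category.assoc, Category.assoc, Iso.inv_hom_id, Category.comp_id]
  exists_eq {A k f f' γ γ'} e :=
    exists_of_incMap_eq hK ((incMap_eq D γ).trans ((EqMod.of_eq e).trans (incMap_eq D γ').symm)).eq

end Generating

section CanonicalOf

variable {C : Type w} [Bicategory.{t, v} C] [Strict C] {K : Type w'} [Bicategory.{t', v'} K]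
  [Strict K] {P : Type w''} [Bicategory.{t'', v''} P] [Strict P]
  {c : StrictPseudofunctor C P} {D : StrictPseudofunctor K C} {X : P}
  {π : PseudoCone (D.comp c) X} {M : StrictPseudofunctor C Cat.{t'', v''}} {σ : PsFam D M}
  (θ : c.comp (homFrom X) ⟶ M)

/-- Evaluation of arrows `X ⟶ cA`. -/
def evC (A : C) : (X ⟶ c.obj A) ⥤ car M A := tf θ A

variable {θ} {A B : C}

lemma evC_comp (g : X ⟶ c.obj A) (f : A ⟶ B) :
    (evC θ B).obj (g ≫ c.map f) = (fn M f).obj ((evC θ A).obj g) :=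
  tf_natural_obj θ f g

lemma evC_whiskerRight {g g' : X ⟶ c.obj A} (s : g ⟶ g') (f : A ⟶ B) :
    (evC θ B).map (s ▷ c.map f) ≐ (fn M f).map ((evC θ A).map s) :=
  EqMod.tf_fn θ f s

lemma evC_whiskerLeft (g : X ⟶ c.obj A) {f f' : A ⟶ B} (γ : f ⟶ f') :
    (evC θ B).map (g ◁ c.map₂ γ) ≐ (nt M γ).app ((evC θ A).obj g) :=
  EqMod.tf_nt θ γ g

section

variable (h : (coneFam D θ).obj π = σ)

include h

lemma evC_leg_comp {k : K} (f : D.obj k ⟶ A) :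
    (evC θ _).obj (π.leg k ≫ c.map f) = (fn M f).obj (σ.pt k) :=
  (evC_comp _ f).trans (congrArg _ (coneFam_leg θ h k))

lemma evC_leg_whisker {k : K} {f f' : D.obj k ⟶ A} (γ : f ⟶ f') :
    (evC θ _).map (π.leg k ◁ c.map₂ γ) ≐ (nt M γ).app (σ.pt k) :=
  (evC_whiskerLeft _ γ).trans (EqMod.app _ (coneFam_leg θ h k))

lemma evC_shift {k l : K} (u : l ⟶ k) (f : D.obj k ⟶ A) :
    (evC θ A).map (shift π u f).hom ≐ (fn M f).map (σ.cell u).hom :=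
  ((shift_eqMod π u f).map _).trans ((evC_whiskerRight _ f).trans
    ((coneFam_cell θ h u).map _))

/-- A pseudolimit pseudocone corresponding to a generating family is canonical. -/
lemma isCanonical_of (hK : TwoCofiltered K) (hσ : σ.Generates) (hπ : π.IsPseudolimit)
    (hθ : ∀ A, IsIsoCat (tf θ A)) : IsCanonical c D π where
  cofiltered := hK
  isPseudolimit := hπ
  exists_leg {A} g := by
    obtain ⟨k, f, e⟩ := hσ.exists_obj ((evC θ A).obj g)
    exact ⟨k, f, (hθ A).obj.1 (e.trans (evC_leg_comp h f).symm)⟩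
  exists_whisker {A k l f g} s := by
    obtain ⟨m, u, v, γ, e⟩ := hσ.exists_map
      (eqToHom (evC_leg_comp h f).symm ≫ (evC θ A).map s ≫ eqToHom (evC_leg_comp h g))
    refine ⟨m, u, v, γ, ((hθ A).map _ _).1 (EqMod.eq ?_)⟩
    refine (EqMod.of_eq ((evC θ A).map_comp _ _)).trans (.trans ?_
      (.of_eq ((evC θ A).map_comp _ _).symm))
    refine (EqMod.comp (.symm (.of_conj rfl)) (.trans (evC_shift h v g) (EqMod.symm
      (.comp_eqToHom _ (fn_comp_obj M (D.map v) g (σ.pt m)).symm)))).trans (.trans (.of_eq e) ?_)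
    exact EqMod.comp (evC_shift h u f).symm (.trans (.eqToHom_comp (fn_comp_obj M _ f _).symm _)
      (evC_leg_whisker h γ).symm)
  exists_of_whisker_eq {A k f f' γ γ'} e :=
    hσ.exists_eq ((evC_leg_whisker h γ).symm.trans
      ((EqMod.of_eq (congrArg (evC θ A).map e)).trans (evC_leg_whisker h γ'))).eq

end

end CanonicalOf

end

section Canonical

variable {C : Type (max w (u + 1))} [Bicategory.{max w (u + 1), max w (u + 1)} C] [Strict C]

variable (C) in
/-- The universal elements of the categories `L(cA)(A)`. -/
noncomputable def constElement : NatElement (cPro.{w, u} C)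
    (StrictPseudofunctor.id (ProOf.{w, u} C)) (StrictPseudofunctor.id C) where
  elem A := inc (constObj Pt A) (k := pt) (𝟙 A)
  natural {A B} f := congrArg (inc (constObj Pt A) (k := pt))
    ((Strict.comp_id f).trans (Strict.id_comp f).symm)
  natural₂ {A B f g} γ := (EqMod.of_eq (colimPreMap_inc (constMap₂ Pt γ) (k := pt) (𝟙 B))).trans
    ((incMap_eqMod (constObj Pt A) (k := pt) (EqMod.whiskerRight_id γ)).trans
      (incMap_eq (constObj Pt A) (k := pt) γ))

/-- The Yoneda transformation `2-Pro(C)(X, c-) ⟶ LX`. -/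
noncomputable def yo (X : ProOf.{w, u} C) : (cPro.{w, u} C).comp (homFrom X) ⟶ ProObj.L X :=
  TwoNat.dropId ((constElement C).ev X)

lemma isIsoCat_yo (X : ProOf.{w, u} C) (A : C) : IsIsoCat (tf (yo X) A) :=
  isIsoCat_evPt X (constObj Pt A)

lemma exists_canonCone (X : ProOf.{w, u} C) :
    ∃ π, (coneFam X.diag (yo X)).obj π = univ X.diag :=
  (isIsoCat_coneFam (yo X) (isIsoCat_yo X)).obj.2 _

/-- The canonical pseudocone over the diagram of a 2-pro-object. -/
noncomputable def canonCone (X : ProOf.{w, u} C) : PseudoCone (X.diag.comp (cPro C)) X :=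
  (exists_canonCone X).choose

lemma coneFam_canonCone (X : ProOf.{w, u} C) :
    (coneFam X.diag (yo X)).obj (canonCone X) = univ X.diag :=
  (exists_canonCone X).choose_spec

lemma yo_comp {B X : ProOf.{w, u} C} (g : B ⟶ X) {A : C} (f : X ⟶ (cPro C).obj A) :
    (tf (yo B) A).obj (g ≫ f) = (tf (M := ProObj.L X) (N := ProObj.L B) g A).obj
      ((tf (yo X) A).obj f) := rfl

lemma yo_whiskerLeft {B X : ProOf.{w, u} C} (g : B ⟶ X) {A : C} {f f' : X ⟶ (cPro C).obj A}
    (s : f ⟶ f') :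
    (tf (yo B) A).map (g ◁ s) = (tf (M := ProObj.L X) (N := ProObj.L B) g A).map
      ((tf (yo X) A).map s) := rfl

lemma yo_whiskerRight {B X : ProOf.{w, u} C} {g g' : B ⟶ X} (s : g ⟶ g') {A : C}
    (f : X ⟶ (cPro C).obj A) :
    (tf (yo B) A).map (s ▷ f) = (mf (M := ProObj.L X) (N := ProObj.L B) s A).app
      ((tf (yo X) A).obj f) := rfl

end Canonical

section Small

variable {C : Type (max w (u + 1))} [Bicategory.{max w (u + 1), max w (u + 1)} C] [Strict C]
  (hC : TwoLocallySmall.{max w (u + 1), max w (u + 1), max w (u + 1), u} C)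

include hC

lemma small_car (X : ProOf.{w, u} C) (A : C) : Small.{u} (car (colimHom X.diag) A) := by
  have (k : X.K) : Small.{u} (X.diag.obj k ⟶ A) := hC.small_hom _ _
  exact small_of_surjective (α := Σ k : X.K, (X.diag.obj k ⟶ A)) (f := fun p => inc X.diag p.2)
    fun x => by
      obtain ⟨k, f, h⟩ := inc_surjective X.diag x
      exact ⟨⟨k, f⟩, h⟩

lemma small_car_hom (X : ProOf.{w, u} C) (A : C) (x y : car (colimHom X.diag) A) :
    Small.{u} (x ⟶ y) := by
  obtain ⟨k, f, rfl⟩ := inc_surjective X.diag x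
  obtain ⟨l, g, rfl⟩ := inc_surjective X.diag y
  have (m : X.K) (u : m ⟶ k) (v : m ⟶ l) : Small.{u} (X.diag.map u ≫ f ⟶ X.diag.map v ≫ g) :=
    hC.small_hom₂ _ _
  exact small_of_surjective (α := Σ (m : X.K) (u : m ⟶ k) (v : m ⟶ l),
      (X.diag.map u ≫ f ⟶ X.diag.map v ≫ g))
    (f := fun p => (incIso X.diag p.2.1 f).hom ≫ incMap X.diag p.2.2.2 ≫
      (incIso X.diag p.2.2.1 g).inv) fun s => by
      obtain ⟨m, u, v, γ, h⟩ := exists_incMap X.cofiltered s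
      exact ⟨⟨m, u, v, γ⟩, h.symm⟩

lemma small_psFam {K : Type u} [Bicategory.{u, u} K] (S : StrictPseudofunctor K C)
    (X : ProOf.{w, u} C) : Small.{u} (PsFam S (colimHom X.diag)) := by
  have (A : C) := small_car hC X A
  have (A : C) (x y : car (colimHom X.diag) A) := small_car_hom hC X A x y
  have (p : ∀ k, car (colimHom X.diag) (S.obj k)) : Small.{u} (∀ (k l : K) (u : k ⟶ l),
      p l ⟶ (fn (colimHom X.diag) (S.map u)).obj (p k)) := inferInstance
  refine small_of_injective (β := Σ p : ∀ k, car (colimHom X.diag) (S.obj k),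
    ∀ (k l : K) (u : k ⟶ l), p l ⟶ (fn (colimHom X.diag) (S.map u)).obj (p k))
    (f := fun σ => ⟨σ.pt, fun k l u => (σ.cell u).hom⟩) fun σ τ h => ?_
  obtain ⟨p, c, _, _, _⟩ := σ
  obtain ⟨p', c', _, _, _⟩ := τ
  injection h with h₁ h₂
  dsimp only at h₁
  subst h₁
  have h₂ := eq_of_heq h₂
  exact PsFam.ext' (fun _ => rfl) (fun {k l} u => .of_eq (congrFun (congrFun (congrFun h₂ k) l) u))

lemma small_psFam_hom {K : Type u} [Bicategory.{u, u} K] (S : StrictPseudofunctor K C)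
    (X : ProOf.{w, u} C) (σ τ : PsFam S (colimHom X.diag)) : Small.{u} (σ ⟶ τ) := by
  have (A : C) (x y : car (colimHom X.diag) A) := small_car_hom hC X A x y
  exact small_of_injective (β := ∀ k, σ.pt k ⟶ τ.pt k) (f := fun f k => PsFam.Hom.app f k)
    fun f g h => PsFam.hom_ext (congrFun h)

lemma twoLocallySmall_proOf : TwoLocallySmall.{_, _, _, u} (ProOf.{w, u} C) where
  small_hom X Y := by
    have := small_psFam hC Y.diag X
    exact small_of_injective (β := PsFam Y.diag (colimHom X.diag))
      (f := (evalUniv Y.diag (colimHom X.diag)).obj) isIsoCat_evalUniv.obj.1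
  small_hom₂ {X Y} f g := by
    have := small_psFam_hom hC Y.diag X ((evalUniv Y.diag (colimHom X.diag)).obj f)
      ((evalUniv Y.diag (colimHom X.diag)).obj g)
    exact small_of_injective (f := ((evalUniv Y.diag (colimHom X.diag)).map :
      (f ⟶ g) → _)) (isIsoCat_evalUniv.map f g).1

end Small

section Canonical

variable {C : Type (max w (u + 1))} [Bicategory.{max w (u + 1), max w (u + 1)} C] [Strict C]

lemma isPseudolimit_canonCone (X : ProOf.{w, u} C) : (canonCone X).IsPseudolimit := by
  rw [isPseudolimit_iff]
  intro B
  refine isIsoCat_evalCone_of (canonCone X) (homFrom B) (yo B) (isIsoCat_yo B)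
    (evalUniv X.diag (ProObj.L B)) isIsoCat_evalUniv (fun g k => ?_) (fun g {k k'} a => ?_)
    (fun {g g'} s k => ?_)
  · exact (yo_comp g _).trans (congrArg (tf (M := ProObj.L X) (N := ProObj.L B) g _).obj
      (coneFam_leg (yo X) (coneFam_canonCone X) k))
  · refine (EqMod.of_eq (yo_whiskerLeft g _)).trans
      (((coneFam_cell (yo X) (coneFam_canonCone X) a).map
        (tf (M := ProObj.L X) (N := ProObj.L B) g _)).trans ?_)
    exact (PsFam.map_cell_hom (M := ProObj.L X) (N := ProObj.L B) g (univ X.diag) a).symm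
  · exact (EqMod.of_eq (yo_whiskerRight s _)).trans
      (EqMod.app (mf (M := ProObj.L X) (N := ProObj.L B) s _)
        (coneFam_leg (yo X) (coneFam_canonCone X) k))

lemma isCanonical_canonCone (X : ProOf.{w, u} C) : IsCanonical (cPro C) X.diag (canonCone X) :=
  isCanonical_of (coneFam_canonCone X) X.cofiltered (generates_univ _ X.cofiltered)
    (isPseudolimit_canonCone X) (isIsoCat_yo X)

end Canonical

section Shrink

lemma EqMod.of_map {A : Type w} [Category.{v} A] {B : Type w'} [Category.{v'} B] {F : A ⥤ B}
    (hF : IsIsoCat F) {a b a' b' : A} {f : a ⟶ b} {g : a' ⟶ b'} (h : F.map f ≐ F.map g) :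
    f ≐ g := by
  obtain ⟨p, q, e⟩ := h
  obtain rfl := hF.obj.1 p
  obtain rfl := hF.obj.1 q
  exact .of_eq ((hF.map _ _).1 (by simpa using e))

/-- A category with small sets of objects and of arrows, made small. -/
structure ShrinkCat (A : Type w) [Category.{v} A] [Small.{u} A] : Type u where
  /-- The underlying element. -/
  code : Shrink.{u} A

namespace ShrinkCat

variable (A : Type w) [Category.{v} A] [Small.{u} A] [∀ a b : A, Small.{u} (a ⟶ b)]

variable {A} in
/-- The underlying object. -/
noncomputable def val (x : ShrinkCat.{v, w, u} A) : A := (equivShrink A).symm x.code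

noncomputable instance : Category.{u} (ShrinkCat.{v, w, u} A) where
  Hom x y := Shrink.{u} (x.val ⟶ y.val)
  id x := equivShrink _ (𝟙 x.val)
  comp f g := equivShrink _ ((equivShrink _).symm f ≫ (equivShrink _).symm g)

/-- The isomorphism to the original category. -/
noncomputable def toCat : ShrinkCat.{v, w, u} A ⥤ A where
  obj := val
  map f := (equivShrink _).symm f
  map_id _ := (equivShrink _).symm_apply_apply _
  map_comp _ _ := (equivShrink _).symm_apply_apply _

lemma isIsoCat_toCat : IsIsoCat (toCat.{v, w, u} A) :=
  ⟨⟨fun ⟨x⟩ ⟨y⟩ h => congrArg mk ((equivShrink A).symm.injective h), fun a =>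
    ⟨⟨equivShrink A a⟩, (equivShrink A).symm_apply_apply a⟩⟩, fun _ _ =>
    (equivShrink _).symm.bijective⟩

lemma exists_inverse : ∃ G : A ⥤ ShrinkCat.{v, w, u} A, G ⋙ toCat A = 𝟭 A :=
  let ⟨G, _, h⟩ := (isIsoCat_iff _).1 (isIsoCat_toCat A)
  ⟨G, h⟩

/-- The inverse of the isomorphism to the original category. -/
noncomputable def ofCat : A ⥤ ShrinkCat.{v, w, u} A := (exists_inverse A).choose

variable {A}

lemma toCat_ofCat_obj (a : A) : (toCat A).obj ((ofCat.{v, w, u} A).obj a) = a :=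
  Functor.congr_obj (exists_inverse A).choose_spec a

lemma toCat_ofCat_map {a b : A} (f : a ⟶ b) : (toCat A).map ((ofCat.{v, w, u} A).map f) ≐ f :=
  EqMod.map_congr (exists_inverse A).choose_spec (.refl f)

end ShrinkCat

/-- A 2-category which is locally small and has a small set of objects, made small. -/
structure ShrinkTwo (T : Type u) [Bicategory.{t, v} T] : Type u where
  /-- The underlying object. -/
  val : T

namespace ShrinkTwo

variable {T : Type u} [Bicategory.{t, v} T] [Strict T] [∀ x y : T, Small.{u} (x ⟶ y)]
  [∀ (x y : T) (f g : x ⟶ y), Small.{u} (f ⟶ g)]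

open ShrinkCat

noncomputable instance : CategoryStruct.{u} (ShrinkTwo.{t, v, u} T) where
  Hom x y := ShrinkCat.{t, v, u} (x.val ⟶ y.val)
  id x := (ofCat _).obj (𝟙 x.val)
  comp f g := (ofCat _).obj (f.val ≫ g.val)

noncomputable instance (x y : ShrinkTwo.{t, v, u} T) : Category.{u} (x ⟶ y) :=
  inferInstanceAs (Category.{u} (ShrinkCat.{t, v, u} (x.val ⟶ y.val)))

variable {x y z a b : ShrinkTwo.{t, v, u} T}

/-- The underlying arrow. -/
noncomputable def arr (f : x ⟶ y) : x.val ⟶ y.val := ShrinkCat.val f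

/-- The underlying 2-cell. -/
noncomputable def cell {f g : x ⟶ y} (η : f ⟶ g) : arr f ⟶ arr g := (toCat (x.val ⟶ y.val)).map η

lemma arr_bijective : Function.Bijective (arr : (x ⟶ y) → (x.val ⟶ y.val)) :=
  (isIsoCat_toCat (x.val ⟶ y.val)).obj

lemma cell_bijective (f g : x ⟶ y) : Function.Bijective (cell : (f ⟶ g) → (arr f ⟶ arr g)) :=
  (isIsoCat_toCat (x.val ⟶ y.val)).map f g

lemma arr_id (x : ShrinkTwo.{t, v, u} T) : arr (𝟙 x) = 𝟙 x.val := toCat_ofCat_obj _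

lemma arr_comp (f : x ⟶ y) (g : y ⟶ z) : arr (f ≫ g) = arr f ≫ arr g := toCat_ofCat_obj _

lemma cell_id (f : x ⟶ y) : cell (𝟙 f) = 𝟙 (arr f) :=
  (toCat (x.val ⟶ y.val)).map_id f

lemma cell_comp {f g h : x ⟶ y} (η : f ⟶ g) (θ : g ⟶ h) : cell (η ≫ θ) = cell η ≫ cell θ :=
  (toCat (x.val ⟶ y.val)).map_comp η θ

lemma eq_of_cell {f g : x ⟶ y} {η θ : f ⟶ g} (h : cell η ≐ cell θ) : η = θ :=
  (EqMod.of_map (isIsoCat_toCat (x.val ⟶ y.val)) h).eq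

lemma comp_id' (f : x ⟶ y) : f ≫ 𝟙 y = f := arr_bijective.1 (by
  rw [arr_comp, arr_id, Strict.comp_id])

lemma id_comp' (f : x ⟶ y) : 𝟙 x ≫ f = f := arr_bijective.1 (by
  rw [arr_comp, arr_id, Strict.id_comp])

lemma assoc' (f : x ⟶ y) (g : y ⟶ z) (h : z ⟶ a) : (f ≫ g) ≫ h = f ≫ g ≫ h :=
  arr_bijective.1 (by rw [arr_comp, arr_comp, arr_comp, arr_comp, Strict.assoc])

/-- Whiskering on the left. -/
noncomputable def wl (f : x ⟶ y) {g h : y ⟶ z} (η : g ⟶ h) : f ≫ g ⟶ f ≫ h :=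
  (ofCat (x.val ⟶ z.val)).map (arr f ◁ cell η)

/-- Whiskering on the right. -/
noncomputable def wr {f g : x ⟶ y} (η : f ⟶ g) (h : y ⟶ z) : f ≫ h ⟶ g ≫ h :=
  (ofCat (x.val ⟶ z.val)).map (cell η ▷ arr h)

lemma cell_wl (f : x ⟶ y) {g h : y ⟶ z} (η : g ⟶ h) : cell (wl f η) ≐ arr f ◁ cell η :=
  toCat_ofCat_map _

lemma cell_wr {f g : x ⟶ y} (η : f ⟶ g) (h : y ⟶ z) : cell (wr η h) ≐ cell η ▷ arr h :=
  toCat_ofCat_map _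

lemma eqMod_of_cell {f g f' g' : x ⟶ y} {η : f ⟶ g} {θ : f' ⟶ g'} (h : cell η ≐ cell θ) : η ≐ θ :=
  EqMod.of_map (isIsoCat_toCat (x.val ⟶ y.val)) h

lemma wl_id (f : x ⟶ y) (g : y ⟶ z) : wl f (𝟙 g) = 𝟙 (f ≫ g) :=
  (congrArg (ofCat _).map ((congrArg _ (cell_id g)).trans (Bicategory.whiskerLeft_id _ _))).trans
    ((ofCat _).map_id _)

lemma id_wr (f : x ⟶ y) (g : y ⟶ z) : wr (𝟙 f) g = 𝟙 (f ≫ g) :=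
  (congrArg (ofCat _).map ((congrArg (· ▷ _) (cell_id f)).trans
    (Bicategory.id_whiskerRight _ _))).trans ((ofCat _).map_id _)

lemma wl_eqToHom (f : x ⟶ y) {g h : y ⟶ z} (e : g = h) :
    wl f (eqToHom e) = eqToHom (congrArg (f ≫ ·) e) := by
  subst e
  exact wl_id f g

lemma eqToHom_wr {f g : x ⟶ y} (e : f = g) (h : y ⟶ z) :
    wr (eqToHom e) h = eqToHom (congrArg (· ≫ h) e) := by
  subst e
  exact id_wr f h

noncomputable instance : Bicategory.{u, u} (ShrinkTwo.{t, v, u} T) where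
  homCategory x y := inferInstance
  whiskerLeft f _ _ η := wl f η
  whiskerRight η h := wr η h
  associator f g h := eqToIso (assoc' f g h)
  leftUnitor f := eqToIso (id_comp' f)
  rightUnitor f := eqToIso (comp_id' f)
  whiskerLeft_id f g := wl_id f g
  whiskerLeft_comp f _ _ _ η θ := (congrArg (ofCat _).map ((congrArg _ (cell_comp η θ)).trans
    (Bicategory.whiskerLeft_comp _ _ _))).trans ((ofCat _).map_comp _ _)
  id_whiskerLeft {a b f g} η := (eqMod_of_cell ((cell_wl _ η).trans
    ((EqMod.whiskerLeft (arr_id a) (.refl _)).trans (EqMod.id_whiskerLeft _)))).conj (id_comp' f) (id_comp' g).symm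
  comp_whiskerLeft {a b c d} f g {h h'} η := (eqMod_of_cell ((cell_wl _ η).trans
    ((EqMod.whiskerLeft (arr_comp f g) (.refl _)).trans ((EqMod.comp_whiskerLeft _ _ _).trans
      (.symm ((cell_wl f _).trans (EqMod.whiskerLeft rfl (cell_wl g η)))))))).conj (assoc' f g h) (assoc' f g h').symm
  id_whiskerRight f g := id_wr f g
  comp_whiskerRight {a b c f g h} η θ i := (congrArg (ofCat _).map ((congrArg (· ▷ _)
    (cell_comp η θ)).trans (Bicategory.comp_whiskerRight _ _ _))).trans ((ofCat _).map_comp _ _)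
  whiskerRight_id {a b f g} η := (eqMod_of_cell ((cell_wr η _).trans
    ((EqMod.whiskerRight (.refl _) (arr_id b)).trans (EqMod.whiskerRight_id _)))).conj (comp_id' f) (comp_id' g).symm
  whiskerRight_comp {a b c d f f'} η g h := (eqMod_of_cell ((cell_wr η _).trans
    ((EqMod.whiskerRight (.refl _) (arr_comp g h)).trans ((EqMod.whiskerRight_comp _ _ _).trans
      (.symm ((cell_wr _ h).trans (EqMod.whiskerRight (cell_wr η g) rfl))))))).conj (assoc' f g h).symm (assoc' f' g h)
  whisker_assoc {a b c d} f g g' η h := (eqMod_of_cell ((cell_wr _ h).trans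
    (.trans (EqMod.whiskerRight (cell_wl f η) rfl) ((EqMod.whisker_assoc _ _ _).trans
      (.symm ((cell_wl f _).trans (EqMod.whiskerLeft rfl (cell_wr η h)))))))).conj (assoc' f g h) (assoc' f g' h).symm
  whisker_exchange {a b c f g h i} η θ := ((ofCat _).map_comp _ _).symm.trans
    ((congrArg (ofCat _).map (Bicategory.whisker_exchange (cell η) (cell θ))).trans
      ((ofCat _).map_comp _ _))
  pentagon f g h i := by simp [wl_eqToHom, eqToHom_wr]
  triangle f g := by simp [wl_eqToHom, eqToHom_wr]

instance : Strict (ShrinkTwo.{t, v, u} T) where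
  id_comp := id_comp'
  comp_id := comp_id'
  assoc := assoc'
  leftUnitor_eqToIso _ := rfl
  rightUnitor_eqToIso _ := rfl
  associator_eqToIso _ _ _ := rfl

variable (T) in
/-- The isomorphism to the original 2-category. -/
noncomputable def toTwo : StrictPseudofunctor (ShrinkTwo.{t, v, u} T) T :=
  StrictPseudofunctor.mk'' {
    obj x := x.val
    map f := arr f
    map₂ η := cell η
    map_id := arr_id
    map_comp := arr_comp
    map₂_id := cell_id
    map₂_comp := cell_comp
    map₂_whisker_left f g h η := (cell_wl f η).conj (arr_comp f g) (arr_comp f h).symm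
    map₂_whisker_right {a b c f g} η h := (cell_wr η h).conj (arr_comp f h) (arr_comp g h).symm }

end ShrinkTwo

end Shrink

section

section MkFam

universe v₁ u₁

variable {C : Type w} [Bicategory.{t, v} C] {K : Type w'} [Bicategory.{t', v'} K]
  {X : StrictPseudofunctor K C} {M : StrictPseudofunctor C Cat.{v₁, u₁}}

namespace PsFam

lemma cell_id_eqMod (σ : PsFam X M) (k : K) : (σ.cell (𝟙 k)).hom ≐ 𝟙 (σ.pt k) :=
  (EqMod.of_eq (σ.cell_id k)).trans (.eqToHom_id _)

lemma cell_comp_eqMod (σ : PsFam X M) {k l m : K} (u : k ⟶ l) (v : l ⟶ m) :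
    (σ.cell (u ≫ v)).hom ≐ (σ.cell v).hom ≫ (fn M (X.map v)).map (σ.cell u).hom :=
  (EqMod.of_eq (σ.cell_comp u v)).trans (.comp (.refl _) (.comp_eqToHom _
    ((fn_comp_obj M (X.map u) (X.map v) _).symm.trans
      (congrArg (fun f => (fn M f).obj (σ.pt k)) (X.map_comp u v).symm))))

lemma cell_of_eq (σ : PsFam X M) {k l : K} {u v : k ⟶ l} (h : u = v) :
    (σ.cell u).hom ≐ (σ.cell v).hom := by
  subst h
  exact .refl _

/-- A pseudo-family from its data, with axioms up to equality of objects. -/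
def ofEqMod (pt : ∀ k, car M (X.obj k))
    (cell : ∀ {k l : K} (u : k ⟶ l), pt l ≅ (fn M (X.map u)).obj (pt k))
    (cell_id : ∀ k, (cell (𝟙 k)).hom ≐ 𝟙 (pt k))
    (cell_comp : ∀ {k l m : K} (u : k ⟶ l) (v : l ⟶ m),
      (cell (u ≫ v)).hom ≐ (cell v).hom ≫ (fn M (X.map v)).map (cell u).hom)
    (cell_nat : ∀ {k l : K} {u v : k ⟶ l} (α : u ⟶ v),
      (cell v).hom = (cell u).hom ≫ (nt M (X.map₂ α)).app (pt k)) : PsFam X M where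
  pt := pt
  cell := cell
  cell_id k := ((cell_id k).trans (EqMod.symm (.eqToHom_id _))).eq
  cell_comp u v := ((cell_comp u v).trans (EqMod.comp (.refl _) (EqMod.symm (.comp_eqToHom _
    ((fn_comp_obj M (X.map u) (X.map v) _).symm.trans
      (congrArg (fun f => (fn M f).obj (pt _)) (X.map_comp u v).symm)))))).eq
  cell_nat := cell_nat

end PsFam

end MkFam

section Reindex

universe v₁ u₁

variable {T : Type u} [Bicategory.{t, v} T] [Strict T] [∀ x y : T, Small.{u} (x ⟶ y)]
  [∀ (x y : T) (f g : x ⟶ y), Small.{u} (f ⟶ g)]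
  {C : Type w} [Bicategory.{t', v'} C] (X : StrictPseudofunctor T C)
  (M : StrictPseudofunctor C Cat.{v₁, u₁})

open ShrinkTwo

lemma TwoCofiltered.shrink (h : TwoCofiltered T) : TwoCofiltered (ShrinkTwo.{t, v, u} T) where
  f0 a b := by
    obtain ⟨c, ⟨p⟩, ⟨q⟩⟩ := h.f0 a.val b.val
    exact ⟨⟨c⟩, ⟨(arr_bijective.2 p).choose⟩, ⟨(arr_bijective.2 q).choose⟩⟩
  f1 {a b} f g := by
    obtain ⟨c, p, ⟨i⟩⟩ := h.f1 (arr f) (arr g)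
    obtain ⟨p, rfl⟩ := arr_bijective (x := ⟨c⟩) (y := a).2 p
    let j : arr (p ≫ f) ≅ arr (p ≫ g) := eqToIso (arr_comp p f) ≪≫ i ≪≫ eqToIso (arr_comp p g).symm
    obtain ⟨s, hs⟩ := (cell_bijective (p ≫ f) (p ≫ g)).2 j.hom
    obtain ⟨r, hr⟩ := (cell_bijective (p ≫ g) (p ≫ f)).2 j.inv
    exact ⟨⟨c⟩, p, ⟨⟨s, r, (cell_bijective _ _).1 (by rw [cell_comp, cell_id, hs, hr, j.hom_inv_id]),
      (cell_bijective _ _).1 (by rw [cell_comp, cell_id, hs, hr, j.inv_hom_id])⟩⟩⟩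
  f2 {a b f g} α β := by
    obtain ⟨c, p, e⟩ := h.f2 (cell α) (cell β)
    obtain ⟨p, rfl⟩ := arr_bijective (x := ⟨c⟩) (y := a).2 p
    exact ⟨⟨c⟩, p, eq_of_cell ((cell_wl p α).trans ((EqMod.of_eq e).trans (cell_wl p β).symm))⟩

/-- Reindexing of pseudo-families along the isomorphism from the small 2-category. -/
noncomputable def PsFam.shrink : PsFam X M ⥤ PsFam ((toTwo T).comp X) M where
  obj σ :=
    { pt k := σ.pt k.val
      cell u := σ.cell (arr u)
      cell_id k := ((PsFam.cell_of_eq σ (arr_id k)).trans ((EqMod.of_eq (σ.cell_id k.val)).trans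
        (.eqToHom_eqToHom _ _ rfl))).eq
      cell_comp {k l m} u v := EqMod.eq ((PsFam.cell_of_eq σ (arr_comp u v)).trans
        ((EqMod.of_eq (σ.cell_comp (arr u) (arr v))).trans
          (.comp (.refl _) (.trans (.comp_eqToHom _ (by rw [X.map_comp, fn_comp_obj]))
            (.symm (.comp_eqToHom _ ((fn_comp_obj M (X.map (arr u)) (X.map (arr v))
              (σ.pt k.val)).symm.trans (congrArg (fun f => (fn M f).obj (σ.pt k.val))
                (((toTwo T).comp X).map_comp u v).symm))))))))
      cell_nat α := σ.cell_nat (ShrinkTwo.cell α) }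
  map s :=
    { app k := PsFam.Hom.app s k.val
      w u := PsFam.Hom.w s (arr u) }
  map_id _ := rfl
  map_comp _ _ := rfl

lemma PsFam.isIsoCat_shrink : IsIsoCat (PsFam.shrink X M) := by
  refine isIsoCat_of _ (fun σ τ e => ?_) (fun τ => ?_) (fun f g e => ?_) (fun {x y} s => ?_)
  · refine ext' (fun k => congrArg (fun s : PsFam ((toTwo T).comp X) M => s.pt ⟨k⟩) e)
      (fun {k l} u => ?_)
    obtain ⟨u, rfl⟩ := arr_bijective (x := ⟨k⟩) (y := ⟨l⟩).2 u
    exact cell_congr (X := (toTwo T).comp X) e u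
  · choose a ha using fun {k l : T} (u : k ⟶ l) => arr_bijective (x := ⟨k⟩) (y := ⟨l⟩).2 u
    have hτ {k l : ShrinkTwo.{t, v, u} T} {u v : k ⟶ l} (h : u = v) :
        (τ.cell u).hom ≐ (τ.cell v).hom := by
      subst h
      exact .refl _
    have hc {k l : T} (u : k ⟶ l) : (fn M (((toTwo T).comp X).map (a u))).obj (τ.pt ⟨k⟩) =
        (fn M (X.map u)).obj (τ.pt ⟨k⟩) :=
      congrArg (fun u => (fn M (X.map u)).obj (τ.pt ⟨k⟩)) (ha u)
    have hc' {k l : T} (u : k ⟶ l) : (τ.cell (a u)).hom ≫ eqToHom (hc u) ≐ (τ.cell (a u)).hom :=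
      .comp_eqToHom _ (hc u)
    refine ⟨⟨fun k => τ.pt ⟨k⟩, fun {k l} u => τ.cell (a u) ≪≫ eqToIso (hc u), fun k => ?_,
      fun {k l m} u v => ?_, fun {k l u v} α => ?_⟩, ?_⟩
    · refine EqMod.eq ((hc' _).trans ((hτ (v := 𝟙 (⟨k⟩ : ShrinkTwo.{t, v, u} T))
        (arr_bijective.1 ((ha _).trans (arr_id ⟨k⟩).symm))).trans
        ((EqMod.of_eq (τ.cell_id ⟨k⟩)).trans (.eqToHom_eqToHom _ _ rfl))))
    · refine EqMod.eq ((hc' _).trans ((hτ (v := a u ≫ a v)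
        (arr_bijective.1 ((ha _).trans ((arr_comp (a u) (a v)).trans
          (congrArg₂ _ (ha u) (ha v))).symm))).trans
        ((EqMod.of_eq (τ.cell_comp (a u) (a v))).trans ?_)))
      refine EqMod.comp (hc' v).symm (.trans (.comp_eqToHom _ ((fn_comp_obj M _ _ _).symm.trans
        (congrArg (fun f => (fn M f).obj (τ.pt ⟨k⟩)) (((toTwo T).comp X).map_comp _ _).symm)))
        (.trans ?_ (.symm (.comp_eqToHom _
          ((fn_comp_obj M (X.map u) (X.map v) (τ.pt ⟨k⟩)).symm.trans
            (congrArg (fun f => (fn M f).obj (τ.pt ⟨k⟩)) (X.map_comp u v).symm))))))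
      exact .fn_congr M (congrArg X.map (ha v)) (hc' u).symm
    · obtain ⟨β, hβ⟩ := (cell_bijective (a u) (a v)).2 (eqToHom (ha u) ≫ α ≫ eqToHom (ha v).symm)
      refine EqMod.eq ((hc' _).trans ((EqMod.of_eq (τ.cell_nat β)).trans
        (.comp (hc' u).symm (.nt_congr M (EqMod.map₂ X (.trans (.of_eq hβ) (.of_conj rfl))) rfl))))
    · refine ext' (fun k => rfl) (fun {k l} u => (hc' _).trans (hτ (arr_bijective.1 (ha _))))
  · exact hom_ext fun k => e ⟨k⟩
  · refine ⟨⟨fun k => PsFam.Hom.app s ⟨k⟩, fun {k l} u => ?_⟩, fun _ => rfl⟩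
    obtain ⟨u, rfl⟩ := arr_bijective (x := ⟨k⟩) (y := ⟨l⟩).2 u
    exact PsFam.Hom.w s u

end Reindex

end

section

universe t₁ v₁ w₁

section Presentation

variable {C : Type w} [Bicategory.{t, v} C] [Strict C] {P : Type w''} [Bicategory.{t'', v''} P]
  [Strict P]

/-- A canonical pseudocone with vertex `X`. -/
structure Presentation (c : StrictPseudofunctor C P) (X : P) where
  /-- The index 2-category. -/
  K : Type u
  [bicategory : Bicategory.{u, u} K]
  [strict : Strict K]
  /-- The diagram. -/
  D : StrictPseudofunctor K C
  /-- The pseudocone. -/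
  π : PseudoCone (D.comp c) X
  canonical : IsCanonical c D π

attribute [instance] Presentation.bicategory Presentation.strict

end Presentation

section Paste

variable {P : Type w} [Bicategory.{t, v} P] {X Y Z A B D E : P}

lemma paste_whiskerLeft {p : X ⟶ A} {f : A ⟶ B} {a : X ⟶ Y} {q : Y ⟶ B} (θ : p ≫ f ⟶ a ≫ q)
    {g g' : B ⟶ D} {b b' : Y ⟶ Z} {r : Z ⟶ D} {ζ : q ≫ g ⟶ b ≫ r} {ζ' : q ≫ g' ⟶ b' ≫ r}
    {β : b ⟶ b'} {δ : g ⟶ g'} (h : ζ ≫ β ▷ r = q ◁ δ ≫ ζ') :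
    (θ ▷ g ≫ (α_ _ _ _).hom ≫ a ◁ ζ) ≫ a ◁ β ▷ r =
      (p ≫ f) ◁ δ ≫ θ ▷ g' ≫ (α_ _ _ _).hom ≫ a ◁ ζ' := by
  rw [whisker_exchange_assoc, Category.assoc, Category.assoc, ← whiskerLeft_comp, h]
  simp

lemma paste_whiskerRight {p : X ⟶ A} {f f' : A ⟶ B} {a a' : X ⟶ Y} {q : Y ⟶ B}
    {θ : p ≫ f ⟶ a ≫ q} {θ' : p ≫ f' ⟶ a' ≫ q} {α : a ⟶ a'} {γ : f ⟶ f'}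
    {g : B ⟶ D} {b : Y ⟶ Z} {r : Z ⟶ D} (ζ : q ≫ g ⟶ b ≫ r) (h : θ ≫ α ▷ q = p ◁ γ ≫ θ') :
    (θ ▷ g ≫ (α_ _ _ _).hom ≫ a ◁ ζ) ≫ α ▷ (b ≫ r) =
      (p ◁ γ) ▷ g ≫ θ' ▷ g ≫ (α_ _ _ _).hom ≫ a' ◁ ζ := by
  rw [← comp_whiskerRight_assoc, ← h, Category.assoc, Category.assoc, whisker_exchange]
  simp

lemma paste_assoc {p : X ⟶ A} {f : A ⟶ B} {a : X ⟶ Y} {q : Y ⟶ B} (θ : p ≫ f ⟶ a ≫ q)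
    {g : B ⟶ D} {b : Y ⟶ Z} {r : Z ⟶ D} (ζ : q ≫ g ⟶ b ≫ r) {W : P} {h : D ⟶ E} {d : Z ⟶ W}
    {s : W ⟶ E} (κ : r ≫ h ⟶ d ≫ s) :
    (θ ▷ g ≫ (α_ _ _ _).hom ≫ a ◁ ζ) ▷ h ≫
      ((α_ _ _ _).hom ≫ a ◁ (α_ _ _ _).hom) ≫ a ◁ b ◁ κ =
    (α_ _ _ _).hom ≫ θ ▷ (g ≫ h) ≫ ((α_ _ _ _).hom ≫ a ◁ (α_ _ _ _).inv) ≫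
      a ◁ (ζ ▷ h ≫ (α_ _ _ _).hom ≫ b ◁ κ) := by
  simp

end Paste

namespace EqMod

section

variable {A : Type w} [Category.{v} A] {a b c d : A}

lemma left_unit {f : a ⟶ b} {g : b ⟶ c} (h : f ≐ 𝟙 d) : f ≫ g ≐ g := by
  obtain ⟨p, q, rfl⟩ := h
  subst p q
  exact .of_eq (by simp)

lemma right_unit {f : a ⟶ b} {g : b ⟶ c} (h : g ≐ 𝟙 d) : f ≫ g ≐ f := by
  obtain ⟨p, q, rfl⟩ := h
  subst p q
  exact .of_eq (by simp)

end

section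

variable {P : Type w} [Bicategory.{t, v} P] [Strict P] {X Y Z A : P}

lemma associator (f : X ⟶ Y) (g : Y ⟶ Z) (h : Z ⟶ A) : (α_ f g h).hom ≐ 𝟙 (f ≫ g ≫ h) := by
  rw [Strict.associator_eqToIso]
  exact (eqToHom_id (Strict.assoc f g h)).trans (id_eq (Strict.assoc _ _ _))

lemma associator_inv (f : X ⟶ Y) (g : Y ⟶ Z) (h : Z ⟶ A) : (α_ f g h).inv ≐ 𝟙 (f ≫ g ≫ h) :=
  EqMod.inv (e := α_ f g h) (e' := Iso.refl _) (associator f g h)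

lemma whiskerLeft_unit (f : X ⟶ Y) {g h k : Y ⟶ Z} {s : g ⟶ h} (e : s ≐ 𝟙 k) :
    f ◁ s ≐ 𝟙 (f ≫ k) :=
  (EqMod.whiskerLeft rfl e).trans (.of_eq (whiskerLeft_id _ _))

lemma unit_whiskerRight {g h k : X ⟶ Y} {s : g ⟶ h} (e : s ≐ 𝟙 k) (f : Y ⟶ Z) :
    s ▷ f ≐ 𝟙 (k ≫ f) :=
  (EqMod.whiskerRight e rfl).trans (.of_eq (id_whiskerRight _ _))

end

end EqMod

section Tot

variable {C : Type w} [Bicategory.{t, v} C] [Strict C] {P : Type w''} [Bicategory.{t'', v''} P]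
  [Strict P] {J : Type w₁} [Bicategory.{t₁, v₁} J] [Strict J]
  {c : StrictPseudofunctor C P} {S : StrictPseudofunctor J P}

/-- The objects of the index 2-category of the pseudolimit of the presented objects `S j`. -/
structure Tot (pr : ∀ j, Presentation.{t, v, w, t'', v'', w'', u} c (S.obj j)) where
  /-- The index in `J`. -/
  base : J
  /-- The index in the presentation of `S base`. -/
  idx : (pr base).K

namespace Tot

variable {pr : ∀ j, Presentation.{t, v, w, t'', v'', w'', u} c (S.obj j)}

/-- The object of `C` at an index. -/
def ob (x : Tot pr) : C := (pr x.base).D.obj x.idx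

/-- The leg at an index. -/
def leg (x : Tot pr) : S.obj x.base ⟶ c.obj x.ob := (pr x.base).π.leg x.idx

/-- Arrows of `Tot pr`. -/
structure Hom (x y : Tot pr) where
  /-- The arrow of `J`. -/
  base : x.base ⟶ y.base
  /-- The arrow of `C`. -/
  ob : x.ob ⟶ y.ob
  /-- The 2-cell of `P`. -/
  iso : x.leg ≫ c.map ob ≅ S.map base ≫ y.leg

lemma Hom.ext' {x y : Tot pr} {f g : Hom x y} (h : f.base = g.base) (h' : f.ob = g.ob)
    (h'' : f.iso.hom ≐ g.iso.hom) : f = g := by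
  obtain ⟨a, f, i⟩ := f
  obtain ⟨a', f', i'⟩ := g
  dsimp only at h h'
  subst h h'
  obtain rfl : i = i' := Iso.ext h''.eq
  rfl

/-- 2-cells of `Tot pr`. -/
@[ext]
structure Hom₂ {x y : Tot pr} (f g : Hom x y) where
  /-- The 2-cell of `J`. -/
  base : f.base ⟶ g.base
  /-- The 2-cell of `C`. -/
  ob : f.ob ⟶ g.ob
  w : f.iso.hom ≫ S.map₂ base ▷ y.leg = x.leg ◁ c.map₂ ob ≫ g.iso.hom

lemma id_eq (x : Tot pr) : x.leg ≫ c.map (𝟙 x.ob) = S.map (𝟙 x.base) ≫ x.leg := by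
  rw [c.map_id, S.map_id, Strict.comp_id, Strict.id_comp]

lemma comp_eq₁ {x y z : Tot pr} (f : Hom x y) (g : Hom y z) :
    x.leg ≫ c.map (f.ob ≫ g.ob) = (x.leg ≫ c.map f.ob) ≫ c.map g.ob := by
  rw [c.map_comp, Strict.assoc]

lemma comp_eq₂ {x y z : Tot pr} (f : Hom x y) (g : Hom y z) :
    S.map f.base ≫ S.map g.base ≫ z.leg = S.map (f.base ≫ g.base) ≫ z.leg := by
  rw [S.map_comp, Strict.assoc]

/-- The pasting of two 2-cells. -/
def paste {x y z : Tot pr} (f : Hom x y) (g : Hom y z) :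
    (x.leg ≫ c.map f.ob) ≫ c.map g.ob ≅ S.map f.base ≫ S.map g.base ≫ z.leg :=
  whiskerRightIso f.iso (c.map g.ob) ≪≫ α_ _ _ _ ≪≫ whiskerLeftIso (S.map f.base) g.iso

instance : CategoryStruct (Tot pr) where
  Hom x y := Hom x y
  id x := ⟨𝟙 _, 𝟙 _, eqToIso (id_eq x)⟩
  comp f g := ⟨f.base ≫ g.base, f.ob ≫ g.ob,
    eqToIso (comp_eq₁ f g) ≪≫ paste f g ≪≫ eqToIso (comp_eq₂ f g)⟩

instance (x y : Tot pr) : Category (x ⟶ y) where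
  Hom f g := Hom₂ f g
  id f := ⟨𝟙 _, 𝟙 _, by simp⟩
  comp s s' := ⟨s.base ≫ s'.base, s.ob ≫ s'.ob, by
    rw [S.map₂_comp, c.map₂_comp, comp_whiskerRight, whiskerLeft_comp, ← Category.assoc, s.w,
      Category.assoc, s'.w, Category.assoc]⟩
  id_comp _ := Hom₂.ext (Category.id_comp _) (Category.id_comp _)
  comp_id _ := Hom₂.ext (Category.comp_id _) (Category.comp_id _)
  assoc _ _ _ := Hom₂.ext (Category.assoc _ _ _) (Category.assoc _ _ _)

variable {x y z a : Tot pr}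

@[simp] lemma base_comp (f : x ⟶ y) (g : y ⟶ z) : Hom.base (f ≫ g) = f.base ≫ g.base := rfl
@[simp] lemma ob_comp (f : x ⟶ y) (g : y ⟶ z) : Hom.ob (f ≫ g) = f.ob ≫ g.ob := rfl
@[simp] lemma base_comp₂ {f g h : x ⟶ y} (s : f ⟶ g) (s' : g ⟶ h) :
    Hom₂.base (s ≫ s') = s.base ≫ s'.base := rfl
@[simp] lemma ob_comp₂ {f g h : x ⟶ y} (s : f ⟶ g) (s' : g ⟶ h) :
    Hom₂.ob (s ≫ s') = s.ob ≫ s'.ob := rfl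

lemma cell_ext {f g : x ⟶ y} {s s' : f ⟶ g} (h : Hom₂.base s = Hom₂.base s')
    (h' : Hom₂.ob s = Hom₂.ob s') : s = s' := Hom₂.ext h h'

@[simp] lemma base_eqToHom {f g : x ⟶ y} (h : f = g) :
    Hom₂.base (eqToHom h) = eqToHom (congrArg Hom.base h) := by subst h; rfl

@[simp] lemma ob_eqToHom {f g : x ⟶ y} (h : f = g) :
    Hom₂.ob (eqToHom h) = eqToHom (congrArg Hom.ob h) := by subst h; rfl

lemma id_iso (x : Tot pr) : (Hom.iso (𝟙 x)).hom ≐ 𝟙 x.leg :=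
  (EqMod.eqToHom_id (id_eq x)).trans (.id_eq (by rw [c.map_id, Strict.comp_id]))

lemma comp_iso (f : x ⟶ y) (g : y ⟶ z) : (Hom.iso (f ≫ g)).hom ≐ (paste f g).hom :=
  (EqMod.eqToHom_comp (comp_eq₁ f g) _).trans (.comp_eqToHom _ (comp_eq₂ f g))

/-- Left whiskering. -/
def wl (f : x ⟶ y) {g h : y ⟶ z} (s : g ⟶ h) : f ≫ g ⟶ f ≫ h where
  base := f.base ◁ s.base
  ob := f.ob ◁ s.ob
  w := by
    refine EqMod.eq ((EqMod.comp (comp_iso f g) ?_).trans ((EqMod.of_eq (paste_whiskerLeft f.iso.hom s.w)).trans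
      (EqMod.comp ?_ (comp_iso f h).symm)))
    · exact (EqMod.whiskerRight (EqMod.map₂_whiskerLeft S _ _) rfl).trans (.whisker_assoc _ _ _)
    · exact (EqMod.comp_whiskerLeft _ _ _).trans
        (EqMod.whiskerLeft rfl (EqMod.map₂_whiskerLeft c _ _).symm)

/-- Right whiskering. -/
def wr {f g : x ⟶ y} (s : f ⟶ g) (h : y ⟶ z) : f ≫ h ⟶ g ≫ h where
  base := s.base ▷ h.base
  ob := s.ob ▷ h.ob
  w := by
    refine EqMod.eq ((EqMod.comp (comp_iso f h) ?_).trans ((EqMod.of_eq (paste_whiskerRight h.iso.hom s.w)).trans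
      (EqMod.comp ?_ (comp_iso g h).symm)))
    · exact (EqMod.whiskerRight (EqMod.map₂_whiskerRight S _ _) rfl).trans
        (EqMod.whiskerRight_comp _ _ _).symm
    · exact (EqMod.whisker_assoc _ _ _).trans
        (EqMod.whiskerLeft rfl (EqMod.map₂_whiskerRight c _ _).symm)

lemma id_comp' (f : x ⟶ y) : 𝟙 x ≫ f = f := by
  refine Hom.ext' (Strict.id_comp _) (Strict.id_comp _) ((comp_iso _ _).trans ?_)
  refine (EqMod.left_unit (EqMod.unit_whiskerRight (id_iso x) _)).trans
    ((EqMod.left_unit (EqMod.associator _ _ _)).trans ?_)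
  exact (EqMod.whiskerLeft (S.map_id _) (.refl _)).trans (EqMod.id_whiskerLeft _)

lemma comp_id' (f : x ⟶ y) : f ≫ 𝟙 y = f := by
  refine Hom.ext' (Strict.comp_id _) (Strict.comp_id _) ((comp_iso _ _).trans ?_)
  refine (EqMod.right_unit ((EqMod.left_unit (EqMod.associator _ _ _)).trans
    (EqMod.whiskerLeft_unit _ (id_iso y)))).trans ?_
  exact (EqMod.whiskerRight (.refl _) (c.map_id _)).trans (EqMod.whiskerRight_id _)

lemma assoc' (f : x ⟶ y) (g : y ⟶ z) (h : z ⟶ a) : (f ≫ g) ≫ h = f ≫ g ≫ h := by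
  refine Hom.ext' (Strict.assoc _ _ _) (Strict.assoc _ _ _) ((comp_iso _ _).trans
    (.trans ?_ (comp_iso _ _).symm))
  refine EqMod.trans ?_ (.trans (.of_eq (paste_assoc f.iso.hom g.iso.hom h.iso.hom)) ?_)
  · refine EqMod.comp (EqMod.whiskerRight (comp_iso f g) rfl) (EqMod.comp ?_ ?_)
    · refine (EqMod.associator _ _ _).trans (.trans (.id_eq ?_) (EqMod.symm
        ((EqMod.left_unit (EqMod.associator _ _ _)).trans
          (EqMod.whiskerLeft_unit _ (EqMod.associator _ _ _)))))
      rw [base_comp, S.map_comp, Strict.assoc]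
    · exact (EqMod.whiskerLeft (S.map_comp _ _) (.refl _)).trans (EqMod.comp_whiskerLeft _ _ _)
  · refine (EqMod.left_unit (EqMod.associator _ _ _)).trans (EqMod.comp
      (EqMod.whiskerRight (.refl _) (c.map_comp _ _).symm) (EqMod.comp ?_ ?_))
    · refine (EqMod.right_unit (EqMod.whiskerLeft_unit _ (EqMod.associator_inv _ _ _))).trans
        ((EqMod.associator _ _ _).trans (.trans (.id_eq ?_) (EqMod.associator _ _ _).symm))
      rw [ob_comp, c.map_comp]
    · exact EqMod.whiskerLeft rfl (comp_iso g h).symm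

lemma cell_conj {f g f' g' : x ⟶ y} {s : f ⟶ g} {s' : f' ⟶ g'}
    (hb : Hom₂.base s ≐ Hom₂.base s') (ho : Hom₂.ob s ≐ Hom₂.ob s') (p : f = f') (q : g' = g) :
    s = eqToHom p ≫ s' ≫ eqToHom q := by
  subst p q
  rw [eqToHom_refl, eqToHom_refl, Category.id_comp, Category.comp_id]
  exact cell_ext hb.eq ho.eq

instance : Bicategory (Tot pr) where
  homCategory x y := inferInstance
  whiskerLeft f _ _ s := wl f s
  whiskerRight s h := wr s h
  associator f g h := eqToIso (assoc' f g h)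
  leftUnitor f := eqToIso (id_comp' f)
  rightUnitor f := eqToIso (comp_id' f)
  whiskerLeft_id f g := cell_ext (whiskerLeft_id _ _) (whiskerLeft_id _ _)
  whiskerLeft_comp f _ _ _ s s' := cell_ext (whiskerLeft_comp _ _ _) (whiskerLeft_comp _ _ _)
  id_whiskerLeft s := cell_conj (.id_whiskerLeft _) (.id_whiskerLeft _) (id_comp' _) (id_comp' _).symm
  comp_whiskerLeft f g _ _ s := cell_conj (.comp_whiskerLeft _ _ _) (.comp_whiskerLeft _ _ _)
    (assoc' _ _ _) (assoc' _ _ _).symm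
  id_whiskerRight f g := cell_ext (id_whiskerRight _ _) (id_whiskerRight _ _)
  comp_whiskerRight s s' h := cell_ext (comp_whiskerRight _ _ _) (comp_whiskerRight _ _ _)
  whiskerRight_id s := cell_conj (.whiskerRight_id _) (.whiskerRight_id _) (comp_id' _) (comp_id' _).symm
  whiskerRight_comp s g h := cell_conj (.whiskerRight_comp _ _ _) (.whiskerRight_comp _ _ _)
    (assoc' _ _ _).symm (assoc' _ _ _)
  whisker_assoc f _ _ s h := cell_conj (.whisker_assoc _ _ _) (.whisker_assoc _ _ _)
    (assoc' _ _ _) (assoc' _ _ _).symm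
  whisker_exchange s s' := cell_ext (whisker_exchange _ _) (whisker_exchange _ _)
  pentagon f g h i := cell_ext (by simp [wl, wr]) (by simp [wl, wr])
  triangle f g := cell_ext (by simp [wl, wr]) (by simp [wl, wr])

instance : Strict (Tot pr) where
  id_comp := id_comp'
  comp_id := comp_id'
  assoc := assoc'
  leftUnitor_eqToIso _ := rfl
  rightUnitor_eqToIso _ := rfl
  associator_eqToIso _ _ _ := rfl

variable (pr) in
/-- The projection to `C`. -/
def proj : StrictPseudofunctor (Tot pr) C :=
  StrictPseudofunctor.mk'' {
    obj x := x.ob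
    map f := f.ob
    map₂ s := s.ob
    map_id _ := rfl
    map_comp _ _ := rfl
    map₂_id _ := rfl
    map₂_comp _ _ := rfl
    map₂_whisker_left _ _ _ s := EqMod.conj (.refl _) rfl rfl
    map₂_whisker_right s h := EqMod.conj (.refl _) rfl rfl }

end Tot

end Tot

end

section

universe t₁ v₁ w₁

section Weak

variable {K : Type w} [Bicategory.{t, v} K] [Strict K]

/-- In the second axiom it is enough to have 2-cells which are not necessarily invertible. -/
lemma TwoCofiltered.of_weak (f0 : ∀ a b : K, ∃ c : K, Nonempty (c ⟶ a) ∧ Nonempty (c ⟶ b))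
    (f1 : ∀ {a b : K} (f g : a ⟶ b), ∃ (c : K) (h : c ⟶ a), Nonempty (h ≫ f ⟶ h ≫ g))
    (f2 : ∀ {a b : K} {f g : a ⟶ b} (α β : f ⟶ g), ∃ (c : K) (h : c ⟶ a), h ◁ α = h ◁ β) :
    TwoCofiltered K where
  f0 := f0
  f2 := f2
  f1 {a b} f g := by
    obtain ⟨c, x, ⟨γ⟩⟩ := f1 f g
    obtain ⟨c', y, ⟨δ⟩⟩ := f1 g f
    obtain ⟨d, ⟨p⟩, ⟨q⟩⟩ := f0 c c'
    obtain ⟨e, r, ⟨θ⟩⟩ := f1 (p ≫ x) (q ≫ y)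
    obtain ⟨e', r', ⟨θ'⟩⟩ := f1 (r ≫ q ≫ y) (r ≫ p ≫ x)
    let z := r' ≫ r ≫ p ≫ x
    let z' := r' ≫ r ≫ q ≫ y
    have γ₁ : z ≫ f ⟶ z ≫ g :=
      eqToHom (by simp [z]) ≫ (r' ≫ r ≫ p) ◁ γ ≫ eqToHom (by simp [z])
    have δ₁ : z' ≫ g ⟶ z' ≫ f :=
      eqToHom (by simp [z']) ≫ (r' ≫ r ≫ q) ◁ δ ≫ eqToHom (by simp [z'])
    have δ₂ : z ≫ g ⟶ z ≫ f := (r' ◁ θ) ▷ g ≫ δ₁ ≫ θ' ▷ f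
    obtain ⟨k, s, hs⟩ := f2 (γ₁ ≫ δ₂) (𝟙 _)
    obtain ⟨k', s', hs'⟩ := f2 (s ◁ (δ₂ ≫ γ₁)) (𝟙 _)
    have h₁ : s' ◁ s ◁ γ₁ ≫ s' ◁ s ◁ δ₂ = 𝟙 _ := by
      rw [← whiskerLeft_comp, ← whiskerLeft_comp, hs, whiskerLeft_id, whiskerLeft_id]
    have h₂ : s' ◁ s ◁ δ₂ ≫ s' ◁ s ◁ γ₁ = 𝟙 _ := by
      rw [← whiskerLeft_comp, ← whiskerLeft_comp, hs', whiskerLeft_id]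
    have e₁ (f : a ⟶ b) : (s' ≫ s ≫ z) ≫ f = s' ≫ s ≫ z ≫ f := by simp
    exact ⟨k', s' ≫ s ≫ z, ⟨eqToIso (e₁ f) ≪≫ ⟨_, _, h₁, h₂⟩ ≪≫ eqToIso (e₁ g).symm⟩⟩

end Weak

section Iso

variable {A : Type w} [Category.{v} A] {x y z x' y' z' : A}

lemma inv_eq_comp_inv {a : x ≅ y} {b : x ≅ z} {m : y ⟶ z} (h : b.hom = a.hom ≫ m) :
    a.inv = m ≫ b.inv := by
  rw [Iso.eq_comp_inv, Iso.inv_comp_eq, h]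

lemma inv_comp_eq_of {a : x ≅ x'} {b : z ≅ z'} {f : x ⟶ y} {s : y ⟶ y'} {g : z ≅ y'}
    {m : x' ⟶ z'} (h : (f ≫ s ≫ g.inv) ≫ b.hom = a.hom ≫ m) :
    (a.inv ≫ f) ≫ s = m ≫ b.inv ≫ g.hom := by
  rw [Category.assoc, Iso.inv_comp_eq, ← reassoc_of% h]
  simp

end Iso

section Tot

variable {C : Type w} [Bicategory.{t, v} C] [Strict C] {P : Type w''} [Bicategory.{t'', v''} P]
  [Strict P] {J : Type w₁} [Bicategory.{t₁, v₁} J] [Strict J]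
  {c : StrictPseudofunctor C P} {S : StrictPseudofunctor J P}

namespace Tot

variable {pr : ∀ j, Presentation.{t, v, w, t'', v'', w'', u} c (S.obj j)}

/-- An object over a given object of `J`. -/
abbrev fib (j : J) (k : (pr j).K) : Tot pr := ⟨j, k⟩

/-- The arrows over an identity. -/
def vert {j : J} {k l : (pr j).K} (a : k ⟶ l) : (fib j k : Tot pr) ⟶ fib j l where
  base := 𝟙 j
  ob := (pr j).D.map a
  iso := ((pr j).π.cell a).symm ≪≫
    eqToIso ((Strict.id_comp _).symm.trans (congrArg (· ≫ _) (S.map_id j).symm))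

lemma vert_iso {j : J} {k l : (pr j).K} (a : k ⟶ l) :
    (Hom.iso (vert (pr := pr) a)).hom ≐ ((pr j).π.cell a).inv :=
  EqMod.comp_eqToHom _ ((Strict.id_comp _).symm.trans (congrArg (· ≫ _) (S.map_id j).symm))

lemma vert_comp_iso {j : J} {k l : (pr j).K} (a : k ⟶ l) {y : Tot pr} (f : fib j l ⟶ y) :
    (Hom.iso (vert a ≫ f)).hom ≐ (shift (pr j).π a f.ob).inv ≫ f.iso.hom := by
  refine (comp_iso _ _).trans (EqMod.comp ?_ ((EqMod.left_unit (EqMod.associator _ _ _)).trans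
    ((EqMod.whiskerLeft (S.map_id _) (.refl _)).trans (EqMod.id_whiskerLeft _))))
  refine (EqMod.whiskerRight (vert_iso a) rfl).trans ?_
  exact (EqMod.inv (e := shift (pr j).π a f.ob) (e' := whiskerRightIso ((pr j).π.cell a) _)
    (shift_eqMod (pr j).π a f.ob)).symm

lemma vert_comp {j : J} {k l m : (pr j).K} (a : k ⟶ l) (b : l ⟶ m) :
    vert (pr := pr) (a ≫ b) = vert a ≫ vert b := by
  refine Hom.ext' (Strict.id_comp _).symm ((pr j).D.map_comp a b) ((vert_iso _).trans (.trans ?_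
    ((vert_comp_iso a (vert b)).trans (EqMod.comp (.refl _) (vert_iso b))).symm))
  refine EqMod.inv (e := (pr j).π.cell (a ≫ b))
    (e' := (pr j).π.cell b ≪≫ shift (pr j).π a ((pr j).D.map b)) ?_
  refine (EqMod.of_eq ((pr j).π.cell_comp a b)).trans (EqMod.comp (.refl _) ?_)
  exact (EqMod.comp_eqToHom _ (by rw [StrictPseudofunctor.map_comp, Strict.assoc])).trans
    (shift_eqMod _ _ _).symm

/-- The 2-cells over an identity. -/
def vertMap {j : J} {k l : (pr j).K} {a b : k ⟶ l} (s : a ⟶ b) :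
    vert (pr := pr) a ⟶ vert b where
  base := 𝟙 _
  ob := (pr j).D.map₂ s
  w := by
    refine EqMod.eq ((EqMod.right_unit (d := S.map (𝟙 j) ≫ (pr j).π.leg l) (.of_eq ?_)).trans
      ((vert_iso a).trans (.trans (.of_eq ?_) (EqMod.comp (.refl _) (vert_iso b).symm))))
    · exact (congrArg (· ▷ _) (S.map₂_id _)).trans (id_whiskerRight _ _)
    · exact inv_eq_comp_inv ((pr j).π.cell_naturality s)

lemma exists_fib (y : Tot pr) {j : J} (a : j ⟶ y.base) :
    ∃ (k : (pr j).K) (f : fib j k ⟶ y), f.base = a := by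
  obtain ⟨k, f, e⟩ := (pr j).canonical.exists_leg (S.map a ≫ y.leg)
  exact ⟨k, ⟨a, f, eqToIso e.symm⟩, rfl⟩

lemma exists_vert_comp_hom {j : J} {k l : (pr j).K} {y : Tot pr} (f : fib j k ⟶ y)
    (g : fib j l ⟶ y) (α : f.base ⟶ g.base) : ∃ (m : (pr j).K) (a : m ⟶ k) (b : m ⟶ l)
      (s : vert a ≫ f ⟶ vert b ≫ g), Hom₂.base s = 𝟙 j ◁ α := by
  obtain ⟨m, a, b, γ, e⟩ := (pr j).canonical.exists_whisker (f := f.ob) (g := g.ob)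
    (f.iso.hom ≫ S.map₂ α ▷ y.leg ≫ g.iso.inv)
  refine ⟨m, a, b, ⟨𝟙 j ◁ α, γ, ?_⟩, rfl⟩
  have e' : ((shift (pr j).π a f.ob).inv ≫ f.iso.hom) ≫ S.map₂ α ▷ y.leg =
      (pr j).π.leg m ◁ c.map₂ γ ≫ (shift (pr j).π b g.ob).inv ≫ g.iso.hom :=
    inv_comp_eq_of (g := g.iso) e
  refine EqMod.eq ((EqMod.comp (vert_comp_iso a f) ?_).trans ((EqMod.of_eq e').trans
    (EqMod.comp (.refl _) (vert_comp_iso b g).symm)))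
  exact EqMod.whiskerRight (EqMod.map₂ S (EqMod.id_whiskerLeft α)) rfl

lemma twoCofiltered (hJ : TwoCofiltered J) : TwoCofiltered (Tot pr) := by
  refine .of_weak (fun x y => ?_) (fun {x y} f g => ?_) (fun {x y f g} α β => ?_)
  · obtain ⟨j, ⟨a⟩, ⟨b⟩⟩ := hJ.f0 x.base y.base
    obtain ⟨k, f, -⟩ := exists_fib x a
    obtain ⟨l, g, -⟩ := exists_fib y b
    obtain ⟨m, ⟨p⟩, ⟨q⟩⟩ := (pr j).canonical.cofiltered.f0 k l
    exact ⟨fib j m, ⟨vert p ≫ f⟩, ⟨vert q ≫ g⟩⟩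
  · obtain ⟨j, h, ⟨α⟩⟩ := hJ.f1 f.base g.base
    obtain ⟨k, t, rfl⟩ := exists_fib x h
    obtain ⟨m, a, b, s, -⟩ := exists_vert_comp_hom (t ≫ f) (t ≫ g) α.hom
    obtain ⟨n, r, ⟨ρ⟩⟩ := (pr j).canonical.cofiltered.f1 b a
    refine ⟨fib j n, vert r ≫ vert a ≫ t, ⟨eqToHom ?_ ≫ vert r ◁ s ≫ eqToHom ?_ ≫
      vertMap ρ.hom ▷ (t ≫ g) ≫ eqToHom ?_⟩⟩
    · simp only [Strict.assoc]
    · simp only [Strict.assoc, vert_comp]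
    · simp only [Strict.assoc, vert_comp]
  · obtain ⟨j, h, e⟩ := hJ.f2 (Hom₂.base α) (Hom₂.base β)
    obtain ⟨k, t, rfl⟩ := exists_fib x h
    have e' : (pr j).π.leg k ◁ c.map₂ (Hom₂.ob (t ◁ α)) = (pr j).π.leg k ◁ c.map₂ (Hom₂.ob (t ◁ β)) := by
      have h : Hom₂.base (t ◁ α) = Hom₂.base (t ◁ β) := e
      have hα := Hom₂.w (t ◁ α)
      rw [h, Hom₂.w (t ◁ β)] at hα
      exact ((cancel_mono _).1 hα).symm
    obtain ⟨m, a, e'⟩ := (pr j).canonical.exists_of_whisker_eq e'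
    refine ⟨fib j m, vert a ≫ t, ?_⟩
    rw [comp_whiskerLeft, comp_whiskerLeft, show vert a ◁ t ◁ α = vert a ◁ t ◁ β from
      cell_ext (congrArg (𝟙 j ◁ ·) e) e']

end Tot

end Tot

end

section

universe t₁ v₁ w₁ v₂ u₂

section Tot

variable {C : Type w} [Bicategory.{t, v} C] [Strict C] {P : Type w''} [Bicategory.{t'', v''} P]
  [Strict P] {J : Type w₁} [Bicategory.{t₁, v₁} J] [Strict J]
  {c : StrictPseudofunctor C P} {S : StrictPseudofunctor J P}

namespace Tot

variable {pr : ∀ j, Presentation.{t, v, w, t'', v'', w'', u} c (S.obj j)}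

section Transport

variable (Y : StrictPseudofunctor P Cat.{v₂, u₂}) {x y z : Tot pr}

/-- The comparison isomorphism given by the 2-cell of an arrow. -/
def tr (f : x ⟶ y) (b : car Y (S.obj x.base)) :
    (fn Y (c.map f.ob)).obj ((fn Y x.leg).obj b) ≅ (fn Y y.leg).obj ((fn Y (S.map f.base)).obj b) :=
  eqToIso (fn_comp_obj Y x.leg (c.map f.ob) b).symm ≪≫ ntIso Y f.iso b ≪≫
    eqToIso (fn_comp_obj Y (S.map f.base) y.leg b)

lemma tr_hom (f : x ⟶ y) (b : car Y (S.obj x.base)) : (tr Y f b).hom ≐ (nt Y f.iso.hom).app b :=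
  (EqMod.eqToHom_comp (fn_comp_obj Y x.leg (c.map f.ob) b).symm _).trans
    (.comp_eqToHom _ (fn_comp_obj Y (S.map f.base) y.leg b))

lemma tr_inv (f : x ⟶ y) (b : car Y (S.obj x.base)) : (tr Y f b).inv ≐ (nt Y f.iso.inv).app b :=
  EqMod.inv (e' := ntIso Y f.iso b) (tr_hom Y f b)

lemma tr_naturality (f : x ⟶ y) {b b' : car Y (S.obj x.base)} (s : b ⟶ b') :
    (fn Y (c.map f.ob)).map ((fn Y x.leg).map s) ≫ (tr Y f b').hom =
      (tr Y f b).hom ≫ (fn Y y.leg).map ((fn Y (S.map f.base)).map s) :=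
  EqMod.eq ((EqMod.comp (EqMod.fn_comp Y _ _ s).symm (tr_hom Y f b')).trans
    ((EqMod.of_eq ((nt Y f.iso.hom).naturality s)).trans
      (EqMod.comp (tr_hom Y f b).symm (EqMod.fn_comp Y _ _ s))))

lemma tr_inv_naturality (f : x ⟶ y) {b b' : car Y (S.obj x.base)} (s : b ⟶ b') :
    (fn Y y.leg).map ((fn Y (S.map f.base)).map s) ≫ (tr Y f b').inv =
      (tr Y f b).inv ≫ (fn Y (c.map f.ob)).map ((fn Y x.leg).map s) := by
  rw [Iso.comp_inv_eq, Category.assoc, tr_naturality, Iso.inv_hom_id_assoc]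

lemma tr_id (x : Tot pr) (b : car Y (S.obj x.base)) :
    (tr Y (𝟙 x) b).hom ≐ 𝟙 ((fn Y x.leg).obj b) :=
  (tr_hom Y (𝟙 x) b).trans ((EqMod.nt_congr Y (id_iso x) rfl).trans
    (.of_eq (nt_id_app Y (f := x.leg) b)))

lemma tr_comp (f : x ⟶ y) (g : y ⟶ z) (b : car Y (S.obj x.base)) :
    (tr Y (f ≫ g) b).hom ≐ (fn Y (c.map g.ob)).map (tr Y f b).hom ≫
      (tr Y g ((fn Y (S.map f.base)).obj b)).hom := by
  refine (tr_hom Y (f ≫ g) b).trans ((EqMod.nt_congr Y (comp_iso f g) rfl).trans ?_)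
  refine (EqMod.of_eq (nt_comp_app Y _ _ b)).trans (EqMod.comp ?_ ?_)
  · exact (EqMod.nt_whiskerRight Y f.iso.hom (c.map g.ob) b).trans
      ((tr_hom Y f b).symm.map (fn Y (c.map g.ob)))
  · refine (EqMod.of_eq (nt_comp_app Y _ _ b)).trans
      ((EqMod.left_unit (d := (fn Y (S.map f.base ≫ y.leg ≫ c.map g.ob)).obj b) ?_).trans ?_)
    · exact (EqMod.nt_congr Y (EqMod.associator _ _ _) rfl).trans (.of_eq (nt_id_app Y _))
    · exact (EqMod.nt_whiskerLeft Y _ _ b).trans (tr_hom Y g _).symm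

lemma tr_cell {f g : x ⟶ y} (s : f ⟶ g) (b : car Y (S.obj x.base)) :
    (tr Y f b).hom ≫ (fn Y y.leg).map ((nt Y (S.map₂ (Hom₂.base s))).app b) =
      (nt Y (c.map₂ (Hom₂.ob s))).app ((fn Y x.leg).obj b) ≫ (tr Y g b).hom := by
  have h : (nt Y f.iso.hom).app b ≫ (nt Y (S.map₂ (Hom₂.base s) ▷ y.leg)).app b =
      (nt Y (x.leg ◁ c.map₂ (Hom₂.ob s))).app b ≫ (nt Y g.iso.hom).app b :=
    (nt_comp_app Y _ _ b).symm.trans ((congrArg (fun t => (nt Y t).app b) (Hom₂.w s)).trans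
      (nt_comp_app Y _ _ b))
  exact EqMod.eq ((EqMod.comp (tr_hom Y f b) (EqMod.nt_whiskerRight Y _ _ b).symm).trans
    ((EqMod.of_eq h).trans (EqMod.comp (EqMod.nt_whiskerLeft Y _ _ b) (tr_hom Y g b).symm)))

lemma tr_inv_cell {f g : x ⟶ y} (s : f ⟶ g) (b : car Y (S.obj x.base)) :
    (fn Y y.leg).map ((nt Y (S.map₂ (Hom₂.base s))).app b) ≫ (tr Y g b).inv =
      (tr Y f b).inv ≫ (nt Y (c.map₂ (Hom₂.ob s))).app ((fn Y x.leg).obj b) := by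
  rw [Iso.comp_inv_eq, Category.assoc, ← tr_cell, Iso.inv_hom_id_assoc]

lemma tr_vert {j : J} {k l : (pr j).K} (a : k ⟶ l) (b : car Y (S.obj j)) :
    (tr (pr := pr) Y (vert a) b).hom ≐ (nt Y ((pr j).π.cell a).inv).app b :=
  (tr_hom Y (vert a) b).trans (EqMod.nt_congr Y (vert_iso a) rfl)

end Transport

variable (pr) (Y : StrictPseudofunctor P Cat.{v₂, u₂})

/-- A pseudo-family for `S` induces one for the projection `Tot pr → C`. -/
def res : PsFam S Y ⥤ PsFam (proj pr) (c.comp Y) where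
  obj b := PsFam.ofEqMod (X := proj pr) (M := c.comp Y) (fun x => (fn Y x.leg).obj (b.pt x.base))
    (fun {x y} f => (fn Y y.leg).mapIso (b.cell (Hom.base f)) ≪≫ (tr Y f (b.pt x.base)).symm)
    (fun x => (EqMod.right_unit (EqMod.inv (e' := Iso.refl _) (tr_id Y x _))).trans
      (((b.cell_id_eqMod x.base).map (fn Y x.leg)).trans (.of_eq ((fn Y x.leg).map_id _))))
    (fun {x y z} f g => by
      refine (EqMod.comp (((b.cell_comp_eqMod _ _).map (fn Y z.leg)).trans
        (.of_eq ((fn Y z.leg).map_comp _ _))) (EqMod.inv (e' := (fn Y (c.map g.ob)).mapIso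
          (tr Y f _) ≪≫ tr Y g _) (tr_comp Y f g _))).trans (.of_eq ?_)
      refine (Category.assoc _ _ _).trans (Eq.trans ?_ (Category.assoc _ _ _).symm)
      refine congrArg (_ ≫ ·) ?_
      refine ((Category.assoc _ _ _).symm.trans (congrArg (· ≫ _)
        (tr_inv_naturality Y g (b.cell f.base).hom))).trans ((Category.assoc _ _ _).trans ?_)
      exact congrArg (_ ≫ ·) ((fn Y (c.map g.ob)).map_comp _ _).symm)
    (fun {x y f g} s => by
      refine (congrArg (fun t => (fn Y y.leg).map t ≫ (tr Y g _).inv)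
        (b.cell_nat (Hom₂.base s))).trans ?_
      refine (congrArg (· ≫ _) ((fn Y y.leg).map_comp _ _)).trans ((Category.assoc _ _ _).trans
        (Eq.trans ?_ (Category.assoc _ _ _).symm))
      exact congrArg (_ ≫ ·) (tr_inv_cell Y s _))
  map {b b'} φ :=
    { app x := (fn Y x.leg).map (PsFam.Hom.app φ x.base)
      w {x y} f := by
        refine (Category.assoc _ _ _).trans ((congrArg (_ ≫ ·)
          (tr_inv_naturality Y f (PsFam.Hom.app φ x.base)).symm).trans ?_)
        refine (Category.assoc _ _ _).symm.trans (Eq.trans (congrArg (· ≫ _) ?_)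
          (Category.assoc _ _ _))
        exact ((fn Y y.leg).map_comp _ _).symm.trans ((congrArg (fn Y y.leg).map
          (PsFam.Hom.w φ (Hom.base f))).trans ((fn Y y.leg).map_comp _ _)) }
  map_id b := PsFam.hom_ext fun x => (fn Y x.leg).map_id _
  map_comp f g := PsFam.hom_ext fun x => (fn Y x.leg).map_comp _ _

end Tot

end Tot

end

section

universe t₁ v₁ w₁ v₂ u₂

section IsoFam

variable {C : Type w} [Bicategory.{t, v} C] {K : Type w'} [Bicategory.{t', v'} K]
  {X : StrictPseudofunctor K C} {M : StrictPseudofunctor C Cat.{v₂, u₂}}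

lemma PsFam.isIso_of_app {σ τ : PsFam X M} (f : σ ⟶ τ) (h : ∀ k, IsIso (Hom.app f k)) : IsIso f :=
  ⟨⟨fun k => inv (Hom.app f k), fun {k l} u => by
      rw [CategoryTheory.Functor.map_inv, IsIso.comp_inv_eq, Category.assoc, IsIso.eq_inv_comp]
      exact (Hom.w f u).symm⟩,
    hom_ext fun k => IsIso.hom_inv_id _, hom_ext fun k => IsIso.inv_hom_id _⟩

lemma IsIsoCat.isIso {A : Type*} [Category* A] {B : Type*} [Category* B] {F : A ⥤ B}
    (hF : IsIsoCat F) {a b : A} (f : a ⟶ b) [IsIso (F.map f)] : IsIso f := by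
  obtain ⟨g, hg⟩ := (hF.map _ _).2 (inv (F.map f))
  exact ⟨g, (hF.map _ _).1 (by simp [hg]), (hF.map _ _).1 (by simp [hg])⟩

end IsoFam

lemma comp_map_comp {A : Type*} [Category* A] {B : Type*} [Category* B] {G : A ⥤ B} {a b c d : A}
    {x y : B} (p : x ⟶ G.obj a) (q : a ⟶ b) (r : b ⟶ c) (s : c ⟶ d) (h : G.obj d ⟶ y) :
    (p ≫ G.map q) ≫ G.map r ≫ G.map s ≫ h = p ≫ G.map (q ≫ r ≫ s) ≫ h := by simp

section Tot

variable {C : Type w} [Bicategory.{t, v} C] [Strict C] {P : Type w''} [Bicategory.{t'', v''} P]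
  [Strict P] {J : Type w₁} [Bicategory.{t₁, v₁} J] [Strict J]
  {c : StrictPseudofunctor C P} {S : StrictPseudofunctor J P}

namespace Tot

variable {pr : ∀ j, Presentation.{t, v, w, t'', v'', w'', u} c (S.obj j)}
  {Y : StrictPseudofunctor P Cat.{v₂, u₂}}

lemma vert_id {j : J} (k : (pr j).K) : vert (pr := pr) (𝟙 k) = 𝟙 (fib j k) := by
  refine Hom.ext' rfl ((pr j).D.map_id k) ((vert_iso _).trans (.trans ?_ (id_iso _).symm))
  exact EqMod.inv (e' := Iso.refl _)
    ((EqMod.of_eq ((pr j).π.cell_id k)).trans (.eqToHom_id _))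

/-- The restriction of a pseudo-family to the objects over `j`. -/
def vertFam (τ : PsFam (proj pr) (c.comp Y)) (j : J) : PsFam ((pr j).D.comp c) Y :=
  PsFam.ofEqMod (fun k => τ.pt (fib j k)) (fun a => τ.cell (vert a))
    (fun k => (τ.cell_of_eq (vert_id k)).trans (τ.cell_id_eqMod (fib j k)))
    (fun a b => (τ.cell_of_eq (vert_comp a b)).trans (τ.cell_comp_eqMod (vert a) (vert b)))
    (fun {k l a b} s => τ.cell_nat (vertMap s))

lemma res_cell (b : PsFam S Y) {x y : Tot pr} (f : x ⟶ y) :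
    (((res pr Y).obj b).cell f).hom =
      (fn Y y.leg).map (b.cell (Hom.base f)).hom ≫ (tr Y f (b.pt x.base)).inv := rfl

lemma leg_map_cell (b : PsFam S Y) {x y : Tot pr} (f : x ⟶ y) :
    (fn Y y.leg).map (b.cell (Hom.base f)).hom =
      (((res pr Y).obj b).cell f).hom ≫ (tr Y f (b.pt x.base)).hom := by
  rw [res_cell]
  exact ((Category.assoc _ _ _).trans ((congrArg (_ ≫ ·) (Iso.inv_hom_id _)).trans
    (Category.comp_id _))).symm

lemma vertFam_res (b : PsFam S Y) (j : J) :
    vertFam ((res pr Y).obj b) j = (evalCone (pr j).π Y).obj (b.pt j) := by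
  refine PsFam.ext' (fun _ => rfl) (fun {k l} a => ?_)
  refine (EqMod.of_eq (res_cell b (vert a))).trans (EqMod.trans ?_
    (evalCone_cell_hom (pr j).π Y (b.pt j) a).symm)
  refine (EqMod.left_unit (((b.cell_id_eqMod j).map _).trans
    (.of_eq ((fn Y (leg (fib j l))).map_id _)))).trans ?_
  exact EqMod.inv (e' := (ntIso Y ((pr j).π.cell a) (b.pt j)).symm) (tr_vert Y a (b.pt j))

lemma leg_faithful (hY : ∀ j, IsIsoCat (evalCone (pr j).π Y)) {j : J} {z z' y y' : car Y (S.obj j)}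
    {s : z ⟶ z'} {s' : y ⟶ y'} (e : z = y) (e' : z' = y')
    (h : ∀ k, (fn Y (leg (fib (pr := pr) j k))).map s ≐ (fn Y (leg (fib (pr := pr) j k))).map s') :
    s ≐ s' := by
  subst e e'
  exact .of_eq (((hY j).map _ _).1 (PsFam.hom_ext fun k => (h k).eq))

section Glue

variable {τ : PsFam (proj pr) (c.comp Y)} {b : ∀ j, car Y (S.obj j)}
  (hb : ∀ j, (evalCone (pr j).π Y).obj (b j) = vertFam τ j)

include hb

lemma glue_pt (x : Tot pr) : (fn Y x.leg).obj (b x.base) = τ.pt x :=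
  congrArg (fun σ : PsFam ((pr x.base).D.comp c) Y => σ.pt x.idx) (hb x.base)

lemma glue_nt {j : J} {k l : (pr j).K} (a : k ⟶ l) :
    (nt Y ((pr j).π.cell a).hom).app (b j) ≐ (τ.cell (vert a)).hom :=
  (evalCone_cell_hom (pr j).π Y (b j) a).symm.trans (PsFam.cell_congr (hb j) a)

/-- The cell at `f` of the pseudo-family under construction, at the target of `f`. -/
def glue {x y : Tot pr} (f : x ⟶ y) :
    τ.pt y ≅ (fn Y y.leg).obj ((fn Y (S.map (Hom.base f))).obj (b x.base)) :=
  τ.cell f ≪≫ (fn Y (c.map (Hom.ob f))).mapIso (eqToIso (glue_pt hb x).symm) ≪≫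
    tr Y f (b x.base)

lemma glue_hom {x y : Tot pr} (f : x ⟶ y) : (glue hb f).hom = (τ.cell f).hom ≫
    (fn Y (c.map (Hom.ob f))).map (eqToHom (glue_pt hb x).symm) ≫ (tr Y f (b x.base)).hom := rfl

lemma glue_comp {x y z : Tot pr} (f : x ⟶ y) (g : y ⟶ z) : (glue hb (f ≫ g)).hom ≐
    (τ.cell g).hom ≫ (fn Y (c.map (Hom.ob g))).map (glue hb f).hom ≫
      (tr Y g ((fn Y (S.map (Hom.base f))).obj (b x.base))).hom := by
  have h : (fn Y (c.map (Hom.ob (f ≫ g)))).map (eqToHom (glue_pt hb x).symm) ≐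
      (fn Y (c.map (Hom.ob g))).map ((fn Y (c.map (Hom.ob f))).map
        (eqToHom (glue_pt hb x).symm)) :=
    (EqMod.fn_congr Y (c.map_comp f.ob g.ob) (.refl _)).trans (EqMod.fn_comp Y _ _ _)
  exact (EqMod.of_eq (glue_hom hb _)).trans ((EqMod.comp (τ.cell_comp_eqMod f g)
    (EqMod.comp h (tr_comp Y f g _))).trans (.of_eq (comp_map_comp _ _ _ _ _)))

lemma glue_cell {x y : Tot pr} {f g : x ⟶ y} (s : f ⟶ g) :
    (glue hb f).hom ≫ (fn Y y.leg).map ((nt Y (S.map₂ (Hom₂.base s))).app (b x.base)) =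
      (glue hb g).hom := by
  have h₁ : (τ.cell g).hom = (τ.cell f).hom ≫ (nt Y (c.map₂ (Hom₂.ob s))).app (τ.pt x) :=
    τ.cell_nat s
  have h₂ := (nt Y (c.map₂ (Hom₂.ob s))).naturality (eqToHom (glue_pt hb x).symm)
  rw [glue_hom, glue_hom]
  refine Eq.trans ?_ (congrArg (· ≫ _) h₁).symm
  refine (Category.assoc _ _ _).trans (Eq.trans (congrArg (_ ≫ ·) ?_) (Category.assoc _ _ _).symm)
  refine (Category.assoc _ _ _).trans ((congrArg (_ ≫ ·) (tr_cell Y s _)).trans ?_)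
  exact (Category.assoc _ _ _).symm.trans ((congrArg (· ≫ _) h₂).trans (Category.assoc _ _ _))

lemma glue_vert {j : J} {k l : (pr j).K} (a : k ⟶ l) :
    (glue hb (vert a)).hom ≐ 𝟙 (τ.pt (fib j l)) := by
  refine EqMod.trans (EqMod.comp (glue_nt hb a).symm (EqMod.trans (EqMod.left_unit
    (d := (fn Y (c.map (Hom.ob (vert a)))).obj (τ.pt (fib j k))) ?_) (tr_vert Y a (b j)))) ?_
  · exact (EqMod.map _ (.eqToHom_id (glue_pt hb (fib j k)).symm)).trans (.of_eq (CategoryTheory.Functor.map_id _ _))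
  · exact (EqMod.of_eq (nt_inv_app Y _ _)).trans (.id_eq (glue_pt hb (fib j l)))

lemma glue_vert_comp {j : J} {k l : (pr j).K} (a : k ⟶ l) {y : Tot pr} (f : fib j l ⟶ y) :
    (glue hb (vert a ≫ f)).hom ≐ (glue hb f).hom := by
  refine (glue_comp hb (vert a) f).trans (EqMod.comp (.refl _) (EqMod.comp ?_ ?_))
  · exact EqMod.map _ ((glue_vert hb a).trans (EqMod.symm (.eqToHom_id (glue_pt hb (fib j l)).symm)))
  · refine (tr_hom Y f _).trans (.trans (EqMod.app _ ?_) (tr_hom Y f _).symm)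
    exact (congrArg (fun g => (fn Y g).obj (b j)) (S.map_id j)).trans (fn_id_obj Y _)

lemma glue_eqMod {j : J} {k l : (pr j).K} {y : Tot pr} (f : fib j k ⟶ y) (g : fib j l ⟶ y)
    (α : f.base ⟶ g.base) :
    (glue hb f).hom ≫ (fn Y y.leg).map ((nt Y (S.map₂ α)).app (b j)) ≐ (glue hb g).hom := by
  obtain ⟨m, a, a', s, hs⟩ := exists_vert_comp_hom f g α
  refine EqMod.trans (EqMod.comp (glue_vert_comp hb a f).symm (EqMod.map _ ?_))
    ((EqMod.of_eq (glue_cell hb s)).trans (glue_vert_comp hb a' g))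
  rw [hs]
  exact EqMod.nt_congr Y (EqMod.map₂ S (EqMod.id_whiskerLeft α)).symm rfl

end Glue

end Tot

end Tot

end

section

universe t₁ v₁ w₁ v₂ u₂

lemma comp_comp_hom_inv {C : Type w} [Category.{v} C] {a b d d' : C} (f : a ⟶ b) (g : b ⟶ d)
    (e : d ≅ d') : (f ≫ g ≫ e.hom) ≫ e.inv = f ≫ g := by simp

section Tot

variable {C : Type w} [Bicategory.{t, v} C] [Strict C] {P : Type w''} [Bicategory.{t'', v''} P]
  [Strict P] {J : Type w₁} [Bicategory.{t₁, v₁} J] [Strict J]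
  {c : StrictPseudofunctor C P} {S : StrictPseudofunctor J P}

namespace Tot

variable {pr : ∀ j, Presentation.{t, v, w, t'', v'', w'', u} c (S.obj j)}
  {Y : StrictPseudofunctor P Cat.{v₂, u₂}}

section Glue

variable {τ : PsFam (proj pr) (c.comp Y)} {b : ∀ j, car Y (S.obj j)}
  (hb : ∀ j, (evalCone (pr j).π Y).obj (b j) = vertFam τ j)

include hb

lemma glue_of_base_eq {j : J} {k l : (pr j).K} {y : Tot pr} (f : fib j k ⟶ y) (g : fib j l ⟶ y)
    (e : f.base = g.base) : (glue hb f).hom ≐ (glue hb g).hom := by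
  refine EqMod.trans (EqMod.symm (EqMod.right_unit
    (d := (fn Y y.leg).obj ((fn Y (S.map f.base)).obj (b j))) ?_)) (glue_eqMod hb f g (eqToHom e))
  refine (EqMod.map _ ((EqMod.nt_congr Y (EqMod.map₂ S (EqMod.eqToHom_id e)) rfl).trans
    ((EqMod.nt_congr Y (.of_eq (S.map₂_id _)) rfl).trans (.of_eq (nt_id_app Y _))))).trans ?_
  exact .of_eq ((fn Y y.leg).map_id _)

lemma exists_cell (hY : ∀ j, IsIsoCat (evalCone (pr j).π Y)) {i j : J} (a : i ⟶ j) : ∃ φ : b j ≅ (fn Y (S.map a)).obj (b i),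
    ∀ {k : (pr i).K} {l : (pr j).K} (f : fib i k ⟶ fib j l), Hom.base f = a →
      (fn Y (leg (fib (pr := pr) j l))).map φ.hom ≐ (glue hb f).hom := by
  choose k f hf using fun l => exists_fib (pr := pr) (fib j l) a
  let g (l : (pr j).K) : (fn Y (leg (fib (pr := pr) j l))).obj (b j) ≅
      (fn Y (leg (fib (pr := pr) j l))).obj ((fn Y (S.map a)).obj (b i)) :=
    eqToIso (glue_pt hb (fib j l)) ≪≫ glue hb (f l) ≪≫
      eqToIso (congrArg (fun a => (fn Y _).obj ((fn Y (S.map a)).obj (b i))) (hf l))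
  have hg (l) : (g l).hom ≐ (glue hb (f l)).hom := EqMod.of_conj (p := glue_pt hb (fib j l))
    (q := congrArg (fun a => (fn Y (leg (fib (pr := pr) j l))).obj ((fn Y (S.map a)).obj (b i))) (hf l)) rfl
  let s : (evalCone (pr j).π Y).obj (b j) ⟶
      (evalCone (pr j).π Y).obj ((fn Y (S.map a)).obj (b i)) := ⟨fun l => (g l).hom, fun {l l'} u => by
    have h₁ := EqMod.comp ((evalCone_cell_hom (pr j).π Y (b j) u).trans (glue_nt hb u))
      ((hg l).map (fn Y (c.map ((pr j).D.map u))))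
    have h₂ : (g l').hom ≐ _ := (hg l').trans ((glue_of_base_eq hb (f l') (f l ≫ vert u)
      ((hf l').trans ((hf l).symm.trans (Strict.comp_id _).symm))).trans (glue_comp hb _ _))
    have h₃ : ((((evalCone (pr j).π Y).obj ((fn Y (S.map a)).obj (b i)))).cell u).hom ≐
        (tr Y (vert u) ((fn Y (S.map (Hom.base (f l)))).obj (b i))).inv := by
      rw [hf l]
      exact (evalCone_cell_hom (pr j).π Y _ u).trans
        (EqMod.inv (e' := (ntIso Y ((pr j).π.cell u) _).symm) (tr_vert Y u _)).symm
    refine EqMod.eq (h₁.trans (EqMod.symm ((EqMod.comp h₂ h₃).trans (.of_eq ?_))))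
    exact comp_comp_hom_inv _ _ _⟩
  have : IsIso s := PsFam.isIso_of_app s fun l => (g l).isIso_hom
  obtain ⟨φ, hφ⟩ := ((hY j).map _ _).2 s
  have : IsIso ((evalCone (pr j).π Y).map φ) := by rwa [hφ]
  have := (hY j).isIso φ
  refine ⟨asIso φ, fun {k' l} f' h => .trans (.of_eq ?_) ((hg l).trans
    (glue_of_base_eq hb _ _ ((hf l).trans h.symm)))⟩
  exact congrArg (fun t => PsFam.Hom.app t l) hφ

end Glue

lemma isIsoCat_res (hY : ∀ j, IsIsoCat (evalCone (pr j).π Y)) : IsIsoCat (res pr Y) := by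
  refine PsFam.isIsoCat_of _ (fun b b' e => ?_) (fun τ => ?_) (fun f g e => ?_) (fun {b b'} s => ?_)
  · have hp (j : J) : b.pt j = b'.pt j := (hY j).obj.1 (by
      rw [← vertFam_res, ← vertFam_res, e])
    refine PsFam.ext' hp (fun {i j} a => leg_faithful hY (hp j)
      (congrArg (fn Y (S.map a)).obj (hp i)) fun l => ?_)
    obtain ⟨k, f, rfl⟩ := exists_fib (fib j l) a
    refine (EqMod.of_eq (leg_map_cell b f)).trans (.trans (.comp (PsFam.cell_congr e f)
      ((tr_hom Y f _).trans (.trans (.app _ (hp i)) (tr_hom Y f _).symm)))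
      (.of_eq (leg_map_cell b' f).symm))
  · choose b hb using fun j => (hY j).obj.2 (vertFam τ j)
    choose φ hφ using fun {i j : J} (a : i ⟶ j) => exists_cell hb hY a
    refine ⟨PsFam.ofEqMod b φ (fun j => ?_) (fun {i j m} a a' => ?_) (fun {i j a a'} α => ?_),
      PsFam.ext' (glue_pt hb) (fun {x y} f => ?_)⟩
    · refine leg_faithful hY rfl ((congrArg (fun g => (fn Y g).obj (b j)) (S.map_id j)).trans
        (fn_id_obj Y _)) fun k => (hφ (𝟙 j) (𝟙 (fib j k)) rfl).trans ?_
      refine (glue_of_base_eq hb (𝟙 (fib j k)) (vert (𝟙 k)) rfl).trans ((glue_vert hb (𝟙 k)).trans ?_)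
      exact (EqMod.id_eq (glue_pt hb (fib j k)).symm).trans
        (.of_eq ((fn Y _).map_id _).symm)
    · refine leg_faithful hY rfl ((congrArg (fun g => (fn Y g).obj (b i)) (S.map_comp a a')).trans
        (fn_comp_obj Y _ _ _)) fun l => ?_
      obtain ⟨k', g, rfl⟩ := exists_fib (pr := pr) (fib m l) a'
      obtain ⟨k, f, rfl⟩ := exists_fib (pr := pr) (fib j k') a
      refine (hφ _ (f ≫ g) rfl).trans ((glue_comp hb f g).trans (.trans (.of_eq ?_)
        ((EqMod.comp (hφ _ g rfl) (.refl _)).symm.trans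
          (.of_eq ((fn Y (leg (fib (pr := pr) m l))).map_comp _ _).symm))))
      have h : (glue hb f).hom = eqToHom (glue_pt hb (fib j k')).symm ≫
          (fn Y (leg (fib (pr := pr) j k'))).map (φ (Hom.base f)).hom :=
        EqMod.eq ((hφ _ f rfl).symm.trans (EqMod.symm (.eqToHom_comp (glue_pt hb (fib j k')).symm _)))
      rw [h, glue_hom]
      refine (congrArg (fun t => _ ≫ t ≫ _) ((fn Y (c.map (Hom.ob g))).map_comp _ _)).trans ?_
      refine (congrArg (_ ≫ ·) (Category.assoc _ _ _)).trans ((congrArg (fun t => _ ≫ _ ≫ t)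
        (tr_naturality Y g (φ (Hom.base f)).hom)).trans ?_)
      exact (congrArg (_ ≫ ·) (Category.assoc _ _ _).symm).trans (Category.assoc _ _ _).symm
    · refine (leg_faithful hY rfl rfl fun l => ?_).eq
      obtain ⟨k, f, rfl⟩ := exists_fib (pr := pr) (fib j l) a
      obtain ⟨k', g, rfl⟩ := exists_fib (pr := pr) (fib j l) a'
      refine (hφ _ g rfl).trans ((glue_eqMod hb f g α).symm.trans (.trans
        (EqMod.comp (hφ _ f rfl).symm (.refl _)) (.of_eq ((fn Y _).map_comp _ _).symm)))
    · refine (EqMod.of_eq (res_cell _ f)).trans ((EqMod.comp (hφ _ f rfl) (.refl _)).trans ?_)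
      refine (EqMod.of_eq ((congrArg (· ≫ _) (glue_hom hb f)).trans ?_)).trans
        (EqMod.right_unit (((EqMod.eqToHom_id (glue_pt hb x).symm).map
          (fn Y (c.map (Hom.ob f)))).trans (.of_eq ((fn Y (c.map (Hom.ob f))).map_id _))))
      refine (Category.assoc _ _ _).trans (congrArg (_ ≫ ·) ((Category.assoc _ _ _).trans ?_))
      exact (congrArg (_ ≫ ·) (Iso.hom_inv_id _)).trans (Category.comp_id _)
  · exact PsFam.hom_ext fun j => (leg_faithful hY (s := PsFam.Hom.app f j)
      (s' := PsFam.Hom.app g j) rfl rfl fun k => EqMod.of_eq (e ⟨j, k⟩ :)).eq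
  · have hφ (j : J) : ∃ φ : b.pt j ⟶ b'.pt j, ∀ k, (fn Y (leg (fib (pr := pr) j k))).map φ =
        PsFam.Hom.app s (fib j k) := by
      have h (b : PsFam S Y) {k l : (pr j).K} (u : k ⟶ l) :
          (((evalCone (pr j).π Y).obj (b.pt j)).cell u).hom =
            (((res pr Y).obj b).cell (vert u)).hom :=
        (PsFam.cell_congr (vertFam_res (pr := pr) b j) u).eq.symm
      let s' : (evalCone (pr j).π Y).obj (b.pt j) ⟶ (evalCone (pr j).π Y).obj (b'.pt j) :=
        ⟨fun k => PsFam.Hom.app s (fib j k), fun {k l} u => by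
          rw [h b u, h b' u]
          exact PsFam.Hom.w s (vert u)⟩
      obtain ⟨φ, hφ⟩ := ((hY j).map _ _).2 s'
      exact ⟨φ, fun k => congrArg (fun t => PsFam.Hom.app t k) hφ⟩
    choose φ hφ using hφ
    refine ⟨⟨φ, fun {i j} a => (leg_faithful hY rfl rfl fun l => .of_eq ?_).eq⟩,
      fun x => hφ x.base x.idx⟩
    obtain ⟨k, f, rfl⟩ := exists_fib (fib j l) a
    refine ((fn Y _).map_comp _ _).trans (Eq.trans ?_ ((fn Y _).map_comp _ _).symm)
    refine (congrArg (· ≫ _) (leg_map_cell b f)).trans (Eq.trans ?_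
      (congrArg₂ (· ≫ ·) (hφ j l) (leg_map_cell b' f)).symm)
    refine (Category.assoc _ _ _).trans ((congrArg (_ ≫ ·)
      (tr_naturality Y f (φ i)).symm).trans ?_)
    refine (congrArg (fun t => _ ≫ (fn Y (c.map (Hom.ob f))).map t ≫ _) (hφ i k)).trans ?_
    refine (Category.assoc _ _ _).symm.trans ((congrArg (· ≫ _) (PsFam.Hom.w s f)).trans ?_)
    exact Category.assoc _ _ _

end Tot

end Tot

end

section

universe t₁ v₁ w₁ v₂ u₂

section Tot

variable {C : Type w} [Bicategory.{t, v} C] [Strict C] {P : Type w''} [Bicategory.{t'', v''} P]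
  [Strict P] {c : StrictPseudofunctor C P}

namespace Tot

section Small

variable {J : Type u} [Bicategory.{u, u} J] [Strict J] {S : StrictPseudofunctor J P}
  (pr : ∀ j, Presentation.{t, v, w, t'', v'', w'', u} c (S.obj j))

lemma small_hom (hC : TwoLocallySmall.{t, v, w, u} C) (hP : TwoLocallySmall.{t'', v'', w'', u} P)
    (x y : Tot pr) : Small.{u} (x ⟶ y) := by
  have := hC.small_hom x.ob y.ob
  have (f : x.ob ⟶ y.ob) (a : x.base ⟶ y.base) :
      Small.{u} (x.leg ≫ c.map f ⟶ S.map a ≫ y.leg) := hP.small_hom₂ _ _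
  refine small_of_injective (β := Σ (f : x.ob ⟶ y.ob) (a : x.base ⟶ y.base),
    (x.leg ≫ c.map f ⟶ S.map a ≫ y.leg)) (f := fun h => ⟨h.ob, h.base, h.iso.hom⟩) fun h h' e => ?_
  obtain ⟨a, f, i⟩ := h
  obtain ⟨a', f', i'⟩ := h'
  injection e with e₁ e₂
  dsimp only at e₁
  subst e₁
  injection eq_of_heq e₂ with e₁ e₂
  dsimp only at e₁
  subst e₁
  exact Hom.ext' rfl rfl (.of_eq (eq_of_heq e₂))

lemma small_hom₂ (hC : TwoLocallySmall.{t, v, w, u} C) (x y : Tot pr) (f g : x ⟶ y) :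
    Small.{u} (f ⟶ g) := by
  have := hC.small_hom₂ (Hom.ob f) (Hom.ob g)
  exact small_of_injective (β := (Hom.base f ⟶ Hom.base g) × (Hom.ob f ⟶ Hom.ob g))
    (f := fun s => ⟨Hom₂.base s, Hom₂.ob s⟩) fun s s' e =>
      cell_ext (congrArg Prod.fst e) (congrArg Prod.snd e)

end Small

section Limit

variable {J : Type u} [Bicategory.{t₁, v₁} J] [Strict J] {S : StrictPseudofunctor J P}
  {pr : ∀ j, Presentation.{t, v, w, t'', v'', w'', u} c (S.obj j)}
  [∀ x y : Tot pr, Small.{u} (x ⟶ y)] [∀ (x y : Tot pr) (f g : x ⟶ y), Small.{u} (f ⟶ g)]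
  {X : P} {ζ : PseudoCone (((ShrinkTwo.toTwo (Tot pr)).comp (proj pr)).comp c) X}
  {π : PseudoCone S X}
  (h : (PsFam.shrink (proj pr) (c.comp (homFrom X))).obj ((res pr (homFrom X)).obj
      ((toFam S X).obj π)) =
    (PsFam.assoc ((ShrinkTwo.toTwo (Tot pr)).comp (proj pr)) c (homFrom X)).obj
      ((toFam _ X).obj ζ))

include h

lemma leg_eq (k : ShrinkTwo (Tot pr)) : π.leg k.val.base ≫ k.val.leg = ζ.leg k :=
  congrArg (fun σ : PsFam ((ShrinkTwo.toTwo (Tot pr)).comp (proj pr)) (c.comp (homFrom X)) =>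
    σ.pt k) h

lemma cell_eqMod {k l : ShrinkTwo (Tot pr)} (f : k ⟶ l) :
    (π.cell (ShrinkTwo.arr f).base).hom ▷ l.val.leg ≫
      eqToHom (Strict.assoc _ _ _) ≫ π.leg k.val.base ◁ (ShrinkTwo.arr f).iso.inv ≐
        (ζ.cell f).hom := by
  refine EqMod.trans ?_ (PsFam.cell_congr h f)
  refine .comp (.refl _) (EqMod.trans (.eqToHom_comp (Strict.assoc _ _ _) _)
    (tr_inv (homFrom X) (ShrinkTwo.arr f) (π.leg k.val.base)).symm)

lemma evalCone_res (Y : StrictPseudofunctor P Cat.{v₂, u₂}) :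
    evalCone π Y ⋙ res pr Y ⋙ PsFam.shrink (proj pr) (c.comp Y) =
      evalCone ζ Y ⋙ PsFam.assoc _ c Y := by
  refine PsFam.functor_ext (fun y => PsFam.ext' (fun k => ?_) fun {k l} f => ?_) fun {y y'} s k => ?_
  · exact (fn_comp_obj Y (π.leg k.val.base) k.val.leg y).symm.trans
      (congrArg (fun g => (fn Y g).obj y) (leg_eq h k))
  · refine EqMod.trans ?_ (evalCone_cell_hom ζ Y y f).symm
    refine EqMod.trans ?_ (EqMod.nt_congr Y (cell_eqMod h f) (rfl : y = y))
    refine EqMod.trans ?_ (.of_eq (nt_comp_app Y _ _ y).symm)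
    refine EqMod.comp ?_ ?_
    · exact ((evalCone_cell_hom π Y y _).map (fn Y l.val.leg)).trans
        (EqMod.nt_whiskerRight Y _ _ _).symm
    · refine EqMod.trans ?_ (EqMod.nt_congr Y (EqMod.symm (EqMod.eqToHom_comp (Strict.assoc _ _ _) _))
        (rfl : y = y))
      exact (tr_inv Y _ _).trans (EqMod.nt_whiskerLeft Y _ _ _).symm
  · exact (EqMod.fn_comp Y (π.leg k.val.base) k.val.leg s).symm.trans
      (EqMod.fn_congr Y (leg_eq h k) (.refl s))

lemma isIsoCat_evalCone (Y : StrictPseudofunctor P Cat.{v₂, u₂})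
    (hY : ∀ j, IsIsoCat (evalCone (pr j).π Y)) (hζ : IsIsoCat (evalCone ζ Y)) :
    IsIsoCat (evalCone π Y) :=
  .of_eq (evalCone_res h Y) (hζ.comp (PsFam.isIsoCat_assoc _ _ _))
    ((isIsoCat_res hY).comp (PsFam.isIsoCat_shrink _ _))

end Limit

end Tot

end Tot

end

section

universe t₁ v₁ w₁ v₂ u₂

section Uniqueness

variable {C : Type w} [Bicategory.{t, v} C] [Strict C] {K : Type w'} [Bicategory.{t', v'} K]
  [Strict K] {S : StrictPseudofunctor K C} {A B : C}

lemma evalCone_whisker (π : PseudoCone S A) (x : B ⟶ A) (Y : StrictPseudofunctor C Cat.{v₂, u₂}) :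
    evalCone (π.whisker x) Y = fn Y x ⋙ evalCone π Y := by
  refine PsFam.functor_ext (fun y => PsFam.ext' (fun k => fn_comp_obj Y x (π.leg k) y)
    fun {k l} u => ?_) fun {y y'} s k => EqMod.fn_comp Y x (π.leg k) s
  refine (evalCone_cell_hom (π.whisker x) Y y u).trans (.trans ?_
    (evalCone_cell_hom π Y _ u).symm)
  exact (EqMod.nt_congr Y (EqMod.comp_eqToHom _ (Strict.assoc _ _ _).symm) rfl).trans
    (EqMod.nt_whiskerLeft Y x _ y)

lemma whisker_id (π : PseudoCone S A) : π.whisker (𝟙 A) = π :=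
  (isIsoCat_toFam S A).obj.1 (PsFam.ext' (fun k => Strict.id_comp _) fun {k l} u =>
    (EqMod.comp_eqToHom _ (Strict.assoc _ _ _).symm).trans (EqMod.id_whiskerLeft _))

lemma whisker_comp (π : PseudoCone S A) (x : B ⟶ A) {B' : C} (x' : B' ⟶ B) :
    (π.whisker x).whisker x' = π.whisker (x' ≫ x) :=
  (isIsoCat_toFam S B').obj.1 (PsFam.ext' (fun k => (Strict.assoc _ _ _).symm) fun {k l} u =>
    (EqMod.comp_eqToHom _ (Strict.assoc _ _ _).symm).trans ((EqMod.whiskerLeft rfl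
      (EqMod.comp_eqToHom _ (Strict.assoc _ _ _).symm)).trans
      (.trans (EqMod.comp_whiskerLeft _ _ _).symm
        (EqMod.comp_eqToHom _ (Strict.assoc _ _ _).symm).symm)))

lemma isIsoCat_fn (Y : StrictPseudofunctor C Cat.{v₂, u₂}) {x : B ⟶ A} {x' : A ⟶ B}
    (h : x ≫ x' = 𝟙 B) (h' : x' ≫ x = 𝟙 A) : IsIsoCat (fn Y x) := by
  have e : fn Y x ⋙ fn Y x' = 𝟭 _ := by rw [← fn_comp, h, fn_id]
  have e' : fn Y x' ⋙ fn Y x = 𝟭 _ := by rw [← fn_comp, h', fn_id]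
  exact (isIsoCat_iff _).2 ⟨fn Y x', e, e'⟩

lemma PseudoCone.IsPseudolimit.isIsoCat_evalCone {π : PseudoCone S A} {π' : PseudoCone S B}
    (hπ : π.IsPseudolimit) (hπ' : π'.IsPseudolimit) (Y : StrictPseudofunctor C Cat.{v₂, u₂})
    (h : IsIsoCat (evalCone π Y)) : IsIsoCat (evalCone π' Y) := by
  have inj {A : C} {π : PseudoCone S A} (hπ : π.IsPseudolimit) {x y : A ⟶ A}
    (e : π.whisker x = π.whisker y) : x = y := ((isIsoCat_iff _).2 (hπ A)).obj.1 e
  obtain ⟨x, hx⟩ := ((isIsoCat_iff _).2 (hπ B)).obj.2 π'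
  obtain ⟨x', hx'⟩ := ((isIsoCat_iff _).2 (hπ' A)).obj.2 π
  change π.whisker x = π' at hx
  change π'.whisker x' = π at hx'
  have e : x ≫ x' = 𝟙 B := inj hπ' (by rw [← whisker_comp, hx', hx, whisker_id])
  have e' : x' ≫ x = 𝟙 A := inj hπ (by rw [← whisker_comp, hx, hx', whisker_id])
  rw [← hx, evalCone_whisker]
  exact (isIsoCat_fn Y e e').comp h

end Uniqueness

section Completion

variable {C : Type w} [Bicategory.{t, v} C] [Strict C] {P : Type w''} [Bicategory.{t'', v''} P]
  [Strict P]

/-- `P` consists of canonical pseudolimits of the small 2-cofiltered diagrams in `C`. -/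
structure IsProCompletion (c : StrictPseudofunctor C P) : Prop where
  exists_canonical (K : Type u) [Bicategory.{u, u} K] [Strict K] (D : StrictPseudofunctor K C)
    (hK : TwoCofiltered K) : ∃ (X : P) (π : PseudoCone (D.comp c) X), IsCanonical c D π
  exists_presentation (X : P) : Nonempty (Presentation.{t, v, w, t'', v'', w'', u} c X)

variable {c : StrictPseudofunctor C P} (hc : IsProCompletion.{t, v, w, t'', v'', w'', u} c)
  (hC : TwoLocallySmall.{t, v, w, u} C) (hP : TwoLocallySmall.{t'', v'', w'', u} P)

include hc hC hP

lemma IsProCompletion.exists_pseudolimit {J : Type u} [Bicategory.{u, u} J] [Strict J]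
    (hJ : TwoCofiltered J) (S : StrictPseudofunctor J P) :
    ∃ (X : P) (π : PseudoCone S X), π.IsPseudolimit ∧
      ∀ {Q : Type w'} [Bicategory.{t', v'} Q] [Strict Q] (Φ : StrictPseudofunctor P Q),
        (∀ (X : P) (p : Presentation.{t, v, w, t'', v'', w'', u} c X), (p.π.map Φ).IsPseudolimit) →
          (π.map Φ).IsPseudolimit := by
  let pr (j : J) := (hc.exists_presentation (S.obj j)).some
  have := Tot.small_hom pr hC hP
  have := Tot.small_hom₂ pr hC
  obtain ⟨X, ζ, hζ⟩ := hc.exists_canonical (ShrinkTwo (Tot pr))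
    ((ShrinkTwo.toTwo (Tot pr)).comp (Tot.proj pr)) (TwoCofiltered.shrink (Tot.twoCofiltered hJ))
  have hp (j : J) (B : P) := (isPseudolimit_iff (pr j).π).1 (pr j).canonical.isPseudolimit B
  obtain ⟨σ, hσ⟩ := ((Tot.isIsoCat_res fun j => hp j X).comp (PsFam.isIsoCat_shrink (Tot.proj pr)
    (c.comp (homFrom X)))).obj.2 ((PsFam.assoc _ c (homFrom X)).obj ((toFam _ X).obj ζ))
  obtain ⟨π, rfl⟩ := (isIsoCat_toFam S X).obj.2 σ
  refine ⟨X, π, (isPseudolimit_iff π).2 fun B => Tot.isIsoCat_evalCone hσ _ (fun j => hp j B)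
    ((isPseudolimit_iff ζ).1 hζ.isPseudolimit B), fun Φ hΦ => (isPseudolimit_map_iff π Φ).2 fun B =>
      Tot.isIsoCat_evalCone hσ _ (fun j => (isPseudolimit_map_iff _ Φ).1 (hΦ _ (pr j)) B)
        ((isPseudolimit_map_iff ζ Φ).1 (hΦ X ⟨_, _, ζ, hζ⟩) B)⟩

lemma IsProCompletion.hasCofilteredPseudolimits :
    HasCofilteredPseudolimits.{t'', v'', w'', u} P := fun K _ _ hK S => by
  obtain ⟨X, π, h, -⟩ := hc.exists_pseudolimit.{t, v, w, 0, 0, 0} hC hP hK S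
  exact ⟨X, π, h⟩

lemma IsProCompletion.preserves {Q : Type w'} [Bicategory.{t', v'} Q] [Strict Q]
    {Φ : StrictPseudofunctor P Q}
    (hΦ : ∀ (X : P) (p : Presentation.{t, v, w, t'', v'', w'', u} c X), (p.π.map Φ).IsPseudolimit) :
    PreservesCofilteredPseudolimits.{t'', v'', w'', t', v', w', u} Φ := fun K _ _ hK S A π hπ => by
  obtain ⟨X, π', h, h'⟩ := hc.exists_pseudolimit hC hP hK S
  exact (isPseudolimit_map_iff π Φ).2 fun B => h.isIsoCat_evalCone hπ _
    ((isPseudolimit_map_iff π' Φ).1 (h' Φ hΦ) B)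

end Completion

end

section Universal

variable {𝒜 : Type w} [Bicategory.{t, v} 𝒜] [Strict 𝒜] {ℬ : Type w'} [Bicategory.{t', v'} ℬ]
  [Strict ℬ] (R : StrictPseudofunctor ℬ 𝒜) {a a' a'' : 𝒜} {b b' b'' : ℬ}

/-- Composition of `T : a ⟶ R b` with arrows `R m`. -/
def postFunctor (T : a ⟶ R.obj b) (b' : ℬ) : (b ⟶ b') ⥤ (a ⟶ R.obj b') where
  obj m := T ≫ R.map m
  map μ := T ◁ R.map₂ μ
  map_id m := by rw [R.map₂_id, whiskerLeft_id]
  map_comp μ ν := by rw [R.map₂_comp, whiskerLeft_comp]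

/-- `T : a ⟶ R b` is a universal arrow from `a` to `R`, in the strict 2-categorical sense. -/
def IsUniv (T : a ⟶ R.obj b) : Prop := ∀ b', IsIsoCat (postFunctor R T b')

variable {R} {T : a ⟶ R.obj b} (hT : IsUniv R T)

namespace IsUniv

include hT

lemma hom_ext {m n : b ⟶ b'} (h : T ≫ R.map m = T ≫ R.map n) : m = n := (hT b').obj.1 h

lemma cell_ext {m n m' n' : b ⟶ b'} {μ : m ⟶ n} {μ' : m' ⟶ n'}
    (h : T ◁ R.map₂ μ ≐ T ◁ R.map₂ μ') : μ ≐ μ' := EqMod.of_map (hT b') h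

lemma exists_inverse (b' : ℬ) : ∃ G : (a ⟶ R.obj b') ⥤ (b ⟶ b'), G ⋙ postFunctor R T b' = 𝟭 _ :=
  ((isIsoCat_iff _).1 (hT b')).imp fun _ h => h.2

/-- The factorization of arrows through a universal arrow. -/
noncomputable def lift (b' : ℬ) : (a ⟶ R.obj b') ⥤ (b ⟶ b') := (hT.exists_inverse b').choose

lemma comp_map_lift (s : a ⟶ R.obj b') : T ≫ R.map ((hT.lift b').obj s) = s :=
  Functor.congr_obj (hT.exists_inverse b').choose_spec s

lemma whiskerLeft_map₂_lift {s s' : a ⟶ R.obj b'} (σ : s ⟶ s') :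
    T ◁ R.map₂ ((hT.lift b').map σ) ≐ σ :=
  .of_conj (Functor.congr_hom (hT.exists_inverse b').choose_spec σ)

end IsUniv

section Square

variable {T' : a' ⟶ R.obj b'} {T'' : a'' ⟶ R.obj b''}

lemma square_id (T : a ⟶ R.obj b) : T ≫ R.map (𝟙 b) = 𝟙 a ≫ T := by
  rw [R.map_id, Strict.comp_id, Strict.id_comp]

lemma square_comp {g : a ⟶ a'} {g' : a' ⟶ a''} {m : b ⟶ b'} {m' : b' ⟶ b''}
    (h : T ≫ R.map m = g ≫ T') (h' : T' ≫ R.map m' = g' ≫ T'') :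
    T ≫ R.map (m ≫ m') = (g ≫ g') ≫ T'' := by
  rw [R.map_comp, ← Strict.assoc, h, Strict.assoc, h', Strict.assoc]

lemma square_whiskerLeft {g : a ⟶ a'} {g' g'' : a' ⟶ a''} {γ : g' ⟶ g''} {m : b ⟶ b'}
    {m' m'' : b' ⟶ b''} {μ : m' ⟶ m''}
    (h : T ≫ R.map m = g ≫ T') (h' : T' ◁ R.map₂ μ ≐ γ ▷ T'') :
    T ◁ R.map₂ (m ◁ μ) ≐ (g ◁ γ) ▷ T'' :=
  (EqMod.whiskerLeft rfl (EqMod.map₂_whiskerLeft R m μ)).trans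
    ((EqMod.comp_whiskerLeft _ _ _).symm.trans ((EqMod.whiskerLeft h (.refl _)).trans
      ((EqMod.comp_whiskerLeft _ _ _).trans ((EqMod.whiskerLeft rfl h').trans
        (EqMod.whisker_assoc _ _ _).symm))))

lemma square_whiskerRight {g g' : a ⟶ a'} {g'' : a' ⟶ a''} {γ : g ⟶ g'} {m m' : b ⟶ b'}
    {m'' : b' ⟶ b''} {μ : m ⟶ m'}
    (h : T ◁ R.map₂ μ ≐ γ ▷ T') (h' : T' ≫ R.map m'' = g'' ≫ T'') :
    T ◁ R.map₂ (μ ▷ m'') ≐ (γ ▷ g'') ▷ T'' :=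
  (EqMod.whiskerLeft rfl (EqMod.map₂_whiskerRight R μ m'')).trans
    ((EqMod.whisker_assoc _ _ _).symm.trans ((EqMod.whiskerRight h rfl).trans
      ((EqMod.whiskerRight_comp _ _ _).symm.trans ((EqMod.whiskerRight (.refl _) h').trans
        (EqMod.whiskerRight_comp _ _ _)))))

end Square

section Ext

variable (T' : a' ⟶ R.obj b') (T'' : a'' ⟶ R.obj b'')

namespace IsUniv

/-- The arrow `b ⟶ b'` induced by an arrow `a ⟶ a'`. -/
noncomputable def ext : (a ⟶ a') ⥤ (b ⟶ b') where
  obj g := (hT.lift b').obj (g ≫ T')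
  map γ := (hT.lift b').map (γ ▷ T')
  map_id g := by rw [id_whiskerRight, CategoryTheory.Functor.map_id]
  map_comp γ δ := by rw [comp_whiskerRight, CategoryTheory.Functor.map_comp]

lemma ext_square (g : a ⟶ a') : T ≫ R.map ((hT.ext T').obj g) = g ≫ T' := hT.comp_map_lift _

lemma ext_square₂ {g g' : a ⟶ a'} (γ : g ⟶ g') : T ◁ R.map₂ ((hT.ext T').map γ) ≐ γ ▷ T' :=
  hT.whiskerLeft_map₂_lift _

lemma ext_id : (hT.ext T).obj (𝟙 a) = 𝟙 b :=
  hT.hom_ext ((hT.ext_square T _).trans (square_id T).symm)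

variable {T'} (hT' : IsUniv R T')

lemma ext_comp (g : a ⟶ a') (g' : a' ⟶ a'') :
    (hT.ext T'').obj (g ≫ g') = (hT.ext T').obj g ≫ (hT'.ext T'').obj g' :=
  hT.hom_ext ((hT.ext_square T'' _).trans
    (square_comp (hT.ext_square T' g) (hT'.ext_square T'' g')).symm)

lemma ext_whiskerLeft (g : a ⟶ a') {g' g'' : a' ⟶ a''} (γ : g' ⟶ g'') :
    (hT.ext T'').map (g ◁ γ) ≐ (hT.ext T').obj g ◁ (hT'.ext T'').map γ :=
  hT.cell_ext ((hT.ext_square₂ T'' _).trans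
    (square_whiskerLeft (hT.ext_square T' g) (hT'.ext_square₂ T'' γ)).symm)

lemma ext_whiskerRight {g g' : a ⟶ a'} (γ : g ⟶ g') (g'' : a' ⟶ a'') :
    (hT.ext T'').map (γ ▷ g'') ≐ (hT.ext T').map γ ▷ (hT'.ext T'').obj g'' :=
  hT.cell_ext ((hT.ext_square₂ T'' _).trans
    (square_whiskerRight (hT.ext_square₂ T' γ) (hT'.ext_square T'' g'')).symm)

end IsUniv

end Ext

end Universal

section

universe t₁ v₁ w₁ v₂ u₂

section Precomp

variable {C : Type w} [Bicategory.{t, v} C] {D : Type w'} [Bicategory.{t', v'} D] [Strict D]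
  (E : Type w'') [Bicategory.{t'', v''} E] [Strict E]

/-- Precomposition with a 2-functor. -/
def precomp (F : StrictPseudofunctor C D) :
    StrictPseudofunctor (StrictPseudofunctor D E) (StrictPseudofunctor C E) :=
  StrictPseudofunctor.mk'' {
    obj G := F.comp G
    map θ := TwoNat.whiskerLeft F θ
    map₂ {G H θ η} ρ :=
      { app a := Modif.app ρ (F.obj a)
        naturality f := Modif.naturality ρ (F.map f) }
    map₂_id _ := rfl
    map₂_comp _ _ := rfl
    map_id _ := rfl
    map_comp _ _ := rfl
    map₂_whisker_left {G H I} f {_ _} s := by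
      refine Modif.ext' fun a => ?_
      simp only [Modif.comp_app, Modif.eqToHom_app]
      exact EqMod.conj (.refl _) rfl rfl
    map₂_whisker_right {G H I f f'} s h := by
      refine Modif.ext' fun a => ?_
      simp only [Modif.comp_app, Modif.eqToHom_app]
      exact EqMod.conj (.refl _) rfl rfl }

/-- Precomposition with a 2-natural transformation. -/
def precompMap {F F' : StrictPseudofunctor C D} (η : TwoNat F F') :
    TwoNat (precomp E F) (precomp E F') where
  app G := (TwoNat.whiskerRight η G : TwoNat (F.comp G) (F'.comp G))
  naturality θ := TwoNat.ext' fun a => (TwoNat.naturality θ (η.app a)).symm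
  naturality₂ {G H θ θ'} ρ := Modif.ext' fun a => by
    refine EqMod.eq ((EqMod.modif ρ (η.app a)).symm.trans (EqMod.symm ?_))
    simp only [Modif.comp_app, Modif.eqToHom_app]
    exact .trans (.eqToHom_comp _ _) (.comp_eqToHom _ _)

end Precomp

section Transport

variable {C : Type w} [Bicategory.{t, v} C] [Strict C] {D : Type w'} [Bicategory.{t, v} D]
  [Strict D] {K : Type w''} [Bicategory.{t'', v''} K] [Strict K]
  (F : StrictPseudofunctor C D) (X : StrictPseudofunctor K C)

/-- The 2-natural transformation `colim C(X k, -) ⇒ colim D(F(X k), F-)`. -/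
noncomputable def transport : colimHom X ⟶ (precomp Cat F).obj (colimHom (X.comp F)) :=
  desc (M := F.comp (colimHom (X.comp F)))
    ((PsFam.assoc X F (colimHom (X.comp F))).obj (univ (X.comp F)))

lemma evalUniv_transport : (evalUniv X (F.comp (colimHom (X.comp F)))).obj (transport F X) =
    (PsFam.assoc X F (colimHom (X.comp F))).obj (univ (X.comp F)) :=
  evalUniv_desc (M := F.comp (colimHom (X.comp F))) _

lemma isUniv_transport : IsUniv (precomp Cat F) (transport F X) := by
  intro M
  have hpt (k : K) := congrArg (fun σ : PsFam X (F.comp (colimHom (X.comp F))) => σ.pt k)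
    (evalUniv_transport F X)
  have e : postFunctor (precomp Cat F) (transport F X) M ⋙ evalUniv X (F.comp M) =
      evalUniv (X.comp F) M ⋙ PsFam.assoc X F M := by
    refine PsFam.functor_ext (fun θ => PsFam.ext' (fun k => ?_) fun {k l} a => ?_)
      (fun {θ η} ρ k => ?_)
    · exact congrArg (tf θ (F.obj (X.obj k))).obj (hpt k)
    · refine (PsFam.map_cell_hom (M := colimHom X) (N := F.comp M) _ (univ X) a).trans ?_
      refine EqMod.trans ?_ (PsFam.map_cell_hom θ (univ (X.comp F)) a).symm
      refine EqMod.map (tf θ (F.obj (X.obj l))) ?_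
      exact (PsFam.map_cell_hom (M := colimHom X) (N := F.comp (colimHom (X.comp F)))
        (transport F X) (univ X) a).symm.trans (PsFam.cell_congr (evalUniv_transport F X) a)
    · exact EqMod.app (mf ρ (F.obj (X.obj k))) (hpt k)
  exact .of_eq e (isIsoCat_evalUniv.comp (PsFam.isIsoCat_assoc _ _ _)) isIsoCat_evalUniv

end Transport

end

section ProMap

variable {C : Type (max w (u + 1))} [Bicategory.{max w (u + 1), max w (u + 1)} C] [Strict C]
  {D : Type (max w (u + 1))} [Bicategory.{max w (u + 1), max w (u + 1)} D] [Strict D]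
  (F : StrictPseudofunctor C D)

/-- The 2-functor `2-Pro(F)`. -/
noncomputable def proMap : StrictPseudofunctor (ProOf.{w, u} C) (ProOf.{w, u} D) :=
  StrictPseudofunctor.mk'' {
    obj X := ProObj.map F X
    map {X Y} g := ((isUniv_transport F Y.diag).ext (transport F X.diag)).obj g
    map₂ {X Y g h} γ := ((isUniv_transport F Y.diag).ext (transport F X.diag)).map γ
    map₂_id {X Y} g := ((isUniv_transport F Y.diag).ext (transport F X.diag)).map_id g
    map₂_comp {X Y g h i} γ δ :=
      ((isUniv_transport F Y.diag).ext (transport F X.diag)).map_comp γ δ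
    map_id X := (isUniv_transport F X.diag).ext_id
    map_comp {X Y Z} g h := (isUniv_transport F Z.diag).ext_comp (transport F X.diag)
      (isUniv_transport F Y.diag) h g
    map₂_whisker_left {X Y Z} g h i γ := ((isUniv_transport F Z.diag).ext_whiskerRight
      (transport F X.diag) (isUniv_transport F Y.diag) γ g).conj _ _
    map₂_whisker_right {X Y Z g h} γ i := ((isUniv_transport F Z.diag).ext_whiskerLeft
      (transport F X.diag) (isUniv_transport F Y.diag) i γ).conj _ _ }

end ProMap

section TransportUniv

variable {C : Type w} [Bicategory.{t, v} C] [Strict C] {D : Type w'} [Bicategory.{t, v} D]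
  [Strict D] {K : Type w''} [Bicategory.{t'', v''} K] [Strict K] {K' : Type w''}
  [Bicategory.{t'', v''} K'] [Strict K'] (F : StrictPseudofunctor C D)
  (X : StrictPseudofunctor K C) (Y : StrictPseudofunctor K' C)

lemma transport_pt (k : K) :
    (tf (M := colimHom X) (N := F.comp (colimHom (X.comp F))) (transport F X) (X.obj k)).obj
      ((univ X).pt k) = (univ (X.comp F)).pt k :=
  congrArg (fun σ : PsFam X (F.comp (colimHom (X.comp F))) => σ.pt k) (evalUniv_transport F X)

lemma transport_cell {k l : K} (u : k ⟶ l) :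
    (tf (M := colimHom X) (N := F.comp (colimHom (X.comp F))) (transport F X) (X.obj l)).map
      ((univ X).cell u).hom ≐ ((univ (X.comp F)).cell u).hom :=
  (PsFam.map_cell_hom (M := colimHom X) (N := F.comp (colimHom (X.comp F)))
    (transport F X) (univ X) u).symm.trans (PsFam.cell_congr (evalUniv_transport F X) u)

lemma tf_ext_pt (g : colimHom Y ⟶ colimHom X) (k : K') :
    (tf (((isUniv_transport F Y).ext (transport F X)).obj g) (F.obj (Y.obj k))).obj
      ((univ (Y.comp F)).pt k) =
    (tf (M := colimHom X) (N := F.comp (colimHom (X.comp F))) (transport F X) (Y.obj k)).obj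
      ((tf g (Y.obj k)).obj ((univ Y).pt k)) := by
  have h := congrArg (fun θ : colimHom Y ⟶ F.comp (colimHom (X.comp F)) =>
    (tf θ (Y.obj k)).obj ((univ Y).pt k)) ((isUniv_transport F Y).ext_square (transport F X) g)
  exact (congrArg (tf (((isUniv_transport F Y).ext (transport F X)).obj g) (F.obj (Y.obj k))).obj
    (transport_pt F Y k)).symm.trans h

lemma mf_congr {M N : StrictPseudofunctor C Cat.{v', w'}} {θ η θ' η' : M ⟶ N} {ρ : θ ⟶ η}
    {ρ' : θ' ⟶ η'} (h : ρ ≐ ρ') (A : C) (x : car M A) : (mf ρ A).app x ≐ (mf ρ' A).app x := by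
  obtain ⟨p, q, rfl⟩ := h
  subst p q
  exact .of_eq (by simp)

lemma mf_ext_pt {g h : colimHom Y ⟶ colimHom X} (γ : g ⟶ h) (k : K') :
    (mf (((isUniv_transport F Y).ext (transport F X)).map γ) (F.obj (Y.obj k))).app
      ((univ (Y.comp F)).pt k) ≐
    (tf (M := colimHom X) (N := F.comp (colimHom (X.comp F))) (transport F X) (Y.obj k)).map
      ((mf γ (Y.obj k)).app ((univ Y).pt k)) :=
  (EqMod.app _ (transport_pt F Y k).symm).trans
    (mf_congr (M := colimHom Y) (N := F.comp (colimHom (X.comp F)))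
      ((isUniv_transport F Y).ext_square₂ (transport F X) γ) (Y.obj k) ((univ Y).pt k))

end TransportUniv

section ProMap

variable {C : Type (max w (u + 1))} [Bicategory.{max w (u + 1), max w (u + 1)} C] [Strict C]
  {D : Type (max w (u + 1))} [Bicategory.{max w (u + 1), max w (u + 1)} D] [Strict D]
  (F : StrictPseudofunctor C D)

/-- The universal elements of the categories `L(F(cA))(FA)`. -/
noncomputable def mapElement : NatElement (cPro.{w, u} C) (proMap.{w, u} F) F where
  elem A := (univ ((constObj Pt A).comp F)).pt pt
  natural {A B} f := (tf_ext_pt F (constObj Pt A) (constObj Pt B) _ pt).trans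
    ((congrArg (tf (M := colimHom (constObj Pt A)) (N := F.comp (colimHom ((constObj Pt A).comp F)))
      (transport F (constObj Pt A)) B).obj ((constElement C).natural f)).trans
      ((tf_natural_obj _ _ _).trans (congrArg (fn (F.comp (colimHom ((constObj Pt A).comp F))) f).obj
        (transport_pt F (constObj Pt A) pt))))
  natural₂ {A B f g} γ := (mf_ext_pt F (constObj Pt A) (constObj Pt B) _ pt).trans
    ((((constElement C).natural₂ γ).map (tf (M := colimHom (constObj Pt A))
      (N := F.comp (colimHom ((constObj Pt A).comp F))) (transport F (constObj Pt A)) B)).trans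
      ((EqMod.tf_nt (M := colimHom (constObj Pt A)) (N := F.comp (colimHom ((constObj Pt A).comp F)))
        (transport F (constObj Pt A)) γ _).trans (EqMod.app _ (transport_pt F (constObj Pt A) pt))))

end ProMap

section ProMap

variable {C : Type (max w (u + 1))} [Bicategory.{max w (u + 1), max w (u + 1)} C] [Strict C]
  {D : Type (max w (u + 1))} [Bicategory.{max w (u + 1), max w (u + 1)} D] [Strict D]
  (F : StrictPseudofunctor C D)

lemma proMap_leg (X : ProOf.{w, u} C) (k : X.K) :
    (tf (M := ProObj.L ((proMap F).obj ((cPro C).obj (X.diag.obj k))))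
      (N := ProObj.L ((proMap F).obj X)) ((proMap F).map ((canonCone X).leg k))
        (F.obj (X.diag.obj k))).obj ((mapElement F).elem (X.diag.obj k)) =
    (univ (X.diag.comp F)).pt k :=
  (tf_ext_pt F X.diag (constObj Pt (X.diag.obj k)) ((canonCone X).leg k) pt).trans
    ((congrArg (tf (M := colimHom X.diag) (N := F.comp (colimHom (X.diag.comp F)))
      (transport F X.diag) (X.diag.obj k)).obj (coneFam_leg (yo X) (coneFam_canonCone X) k)).trans
        (transport_pt F X.diag k))

lemma proMap_cell (X : ProOf.{w, u} C) {k l : X.K} (a : k ⟶ l) :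
    (mf (M := ProObj.L ((proMap F).obj ((cPro C).obj (X.diag.obj l))))
      (N := ProObj.L ((proMap F).obj X)) ((proMap F).map₂ ((canonCone X).cell a).hom)
        (F.obj (X.diag.obj l))).app ((mapElement F).elem (X.diag.obj l)) ≐
    ((univ (X.diag.comp F)).cell a).hom :=
  (mf_ext_pt F X.diag (constObj Pt (X.diag.obj l)) ((canonCone X).cell a).hom pt).trans
    (((coneFam_cell (yo X) (coneFam_canonCone X) a).map (tf (M := colimHom X.diag)
      (N := F.comp (colimHom (X.diag.comp F))) (transport F X.diag) (X.diag.obj l))).trans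
        (transport_cell F X.diag a))

lemma isIsoCat_evalCone_canonCone (X : ProOf.{w, u} C) (B : ProOf.{w, u} D) :
    IsIsoCat (evalCone (canonCone X) ((proMap F).comp (homFrom B))) := by
  refine isIsoCat_evalCone_of (canonCone X) ((proMap F).comp (homFrom B)) ((mapElement F).ev B)
    (fun A => isIsoCat_evPt B ((constObj Pt A).comp F))
    (evalUniv (X.diag.comp F) (ProObj.L B) ⋙ PsFam.assoc X.diag F (ProObj.L B))
    (isIsoCat_evalUniv.comp (PsFam.isIsoCat_assoc _ _ _))
    (fun g k => ?_) (fun g {k k'} a => ?_) (fun {g g'} s k => ?_)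
  · exact congrArg (tf (M := ProObj.L ((proMap F).obj X)) (N := ProObj.L B) g _).obj
      (proMap_leg F X k)
  · refine ((proMap_cell F X a).map
      (tf (M := ProObj.L ((proMap F).obj X)) (N := ProObj.L B) g _)).trans ?_
    exact (PsFam.map_cell_hom (M := ProObj.L ((proMap F).obj X)) (N := ProObj.L B) g
      (univ (X.diag.comp F)) a).symm
  · exact EqMod.app (mf (M := ProObj.L ((proMap F).obj X)) (N := ProObj.L B) s _)
      (proMap_leg F X k)

variable (C) in
lemma isProCompletion_cPro : IsProCompletion.{_, _, _, _, _, _, u} (cPro.{w, u} C) where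
  exists_canonical K _ _ D hK := by
    let X : ProOf.{w, u} C := ⟨K, hK, D⟩
    exact ⟨X, canonCone X, isCanonical_canonCone X⟩
  exists_presentation X := ⟨⟨X.K, X.diag, canonCone X, isCanonical_canonCone X⟩⟩

lemma isPseudolimit_map_proMap (X : ProOf.{w, u} C)
    (p : Presentation.{_, _, _, _, _, _, u} (cPro.{w, u} C) X) :
    (p.π.map (proMap F)).IsPseudolimit := by
  let X' : ProOf.{w, u} C := ⟨p.K, p.canonical.cofiltered, p.D⟩
  refine (isPseudolimit_map_iff _ _).2 fun B => ?_
  exact (isPseudolimit_canonCone X').isIsoCat_evalCone p.canonical.isPseudolimit _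
    (isIsoCat_evalCone_canonCone F X' B)

end ProMap

section PasteArrow

variable {𝒜 : Type w} [Bicategory.{t, v} 𝒜] [Strict 𝒜] {ℬ : Type w'} [Bicategory.{t', v'} ℬ]
  [Strict ℬ] {𝒞 : Type w''} [Bicategory.{t'', v''} 𝒞] [Strict 𝒞]
  {R : StrictPseudofunctor ℬ 𝒜} {R' : StrictPseudofunctor 𝒞 ℬ} {R'' : StrictPseudofunctor 𝒞 𝒜}

/-- The component of a 2-natural transformation out of a composite. -/
def compApp (κ : TwoNat (R'.comp R) R'') (c : 𝒞) : R.obj (R'.obj c) ⟶ R''.obj c := κ.app c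

lemma compApp_naturality (κ : TwoNat (R'.comp R) R'') {c c' : 𝒞} (n : c ⟶ c') :
    compApp κ c ≫ R''.map n = R.map (R'.map n) ≫ compApp κ c' := (κ.naturality n).symm

lemma compApp_map₂ (κ : TwoNat (R'.comp R) R'') {c c' : 𝒞} {n n' : c ⟶ c'} (ν : n ⟶ n') :
    R.map₂ (R'.map₂ ν) ▷ compApp κ c' ≐ compApp κ c ◁ R''.map₂ ν := EqMod.app_map₂ κ ν

/-- The composite of two arrows with values in 2-functors. -/
def pasteArrow (κ : TwoNat (R'.comp R) R'') {a : 𝒜} {b : ℬ} {c : 𝒞} (T : a ⟶ R.obj b)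
    (U : b ⟶ R'.obj c) : a ⟶ R''.obj c := T ≫ R.map U ≫ compApp κ c

variable (κ : TwoNat (R'.comp R) R'') {a a' : 𝒜} {b b' : ℬ} {c c' : 𝒞}
  {T : a ⟶ R.obj b} {T' : a' ⟶ R.obj b'} {U : b ⟶ R'.obj c} {U' : b' ⟶ R'.obj c'}

lemma pasteArrow_comp (T : a ⟶ R.obj b) (U : b ⟶ R'.obj c) (n : c ⟶ c') :
    pasteArrow κ T U ≫ R''.map n = T ≫ R.map (U ≫ R'.map n) ≫ compApp κ c' := by
  rw [pasteArrow, R.map_comp, Strict.assoc, Strict.assoc, compApp_naturality, Strict.assoc]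

lemma comp_pasteArrow (T : a ⟶ R.obj b) (m : b ⟶ b') (U : b' ⟶ R'.obj c) :
    T ≫ R.map (m ≫ U) ≫ compApp κ c = pasteArrow κ (T ≫ R.map m) U := by
  rw [pasteArrow, R.map_comp, Strict.assoc, Strict.assoc]

lemma square_pasteArrow {g : a ⟶ a'} {m : b ⟶ b'} {n : c ⟶ c'} (h : T ≫ R.map m = g ≫ T')
    (h' : U ≫ R'.map n = m ≫ U') :
    pasteArrow κ T U ≫ R''.map n = g ≫ pasteArrow κ T' U' := by
  rw [pasteArrow_comp, h', comp_pasteArrow, h, pasteArrow, pasteArrow, Strict.assoc]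

lemma square₂_pasteArrow {g g' : a ⟶ a'} {γ : g ⟶ g'} {m m' : b ⟶ b'} {μ : m ⟶ m'} {n n' : c ⟶ c'}
    {ν : n ⟶ n'} (h : T ◁ R.map₂ μ ≐ γ ▷ T') (h' : U ◁ R'.map₂ ν ≐ μ ▷ U') :
    pasteArrow κ T U ◁ R''.map₂ ν ≐ γ ▷ pasteArrow κ T' U' := by
  have e₁ : pasteArrow κ T U ◁ R''.map₂ ν ≐ T ◁ R.map U ◁ compApp κ c ◁ R''.map₂ ν :=
    (EqMod.comp_whiskerLeft _ _ _).trans (EqMod.whiskerLeft rfl (EqMod.comp_whiskerLeft _ _ _))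
  have e₂ : T ◁ R.map U ◁ compApp κ c ◁ R''.map₂ ν ≐ T ◁ R.map₂ (U ◁ R'.map₂ ν) ▷ compApp κ c' :=
    EqMod.whiskerLeft rfl ((EqMod.whiskerLeft rfl (compApp_map₂ κ ν).symm).trans
      ((EqMod.whisker_assoc _ _ _).symm.trans
        (EqMod.whiskerRight (EqMod.map₂_whiskerLeft R _ _).symm rfl)))
  have e₃ : T ◁ R.map₂ (U ◁ R'.map₂ ν) ▷ compApp κ c' ≐ T ◁ (R.map₂ μ ▷ (R.map U' ≫ compApp κ c')) :=
    EqMod.whiskerLeft rfl ((EqMod.whiskerRight ((EqMod.map₂ R h').trans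
      (EqMod.map₂_whiskerRight R μ U')) rfl).trans (EqMod.whiskerRight_comp _ _ _).symm)
  have e₄ : T ◁ (R.map₂ μ ▷ (R.map U' ≫ compApp κ c')) ≐ γ ▷ pasteArrow κ T' U' :=
    (EqMod.whisker_assoc _ _ _).symm.trans ((EqMod.whiskerRight h rfl).trans
      (EqMod.whiskerRight_comp _ _ _).symm)
  exact e₁.trans (e₂.trans (e₃.trans e₄))

end PasteArrow

section HEqLift

variable {𝒜 : Type w} [Bicategory.{t, v} 𝒜] [Strict 𝒜] {ℬ : Type w'} [Bicategory.{t', v'} ℬ]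
  [Strict ℬ] {R : StrictPseudofunctor ℬ 𝒜} {a : 𝒜} {b₁ b₂ b₁' b₂' : ℬ} {T₁ : a ⟶ R.obj b₁}
  {T₂ : a ⟶ R.obj b₂}

lemma IsUniv.heq_of (hT : IsUniv R T₁) (hb : b₁ = b₂) (hb' : b₁' = b₂') (h : T₁ ≍ T₂)
    {s₁ : a ⟶ R.obj b₁'} {s₂ : a ⟶ R.obj b₂'} (hs : s₁ ≍ s₂) {m₁ : b₁ ⟶ b₁'} {m₂ : b₂ ⟶ b₂'}
    (h₁ : T₁ ≫ R.map m₁ = s₁) (h₂ : T₂ ≫ R.map m₂ = s₂) : m₁ ≍ m₂ := by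
  subst hb hb' h₁ h₂
  obtain rfl := eq_of_heq h
  exact heq_of_eq (hT.hom_ext (eq_of_heq hs))

lemma IsUniv.heq_of₂ {a' : 𝒜} (hT : IsUniv R T₁) (hb : b₁ = b₂) (hb' : b₁' = b₂') (h : T₁ ≍ T₂)
    {T₁' : a' ⟶ R.obj b₁'} {T₂' : a' ⟶ R.obj b₂'} (h' : T₁' ≍ T₂') {g g' : a ⟶ a'} {γ : g ⟶ g'}
    {m₁ n₁ : b₁ ⟶ b₁'} {m₂ n₂ : b₂ ⟶ b₂'} {μ₁ : m₁ ⟶ n₁} {μ₂ : m₂ ⟶ n₂} (hm : m₁ ≍ m₂)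
    (hn : n₁ ≍ n₂) (h₁ : T₁ ◁ R.map₂ μ₁ ≐ γ ▷ T₁') (h₂ : T₂ ◁ R.map₂ μ₂ ≐ γ ▷ T₂') : μ₁ ≍ μ₂ := by
  subst hb hb'
  obtain rfl := eq_of_heq h
  obtain rfl := eq_of_heq h'
  obtain rfl := eq_of_heq hm
  obtain rfl := eq_of_heq hn
  exact heq_of_eq (hT.cell_ext (h₁.trans h₂.symm)).eq

end HEqLift

section

universe t₁ v₁ w₁

section Mate

variable {𝒜 : Type w} [Bicategory.{t, v} 𝒜] [Strict 𝒜] {ℬ : Type w'} [Bicategory.{t', v'} ℬ]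
  [Strict ℬ] {R R' : StrictPseudofunctor ℬ 𝒜} (ρ : TwoNat R R') {a₁ a₂ : 𝒜} {b₁ b₂ b₁' b₂' : ℬ}
  {T₁ : a₁ ⟶ R.obj b₁} {T₂ : a₂ ⟶ R.obj b₂} {T₁' : a₁ ⟶ R'.obj b₁'} {T₂' : a₂ ⟶ R'.obj b₂'}
  (hT : IsUniv R' T₁') {n₁ : b₁' ⟶ b₁} {n₂ : b₂' ⟶ b₂} (h₁ : T₁' ≫ R'.map n₁ = T₁ ≫ ρ.app b₁)
  (h₂ : T₂' ≫ R'.map n₂ = T₂ ≫ ρ.app b₂)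

include hT h₁ h₂

lemma mate_naturality {g : a₁ ⟶ a₂} {m : b₁ ⟶ b₂} {m' : b₁' ⟶ b₂'}
    (h : T₁ ≫ R.map m = g ≫ T₂) (h' : T₁' ≫ R'.map m' = g ≫ T₂') : n₁ ≫ m = m' ≫ n₂ := by
  refine hT.hom_ext ?_
  rw [R'.map_comp, R'.map_comp, ← Strict.assoc, ← Strict.assoc, h₁, h', Strict.assoc, Strict.assoc,
    h₂, ← ρ.naturality, ← Strict.assoc, h, Strict.assoc]

lemma mate_naturality₂ {g g' : a₁ ⟶ a₂} {γ : g ⟶ g'} {m k : b₁ ⟶ b₂} {m' k' : b₁' ⟶ b₂'}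
    {μ : m ⟶ k} {μ' : m' ⟶ k'} (h : T₁ ◁ R.map₂ μ ≐ γ ▷ T₂) (h' : T₁' ◁ R'.map₂ μ' ≐ γ ▷ T₂') :
    n₁ ◁ μ ≐ μ' ▷ n₂ := by
  refine hT.cell_ext ?_
  have e₁ : T₁' ◁ R'.map₂ (n₁ ◁ μ) ≐ (T₁ ≫ ρ.app b₁) ◁ R'.map₂ μ :=
    (EqMod.whiskerLeft rfl (EqMod.map₂_whiskerLeft R' n₁ μ)).trans
      ((EqMod.comp_whiskerLeft _ _ _).symm.trans (EqMod.whiskerLeft h₁ (.refl _)))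
  have e₂ : (T₁ ≫ ρ.app b₁) ◁ R'.map₂ μ ≐ γ ▷ (T₂ ≫ ρ.app b₂) :=
    (EqMod.comp_whiskerLeft _ _ _).trans ((EqMod.whiskerLeft rfl (EqMod.app_map₂ ρ μ).symm).trans
      ((EqMod.whisker_assoc _ _ _).symm.trans ((EqMod.whiskerRight h rfl).trans
        (EqMod.whiskerRight_comp _ _ _).symm)))
  have e₃ : T₁' ◁ R'.map₂ (μ' ▷ n₂) ≐ γ ▷ (T₂ ≫ ρ.app b₂) :=
    (EqMod.whiskerLeft rfl (EqMod.map₂_whiskerRight R' μ' n₂)).trans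
      ((EqMod.whisker_assoc _ _ _).symm.trans ((EqMod.whiskerRight h' rfl).trans
        ((EqMod.whiskerRight_comp _ _ _).symm.trans (EqMod.whiskerRight (.refl _) h₂))))
  exact e₁.trans (e₂.trans e₃.symm)

end Mate

lemma Modif.conj {C : Type w} [Bicategory.{t, v} C] {D : Type w'} [Bicategory.{t', v'} D] [Strict D]
    {F G : StrictPseudofunctor C D} {θ η θ' η' : F ⟶ G} {ρ : θ ⟶ η} {ρ' : θ' ⟶ η'}
    (h : ∀ a, Modif.app ρ a ≐ Modif.app ρ' a) (p : θ = θ') (q : η' = η) :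
    ρ = eqToHom p ≫ ρ' ≫ eqToHom q := by
  subst p q
  simpa using Modif.ext' fun a => (h a).eq

section PrecompAssoc

variable {B : Type w} [Bicategory.{t, v} B] {C : Type w'} [Bicategory.{t', v'} C] [Strict C]
  {D : Type w''} [Bicategory.{t'', v''} D] [Strict D] (E : Type w₁) [Bicategory.{t₁, v₁} E] [Strict E]

/-- Associativity of precomposition. -/
def precompAssoc (F : StrictPseudofunctor B C) (G : StrictPseudofunctor C D) :
    TwoNat ((precomp E G).comp (precomp E F)) (precomp E (F.comp G)) where
  app M := ({
    app a := 𝟙 _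
    naturality f := (TwoNat.id ((F.comp G).comp M)).naturality f
    naturality₂ α := (TwoNat.id ((F.comp G).comp M)).naturality₂ α } :
      TwoNat (F.comp (G.comp M)) ((F.comp G).comp M))
  naturality {M N} θ := TwoNat.ext' (F := F.comp (G.comp M)) (G := (F.comp G).comp N) fun a =>
    (Strict.comp_id (θ.app (G.obj (F.obj a)))).trans (Strict.id_comp _).symm
  naturality₂ {M N θ θ'} ρ := Modif.conj (F := F.comp (G.comp M)) (G := (F.comp G).comp N) (fun a =>
    (EqMod.whiskerRight_id (Modif.app ρ (G.obj (F.obj a)))).trans (EqMod.id_whiskerLeft _).symm) _ _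

/-- Precomposition with the identity. -/
def precompId : TwoNat (StrictPseudofunctor.id (StrictPseudofunctor B E))
    (precomp E (StrictPseudofunctor.id B)) where
  app M := ({
    app a := 𝟙 _
    naturality f := (TwoNat.id M).naturality f
    naturality₂ α := (TwoNat.id M).naturality₂ α } :
      TwoNat M ((StrictPseudofunctor.id B).comp M))
  naturality {M N} θ := TwoNat.ext' (F := M) (G := (StrictPseudofunctor.id B).comp N) fun a =>
    (Strict.comp_id (θ.app a)).trans (Strict.id_comp _).symm
  naturality₂ {M N θ θ'} ρ := Modif.conj (F := M) (G := (StrictPseudofunctor.id B).comp N) (fun a =>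
    (EqMod.whiskerRight_id (Modif.app ρ a)).trans (EqMod.id_whiskerLeft _).symm) _ _

end PrecompAssoc

section HEq

lemma EqMod.heq {A : Type w} [Category.{v} A] {a b a' b' : A} {f : a ⟶ b} {g : a' ⟶ b'}
    (h : f ≐ g) : f ≍ g := by
  obtain ⟨p, q, rfl⟩ := h
  subst p q
  simp

lemma EqMod.of_heq {A : Type w} [Category.{v} A] {a b a' b' : A} {f : a ⟶ b} {g : a' ⟶ b'}
    (p : a = a') (q : b = b') (h : f ≍ g) : f ≐ g := by
  subst p q
  exact .of_eq (eq_of_heq h)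

variable {C : Type w} [Bicategory.{t, v} C] {D : Type w'} [Bicategory.{t', v'} D]

lemma strictPseudofunctor_hext {F G : StrictPseudofunctor C D} (hobj : ∀ a, F.obj a = G.obj a)
    (hmap : ∀ {a b : C} (f : a ⟶ b), F.map f ≍ G.map f)
    (hmap₂ : ∀ {a b : C} {f g : a ⟶ b} (α : f ⟶ g), F.map₂ α ≍ G.map₂ α) : F = G := by
  apply strictPseudofunctor_ext
  obtain ⟨⟨⟨⟨⟨⟨Fo, Fm⟩, F₂⟩, _, _⟩, _, _, _, _, _, _, _⟩, _, _⟩, _, _⟩ := F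
  obtain ⟨⟨⟨⟨⟨⟨Go, Gm⟩, G₂⟩, _, _⟩, _, _, _, _, _, _, _⟩, _, _⟩, _, _⟩ := G
  dsimp only at hobj hmap hmap₂ ⊢
  obtain rfl : Fo = Go := funext hobj
  obtain rfl : @Fm = @Gm := by funext a b f; exact eq_of_heq (hmap f)
  obtain rfl : @F₂ = @G₂ := by funext a b f g α; exact eq_of_heq (hmap₂ α)
  rfl

end HEq

end

section

universe t₁ v₁ w₁

section TransportHEq

variable {C : Type w} [Bicategory.{t, v} C] [Strict C] {D : Type w'} [Bicategory.{t, v} D]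
  [Strict D] {K : Type w''} [Bicategory.{t'', v''} K] [Strict K] {F : StrictPseudofunctor C D}
  {X : StrictPseudofunctor K C}

lemma transport_heq {W : StrictPseudofunctor K D} (h : X.comp F = W)
    (θ : colimHom X ⟶ F.comp (colimHom W))
    (hpt : ∀ k, (tf θ (X.obj k)).obj ((univ X).pt k) ≍ (univ W).pt k)
    (hcell : ∀ {k l} (u : k ⟶ l), (tf θ (X.obj l)).map ((univ X).cell u).hom ≍
      ((univ W).cell u).hom) : transport F X ≍ θ := by
  subst h
  refine heq_of_eq (isIsoCat_evalUniv.obj.1 ((evalUniv_transport F X).trans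
    (PsFam.ext' (fun k => (eq_of_heq (hpt k)).symm) fun {k l} u => ?_)))
  refine .trans (.symm (.of_heq (eq_of_heq (hpt l)) ?_ (hcell u))) (PsFam.map_cell_hom θ _ u).symm
  exact (tf_natural_obj θ (X.map u) _).trans
    (congrArg (fn (F.comp (colimHom (X.comp F))) (X.map u)).obj (eq_of_heq (hpt k)))

variable {E : Type w₁} [Bicategory.{t, v} E] [Strict E]

lemma transport_comp_heq (F : StrictPseudofunctor C D) (G : StrictPseudofunctor D E)
    (X : StrictPseudofunctor K C) : transport (F.comp G) X ≍
      pasteArrow (precompAssoc Cat F G) (transport F X) (transport G (X.comp F)) := by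
  refine transport_heq (F := F.comp G) (X := X) (W := (X.comp F).comp G) (strictPseudofunctor_ext rfl)
    (pasteArrow (precompAssoc Cat F G) (transport F X) (transport G (X.comp F)))
    (fun k => heq_of_eq ?_) fun {k l} u => EqMod.heq ?_
  · exact (congrArg (tf (M := colimHom (X.comp F)) (N := G.comp (colimHom ((X.comp F).comp G)))
      (transport G (X.comp F)) (F.obj (X.obj k))).obj (transport_pt F X k)).trans
        (transport_pt G (X.comp F) k)
  · exact ((transport_cell F X u).map (tf (M := colimHom (X.comp F))
      (N := G.comp (colimHom ((X.comp F).comp G))) (transport G (X.comp F)) (F.obj (X.obj l)))).trans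
        (transport_cell G (X.comp F) u)

lemma transport_id_heq (X : StrictPseudofunctor K C) :
    transport (StrictPseudofunctor.id C) X ≍ (precompId Cat).app (colimHom X) :=
  transport_heq (W := X) (strictPseudofunctor_ext rfl) ((precompId Cat).app (colimHom X))
    (fun _ => HEq.rfl) fun _ => HEq.rfl

end TransportHEq

section ProMap

variable {C : Type (max w (u + 1))} [Bicategory.{max w (u + 1), max w (u + 1)} C] [Strict C]
  {D : Type (max w (u + 1))} [Bicategory.{max w (u + 1), max w (u + 1)} D] [Strict D]
  {E : Type (max w (u + 1))} [Bicategory.{max w (u + 1), max w (u + 1)} E] [Strict E]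
  {F : StrictPseudofunctor C D}

lemma proMap_eq_of (H : StrictPseudofunctor (ProOf.{w, u} C) (ProOf.{w, u} D))
    (hobj : ∀ X, ProObj.map F X = H.obj X)
    (T : ∀ X : ProOf.{w, u} C, ProObj.L X ⟶ (precomp Cat F).obj (ProObj.L (H.obj X)))
    (hT : ∀ X : ProOf.{w, u} C, transport F X.diag ≍ T X)
    (hmap : ∀ {X Y : ProOf.{w, u} C} (g : ProObj.L Y ⟶ ProObj.L X),
      T Y ≫ (precomp Cat F).map (X := ProObj.L (H.obj Y)) (Y := ProObj.L (H.obj X))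
        (H.map (X := X) (Y := Y) g) = g ≫ T X)
    (hmap₂ : ∀ {X Y : ProOf.{w, u} C} {g g' : ProObj.L Y ⟶ ProObj.L X} (γ : g ⟶ g'),
      T Y ◁ (precomp Cat F).map₂ (a := ProObj.L (H.obj Y)) (b := ProObj.L (H.obj X))
        (H.map₂ (a := X) (b := Y) γ) ≐ γ ▷ T X) : proMap F = H := by
  have hL (X : ProOf.{w, u} C) : ProObj.L (ProObj.map F X) = ProObj.L (H.obj X) :=
    congrArg ProObj.L (hobj X)
  have hs {X Y : ProOf.{w, u} C} (g : ProObj.L Y ⟶ ProObj.L X) :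
      (g ≫ transport F X.diag : ProObj.L Y ⟶ _) ≍ g ≫ T X := by
    have := hT X
    have := hL X
    congr 1
    exact congrArg _ (hL X)
  have hm {X Y : ProOf.{w, u} C} (g : ProObj.L Y ⟶ ProObj.L X) :
      (proMap F).map (X := X) (Y := Y) g ≍ H.map (X := X) (Y := Y) g :=
    (isUniv_transport F Y.diag).heq_of (hL Y) (hL X) (hT Y) (hs g)
      ((isUniv_transport F Y.diag).ext_square (transport F X.diag) g) (hmap g)
  exact strictPseudofunctor_hext hobj (fun {X Y} g => hm g) fun {X Y g g'} γ =>
    (isUniv_transport F Y.diag).heq_of₂ (hL Y) (hL X) (hT Y) (hT X) (hm g) (hm g')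
      ((isUniv_transport F Y.diag).ext_square₂ (transport F X.diag) γ) (hmap₂ γ)

lemma proMap_id : proMap (StrictPseudofunctor.id C) = StrictPseudofunctor.id (ProOf.{w, u} C) :=
  proMap_eq_of _ (fun X => congrArg (ProObj.mk X.K X.cofiltered) (strictPseudofunctor_ext rfl))
    (fun X => (precompId Cat).app (ProObj.L X)) (fun X => transport_id_heq X.diag)
    (fun g => ((precompId Cat).naturality g).symm) (fun γ => (EqMod.app_map₂ (precompId Cat) γ).symm)

lemma proMap_comp (F : StrictPseudofunctor C D) (G : StrictPseudofunctor D E) :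
    proMap (F.comp G) = (proMap.{w, u} F).comp (proMap G) :=
  proMap_eq_of _ (fun X => congrArg (ProObj.mk X.K X.cofiltered) (strictPseudofunctor_ext rfl))
    (fun X => pasteArrow (precompAssoc Cat F G) (transport F X.diag) (transport G (X.diag.comp F)))
    (fun X => transport_comp_heq F G X.diag)
    (fun {X Y} g => square_pasteArrow _ ((isUniv_transport F Y.diag).ext_square _ g)
      ((isUniv_transport G (Y.diag.comp F)).ext_square _ _))
    (fun {X Y g g'} γ => square₂_pasteArrow _ ((isUniv_transport F Y.diag).ext_square₂ _ γ)
      ((isUniv_transport G (Y.diag.comp F)).ext_square₂ _ _))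

end ProMap

end

section

universe t₁ v₁ w₁

section Abstract

variable {𝒜 : Type w} [Bicategory.{t, v} 𝒜] [Strict 𝒜] {ℬ : Type w'} [Bicategory.{t', v'} ℬ]
  [Strict ℬ] {R R' : StrictPseudofunctor ℬ 𝒜} {a : 𝒜}

lemma comp_app_heq (ρ : TwoNat R R') {b b' : ℬ} (hb : b = b') {T : a ⟶ R.obj b} {T' : a ⟶ R.obj b'}
    (h : T ≍ T') : T ≫ ρ.app b ≍ T' ≫ ρ.app b' := by
  subst hb
  obtain rfl := eq_of_heq h
  rfl

variable {𝒞 : Type w''} [Bicategory.{t'', v''} 𝒞] [Strict 𝒞]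

lemma pasteArrow_whiskerLeft {S S' : StrictPseudofunctor 𝒞 ℬ} {Q Q' : StrictPseudofunctor 𝒞 𝒜}
    (κ : TwoNat (S.comp R) Q) (κ' : TwoNat (S'.comp R) Q') (ρ : TwoNat S S') (σ : TwoNat Q Q')
    (hσ : ∀ c, R.map (ρ.app c) ≫ compApp κ' c = compApp κ c ≫ σ.app c) {b : ℬ} {c c' : 𝒞}
    {T : a ⟶ R.obj b} {U : b ⟶ S.obj c} {U' : b ⟶ S'.obj c'} {n : c' ⟶ c}
    (h : U' ≫ S'.map n = U ≫ ρ.app c) :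
    pasteArrow κ' T U' ≫ Q'.map n = pasteArrow κ T U ≫ σ.app c := by
  rw [pasteArrow_comp, h, R.map_comp, pasteArrow, Strict.assoc, hσ, Strict.assoc, Strict.assoc]

lemma pasteArrow_whiskerRight {S : StrictPseudofunctor 𝒞 ℬ} {Q Q' : StrictPseudofunctor 𝒞 𝒜}
    (κ : TwoNat (S.comp R) Q) (κ' : TwoNat (S.comp R') Q') (ρ : TwoNat R R') (σ : TwoNat Q Q')
    (hσ : ∀ c, ρ.app (S.obj c) ≫ compApp κ' c = compApp κ c ≫ σ.app c) {b b' : ℬ} {c c' : 𝒞}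
    {T : a ⟶ R.obj b} {T' : a ⟶ R'.obj b'} {U : b ⟶ S.obj c} {U' : b' ⟶ S.obj c'} {m : b' ⟶ b}
    {n : c' ⟶ c} (h : T' ≫ R'.map m = T ≫ ρ.app b) (h' : U' ≫ S.map n = m ≫ U) :
    pasteArrow κ' T' U' ≫ Q'.map n = pasteArrow κ T U ≫ σ.app c := by
  rw [pasteArrow_comp, h', comp_pasteArrow, h, pasteArrow, pasteArrow, Strict.assoc, Strict.assoc,
    Strict.assoc, ← hσ, ← Strict.assoc (ρ.app b), ← ρ.naturality, Strict.assoc]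

end Abstract

section OfEqMod

variable {C : Type w} [Bicategory.{t, v} C] {D : Type w'} [Bicategory.{t', v'} D] [Strict D]
  {F G : StrictPseudofunctor C D}

/-- A constructor for 2-natural transformations. -/
def TwoNat.ofEqMod (app : ∀ a, F.obj a ⟶ G.obj a)
    (naturality : ∀ {a b : C} (f : a ⟶ b), F.map f ≫ app b = app a ≫ G.map f)
    (naturality₂ : ∀ {a b : C} {f g : a ⟶ b} (α : f ⟶ g), F.map₂ α ▷ app b ≐ app a ◁ G.map₂ α) :
    TwoNat F G where
  app := app
  naturality := naturality
  naturality₂ α := (naturality₂ α).conj (naturality _) (naturality _).symm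

end OfEqMod

section MateExt

variable {𝒜 : Type w} [Bicategory.{t, v} 𝒜] [Strict 𝒜] {ℬ : Type w'} [Bicategory.{t', v'} ℬ]
  [Strict ℬ] {R R' : StrictPseudofunctor ℬ 𝒜} {a₁ a₂ : 𝒜} {b₁ b₂ b₁' b₂' : ℬ}
  {T₁ : a₁ ⟶ R.obj b₁} {T₂ : a₂ ⟶ R.obj b₂} {T₁' : a₁ ⟶ R'.obj b₁'} {T₂' : a₂ ⟶ R'.obj b₂'}

namespace IsUniv

/-- The mate of a 2-natural transformation. -/
noncomputable def mate (hT' : IsUniv R' T₁') (ρ : TwoNat R R') (T : a₁ ⟶ R.obj b₁) : b₁' ⟶ b₁ :=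
  (hT'.lift b₁).obj (T ≫ ρ.app b₁)

lemma comp_map_mate (hT' : IsUniv R' T₁') (ρ : TwoNat R R') (T : a₁ ⟶ R.obj b₁) :
    T₁' ≫ R'.map (hT'.mate ρ T) = T ≫ ρ.app b₁ := hT'.comp_map_lift _

variable (h₁ : IsUniv R T₁) (h₁' : IsUniv R' T₁') (h₂' : IsUniv R' T₂') (ρ : TwoNat R R')

lemma mate_ext (g : a₁ ⟶ a₂) :
    h₁'.mate ρ T₁ ≫ (h₁.ext T₂).obj g = (h₁'.ext T₂').obj g ≫ h₂'.mate ρ T₂ :=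
  mate_naturality ρ h₁' (h₁'.comp_map_mate ρ T₁) (h₂'.comp_map_mate ρ T₂) (h₁.ext_square _ g)
    (h₁'.ext_square _ g)

lemma mate_ext₂ {g g' : a₁ ⟶ a₂} (γ : g ⟶ g') :
    h₁'.mate ρ T₁ ◁ (h₁.ext T₂).map γ ≐ (h₁'.ext T₂').map γ ▷ h₂'.mate ρ T₂ :=
  mate_naturality₂ ρ h₁' (h₁'.comp_map_mate ρ T₁) (h₂'.comp_map_mate ρ T₂) (h₁.ext_square₂ _ γ)
    (h₁'.ext_square₂ _ γ)

end IsUniv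

end MateExt

section ProMap

variable {B : Type (max w (u + 1))} [Bicategory.{max w (u + 1), max w (u + 1)} B] [Strict B]
  {C : Type (max w (u + 1))} [Bicategory.{max w (u + 1), max w (u + 1)} C] [Strict C]
  {D : Type (max w (u + 1))} [Bicategory.{max w (u + 1), max w (u + 1)} D] [Strict D]

section

variable {F G : StrictPseudofunctor C D} (η : TwoNat F G)

/-- The components of `2-Pro(η)`. -/
noncomputable def proMapApp (X : ProOf.{w, u} C) : (proMap F).obj X ⟶ (proMap G).obj X :=
  (isUniv_transport G X.diag).mate (precompMap Cat η) (transport F X.diag)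

lemma proMapApp_spec (X : ProOf.{w, u} C) :
    transport G X.diag ≫ (precomp Cat G).map (X := colimHom (X.diag.comp G))
      (Y := colimHom (X.diag.comp F)) (proMapApp η X) =
    transport F X.diag ≫ (precompMap Cat η).app (colimHom (X.diag.comp F)) :=
  (isUniv_transport G X.diag).comp_map_mate _ _

lemma map_comp_proMapApp {X Y : ProOf.{w, u} C} (g : X ⟶ Y) :
    (proMap F).map g ≫ proMapApp η Y =
      proMapApp η X ≫ (proMap G).map g :=
  (isUniv_transport F Y.diag).mate_ext (isUniv_transport G Y.diag)
    (isUniv_transport G X.diag) (precompMap Cat η) g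

lemma map₂_whiskerRight_proMapApp {X Y : ProOf.{w, u} C} {g h : X ⟶ Y} (γ : g ⟶ h) :
    (proMap F).map₂ γ ▷ proMapApp η Y ≐
      proMapApp η X ◁ (proMap G).map₂ γ :=
  (isUniv_transport F Y.diag).mate_ext₂ (isUniv_transport G Y.diag)
    (isUniv_transport G X.diag) (precompMap Cat η) γ

/-- The 2-natural transformation `2-Pro(η)`. -/
noncomputable def proMap₂ : TwoNat (proMap.{w, u} F) (proMap.{w, u} G) :=
  TwoNat.ofEqMod (proMapApp η) (map_comp_proMapApp η) (map₂_whiskerRight_proMapApp η)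

end

lemma proMap₂_id (F : StrictPseudofunctor C D) :
    proMap₂.{w, u} (𝟙 F : F ⟶ F) = TwoNat.id (proMap F) := by
  refine TwoNat.ext' fun X => (isUniv_transport F X.diag).hom_ext ((proMapApp_spec (𝟙 F : F ⟶ F) X).trans ?_)
  have h : (precompMap Cat (𝟙 F : F ⟶ F)).app (colimHom (X.diag.comp F)) = 𝟙 _ :=
    TwoNat.ext' fun a => (colimHom (X.diag.comp F)).map_id _
  rw [h, Strict.comp_id]
  exact (Strict.comp_id _).symm

lemma proMap₂_comp {F G H : StrictPseudofunctor C D} (η : F ⟶ G) (θ : G ⟶ H) :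
    proMap₂.{w, u} (η ≫ θ : F ⟶ H) = TwoNat.vcomp (proMap₂ η) (proMap₂ θ) := by
  refine TwoNat.ext' fun X => (isUniv_transport H X.diag).hom_ext ((proMapApp_spec (η ≫ θ) X).trans ?_)
  have h : (precompMap Cat (η ≫ θ)).app (colimHom (X.diag.comp F)) =
      (precompMap Cat η).app _ ≫ (precompMap Cat θ).app (colimHom (X.diag.comp F)) :=
    TwoNat.ext' fun a => (colimHom (X.diag.comp F)).map_comp _ _
  refine Eq.trans ?_ (congrArg (transport H X.diag ≫ ·) ((precomp Cat H).map_comp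
    (a := colimHom (X.diag.comp H)) (b := colimHom (X.diag.comp G)) (c := colimHom (X.diag.comp F))
    (proMapApp θ X) (proMapApp η X))).symm
  rw [h, ← Strict.assoc, ← Strict.assoc, proMapApp_spec θ X, ← proMapApp_spec η X, Strict.assoc,
    Strict.assoc]
  exact congrArg (transport G X.diag ≫ ·) ((precompMap Cat θ).naturality (proMapApp η X))

lemma proMap₂_whiskerLeft (F : StrictPseudofunctor B C) {G H : StrictPseudofunctor C D}
    (η : TwoNat G H) (X : ProOf.{w, u} B) :
    (proMap₂ (TwoNat.whiskerLeft F η)).app X ≍ (proMap₂ η).app (ProObj.map F X) := by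
  have e (G : StrictPseudofunctor C D) : colimHom (X.diag.comp (F.comp G)) =
      colimHom ((X.diag.comp F).comp G) := congrArg colimHom (strictPseudofunctor_ext rfl)
  refine (isUniv_transport (F.comp H) X.diag).heq_of (e H) (e G) (transport_comp_heq F H X.diag)
    (comp_app_heq (precompMap Cat (TwoNat.whiskerLeft F η)) (e G) (transport_comp_heq F G X.diag))
    (proMapApp_spec (TwoNat.whiskerLeft F η) X) ?_
  exact pasteArrow_whiskerLeft (precompAssoc Cat F G) (precompAssoc Cat F H) (precompMap Cat η)
    (precompMap Cat (TwoNat.whiskerLeft F η)) (fun M => TwoNat.ext' fun a =>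
      (Strict.comp_id _).trans (Strict.id_comp _).symm) (proMapApp_spec η (ProObj.map F X))

lemma proMap₂_whiskerRight {F G : StrictPseudofunctor B C} (η : TwoNat F G)
    (H : StrictPseudofunctor C D) (X : ProOf.{w, u} B) :
    (proMap₂ (TwoNat.whiskerRight η H)).app X ≍ (proMap H).map ((proMap₂ η).app X) := by
  have e (F : StrictPseudofunctor B C) : colimHom (X.diag.comp (F.comp H)) =
      colimHom ((X.diag.comp F).comp H) := congrArg colimHom (strictPseudofunctor_ext rfl)
  refine (isUniv_transport (G.comp H) X.diag).heq_of (e G) (e F) (transport_comp_heq G H X.diag)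
    (comp_app_heq (precompMap Cat (TwoNat.whiskerRight η H)) (e F) (transport_comp_heq F H X.diag))
    (proMapApp_spec (TwoNat.whiskerRight η H) X) ?_
  exact pasteArrow_whiskerRight (precompAssoc Cat F H) (precompAssoc Cat G H) (precompMap Cat η)
    (precompMap Cat (TwoNat.whiskerRight η H)) (fun M => TwoNat.ext' fun a =>
      (Strict.comp_id _).trans (Strict.id_comp _).symm) (proMapApp_spec η X)
    ((isUniv_transport H (X.diag.comp G)).ext_square _ _)

end ProMap

end

section PtEval

variable {C : Type w} [Bicategory.{t, v} C] [Strict C] {D : StrictPseudofunctor Pt.{u} C}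
  {M : StrictPseudofunctor C Cat.{max (max t v) u, max v u}}

lemma colimHom_pt_hom_ext {θ θ' : colimHom D ⟶ M}
    (h : (tf θ (D.obj pt)).obj ((univ D).pt pt) = (tf θ' (D.obj pt)).obj ((univ D).pt pt)) :
    θ = θ' :=
  (isIsoCat_evalUniv.comp (isIsoCat_ptEval D M)).obj.1 h

lemma colimHom_pt_cell_ext {θ η θ' η' : colimHom D ⟶ M} {ρ : θ ⟶ η} {ρ' : θ' ⟶ η'}
    (h : (mf ρ (D.obj pt)).app ((univ D).pt pt) ≐ (mf ρ' (D.obj pt)).app ((univ D).pt pt)) :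
    ρ ≐ ρ' :=
  EqMod.of_map (isIsoCat_evalUniv.comp (isIsoCat_ptEval D M)) h

lemma exists_colimHom_pt (x : car M (D.obj pt)) :
    ∃ θ : colimHom D ⟶ M, (tf θ (D.obj pt)).obj ((univ D).pt pt) = x :=
  (isIsoCat_evalUniv.comp (isIsoCat_ptEval D M)).obj.2 x

lemma univ_pt_cell {k l : Pt.{u}} (a : k ⟶ l) : ((univ D).cell a).hom ≐ 𝟙 ((univ D).pt pt) := by
  obtain ⟨⟨⟨⟩⟩⟩ := k
  obtain ⟨⟨⟨⟩⟩⟩ := l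
  rw [subsingleton_pt a (𝟙 pt)]
  exact (EqMod.of_eq ((univ D).cell_id pt)).trans (.eqToHom_id _)

end PtEval

section ConstTransport

variable {C : Type (max w (u + 1))} [Bicategory.{max w (u + 1), max w (u + 1)} C] [Strict C]
  {D : Type (max w (u + 1))} [Bicategory.{max w (u + 1), max w (u + 1)} D] [Strict D]

lemma constObj_comp (F : StrictPseudofunctor C D) (A : C) :
    (constObj Pt.{u} A).comp F = constObj Pt (F.obj A) :=
  strictPseudofunctor_hext (fun _ => rfl) (fun _ => heq_of_eq (F.map_id A))
    fun _ => (EqMod.of_eq (F.map₂_id (𝟙 A))).trans (.id_eq (F.map_id A)) |>.heq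

variable (F : StrictPseudofunctor C D)

/-- The 2-natural transformation `C(A, -) ⇒ D(FA, F-)` induced by `F`. -/
noncomputable def constTransport (A : C) : colimHom (constObj Pt.{u} A) ⟶
    (precomp Cat F).obj (colimHom (constObj Pt.{u} (F.obj A))) :=
  (exists_colimHom_pt (D := constObj Pt.{u} A) (M := F.comp (colimHom (constObj Pt.{u} (F.obj A))))
    ((univ (constObj Pt (F.obj A))).pt pt)).choose

lemma constTransport_pt (A : C) : (tf (M := colimHom (constObj Pt.{u} A))
      (N := F.comp (colimHom (constObj Pt.{u} (F.obj A)))) (constTransport.{w, u} F A) A).obj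
    ((univ (constObj Pt A)).pt pt) = (univ (constObj Pt (F.obj A))).pt pt :=
  (exists_colimHom_pt (D := constObj Pt.{u} A) (M := F.comp (colimHom (constObj Pt.{u} (F.obj A))))
    ((univ (constObj Pt (F.obj A))).pt pt)).choose_spec

lemma transport_constObj_heq (A : C) : transport F (constObj Pt.{u} A) ≍ constTransport.{w, u} F A :=
  transport_heq (constObj_comp F A) (constTransport.{w, u} F A) (fun _ => heq_of_eq (constTransport_pt F A))
    fun a => (((univ_pt_cell a).map (tf (M := colimHom (constObj Pt.{u} A))
      (N := F.comp (colimHom (constObj Pt.{u} (F.obj A)))) (constTransport.{w, u} F A) A)).trans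
        ((EqMod.of_eq (CategoryTheory.Functor.map_id _ _)).trans ((EqMod.id_eq
          (constTransport_pt F A)).trans (univ_pt_cell a).symm))).heq

lemma constTransport_square {A B : C} (f : A ⟶ B) :
    constTransport.{w, u} F B ≫ (precomp Cat F).map (X := colimHom (constObj Pt.{u} (F.obj B)))
      (Y := colimHom (constObj Pt.{u} (F.obj A))) ((cPro.{w, u} D).map (F.map f)) =
    (show colimHom (constObj Pt.{u} B) ⟶ colimHom (constObj Pt.{u} A) from (cPro.{w, u} C).map f) ≫
      constTransport.{w, u} F A := by
  refine colimHom_pt_hom_ext (D := constObj Pt.{u} B)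
    (M := F.comp (colimHom (constObj Pt.{u} (F.obj A)))) ?_
  exact ((congrArg (tf (M := colimHom (constObj Pt.{u} (F.obj B)))
    (N := colimHom (constObj Pt.{u} (F.obj A))) ((cPro.{w, u} D).map (F.map f)) (F.obj B)).obj
      (constTransport_pt F B)).trans ((constElement D).natural (F.map f))).trans
    ((congrArg (tf (M := colimHom (constObj Pt.{u} A))
      (N := F.comp (colimHom (constObj Pt.{u} (F.obj A)))) (constTransport.{w, u} F A) B).obj
        ((constElement C).natural f)).trans ((tf_natural_obj _ _ _).trans
      (congrArg (fn (F.comp (colimHom (constObj Pt.{u} (F.obj A)))) f).obj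
        (constTransport_pt F A)))).symm

lemma constTransport_square₂ {A B : C} {f g : A ⟶ B} (γ : f ⟶ g) :
    constTransport.{w, u} F B ◁ (precomp Cat F).map₂ (a := colimHom (constObj Pt.{u} (F.obj B)))
      (b := colimHom (constObj Pt.{u} (F.obj A))) ((cPro.{w, u} D).map₂ (F.map₂ γ)) ≐
    Bicategory.whiskerRight (a := colimHom (constObj Pt.{u} B)) (b := colimHom (constObj Pt.{u} A))
      ((cPro.{w, u} C).map₂ γ) (constTransport.{w, u} F A) := by
  refine colimHom_pt_cell_ext (D := constObj Pt.{u} B)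
    (M := F.comp (colimHom (constObj Pt.{u} (F.obj A)))) ?_
  have e₁ := EqMod.trans (EqMod.app (mf (M := colimHom (constObj Pt.{u} (F.obj B)))
    (N := colimHom (constObj Pt.{u} (F.obj A))) ((cPro.{w, u} D).map₂ (F.map₂ γ)) (F.obj B))
      (constTransport_pt F B)) ((constElement D).natural₂ (F.map₂ γ))
  have e₂ := ((constElement C).natural₂ γ).map (tf (M := colimHom (constObj Pt.{u} A))
    (N := F.comp (colimHom (constObj Pt.{u} (F.obj A)))) (constTransport.{w, u} F A) B)
  have e₃ := EqMod.tf_nt (M := colimHom (constObj Pt.{u} A))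
    (N := F.comp (colimHom (constObj Pt.{u} (F.obj A)))) (constTransport.{w, u} F A) γ
    ((univ (constObj Pt A)).pt pt)
  have e₄ := EqMod.app (nt (F.comp (colimHom (constObj Pt.{u} (F.obj A)))) γ)
    (constTransport_pt.{w, u} F A)
  exact e₁.trans (EqMod.symm (e₂.trans (e₃.trans e₄)))

end ConstTransport

section ConstNatural

variable {C : Type (max w (u + 1))} [Bicategory.{max w (u + 1), max w (u + 1)} C] [Strict C]
  {D : Type (max w (u + 1))} [Bicategory.{max w (u + 1), max w (u + 1)} D] [Strict D]
  (F : StrictPseudofunctor C D)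

lemma colimHom_constObj_comp (A : C) :
    colimHom ((constObj Pt.{u} A).comp F) = colimHom (constObj Pt.{u} (F.obj A)) :=
  congrArg colimHom (constObj_comp F A)

lemma proMap_map_heq {X Y : ProOf.{w, u} C} {X' Y' : ProOf.{w, u} D}
    (hX : ProObj.L (ProObj.map F X) = ProObj.L X') (hY : ProObj.L (ProObj.map F Y) = ProObj.L Y')
    {T : ProObj.L X ⟶ (precomp Cat F).obj (ProObj.L X')}
    {T' : ProObj.L Y ⟶ (precomp Cat F).obj (ProObj.L Y')} (hT : transport F X.diag ≍ T)
    (hT' : transport F Y.diag ≍ T') {g : ProObj.L Y ⟶ ProObj.L X} {m : ProObj.L Y' ⟶ ProObj.L X'}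
    (h : T' ≫ (precomp Cat F).map m = g ≫ T) : (proMap F).map (X := X) (Y := Y) g ≍ m := by
  refine (isUniv_transport F Y.diag).heq_of hY hX hT' ?_
    ((isUniv_transport F Y.diag).ext_square (transport F X.diag) g) h
  congr 1
  exact congrArg _ hX

lemma proMap_map₂_heq {X Y : ProOf.{w, u} C} {X' Y' : ProOf.{w, u} D}
    (hX : ProObj.L (ProObj.map F X) = ProObj.L X') (hY : ProObj.L (ProObj.map F Y) = ProObj.L Y')
    {T : ProObj.L X ⟶ (precomp Cat F).obj (ProObj.L X')}
    {T' : ProObj.L Y ⟶ (precomp Cat F).obj (ProObj.L Y')} (hT : transport F X.diag ≍ T)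
    (hT' : transport F Y.diag ≍ T') {g h : ProObj.L Y ⟶ ProObj.L X} {γ : g ⟶ h}
    {m n : ProObj.L Y' ⟶ ProObj.L X'} {μ : m ⟶ n} (hm : T' ≫ (precomp Cat F).map m = g ≫ T)
    (hn : T' ≫ (precomp Cat F).map n = h ≫ T) (hμ : T' ◁ (precomp Cat F).map₂ μ ≐ γ ▷ T) :
    (proMap F).map₂ (a := X) (b := Y) γ ≍ μ :=
  (isUniv_transport F Y.diag).heq_of₂ hY hX hT' hT (proMap_map_heq F hX hY hT hT' hm)
    (proMap_map_heq F hX hY hT hT' hn)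
    ((isUniv_transport F Y.diag).ext_square₂ (transport F X.diag) γ) hμ

lemma proMap_constMap_heq {A B : C} (f : A ⟶ B) :
    (cPro.{w, u} D).map (F.map f) ≍ (proMap.{w, u} F).map ((cPro.{w, u} C).map f) :=
  HEq.symm <| proMap_map_heq F (X := (cPro.{w, u} C).obj A) (Y := (cPro.{w, u} C).obj B) (X' := (cPro.{w, u} D).obj (F.obj A))
    (Y' := (cPro.{w, u} D).obj (F.obj B)) (colimHom_constObj_comp F A) (colimHom_constObj_comp F B)
    (transport_constObj_heq F A) (transport_constObj_heq F B) (constTransport_square F f)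

lemma proMap_constMap₂_heq {A B : C} {f g : A ⟶ B} (γ : f ⟶ g) :
    (cPro.{w, u} D).map₂ (F.map₂ γ) ≍ (proMap.{w, u} F).map₂ ((cPro.{w, u} C).map₂ γ) :=
  HEq.symm <| proMap_map₂_heq F (X := (cPro.{w, u} C).obj A) (Y := (cPro.{w, u} C).obj B) (X' := (cPro.{w, u} D).obj (F.obj A))
    (Y' := (cPro.{w, u} D).obj (F.obj B)) (colimHom_constObj_comp F A) (colimHom_constObj_comp F B)
    (transport_constObj_heq F A) (transport_constObj_heq F B) (constTransport_square F f)
    (constTransport_square F g) (constTransport_square₂ F γ)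

lemma cPro_natural : F.comp (cPro.{w, u} D) = (cPro C).comp (proMap F) :=
  strictPseudofunctor_hext
    (fun A => congrArg (ProObj.mk Pt.{u} twoCofiltered_pt) (constObj_comp F A).symm)
    (proMap_constMap_heq F) (proMap_constMap₂_heq F)

lemma constTransport_mate {F G : StrictPseudofunctor C D} (η : TwoNat F G) (A : C) :
    constTransport.{w, u} G A ≫ (precomp Cat G).map (X := colimHom (constObj Pt.{u} (G.obj A)))
      (Y := colimHom (constObj Pt.{u} (F.obj A))) ((cPro.{w, u} D).map (η.app A)) =
    constTransport.{w, u} F A ≫ (precompMap Cat η).app (colimHom (constObj Pt.{u} (F.obj A))) := by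
  refine colimHom_pt_hom_ext (D := constObj Pt.{u} A)
    (M := G.comp (colimHom (constObj Pt.{u} (F.obj A)))) ?_
  exact ((congrArg (tf (M := colimHom (constObj Pt.{u} (G.obj A)))
    (N := colimHom (constObj Pt.{u} (F.obj A))) ((cPro.{w, u} D).map (η.app A)) (G.obj A)).obj
      (constTransport_pt G A)).trans ((constElement D).natural (η.app A))).trans
    (congrArg (fn (colimHom (constObj Pt.{u} (F.obj A))) (η.app A)).obj
      (constTransport_pt F A)).symm

lemma proMapApp_const_heq {F G : StrictPseudofunctor C D} (η : TwoNat F G) (A : C) :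
    proMapApp.{w, u} η ((cPro.{w, u} C).obj A) ≍ (cPro.{w, u} D).map (η.app A) :=
  (isUniv_transport G (constObj Pt.{u} A)).heq_of (colimHom_constObj_comp G A)
    (colimHom_constObj_comp F A) (transport_constObj_heq G A)
    (comp_app_heq (precompMap Cat η) (colimHom_constObj_comp F A) (transport_constObj_heq F A))
    (proMapApp_spec η ((cPro C).obj A)) (constTransport_mate η A)

end ConstNatural

section Extension

variable {C : Type w} [Bicategory.{t, v} C] [Strict C] {P : Type w'} [Bicategory.{t', v'} P]
  [Strict P] {Q : Type w''} [Bicategory.{t'', v''} Q] [Strict Q] {c : StrictPseudofunctor C P}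
  {H G : StrictPseudofunctor P Q} (e : TwoNat (c.comp H) (c.comp G))

/-- The component of a 2-natural transformation between restrictions along `c`. -/
def restApp (A : C) : H.obj (c.obj A) ⟶ G.obj (c.obj A) := e.app A

lemma map_comp_restApp {A B : C} (f : A ⟶ B) :
    H.map (c.map f) ≫ restApp e B = restApp e A ≫ G.map (c.map f) := e.naturality f

lemma map₂_whiskerRight_restApp {A B : C} {f g : A ⟶ B} (γ : f ⟶ g) :
    H.map₂ (c.map₂ γ) ▷ restApp e B ≐ restApp e A ◁ G.map₂ (c.map₂ γ) := EqMod.app_map₂ e γ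

/-- `a : HX ⟶ GX` is compatible with `e` along all arrows and 2-cells from `X` to objects `cA`. -/
structure IsComponent {X : P} (a : H.obj X ⟶ G.obj X) : Prop where
  natural {A : C} (f : X ⟶ c.obj A) : H.map f ≫ restApp e A = a ≫ G.map f
  natural₂ {A : C} {f f' : X ⟶ c.obj A} (s : f ⟶ f') : H.map₂ s ▷ restApp e A ≐ a ◁ G.map₂ s

section Presentation

variable {X : P} (p : Presentation.{t, v, w, t', v', w', u} c X) (hG : (p.π.map G).IsPseudolimit)

include hG

lemma Presentation.map_hom_ext {B : Q} {a b : B ⟶ G.obj X}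
    (h : ∀ {A : C} (f : X ⟶ c.obj A), a ≫ G.map f = b ≫ G.map f)
    (h₂ : ∀ {A : C} {f f' : X ⟶ c.obj A} (s : f ⟶ f'), a ◁ G.map₂ s ≐ b ◁ G.map₂ s) : a = b :=
  ((isPseudolimit_map_iff p.π G).1 hG B).obj.1 (PsFam.ext' (fun k => h (p.π.leg k)) fun {k l} u =>
    (evalCone_cell_hom p.π (G.comp (homFrom B)) a u).trans
      (EqMod.trans (h₂ (A := p.D.obj l) (p.π.cell u).hom)
        (evalCone_cell_hom p.π (G.comp (homFrom B)) b u).symm))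

lemma Presentation.map_cell_ext {B : Q} {a b a' b' : B ⟶ G.obj X} {α : a ⟶ b} {β : a' ⟶ b'}
    (ha : a = a') (hb : b = b') (h : ∀ {A : C} (f : X ⟶ c.obj A), α ▷ G.map f ≐ β ▷ G.map f) :
    α ≐ β := by
  subst ha hb
  exact .of_eq ((((isPseudolimit_map_iff p.π G).1 hG B).map _ _).1
    (PsFam.hom_ext fun k => (h (p.π.leg k)).eq))

lemma Presentation.exists_hom : ∃ a : H.obj X ⟶ G.obj X,
    (∀ k, H.map (p.π.leg k) ≫ restApp e (p.D.obj k) = a ≫ G.map (p.π.leg k)) ∧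
    ∀ {k l : p.K} (u : k ⟶ l), H.map₂ (p.π.cell u).hom ▷ restApp e (p.D.obj l) ≐
      a ◁ G.map₂ (p.π.cell u).hom := by
  let θ : TwoNat (c.comp (H.comp (homFrom (H.obj X)))) (c.comp (G.comp (homFrom (H.obj X)))) :=
    { app A := (TwoNat.whiskerRight e (homFrom (H.obj X))).app A
      naturality f := (TwoNat.whiskerRight e (homFrom (H.obj X))).naturality f
      naturality₂ γ := (TwoNat.whiskerRight e (homFrom (H.obj X))).naturality₂ γ }
  let σ := (PsFam.assoc p.D c (H.comp (homFrom (H.obj X)))).obj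
    ((evalCone p.π (H.comp (homFrom (H.obj X)))).obj (𝟙 (H.obj X)))
  obtain ⟨a, ha⟩ := (((isPseudolimit_map_iff p.π G).1 hG (H.obj X)).comp
    (PsFam.isIsoCat_assoc p.D c (G.comp (homFrom (H.obj X))))).obj.2 ((PsFam.map p.D θ).obj σ)
  refine ⟨a, fun k => ?_, fun {k l} u => ?_⟩
  · exact (congrArg (· ≫ restApp e (p.D.obj k)) (Strict.id_comp (H.map (p.π.leg k)))).symm.trans
      (congrArg (fun τ : PsFam p.D (c.comp (G.comp (homFrom (H.obj X)))) => τ.pt k) ha).symm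
  · have e₁ := (evalCone_cell_hom p.π (G.comp (homFrom (H.obj X))) a u).symm.trans
      ((PsFam.cell_congr ha u).trans (PsFam.map_cell_hom θ σ u))
    have e₂ := (evalCone_cell_hom p.π (H.comp (homFrom (H.obj X))) (𝟙 (H.obj X)) u).map (tf θ (p.D.obj l))
    exact (EqMod.whiskerRight (EqMod.id_whiskerLeft (H.map₂ (p.π.cell u).hom)) rfl).symm.trans
      (e₁.trans e₂).symm

lemma Presentation.exists_isComponent : ∃ a : H.obj X ⟶ G.obj X, IsComponent e a := by
  obtain ⟨a, ha, ha₂⟩ := p.exists_hom e hG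
  refine ⟨a, fun {A} f => ?_, fun {A f f'} s => ?_⟩
  · obtain ⟨k, f, rfl⟩ := p.canonical.exists_leg f
    have h {Z : C} {l : X ⟶ c.obj Z} (hl : H.map l ≫ restApp e Z = a ≫ G.map l) (f : Z ⟶ A) :
        H.map (l ≫ c.map f) ≫ restApp e A = a ≫ G.map (l ≫ c.map f) := by
      rw [H.map_comp, G.map_comp, Strict.assoc, map_comp_restApp, ← Strict.assoc, hl, Strict.assoc]
    exact h (ha k) f
  · have hs {k l : p.K} (u : l ⟶ k) (f : p.D.obj k ⟶ A) :
        H.map₂ (shift p.π u f).hom ▷ restApp e A ≐ a ◁ G.map₂ (shift p.π u f).hom := by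
      have e₁ : H.map₂ (shift p.π u f).hom ▷ restApp e A ≐
          H.map₂ (p.π.cell u).hom ▷ (H.map (c.map f) ≫ restApp e A) :=
        (EqMod.whiskerRight (((shift_eqMod p.π u f).map₂ H).trans
          (EqMod.map₂_whiskerRight H _ _)) rfl).trans (EqMod.whiskerRight_comp _ _ _).symm
      have e₂ : H.map₂ (p.π.cell u).hom ▷ (H.map (c.map f) ≫ restApp e A) ≐
          (a ◁ G.map₂ (p.π.cell u).hom) ▷ G.map (c.map f) :=
        (EqMod.whiskerRight (.refl _) (map_comp_restApp e f)).trans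
          ((EqMod.whiskerRight_comp _ _ _).trans (EqMod.whiskerRight (ha₂ u) rfl))
      have e₃ : (a ◁ G.map₂ (p.π.cell u).hom) ▷ G.map (c.map f) ≐ a ◁ G.map₂ (shift p.π u f).hom :=
        (EqMod.whisker_assoc _ _ _).trans (EqMod.whiskerLeft rfl
          ((EqMod.map₂_whiskerRight G _ _).symm.trans ((shift_eqMod p.π u f).map₂ G).symm))
      exact e₁.trans (e₂.trans e₃)
    obtain ⟨k, f, rfl⟩ := p.canonical.exists_leg f
    obtain ⟨l, f', rfl⟩ := p.canonical.exists_leg f'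
    obtain ⟨m, u, v, γ, h⟩ := p.canonical.exists_whisker s
    have hγ : H.map₂ (p.π.leg m ◁ c.map₂ γ) ▷ restApp e A ≐ a ◁ G.map₂ (p.π.leg m ◁ c.map₂ γ) := by
      have e₁ : H.map₂ (p.π.leg m ◁ c.map₂ γ) ▷ restApp e A ≐
          H.map (p.π.leg m) ◁ (restApp e (p.D.obj m) ◁ G.map₂ (c.map₂ γ)) :=
        (EqMod.whiskerRight (EqMod.map₂_whiskerLeft H _ _) rfl).trans ((EqMod.whisker_assoc _ _ _).trans
          (EqMod.whiskerLeft rfl (map₂_whiskerRight_restApp e γ)))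
      have e₂ : H.map (p.π.leg m) ◁ (restApp e (p.D.obj m) ◁ G.map₂ (c.map₂ γ)) ≐
          a ◁ G.map₂ (p.π.leg m ◁ c.map₂ γ) :=
        (EqMod.comp_whiskerLeft _ _ _).symm.trans ((EqMod.whiskerLeft (ha m) (.refl _)).trans
          ((EqMod.comp_whiskerLeft _ _ _).trans
            (EqMod.whiskerLeft rfl (EqMod.map₂_whiskerLeft G _ _).symm)))
      exact e₁.trans e₂
    have hinv := EqMod.inv (e := whiskerRightIso (H.map₂Iso (shift p.π v f')) (restApp e A))
      (e' := whiskerLeftIso a (G.map₂Iso (shift p.π v f'))) (hs v f')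
    have hsum : s = (shift p.π u f).hom ≫ p.π.leg m ◁ c.map₂ γ ≫ (shift p.π v f').inv := by
      rw [← Category.assoc, ← h, Category.assoc, Iso.hom_inv_id, Category.comp_id]
    rw [hsum, H.map₂_comp, H.map₂_comp, G.map₂_comp, G.map₂_comp, comp_whiskerRight,
      comp_whiskerRight, whiskerLeft_comp, whiskerLeft_comp]
    exact (hs u f).comp (hγ.comp hinv)

end Presentation

variable {e}

lemma IsComponent.eq {X : P} (p : Presentation.{t, v, w, t', v', w', u} c X)
    (hG : (p.π.map G).IsPseudolimit) {a b : H.obj X ⟶ G.obj X} (ha : IsComponent e a)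
    (hb : IsComponent e b) : a = b :=
  p.map_hom_ext hG (fun f => (ha.natural f).symm.trans (hb.natural f))
    fun s => (ha.natural₂ s).symm.trans (hb.natural₂ s)

lemma IsComponent.naturality {X Y : P} (p : Presentation.{t, v, w, t', v', w', u} c Y)
    (hG : (p.π.map G).IsPseudolimit) {a : H.obj X ⟶ G.obj X} {b : H.obj Y ⟶ G.obj Y}
    (ha : IsComponent e a) (hb : IsComponent e b) (g : X ⟶ Y) : H.map g ≫ b = a ≫ G.map g := by
  refine p.map_hom_ext hG (fun f => ?_) fun {A f f'} s => ?_
  · rw [Strict.assoc, ← hb.natural, ← Strict.assoc, ← H.map_comp, ha.natural, G.map_comp,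
      Strict.assoc]
  · have e₁ : (H.map g ≫ b) ◁ G.map₂ s ≐ H.map₂ (g ◁ s) ▷ restApp e A :=
      (EqMod.comp_whiskerLeft _ _ _).trans ((EqMod.whiskerLeft rfl (hb.natural₂ s).symm).trans
        ((EqMod.whisker_assoc _ _ _).symm.trans
          (EqMod.whiskerRight (EqMod.map₂_whiskerLeft H _ _).symm rfl)))
    have e₂ : a ◁ G.map₂ (g ◁ s) ≐ (a ≫ G.map g) ◁ G.map₂ s :=
      (EqMod.whiskerLeft rfl (EqMod.map₂_whiskerLeft G _ _)).trans (EqMod.comp_whiskerLeft _ _ _).symm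
    exact e₁.trans ((ha.natural₂ _).trans e₂)

lemma IsComponent.naturality₂ {X Y : P} (p : Presentation.{t, v, w, t', v', w', u} c Y)
    (hG : (p.π.map G).IsPseudolimit) {a : H.obj X ⟶ G.obj X} {b : H.obj Y ⟶ G.obj Y}
    (ha : IsComponent e a) (hb : IsComponent e b) {g g' : X ⟶ Y} (γ : g ⟶ g') :
    H.map₂ γ ▷ b ≐ a ◁ G.map₂ γ := by
  refine p.map_cell_ext hG (ha.naturality p hG hb g) (ha.naturality p hG hb g') fun {A} f => ?_
  have e₁ : (H.map₂ γ ▷ b) ▷ G.map f ≐ H.map₂ (γ ▷ f) ▷ restApp e A :=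
    (EqMod.whiskerRight_comp _ _ _).symm.trans ((EqMod.whiskerRight (.refl _)
      (hb.natural f).symm).trans ((EqMod.whiskerRight_comp _ _ _).trans
        (EqMod.whiskerRight (EqMod.map₂_whiskerRight H _ _).symm rfl)))
  have e₂ : a ◁ G.map₂ (γ ▷ f) ≐ (a ◁ G.map₂ γ) ▷ G.map f :=
    (EqMod.whiskerLeft rfl (EqMod.map₂_whiskerRight G _ _)).trans (EqMod.whisker_assoc _ _ _).symm
  exact e₁.trans ((ha.natural₂ _).trans e₂)

lemma IsComponent.eq_restApp {A : C} {a : H.obj (c.obj A) ⟶ G.obj (c.obj A)}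
    (ha : IsComponent e a) : a = restApp e A := by
  have h := ha.natural (𝟙 (c.obj A))
  rw [H.map_id, G.map_id, Strict.id_comp, Strict.comp_id] at h
  exact h.symm

lemma isComponent_app (e₁ : TwoNat H G) (h : ∀ A, e₁.app (c.obj A) = restApp e A) (X : P) :
    IsComponent e (e₁.app X) where
  natural f := h _ ▸ e₁.naturality f
  natural₂ s := h _ ▸ EqMod.app_map₂ e₁ s

variable (e) in
/-- A 2-natural transformation between restrictions along `c` extends uniquely, if the target
preserves the canonical pseudolimits. -/
theorem existsUnique_extension (hc : ∀ X : P, Nonempty (Presentation.{t, v, w, t', v', w', u} c X))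
    (hG : ∀ (X : P) (p : Presentation.{t, v, w, t', v', w', u} c X), (p.π.map G).IsPseudolimit) :
    ∃! e₁ : TwoNat H G, ∀ A, e₁.app (c.obj A) = e.app A := by
  have p (X : P) : Presentation.{t, v, w, t', v', w', u} c X := (hc X).some
  choose a ha using fun X => (p X).exists_isComponent e (hG X (p X))
  refine ⟨TwoNat.ofEqMod a (fun {X Y} g => (ha X).naturality (p Y) (hG _ _) (ha Y) g)
    (fun {X Y g g'} γ => (ha X).naturality₂ (p Y) (hG _ _) (ha Y) γ),
    fun A => (ha (c.obj A)).eq_restApp, fun e₁ h => TwoNat.ext' fun X => ?_⟩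
  exact (isComponent_app e₁ h X).eq (p X) (hG _ _) (ha X)

end Extension

section TwoCatLemmas

lemma TwoCAT.conj_of_heq {C D : TwoCAT.{w, u}} {F G F' G' : C ⟶ D} (hF : F = F') (hG : G = G')
    {α : F ⟶ G} {β : F' ⟶ G'} (h : ∀ a, TwoNat.app α a ≍ TwoNat.app β a) :
    α = eqToHom hF ≫ β ≫ eqToHom hG.symm := by
  subst hF hG
  simpa using TwoCAT.hom_ext fun a => eq_of_heq (h a)

lemma TwoCATPlus.conj_of_heq {C D : TwoCATPlus.{w, u}} {F G F' G' : C ⟶ D} (hF : F = F')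
    (hG : G = G') {α : F ⟶ G} {β : F' ⟶ G'}
    (h : ∀ a, TwoNat.app (C := C.toTwoCAT) (D := D.toTwoCAT) α a ≍
      TwoNat.app (C := C.toTwoCAT) (D := D.toTwoCAT) β a) :
    α = eqToHom hF ≫ β ≫ eqToHom hG.symm := by
  subst hF hG
  simpa using (TwoCAT.hom_ext fun a => eq_of_heq (h a) : (α : F.functor ⟶ G.functor) = β)

/-- A 2-natural isomorphism between restrictions along `c` of 2-functors which preserve small
2-cofiltered pseudolimits extends uniquely. -/
theorem existsUnique_iso_extension {C P Q : TwoCAT.{w, u}} {c : C ⟶ P} {H G : P ⟶ Q}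
    (hc : ∀ X : P, Nonempty (Presentation.{w, w, w, w, w, w, u} (C := C) (P := P) c X))
    (hH : PreservesCofilteredPseudolimits.{w, w, w, w, w, w, u} (C := P) (D := Q) H)
    (hG : PreservesCofilteredPseudolimits.{w, w, w, w, w, w, u} (C := P) (D := Q) G)
    (e : c ≫ H ≅ c ≫ G) : ∃! e₁ : H ≅ G, c ◁ e₁.hom = e.hom := by
  have h {H G : P ⟶ Q} (hG : PreservesCofilteredPseudolimits.{w, w, w, w, w, w, u} (C := P)
      (D := Q) G) (e : c ≫ H ⟶ c ≫ G) : ∃! e₁ : H ⟶ G, c ◁ e₁ = e := by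
    obtain ⟨e₁, h₁, h₂⟩ := existsUnique_extension (C := C) (P := P) (Q := Q) (c := c) (H := H)
      (G := G) e hc fun X p => hG _ p.canonical.cofiltered _ _ p.π p.canonical.isPseudolimit
    exact ⟨e₁, TwoCAT.hom_ext h₁, fun e₂ h => h₂ e₂ fun A =>
      congrArg (fun θ : c ≫ H ⟶ c ≫ G => TwoNat.app θ A) h⟩
  obtain ⟨f, hf, -⟩ := h hG e.hom
  obtain ⟨g, hg, -⟩ := h hH e.inv
  refine ⟨⟨f, g, (h hH (𝟙 _)).unique ?_ (Bicategory.whiskerLeft_id c H),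
    (h hG (𝟙 _)).unique ?_ (Bicategory.whiskerLeft_id c G)⟩, hf, fun e' h' =>
      Iso.ext ((h hG e.hom).unique h' hf)⟩
  · rw [Bicategory.whiskerLeft_comp, hf, hg, e.hom_inv_id]
  · rw [Bicategory.whiskerLeft_comp, hf, hg, e.inv_hom_id]

end TwoCatLemmas

section TwoPro

variable (C D : TwoCAT.{max w (u + 1), u})

lemma twoLocallySmall_pro : TwoLocallySmall.{_, _, _, u} (Pro.{w, u} C) :=
  twoLocallySmall_proOf C.locallySmall

lemma hasCofilteredPseudolimits_pro : HasCofilteredPseudolimits.{_, _, _, u} (Pro.{w, u} C) :=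
  (isProCompletion_cPro C).hasCofilteredPseudolimits C.locallySmall (twoLocallySmall_pro C)

variable {C D}

lemma preserves_proMap (F : C ⟶ D) :
    PreservesCofilteredPseudolimits.{_, _, _, _, _, _, u} (proMap.{w, u} (C := C) (D := D) F) :=
  (isProCompletion_cPro C).preserves C.locallySmall (twoLocallySmall_pro C)
    fun X p => isPseudolimit_map_proMap (C := C) (D := D) F X p

variable (C) in
/-- The 2-category `2-Pro(C)`, as an object of `2-CAT_+`. -/
noncomputable abbrev proPlus : TwoCATPlus.{max w (u + 1), u} :=
  TwoCATPlus.mk (proCAT.{w, u} C (twoLocallySmall_pro C)) (hasCofilteredPseudolimits_pro C)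

/-- The 2-functor `2-Pro(F)`, as a 1-cell of `2-CAT_+`. -/
noncomputable def proPlusMap (F : C ⟶ D) : proPlus.{w, u} C ⟶ proPlus D :=
  ⟨proMap.{w, u} (C := C) (D := D) F, preserves_proMap F⟩

lemma proPlusMap_comp {B C D : TwoCAT.{max w (u + 1), u}} (F : B ⟶ C) (G : C ⟶ D) :
    proPlusMap.{w, u} (F ≫ G) = proPlusMap F ≫ proPlusMap G :=
  TwoCATPlus.Hom.ext (proMap_comp (C := B) (D := C) (E := D) F G)

/-- The 2-natural transformation `2-Pro(η)`, as a 2-cell of `2-CAT_+`. -/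
noncomputable def proPlusMap₂ {F G : C ⟶ D} (η : F ⟶ G) :
    proPlusMap.{w, u} F ⟶ proPlusMap G :=
  proMap₂.{w, u} (C := C) (D := D) (F := F) (G := G) η

lemma proPlusMap₂_whiskerLeft {B C D : TwoCAT.{max w (u + 1), u}} (F : B ⟶ C) {G H : C ⟶ D}
    (η : G ⟶ H) : proPlusMap₂.{w, u} (F ◁ η) = eqToHom (proPlusMap_comp F G) ≫
      proPlusMap F ◁ proPlusMap₂ η ≫ eqToHom (proPlusMap_comp F H).symm :=
  TwoCATPlus.conj_of_heq (proPlusMap_comp F G) (proPlusMap_comp F H)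
    (proMap₂_whiskerLeft (B := B) (C := C) (D := D) F (G := G) (H := H) η)

lemma proPlusMap₂_whiskerRight {B C D : TwoCAT.{max w (u + 1), u}} {F G : B ⟶ C} (η : F ⟶ G)
    (H : C ⟶ D) : proPlusMap₂.{w, u} (η ▷ H) = eqToHom (proPlusMap_comp F H) ≫
      proPlusMap₂ η ▷ proPlusMap H ≫ eqToHom (proPlusMap_comp G H).symm :=
  TwoCATPlus.conj_of_heq (proPlusMap_comp F H) (proPlusMap_comp G H)
    (proMap₂_whiskerRight (B := B) (C := C) (D := D) (F := F) (G := G) η H)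

/-- The 2-functor `2-Pro(-)`. -/
noncomputable def proFunctor : TwoFunctorOn fun C : TwoCAT.{max w (u + 1), u} =>
    TwoCATPlus.mk (proCAT.{w, u} C (twoLocallySmall_pro C)) (hasCofilteredPseudolimits_pro C) where
  map F := proPlusMap F
  map₂ η := proPlusMap₂ η
  map₂_id {C D} F := proMap₂_id (C := C) (D := D) F
  map₂_comp {C D F G H} η θ := proMap₂_comp (C := C) (D := D) (F := F) (G := G) (H := H) η θ
  map_id C := TwoCATPlus.Hom.ext (proMap_id (C := C))
  map_comp F G := proPlusMap_comp F G
  map₂_whiskerLeft F _ _ η := proPlusMap₂_whiskerLeft F η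
  map₂_whiskerRight η H := proPlusMap₂_whiskerRight η H

lemma isTwoNatural_cCAT : IsTwoNatural (StrictPseudofunctor.id TwoCAT.{max w (u + 1), u})
    (proFunctor.{w, u}.toStrictPseudofunctor.comp TwoCATPlus.inclusion)
    (fun C => cCAT.{w, u} C (twoLocallySmall_pro C)) where
  naturality {C D} F := cPro_natural (C := C) (D := D) F
  naturality₂ {C D F G} η := TwoCAT.conj_of_heq (cPro_natural (C := C) (D := D) F)
    (cPro_natural (C := C) (D := D) G)
    fun A => (proMapApp_const_heq (C := C) (D := D) (F := F) (G := G) η A).symm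

end TwoPro

end TwoPro

theorem mainTheorem8 :
    ∃ (hs : ∀ C : TwoCAT.{max w (u + 1), u}, TwoLocallySmall.{_, _, _, u} (Pro.{w, u} C))
      (hl : ∀ C : TwoCAT.{max w (u + 1), u}, HasCofilteredPseudolimits.{_, _, _, u} (Pro.{w, u} C))
      (P : TwoFunctorOn fun C : TwoCAT.{max w (u + 1), u} =>
        TwoCATPlus.mk (proCAT.{w, u} C (hs C)) (hl C))
      (hc : IsTwoNatural (StrictPseudofunctor.id TwoCAT.{max w (u + 1), u})
        (P.toStrictPseudofunctor.comp TwoCATPlus.inclusion)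
        (fun C => cCAT.{w, u} C (hs C))),
      (∀ (C D : TwoCAT.{max w (u + 1), u}) (F : C ⟶ D) (X : Pro.{w, u} C),
        (P.map F).functor.obj X = ProObj.map F X) ∧
      (∀ (C D : TwoCAT.{max w (u + 1), u}) (F : C ⟶ D)
        (H : proCAT.{w, u} C (hs C) ⟶ proCAT.{w, u} D (hs D)),
        PreservesCofilteredPseudolimits.{_, _, _, _, _, _, u} H →
        ∀ e : cCAT.{w, u} C (hs C) ≫ H ≅ F ≫ cCAT.{w, u} D (hs D),
          ∃! e₁ : H ≅ (P.map F).functor,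
            cCAT.{w, u} C (hs C) ◁ e₁.hom = e.hom ≫ eqToHom (hc.naturality F)) := by
  refine ⟨twoLocallySmall_pro, hasCofilteredPseudolimits_pro, proFunctor, isTwoNatural_cCAT,
    fun C D F X => rfl, fun C D F H hH e => ?_⟩
  exact existsUnique_iso_extension (C := C) (P := proCAT.{w, u} C (twoLocallySmall_pro C))
    (Q := proCAT.{w, u} D (twoLocallySmall_pro D)) (isProCompletion_cPro C).exists_presentation hH
    (preserves_proMap F) (e ≪≫ eqToIso (isTwoNatural_cCAT.naturality F))
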